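/- **Conventions.** $n$ is the security parameter; all lengths depend on $n$; negligible means $o(n^{-c})$ for every $c$. An efficient (probabilistic) algorithm is a family of Boolean circuits of polynomial size with uniformly random coins as additional input; an efficient quantum algorithm is a family of quantum circuits of polynomial size over the gates $X$, CNOT, Toffoli, $H$, $T$, with classical input and output. A signature scheme is a triple $(G,S,V)$ of efficient algorithms such that signatures made by $S$ on messages of the message space with a secret key generated by $G$ are always accepted by $V$ under the corresponding public key. It is *quantum-safe eu-acma* (resp. *su-acma*) if every efficient quantum forger that gets $pk$ and makes adaptive classical signing queries $M_1,M_2,\dots$ (polynomially many), answered by $\sigma_1,\sigma_2,\dots$, has only negligible probability of outputting $(M^*,\sigma^*)$ accepted by $V$ with $M^*\ne M_i$ for all $i$ (resp. with $(M^*,\sigma^*)\neq(M_i,\sigma_i)$ for all $i$). In the quantum random-oracle model a uniformly random function $\mathcal O$ is drawn first, the algorithms of the scheme may evaluate it, and the forger may also query it in superposition by $|x,y\rangle\mapsto|x,y\oplus\mathcal O(x)\rangle$. A *family of chameleon hash functions* consists of functions $h:\{0,1\}^{k}\times\mathcal R\to\mathcal Y$ given by keys, where $\mathcal R$ and $\mathcal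 Y$ are sets of bit strings of fixed lengths. The following are efficient: evaluation of $h$, deciding membership in $\mathcal R$, sampling from a distribution on $\mathcal R$, sampling from $\mathcal Y$ uniformly up to a negligible error in statistical distance, and an algorithm $HG$ that samples $h$ with a trapdoor $td$. It is required that * (chameleon property) there is an efficient algorithm that, given $td$, $m\in\{0,1\}^k$ and $y\in\mathcal Y$, always outputs some $r\in\mathcal R$ with $h(m,r)=y$, and whose output is, up to a negligible statistical distance (uniformly in $h,td,m,y$), distributed as $r\leftarrow\mathcal R$ conditioned on $h(m,r)=y$; * (uniformity) up to a negligible statistical distance (uniformly in $m$), $(h,h(m,r))$ with $h\leftarrow HG$ and $r\leftarrow\mathcal R$ is distributed as $(h,y)$ with $y$ uniform on $\mathcal Y$ and independent of $h$. It is *quantum-safe collision-resistant* if every efficient quantum algorithm, given $h\leftarrow HG$, finds $(m,r)\neq(m',r')$ in $\{0,1\}^k\times\mathcal R$ with $h(m,r)=h(m',r')$ with only negligible probability. **The transformation.** Let $\Sigma=(G,S,V)$ be a signature scheme with signatures of a fixed length $s$ whose message space contains $\mathcal Y$, let $\mu$ be a polynomially bounded length, and let $\mathcal O:\{0,1\}^{\mu+s}\to\{0,1\}^k$.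 The scheme $\Sigma'=(G',S',V')$ with message space $\{0,1\}^\mu$ is: * $G'$: run $G$ and $HG$ to get $(pk,sk)$ and $(h,td)$; output $pk'=(pk,h)$ and $sk'=(sk,td)$. * $S'$ on $M$: sample a random $C\in\mathcal Y$, let $\sigma=S(C,sk)$ and $m=\mathcal O(M\|\sigma)$, sample $r\in\mathcal R$ with $h(m,r)=C$ by means of $td$, and output $(\sigma,r)$. * $V'$ on $M$ and $(\sigma,r)$: accept if and only if $r\in\mathcal R$ and $V$ accepts $\sigma$ as a signature on $h(\mathcal O(M\|\sigma),r)$ under $pk$. **Theorem.** Let $\Sigma$ be a quantum-safe eu-acma signature scheme (in the plain model), and let $\mathcal H$ be a quantum-safe collision-resistant family of chameleon hash functions as above, with range $\mathcal Y$ contained in the message space of $\Sigma$ and with $2^{-k(n)}$ negligible. Then $\Sigma'$ is a signature scheme (efficient and correct, relative to every oracle $\mathcal O$), and it is quantum-safe su-acma in the quantum random-oracle model. -/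

import Mathlib

open scoped BigOperators

/-- Bit strings of length `n`. -/
abbrev Bits (n : ℕ) : Type := Fin n → Bool

/-- Concatenation of bit strings. -/
abbrev Bits.cat {m n : ℕ} (x : Bits m) (y : Bits n) : Bits (m + n) := Fin.append x y

/-- The first `m` bits of a string of length `m + n`. -/
def Bits.fst {m n : ℕ} (z : Bits (m + n)) : Bits m := fun i => z (Fin.castAdd n i)

/-- The last `n` bits of a string of length `m + n`. -/
def Bits.snd {m n : ℕ} (z : Bits (m + n)) : Bits n := fun i => z (Fin.natAdd m i)

/-- `z` with the bits on the wires `y` replaced by `v`. -/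
noncomputable def Bits.writeAt {w k : ℕ} (y : Fin k ↪ Fin w) (v : Bits k) (z : Bits w) : Bits w :=
  Function.extend y v z

/-- `z` with the string `v` XORed onto the wires `y`. -/
noncomputable def Bits.xorAt {w k : ℕ} (y : Fin k ↪ Fin w) (v : Bits k) (z : Bits w) : Bits w :=
  Bits.writeAt y (fun j => xor (z (y j)) (v j)) z

/-- The string that carries `v` on the wires `y` and `0` on all other wires. -/
noncomputable def Bits.load {w k : ℕ} (y : Fin k ↪ Fin w) (v : Bits k) : Bits w :=
  Bits.writeAt y v (fun _ => false)

/-- Bounded by a polynomial in the security parameter. -/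
def PolyBounded (f : ℕ → ℕ) : Prop := ∃ p : Polynomial ℕ, ∀ n, f n ≤ p.eval n

/-- Negligible in the security parameter: `n ^ c * ε n → 0` for every `c`. -/
def Negligible (ε : ℕ → ℝ) : Prop :=
  Asymptotics.SuperpolynomialDecay Filter.atTop (fun n : ℕ => (n : ℝ)) ε

open Classical in
/-- The indicator of a proposition; `𝔼 c, ind (P c)` is the probability of `P c` for uniform `c`. -/
noncomputable def ind (p : Prop) : ℝ := if p then 1 else 0

/-- Statistical distance of two finitely supported distributions given by their weights. -/
noncomputable def statDist {α : Type} [Fintype α] (P Q : α → ℝ) : ℝ := 2⁻¹ * ∑ x, |P x - Q x|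

/-! ### Boolean circuits with oracle gates

All algorithms are families of circuits, one for each security parameter. An oracle is a function
`Bits a → Bits b`; the plain model is the case `a = b = 0`, where an oracle gate does nothing. -/

/-- One step of a straight-line Boolean program on `w` wires. -/
inductive BoolInstr (w a b : ℕ) : Type
  | nand (t i j : Fin w) : BoolInstr w a b
  | query (x : Fin a → Fin w) (y : Fin b ↪ Fin w) : BoolInstr w a b

noncomputable def BoolInstr.apply {w a b : ℕ} (O : Bits a → Bits b) :
    BoolInstr w a b → Bits w → Bits w
  | .nand t i j, z => Function.update z t (!(z i && z j))
  | .query x y, z => Bits.writeAt y (O (z ∘ x)) z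

/-- A Boolean circuit with `i` input bits and `o` output bits; the other wires start at `0`. -/
structure BoolCircuit (a b i o : ℕ) : Type where
  width : ℕ
  code : List (BoolInstr width a b)
  input : Fin i ↪ Fin width
  output : Fin o ↪ Fin width

/-- Number of wires plus number of gates. -/
def BoolCircuit.size {a b i o : ℕ} (C : BoolCircuit a b i o) : ℕ := C.width + C.code.length

noncomputable def BoolCircuit.eval {a b i o : ℕ} (C : BoolCircuit a b i o) (O : Bits a → Bits b)
    (v : Bits i) : Bits o :=
  (C.code.foldl (fun z g => g.apply O z) (Bits.load C.input v)) ∘ C.output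

/-! ### Quantum circuits with quantum and classical oracles -/

/-- One step of a quantum algorithm on `w` qubits: an elementary gate; a query in superposition to
the oracle `Bits a → Bits b`, with the wires `xy ∘ Sum.inl` as input register and the wires
`xy ∘ Sum.inr` as output register; or a call to a classical oracle (the signing oracle) with
questions of `e` bits and answers of `d` bits. -/
inductive QInstr (w a b e d : ℕ) : Type
  | not (t : Fin w) : QInstr w a b e d
  | cnot (c t : Fin w) (h : c ≠ t) : QInstr w a b e d
  | toffoli (c c' t : Fin w) (h : c ≠ t) (h' : c' ≠ t) : QInstr w a b e d
  | hadamard (t : Fin w) : QInstr w a b e d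
  | phase (t : Fin w) : QInstr w a b e d
  | query (xy : (Fin a ⊕ Fin b) ↪ Fin w) : QInstr w a b e d
  | call (x : Fin e ↪ Fin w) (y : Fin d ↪ Fin w) : QInstr w a b e d

/-- Pure states of `w` qubits, as vectors of amplitudes in the computational basis (a measurement
leaves the unnormalized projected vector, whose squared norm is the probability of the branch). -/
abbrev QState (w : ℕ) : Type := Bits w → ℂ

/-- The basis state `|z⟩`. -/
noncomputable def QState.basis {w : ℕ} (z : Bits w) : QState w := Pi.single z 1

/-- `|x, y⟩ ↦ |x, y ⊕ O(x)⟩` on the given registers. This map of basis states is an involution, so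
the amplitude of `z` after it is the amplitude of the image of `z` before it. -/
noncomputable def QState.query {w a b : ℕ} (O : Bits a → Bits b)
    (xy : (Fin a ⊕ Fin b) ↪ Fin w) (ψ : QState w) : QState w :=
  fun z => ψ (Bits.xorAt (Function.Embedding.inr.trans xy) (O (fun i => z (xy (Sum.inl i)))) z)

/-- Projection onto the outcome `M` of measuring the wires `x` in the computational basis. -/
def QState.project {w e : ℕ} (x : Fin e ↪ Fin w) (M : Bits e) (ψ : QState w) : QState w :=
  fun z => if z ∘ x = M then ψ z else 0

/-- `|y⟩ ↦ |y ⊕ v⟩` on the wires `y`, for a classical string `v`. -/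
noncomputable def QState.receive {w d : ℕ} (y : Fin d ↪ Fin w) (v : Bits d) (ψ : QState w) :
    QState w :=
  fun z => ψ (Bits.xorAt y v z)

/-- `runProb O R payoff code tr ψ` is the expected value of `payoff` when `code` is run from the
state `ψ`. Here `O` is the oracle that is queried in superposition, and `R c M` is the answer with
random coins `c` of the classical oracle to the question `M`. At a call the question register is
measured, the answer is computed with fresh uniform coins, the pair is appended to the transcript,
and the answer is XORed onto the answer register. In the end all wires are measured, and `payoff`
is evaluated at the transcript and the outcome. -/
noncomputable def runProb {w a b e d r : ℕ} (O : Bits a → Bits b) (R : Bits r → Bits e → Bits d)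
    (payoff : List (Bits e × Bits d) → Bits w → ℝ) :
    List (QInstr w a b e d) → List (Bits e × Bits d) → QState w → ℝ
  | [], tr, ψ => ∑ z, ‖ψ z‖ ^ 2 * payoff tr z
  | .not t :: l, tr, ψ =>
      runProb O R payoff l tr (fun z => ψ (Function.update z t (!z t)))
  | .cnot c t _ :: l, tr, ψ =>
      runProb O R payoff l tr (fun z => ψ (Function.update z t (xor (z t) (z c))))
  | .toffoli c c' t _ _ :: l, tr, ψ =>
      runProb O R payoff l tr (fun z => ψ (Function.update z t (xor (z t) (z c && z c'))))
  | .hadamard t :: l, tr, ψ =>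
      runProb O R payoff l tr (fun z => ((Real.sqrt 2 : ℝ) : ℂ)⁻¹ *
        (ψ (Function.update z t false) +
          (if z t then -1 else 1) * ψ (Function.update z t true)))
  | .phase t :: l, tr, ψ =>
      runProb O R payoff l tr
        (fun z => (if z t then Complex.exp (Complex.I * (Real.pi / 4)) else 1) * ψ z)
  | .query xy :: l, tr, ψ => runProb O R payoff l tr (ψ.query O xy)
  | .call x y :: l, tr, ψ =>
      ∑ M, 𝔼 c, runProb O R payoff l (tr ++ [(M, R c M)]) ((ψ.project x M).receive y (R c M))

/-- A quantum algorithm with `i` classical input bits and `o` classical output bits; the other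
wires start in `|0⟩`, and the output is read off by a measurement at the end. -/
structure QCircuit (a b e d i o : ℕ) : Type where
  width : ℕ
  code : List (QInstr width a b e d)
  input : Fin i ↪ Fin width
  output : Fin o ↪ Fin width

/-- Number of qubits plus number of gates, queries and calls. -/
def QCircuit.size {a b e d i o : ℕ} (A : QCircuit a b e d i o) : ℕ := A.width + A.code.length

/-- Expected value of `payoff`, as a function of the transcript of the calls and of the output,
when `A` is run on the input `v`. -/
noncomputable def QCircuit.expected {a b e d i o r : ℕ} (A : QCircuit a b e d i o)
    (O : Bits a → Bits b) (R : Bits r → Bits e → Bits d) (v : Bits i)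
    (payoff : List (Bits e × Bits d) → Bits o → ℝ) : ℝ :=
  runProb O R (fun tr z => payoff tr (z ∘ A.output)) A.code [] (QState.basis (Bits.load A.input v))

/-! ### Signature schemes -/

/-- The algorithms `(G, S, V)` of a signature scheme relative to an oracle `Bits a → Bits b`, for
messages that are strings of length `ℓ`. The last argument of each algorithm is its random coins. -/
structure SigAlgs (a b ℓ : ℕ → ℕ) : Type where
  pkLen : ℕ → ℕ
  skLen : ℕ → ℕ
  sigLen : ℕ → ℕ
  genCoins : ℕ → ℕ
  signCoins : ℕ → ℕ
  verCoins : ℕ → ℕ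
  /-- The message space. -/
  msgs : ∀ n, Set (Bits (ℓ n))
  gen : ∀ n, (Bits (a n) → Bits (b n)) → Bits (genCoins n) → Bits (pkLen n) × Bits (skLen n)
  sign : ∀ n, (Bits (a n) → Bits (b n)) → Bits (skLen n) → Bits (ℓ n) → Bits (signCoins n) →
    Bits (sigLen n)
  verify : ∀ n, (Bits (a n) → Bits (b n)) → Bits (pkLen n) → Bits (ℓ n) → Bits (sigLen n) →
    Bits (verCoins n) → Bool

/-- Signature algorithms in the plain model. -/
abbrev PlainSigAlgs (ℓ : ℕ → ℕ) : Type := SigAlgs (fun _ => 0) (fun _ => 0) ℓ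

namespace SigAlgs

variable {a b ℓ : ℕ → ℕ}

/-- All three algorithms have circuits of polynomial size. -/
def Efficient (S : SigAlgs a b ℓ) : Prop :=
  (∃ C : ∀ n, BoolCircuit (a n) (b n) (S.genCoins n) (S.pkLen n + S.skLen n),
    PolyBounded (fun n => (C n).size) ∧
    ∀ n O c, (C n).eval O c = Bits.cat (S.gen n O c).1 (S.gen n O c).2) ∧
  (∃ C : ∀ n, BoolCircuit (a n) (b n) (S.skLen n + ℓ n + S.signCoins n) (S.sigLen n),
    PolyBounded (fun n => (C n).size) ∧
    ∀ n O sk M c, (C n).eval O ((Bits.cat sk M).cat c) = S.sign n O sk M c) ∧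
  (∃ C : ∀ n, BoolCircuit (a n) (b n) (S.pkLen n + ℓ n + S.sigLen n + S.verCoins n) 1,
    PolyBounded (fun n => (C n).size) ∧
    ∀ n O pk M σ c,
      (C n).eval O (((Bits.cat pk M).cat σ).cat c) = fun _ => S.verify n O pk M σ c)

/-- Honestly generated signatures are always accepted. -/
def Correct (S : SigAlgs a b ℓ) : Prop :=
  ∀ n O g, ∀ M ∈ S.msgs n, ∀ c v,
    S.verify n O (S.gen n O g).1 M (S.sign n O (S.gen n O g).2 M c) v = true

/-- `(G, S, V)` is a signature scheme. -/
def IsScheme (S : SigAlgs a b ℓ) : Prop := S.Efficient ∧ S.Correct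

/-- Quantum forgers for security parameter `n`: they get a public key, query the oracle in
superposition, make classical signing queries and output a message with a signature. -/
abbrev Forger (S : SigAlgs a b ℓ) (n : ℕ) : Type :=
  QCircuit (a n) (b n) (ℓ n) (S.sigLen n) (S.pkLen n) (ℓ n + S.sigLen n)

/-- Probability that the forger wins the chosen message attack game with a uniformly random oracle,
where `fresh` tells which forgeries count as new with respect to the transcript of signing
queries and answers. -/
noncomputable def winProb (S : SigAlgs a b ℓ) (n : ℕ)
    (fresh : List (Bits (ℓ n) × Bits (S.sigLen n)) → Bits (ℓ n) → Bits (S.sigLen n) → Prop)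
    (A : S.Forger n) : ℝ :=
  𝔼 O : Bits (a n) → Bits (b n), 𝔼 g : Bits (S.genCoins n),
    A.expected O (fun c M => S.sign n O (S.gen n O g).2 M c) (S.gen n O g).1
      (fun tr out =>
        ind ((∀ q ∈ tr, q.1 ∈ S.msgs n) ∧ out.fst ∈ S.msgs n ∧ fresh tr out.fst out.snd) *
          𝔼 v : Bits (S.verCoins n),
            ind (S.verify n O (S.gen n O g).1 out.fst out.snd v = true))

/-- Existential unforgeability under adaptive chosen message attack against quantum forgers of
polynomial size: the message `M` of the forgery has not been queried. -/
def QuantumEUACMA (S : SigAlgs a b ℓ) : Prop :=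
  ∀ A : ∀ n, S.Forger n, PolyBounded (fun n => (A n).size) →
    Negligible (fun n => S.winProb n (fun tr M _ => ∀ q ∈ tr, M ≠ q.1) (A n))

/-- Strong unforgeability under adaptive chosen message attack against quantum forgers of
polynomial size: the pair `(M, σ)` differs from all pairs of a query and its answer. -/
def QuantumSUACMA (S : SigAlgs a b ℓ) : Prop :=
  ∀ A : ∀ n, S.Forger n, PolyBounded (fun n => (A n).size) →
    Negligible (fun n => S.winProb n (fun tr M σ => ∀ q ∈ tr, (M, σ) ≠ q) (A n))

end SigAlgs

/-! ### Chameleon hash functions -/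

/-- The algorithms of a family of hash functions `h : {0,1}^k × 𝓡 → 𝓨` with trapdoors, where
`𝓨 ⊆ {0,1}^ℓ`. A function of the family is given by its key. The last argument of each
randomized algorithm is its random coins. -/
structure ChameleonAlgs (ℓ : ℕ → ℕ) : Type where
  keyLen : ℕ → ℕ
  tdLen : ℕ → ℕ
  msgLen : ℕ → ℕ
  rndLen : ℕ → ℕ
  genCoins : ℕ → ℕ
  rndCoins : ℕ → ℕ
  invCoins : ℕ → ℕ
  rangeCoins : ℕ → ℕ
  /-- Membership in the randomness space `𝓡`. -/
  isRnd : ∀ n, Bits (rndLen n) → Bool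
  /-- The range `𝓨`. -/
  range : ∀ n, Set (Bits (ℓ n))
  /-- Samples a hash function with a trapdoor. -/
  gen : ∀ n, Bits (genCoins n) → Bits (keyLen n) × Bits (tdLen n)
  /-- Evaluates the hash function with a given key. -/
  hash : ∀ n, Bits (keyLen n) → Bits (msgLen n) → Bits (rndLen n) → Bits (ℓ n)
  /-- Samples the distribution on `𝓡`. -/
  sampleRnd : ∀ n, Bits (rndCoins n) → Bits (rndLen n)
  /-- Samples a preimage `r` of `y` under `h(m, ·)` by means of the trapdoor. -/
  invert : ∀ n, Bits (tdLen n) → Bits (msgLen n) → Bits (ℓ n) → Bits (invCoins n) →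
    Bits (rndLen n)
  /-- Samples a random element of the range. -/
  sampleRange : ∀ n, Bits (rangeCoins n) → Bits (ℓ n)

namespace ChameleonAlgs

variable {ℓ : ℕ → ℕ}

/-- Weights of the uniform distribution on the range. -/
noncomputable def uniformRange (H : ChameleonAlgs ℓ) (n : ℕ) (y : Bits (ℓ n)) : ℝ :=
  ind (y ∈ H.range n) / (H.range n).ncard

/-- All algorithms have circuits of polynomial size. -/
def Efficient (H : ChameleonAlgs ℓ) : Prop :=
  (∃ C : ∀ n, BoolCircuit 0 0 (H.genCoins n) (H.keyLen n + H.tdLen n),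
    PolyBounded (fun n => (C n).size) ∧
    ∀ n c, (C n).eval id c = Bits.cat (H.gen n c).1 (H.gen n c).2) ∧
  (∃ C : ∀ n, BoolCircuit 0 0 (H.keyLen n + H.msgLen n + H.rndLen n) (ℓ n),
    PolyBounded (fun n => (C n).size) ∧
    ∀ n h m r, (C n).eval id ((Bits.cat h m).cat r) = H.hash n h m r) ∧
  (∃ C : ∀ n, BoolCircuit 0 0 (H.rndLen n) 1,
    PolyBounded (fun n => (C n).size) ∧ ∀ n r, (C n).eval id r = fun _ => H.isRnd n r) ∧
  (∃ C : ∀ n, BoolCircuit 0 0 (H.rndCoins n) (H.rndLen n),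
    PolyBounded (fun n => (C n).size) ∧ ∀ n c, (C n).eval id c = H.sampleRnd n c) ∧
  (∃ C : ∀ n, BoolCircuit 0 0 (H.tdLen n + H.msgLen n + ℓ n + H.invCoins n) (H.rndLen n),
    PolyBounded (fun n => (C n).size) ∧
    ∀ n td m y c, (C n).eval id (((Bits.cat td m).cat y).cat c) = H.invert n td m y c) ∧
  (∃ C : ∀ n, BoolCircuit 0 0 (H.rangeCoins n) (ℓ n),
    PolyBounded (fun n => (C n).size) ∧ ∀ n c, (C n).eval id c = H.sampleRange n c)

/-- `sampleRnd` samples from `𝓡`, the functions `h` map `{0,1}^k × 𝓡` to `𝓨`, and `sampleRange`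
samples from `𝓨`, uniformly up to a negligible error. -/
def WellFormed (H : ChameleonAlgs ℓ) : Prop :=
  (∀ n c, H.isRnd n (H.sampleRnd n c) = true) ∧
  (∀ n g m r, H.isRnd n r = true → H.hash n (H.gen n g).1 m r ∈ H.range n) ∧
  (∀ n c, H.sampleRange n c ∈ H.range n) ∧
  Negligible (fun n =>
    statDist (fun y => 𝔼 c, ind (H.sampleRange n c = y)) (H.uniformRange n))

/-- For every function with its trapdoor, every `m` and every `y ∈ 𝓨`, the trapdoor sampler always
returns an `r ∈ 𝓡` with `h(m, r) = y`, and up to a negligible error this `r` has the distribution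
of `𝓡` conditioned on `h(m, r) = y`. (If the condition has probability `0`, the conditional
weights below are `0` and the distance is `1/2`.) -/
def ChameleonProperty (H : ChameleonAlgs ℓ) : Prop :=
  (∀ n g m, ∀ y ∈ H.range n, ∀ c,
    H.isRnd n (H.invert n (H.gen n g).2 m y c) = true ∧
    H.hash n (H.gen n g).1 m (H.invert n (H.gen n g).2 m y c) = y) ∧
  ∃ ε : ℕ → ℝ, Negligible ε ∧ ∀ n g m, ∀ y ∈ H.range n,
    statDist (fun r => 𝔼 c, ind (H.invert n (H.gen n g).2 m y c = r))
      (fun r => (𝔼 c, ind (H.sampleRnd n c = r ∧ H.hash n (H.gen n g).1 m r = y)) /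
        (𝔼 c, ind (H.hash n (H.gen n g).1 m (H.sampleRnd n c) = y))) ≤ ε n

/-- For every `m`, the pair `(h, h(m, r))` with random `h` and `r` is statistically close to
`(h, y)` with `y` uniform on the range and independent of `h`. -/
def Uniformity (H : ChameleonAlgs ℓ) : Prop :=
  ∃ ε : ℕ → ℝ, Negligible ε ∧ ∀ n m,
    statDist
      (fun p : Bits (H.keyLen n) × Bits (ℓ n) =>
        𝔼 g, 𝔼 c, ind ((H.gen n g).1 = p.1 ∧ H.hash n p.1 m (H.sampleRnd n c) = p.2))
      (fun p => (𝔼 g, ind ((H.gen n g).1 = p.1)) * H.uniformRange n p.2) ≤ ε n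

/-- `H` is a family of chameleon hash functions (collision resistance is separate). -/
def IsFamily (H : ChameleonAlgs ℓ) : Prop :=
  H.Efficient ∧ H.WellFormed ∧ H.ChameleonProperty ∧ H.Uniformity

/-- Quantum collision finders for security parameter `n`: they get the key of a hash function and
output `(m, r)` and `(m', r')`. -/
abbrev CollisionFinder (H : ChameleonAlgs ℓ) (n : ℕ) : Type :=
  QCircuit 0 0 0 0 (H.keyLen n)
    ((H.msgLen n + H.rndLen n) + (H.msgLen n + H.rndLen n))

/-- Probability that the output is a collision. -/
noncomputable def collisionProb (H : ChameleonAlgs ℓ) (n : ℕ) (A : H.CollisionFinder n) : ℝ :=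
  𝔼 g : Bits (H.genCoins n),
    A.expected id (fun (_ : Bits 0) M => M) (H.gen n g).1
      (fun _ out =>
        ind (H.isRnd n out.fst.snd = true ∧ H.isRnd n out.snd.snd = true ∧
          (out.fst.fst, out.fst.snd) ≠ (out.snd.fst, out.snd.snd) ∧
          H.hash n (H.gen n g).1 out.fst.fst out.fst.snd =
            H.hash n (H.gen n g).1 out.snd.fst out.snd.snd))

/-- Collision resistance against quantum algorithms of polynomial size. -/
def QuantumCollisionResistant (H : ChameleonAlgs ℓ) : Prop :=
  ∀ A : ∀ n, H.CollisionFinder n, PolyBounded (fun n => (A n).size) →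
    Negligible (fun n => H.collisionProb n (A n))

end ChameleonAlgs

/-! ### The transformation -/

/-- The scheme `(G', S', V')` for messages of length `μ`, relative to an oracle from strings
`M ‖ σ` to messages of the hash functions. -/
def TOO {ℓ : ℕ → ℕ} (S : PlainSigAlgs ℓ) (H : ChameleonAlgs ℓ) (μ : ℕ → ℕ) :
    SigAlgs (fun n => μ n + S.sigLen n) H.msgLen μ where
  pkLen n := S.pkLen n + H.keyLen n
  skLen n := S.skLen n + H.tdLen n
  sigLen n := S.sigLen n + H.rndLen n
  genCoins n := S.genCoins n + H.genCoins n
  signCoins n := H.rangeCoins n + S.signCoins n + H.invCoins n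
  verCoins := S.verCoins
  msgs _ := Set.univ
  gen n _ c :=
    let (pk, sk) := S.gen n id c.fst
    let (h, td) := H.gen n c.snd
    (Bits.cat pk h, Bits.cat sk td)
  sign n O sk' M c :=
    let C := H.sampleRange n c.fst.fst
    let σ := S.sign n id sk'.fst C c.fst.snd
    let m := O (Bits.cat M σ)
    let r := H.invert n sk'.snd m C c.snd
    Bits.cat σ r
  verify n O pk' M σ' v :=
    let σ := σ'.fst
    let r := σ'.snd
    let m := O (Bits.cat M σ)
    let C := H.hash n pk'.snd m r
    H.isRnd n r && S.verify n id pk'.fst C σ v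

/-! ### Straight-line programs

A straight-line program is represented by the list of the Boolean functions that its gates compute.
-/

section StraightLine

variable {Ω Ω' ι κ : Type} {a b : ℕ}

/-- `f` is an input, the value of a gate, or constantly `false`. -/
def Available (A : Set (Ω → Bool)) (l : List (Ω → Bool)) (f : Ω → Bool) : Prop :=
  f ∈ A ∨ f ∈ l ∨ f = fun _ => false

/-- `l` lists the values of the gates of a straight-line program with inputs `A` and with gates
for the oracle `orc`. -/
inductive StraightLine (orc : Ω → Bits a → Bits b) (A : Set (Ω → Bool)) :
    List (Ω → Bool) → Prop
  | nil : StraightLine orc A []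
  | nand {l : List (Ω → Bool)} {f g : Ω → Bool} : StraightLine orc A l → Available A l f →
      Available A l g → StraightLine orc A (l ++ [fun ω => !(f ω && g ω)])
  | query {l : List (Ω → Bool)} (x : Fin a → Ω → Bool) : StraightLine orc A l →
      (∀ i, Available A l (x i)) →
      StraightLine orc A (l ++ List.ofFn (fun j ω => orc ω (fun i => x i ω) j))

/-- The functions in `B` can be computed from those in `A` by `s` gates. -/
def Computes (orc : Ω → Bits a → Bits b) (A B : Set (Ω → Bool)) (s : ℕ) : Prop :=
  ∃ l, StraightLine orc A l ∧ l.length ≤ s ∧ ∀ f ∈ B, Available A l f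

/-- The set of the bits of a string-valued function. -/
def bits (F : Ω → ι → Bool) : Set (Ω → Bool) := Set.range (fun i ω => F ω i)

theorem mem_bits (F : Ω → ι → Bool) (i : ι) : (fun ω => F ω i) ∈ bits F := ⟨i, rfl⟩

theorem bits_reindex_subset (F : Ω → ι → Bool) (π : κ → ι) :
    bits (fun ω k => F ω (π k)) ⊆ bits F := by
  rintro _ ⟨k, rfl⟩; exact ⟨π k, rfl⟩

theorem Available.mono {A A' : Set (Ω → Bool)} {l l' : List (Ω → Bool)} {f : Ω → Bool}
    (h : Available A l f) (hA : A ⊆ A') (hl : l ⊆ l') : Available A' l' f := by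
  rcases h with h | h | h
  · exact .inl (hA h)
  · exact .inr (.inl (hl h))
  · exact .inr (.inr h)

theorem Available.trans {A B : Set (Ω → Bool)} {l l' : List (Ω → Bool)} {f : Ω → Bool}
    (h : Available B l' f) (hB : ∀ f ∈ B, Available A l f) : Available A (l ++ l') f := by
  rcases h with h | h | h
  · exact (hB f h).mono subset_rfl (by simp)
  · exact .inr (.inl (by simp [h]))
  · exact .inr (.inr h)

theorem StraightLine.append {orc : Ω → Bits a → Bits b} {A B : Set (Ω → Bool)}
    {l l' : List (Ω → Bool)} (hl : StraightLine orc A l) (hB : ∀ f ∈ B, Available A l f)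
    (hl' : StraightLine orc B l') : StraightLine orc A (l ++ l') := by
  induction hl' with
  | nil => simpa using hl
  | nand _ hf hg ih =>
    rw [← List.append_assoc]
    exact ih.nand (hf.trans hB) (hg.trans hB)
  | query x _ hx ih =>
    rw [← List.append_assoc]
    exact ih.query x (fun i => (hx i).trans hB)

theorem StraightLine.comp {orc : Ω → Bits a → Bits b} {orc' : Ω' → Bits a → Bits b}
    {A : Set (Ω → Bool)} {l : List (Ω → Bool)} (h : StraightLine orc A l) (φ : Ω' → Ω)
    (hφ : ∀ ω, orc' ω = orc (φ ω)) :
    StraightLine orc' ((fun f => f ∘ φ) '' A) (l.map (fun f => f ∘ φ)) := by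
  have key : ∀ {l : List (Ω → Bool)} {f : Ω → Bool}, Available A l f →
      Available ((fun f => f ∘ φ) '' A) (l.map (fun f => f ∘ φ)) (f ∘ φ) := by
    intro l f h
    rcases h with h | h | h
    · exact .inl ⟨f, h, rfl⟩
    · exact .inr (.inl (List.mem_map.2 ⟨f, h, rfl⟩))
    · exact .inr (.inr (by subst h; rfl))
  induction h with
  | nil => exact .nil
  | nand _ hf hg ih =>
    rw [List.map_append]
    exact ih.nand (key hf) (key hg)
  | @query l x _ hx ih =>
    rw [List.map_append, List.map_ofFn]
    have := ih.query (fun i => x i ∘ φ) (fun i => key (hx i))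
    simpa [hφ, Function.comp_def] using this

theorem StraightLine.of_plain {orc₀ : Ω → Bits 0 → Bits 0} (orc : Ω → Bits a → Bits b)
    {A : Set (Ω → Bool)} {l : List (Ω → Bool)} (h : StraightLine orc₀ A l) :
    StraightLine orc A l := by
  induction h with
  | nil => exact .nil
  | nand _ hf hg ih => exact ih.nand hf hg
  | query x _ _ ih => simpa using ih

theorem StraightLine.append_nands {orc : Ω → Bits a → Bits b} {A : Set (Ω → Bool)}
    {l : List (Ω → Bool)} (hl : StraightLine orc A l) {n : ℕ} (f g : Fin n → Ω → Bool)
    (hf : ∀ k, Available A l (f k)) (hg : ∀ k, Available A l (g k)) :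
    StraightLine orc A (l ++ List.ofFn (fun k ω => !(f k ω && g k ω))) := by
  induction n with
  | zero => simpa using hl
  | succ n ih =>
    rw [List.ofFn_succ_last, ← List.append_assoc]
    exact (ih (fun k => f k.castSucc) (fun k => g k.castSucc) (fun k => hf _) (fun k => hg _)).nand
      ((hf _).mono subset_rfl (by simp)) ((hg _).mono subset_rfl (by simp))

namespace Computes

variable {orc : Ω → Bits a → Bits b} {A A' B B' C : Set (Ω → Bool)} {s t : ℕ}

theorem mono (h : Computes orc A B s) (hA : A ⊆ A') (hB : B' ⊆ B) (hs : s ≤ t) :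
    Computes orc A' B' t := by
  obtain ⟨l, hl, hls, hlB⟩ := h
  refine ⟨l, ?_, hls.trans hs, fun f hf => (hlB f (hB hf)).mono hA (by simp)⟩
  have := StraightLine.append (orc := orc) (A := A') (B := A) (l := []) .nil
    (fun f hf => .inl (hA hf)) hl
  simpa using this

theorem weaken (h : Computes orc A B s) (hs : s ≤ t) : Computes orc A B t :=
  h.mono subset_rfl subset_rfl hs

theorem of_subset (h : B ⊆ A) : Computes orc A B s :=
  ⟨[], .nil, by simp, fun _ hf => .inl (h hf)⟩

theorem trans_union (h : Computes orc A B s) (h' : Computes orc (A ∪ B) C t) :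
    Computes orc A (B ∪ C) (s + t) := by
  obtain ⟨l, hl, hls, hlB⟩ := h
  obtain ⟨l', hl', hls', hlC⟩ := h'
  have hAB : ∀ f ∈ A ∪ B, Available A l f := by
    rintro f (hf | hf)
    · exact .inl hf
    · exact hlB f hf
  refine ⟨l ++ l', hl.append hAB hl', by simp; omega, ?_⟩
  rintro f (hf | hf)
  · exact (hlB f hf).mono subset_rfl (by simp)
  · exact (hlC f hf).trans hAB

theorem trans (h : Computes orc A B s) (h' : Computes orc (A ∪ B) C t) :
    Computes orc A C (s + t) :=
  (h.trans_union h').mono subset_rfl Set.subset_union_right le_rfl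

theorem union (h : Computes orc A B s) (h' : Computes orc A C t) :
    Computes orc A (B ∪ C) (s + t) :=
  h.trans_union (h'.mono Set.subset_union_left subset_rfl le_rfl)

theorem comp (h : Computes orc A B s) (φ : Ω' → Ω) {orc' : Ω' → Bits a → Bits b}
    (hφ : ∀ ω, orc' ω = orc (φ ω)) :
    Computes orc' ((fun f => f ∘ φ) '' A) ((fun f => f ∘ φ) '' B) s := by
  obtain ⟨l, hl, hls, hlB⟩ := h
  refine ⟨l.map (fun f => f ∘ φ), hl.comp φ hφ, by simpa using hls, ?_⟩
  rintro _ ⟨f, hf, rfl⟩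
  rcases hlB f hf with h | h | h
  · exact .inl ⟨f, h, rfl⟩
  · exact .inr (.inl (List.mem_map.2 ⟨f, h, rfl⟩))
  · exact .inr (.inr (by subst h; rfl))

theorem of_plain {orc₀ : Ω → Bits 0 → Bits 0} (orc : Ω → Bits a → Bits b)
    (h : Computes orc₀ A B s) : Computes orc A B s := by
  obtain ⟨l, hl, hls, hlB⟩ := h
  exact ⟨l, hl.of_plain orc, hls, hlB⟩

/-- Substitution of a string-valued function for the inputs. -/
theorem subst {κ : Type} {F : (ι → Bool) → κ → Bool} {orc₀ : (ι → Bool) → Bits 0 → Bits 0}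
    (h : Computes orc₀ (bits id) (bits F) s) (orc : Ω → Bits a → Bits b) (G : Ω → ι → Bool) :
    Computes orc (bits G) (bits fun ω => F (G ω)) s := by
  have := (h.comp G (orc' := fun ω => orc₀ (G ω)) (fun _ => rfl)).of_plain orc
  refine this.mono ?_ ?_ le_rfl
  · rintro _ ⟨_, ⟨i, rfl⟩, rfl⟩; exact ⟨i, rfl⟩
  · rintro _ ⟨i, rfl⟩; exact ⟨_, ⟨i, rfl⟩, rfl⟩

theorem bits_of_forall {F : Ω → κ → Bool} [Fintype κ]
    (h : ∀ k, Computes orc A {fun ω => F ω k} s) :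
    Computes orc A (bits F) (Fintype.card κ * s) := by
  classical
  have key : ∀ S : Finset κ, Computes orc A {f | ∃ k ∈ S, f = fun ω => F ω k} (S.card * s) := by
    intro S
    induction S using Finset.induction_on with
    | empty => exact ⟨[], .nil, by simp, by simp⟩
    | insert k S hk ih =>
      refine ((h k).union ih).mono subset_rfl ?_ ?_
      · rintro f ⟨j, hj, rfl⟩
        rcases Finset.mem_insert.1 hj with rfl | hj
        · exact .inl rfl
        · exact .inr ⟨j, hj, rfl⟩
      · rw [Finset.card_insert_of_notMem hk]; exact le_of_eq (by ring)
  refine (key Finset.univ).mono subset_rfl ?_ le_rfl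
  rintro _ ⟨k, rfl⟩
  exact ⟨k, Finset.mem_univ _, rfl⟩

theorem iterate (F : ℕ → Ω → κ → Bool) (n : ℕ)
    (h : ∀ i < n, Computes orc (A ∪ bits (F i)) (bits (F (i + 1))) s) :
    Computes orc (A ∪ bits (F 0)) (bits (F n)) (n * s) := by
  induction n with
  | zero => exact of_subset Set.subset_union_right
  | succ n ih =>
    refine ((ih fun i hi => h i (by omega)).trans ((h n (by omega)).mono ?_ subset_rfl le_rfl)).weaken
      (le_of_eq (by ring))
    exact Set.union_subset (Set.subset_union_left.trans Set.subset_union_left)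
      Set.subset_union_right

theorem nand {f g : Ω → Bool} (hf : f ∈ A) (hg : g ∈ A) :
    Computes orc A {fun ω => !(f ω && g ω)} 1 :=
  ⟨[] ++ [_], StraightLine.nil.nand (.inl hf) (.inl hg), by simp, fun _ h => .inr (.inl (by simpa using h))⟩

theorem not {f : Ω → Bool} (hf : f ∈ A) : Computes orc A {fun ω => !f ω} 1 := by
  simpa using nand (orc := orc) hf hf

theorem const_false : Computes orc A {fun _ => false} s :=
  ⟨[], .nil, by simp, fun _ h => .inr (.inr h)⟩

theorem const (c : Bool) : Computes orc A {fun _ => c} 1 := by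
  cases c with
  | false => exact const_false
  | true =>
    refine ⟨[] ++ [_], StraightLine.nil.nand (f := fun _ => false) (g := fun _ => false)
      (.inr (.inr rfl)) (.inr (.inr rfl)), by simp, fun _ h => .inr (.inl (by simpa using h))⟩

theorem const_bits (v : κ → Bool) : Computes orc A (bits fun _ => v) 1 := by
  refine ((const true).union (const_false (s := 0))).mono subset_rfl ?_ le_rfl
  rintro _ ⟨k, rfl⟩
  cases h : v k <;> simp [h]

theorem and {f g : Ω → Bool} (hf : f ∈ A) (hg : g ∈ A) :
    Computes orc A {fun ω => f ω && g ω} 2 := by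
  have := (nand (orc := orc) hf hg).trans (not (orc := orc) (A := A ∪ _) (Or.inr rfl))
  simpa using this

theorem xor {f g : Ω → Bool} (hf : f ∈ A) (hg : g ∈ A) :
    Computes orc A {fun ω => xor (f ω) (g ω)} 4 := by
  have h1 := nand (orc := orc) hf hg
  have h2 := h1.trans ((nand (orc := orc) (A := A ∪ {fun ω => !(f ω && g ω)})
    (Or.inl hf) (Or.inr rfl)).union (nand (orc := orc) (A := A ∪ {fun ω => !(f ω && g ω)})
    (Or.inl hg) (Or.inr rfl)))
  have h3 := h2.trans (nand (orc := orc) (A := A ∪ _) (Or.inr (Or.inl rfl))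
    (Or.inr (Or.inr rfl)))
  refine h3.mono subset_rfl ?_ le_rfl
  intro h hh
  rw [Set.mem_singleton_iff] at hh ⊢
  subst hh
  funext ω
  cases f ω <;> cases g ω <;> rfl

theorem cond {c f g : Ω → Bool} (hc : c ∈ A) (hf : f ∈ A) (hg : g ∈ A) :
    Computes orc A {fun ω => if c ω then f ω else g ω} 4 := by
  have h1 := not (orc := orc) hc
  have h2 := h1.trans ((nand (orc := orc) (A := A ∪ _) (Or.inl hc) (Or.inl hf)).union
    (nand (orc := orc) (A := A ∪ _) (Or.inl hg) (Or.inr rfl)))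
  have h3 := h2.trans (nand (orc := orc) (A := A ∪ _) (Or.inr (Or.inl rfl))
    (Or.inr (Or.inr rfl)))
  refine h3.mono subset_rfl ?_ le_rfl
  intro h hh
  rw [Set.mem_singleton_iff] at hh ⊢
  subst hh
  funext ω
  cases c ω <;> cases f ω <;> cases g ω <;> rfl

theorem cond_bits [Fintype κ] {c : Ω → Bool} {F G : Ω → κ → Bool} (hc : c ∈ A)
    (hF : bits F ⊆ A) (hG : bits G ⊆ A) :
    Computes orc A (bits fun ω => if c ω then F ω else G ω) (Fintype.card κ * 4) := by
  refine bits_of_forall fun k => ?_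
  have := cond (orc := orc) hc (hF (mem_bits F k)) (hG (mem_bits G k))
  convert this using 3
  split <;> rfl

/-- Iterated conjunction. -/
theorem forall_finset (S : Finset ι) (f : ι → Ω → Bool) (hf : ∀ i, f i ∈ A) :
    Computes orc A {fun ω => decide (∀ i ∈ S, f i ω = true)} (S.card * 2 + 1) := by
  classical
  induction S using Finset.induction_on with
  | empty => simpa using const true
  | insert k S hk ih =>
    refine (ih.trans (and (orc := orc) (A := A ∪ _) (Or.inl (hf k)) (Or.inr rfl))).mono
      subset_rfl ?_ ?_
    · intro h hh
      rw [Set.mem_singleton_iff] at hh ⊢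
      subst hh
      funext ω
      simp
    · rw [Finset.card_insert_of_notMem hk]; omega

/-- Iterated exclusive or. -/
theorem xor_list (L : List ι) (f : ι → Ω → Bool) (hf : ∀ i, f i ∈ A) :
    Computes orc A {fun ω => (L.map (f · ω)).foldr Bool.xor false} (L.length * 4) := by
  induction L with
  | nil => exact const_false
  | cons k L ih =>
    refine (ih.trans (xor (orc := orc) (A := A ∪ _) (Or.inl (hf k)) (Or.inr rfl))).mono
      subset_rfl ?_ (by simp; omega)
    intro h hh
    rw [Set.mem_singleton_iff] at hh ⊢
    subst hh
    rfl

/-- Equality test for strings. -/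
theorem eq_test [Fintype κ] [DecidableEq κ] {F G : Ω → κ → Bool} (hF : bits F ⊆ A)
    (hG : bits G ⊆ A) :
    Computes orc A {fun ω => decide (F ω = G ω)} (Fintype.card κ * 8 + 1) := by
  have h1 : Computes orc A (bits fun ω k => !Bool.xor (F ω k) (G ω k)) (Fintype.card κ * 5) := by
    refine bits_of_forall fun k => ?_
    exact (xor (orc := orc) (hF (mem_bits F k)) (hG (mem_bits G k))).trans
      (not (orc := orc) (A := A ∪ _) (Or.inr rfl))
  have h2 := h1.trans (forall_finset (orc := orc) (A := A ∪ _) Finset.univ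
    (fun k ω => !Bool.xor (F ω k) (G ω k)) (fun k => Or.inr ⟨k, rfl⟩))
  refine h2.mono subset_rfl ?_ (by rw [Finset.card_univ]; omega)
  intro h hh
  rw [Set.mem_singleton_iff] at hh ⊢
  subst hh
  funext ω
  simp [funext_iff]

theorem query {x : Ω → Bits a} (hx : bits x ⊆ A) :
    Computes orc A (bits fun ω => orc ω (x ω)) b := by
  refine ⟨[] ++ _, StraightLine.nil.query (fun i ω => x ω i)
    (fun i => .inl (hx (mem_bits x i))), by simp, ?_⟩
  rintro _ ⟨k, rfl⟩
  exact .inr (.inl (by simp))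

end Computes

/-! ### Straight-line programs and circuits -/

theorem Bits.writeAt_apply {w k : ℕ} (y : Fin k ↪ Fin w) (v : Bits k) (z : Bits w) (j : Fin k) :
    Bits.writeAt y v z (y j) = v j := y.injective.extend_apply _ _ _

theorem Bits.writeAt_of_notMem {w k : ℕ} {y : Fin k ↪ Fin w} {v : Bits k} {z : Bits w} {i : Fin w}
    (h : i ∉ Set.range y) : Bits.writeAt y v z i = z i :=
  Function.extend_apply' _ _ _ (by simpa using h)

theorem Bits.load_apply {w k : ℕ} (y : Fin k ↪ Fin w) (v : Bits k) (j : Fin k) :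
    Bits.load y v (y j) = v j := Bits.writeAt_apply _ _ _ _

theorem Computes.load {i w : ℕ} {orc : Ω → Bits a → Bits b} (y : Fin i ↪ Fin w) (F : Ω → Bits i) :
    Computes orc (bits F) (bits fun ω => Bits.load y (F ω)) 0 := by
  refine ⟨[], .nil, le_rfl, ?_⟩
  rintro _ ⟨k, rfl⟩
  by_cases hk : k ∈ Set.range y
  · obtain ⟨j, rfl⟩ := hk
    exact .inl ⟨j, by funext ω; simp [Bits.load_apply]⟩
  · exact .inr (.inr (by funext ω; simp [Bits.load, Bits.writeAt_of_notMem hk]))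

theorem BoolInstr.computes {w : ℕ} (g : BoolInstr w a b) {orc : Ω → Bits a → Bits b}
    (Z : Ω → Bits w) :
    Computes orc (bits Z) (bits fun ω => g.apply (orc ω) (Z ω)) (b + 1) := by
  cases g with
  | nand t i j =>
    have h := Computes.nand (orc := orc) (mem_bits Z i) (mem_bits Z j)
    obtain ⟨l, hl, hls, hlB⟩ := h
    refine ⟨l, hl, by omega, ?_⟩
    rintro _ ⟨k, rfl⟩
    by_cases hk : k = t
    · subst hk
      have := hlB _ rfl
      simpa [BoolInstr.apply] using this
    · simp only [BoolInstr.apply, Function.update_of_ne hk]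
      exact .inl ⟨k, rfl⟩
  | query x y =>
    have h : Computes orc (bits Z) (bits fun ω => orc ω (Z ω ∘ x)) b :=
      Computes.query (orc := orc) (x := fun ω => Z ω ∘ x) (bits_reindex_subset Z x)
    obtain ⟨l, hl, hls, hlB⟩ := h
    refine ⟨l, hl, by omega, ?_⟩
    rintro _ ⟨k, rfl⟩
    by_cases hk : k ∈ Set.range y
    · obtain ⟨j, rfl⟩ := hk
      simp only [BoolInstr.apply, Bits.writeAt_apply]
      exact hlB _ ⟨j, rfl⟩
    · simp only [BoolInstr.apply, Bits.writeAt_of_notMem hk]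
      exact .inl ⟨k, rfl⟩

theorem BoolCircuit.computes {i o : ℕ} (C : BoolCircuit a b i o) (orc : Ω → Bits a → Bits b)
    (F : Ω → Bits i) :
    Computes orc (bits F) (bits fun ω => C.eval (orc ω) (F ω)) (C.code.length * (b + 1)) := by
  have key : ∀ (l : List (BoolInstr C.width a b)) (Z : Ω → Bits C.width),
      Computes orc (bits Z) (bits fun ω => l.foldl (fun z g => g.apply (orc ω) z) (Z ω))
        (l.length * (b + 1)) := by
    intro l
    induction l with
    | nil => exact fun Z => Computes.of_subset subset_rfl
    | cons g l ih =>
      intro Z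
      refine ((g.computes Z).trans ((ih fun ω => g.apply (orc ω) (Z ω)).mono
        Set.subset_union_right subset_rfl le_rfl)).weaken ?_
      simp only [List.length_cons]
      exact le_of_eq (by ring)
  refine ((Computes.load C.input F).trans ((key C.code _).mono
    Set.subset_union_right ?_ le_rfl)).weaken (by omega)
  exact bits_reindex_subset (fun ω => C.code.foldl (fun z g => g.apply (orc ω) z)
    (Bits.load C.input (F ω))) C.output

theorem BoolCircuit.computes_plain {i o : ℕ} (C : BoolCircuit 0 0 i o) (orc : Ω → Bits a → Bits b)
    (F : Ω → Bits i) :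
    Computes orc (bits F) (bits fun ω => C.eval id (F ω)) C.size := by
  refine ((C.computes (fun _ => id) F).of_plain orc).weaken ?_
  simp [BoolCircuit.size]

end StraightLine

section ExistsCircuit

variable {a b i o : ℕ}

theorem Available.exists_wire {W : ℕ} {l : List ((Bits a → Bits b) × Bits i → Bool)}
    (hW : i + l.length < W) {f : (Bits a → Bits b) × Bits i → Bool}
    (hf : Available (bits Prod.snd) l f) :
    ∃ m : Fin W, ∀ O v, (List.ofFn v ++ l.map (· (O, v))).getD m false = f (O, v) := by
  rcases hf with ⟨k, rfl⟩ | hf | rfl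
  · refine ⟨⟨k, by omega⟩, fun O v => ?_⟩
    simp [List.getD_eq_getElem?_getD, List.getElem?_append]
  · obtain ⟨k, hk, rfl⟩ := List.mem_iff_getElem.1 hf
    refine ⟨⟨i + k, by omega⟩, fun O v => ?_⟩
    simp [List.getD_eq_getElem?_getD, hk]
  · refine ⟨⟨i + l.length, hW⟩, fun O v => ?_⟩
    simp [List.getD_eq_getElem?_getD]

theorem BoolInstr.apply_nand {w : ℕ} (O : Bits a → Bits b) (t j k : Fin w) (z : Bits w) :
    (BoolInstr.nand t j k : BoolInstr w a b).apply O z =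
      Function.update z t (!(z j && z k)) := rfl

theorem BoolInstr.apply_query {w : ℕ} (O : Bits a → Bits b) (x : Fin a → Fin w) (y : Fin b ↪ Fin w)
    (z : Bits w) :
    (BoolInstr.query x y).apply O z = Bits.writeAt y (O (z ∘ x)) z := rfl

theorem StraightLine.exists_code {l : List ((Bits a → Bits b) × Bits i → Bool)}
    (h : StraightLine (fun ω => ω.1) (bits Prod.snd) l) (W : ℕ) (hW : i + l.length < W) :
    ∃ code : List (BoolInstr W a b), code.length ≤ l.length ∧ ∀ O v, ∀ m : Fin W,
      code.foldl (fun z g => g.apply O z) (Bits.load (Fin.castLEEmb (by omega : i ≤ W)) v) m =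
        (List.ofFn v ++ l.map (· (O, v))).getD m false := by
  induction h with
  | nil =>
    refine ⟨[], le_rfl, fun O v m => ?_⟩
    simp only [List.foldl_nil, List.map_nil, List.append_nil]
    by_cases hm : (m : ℕ) < i
    · have : m = Fin.castLEEmb (by omega : i ≤ W) ⟨m, hm⟩ := by ext; simp
      rw [this, Bits.load_apply]
      simp [List.getD_eq_getElem?_getD, hm]
    · rw [Bits.load, Bits.writeAt_of_notMem]
      · simp [List.getD_eq_getElem?_getD, hm]
      · rintro ⟨j, rfl⟩
        simp at hm
  | @nand l f g _ hf hg ih =>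
    simp only [List.length_append, List.length_singleton] at hW
    obtain ⟨code, hlen, hc⟩ := ih (by omega)
    obtain ⟨mf, hmf⟩ := hf.exists_wire (W := W) (by omega)
    obtain ⟨mg, hmg⟩ := hg.exists_wire (W := W) (by omega)
    refine ⟨code ++ [.nand ⟨i + l.length, by omega⟩ mf mg], by simpa using hlen, fun O v m => ?_⟩
    rw [List.foldl_append, List.foldl_cons, List.foldl_nil]
    rw [BoolInstr.apply_nand]
    by_cases hm : m = ⟨i + l.length, by omega⟩
    · subst hm
      rw [Function.update_self, hc, hc, hmf, hmg]
      simp [List.getD_eq_getElem?_getD]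
    · rw [Function.update_of_ne hm, hc]
      have hm' : (m : ℕ) ≠ i + l.length := fun h => hm (Fin.ext h)
      rw [List.map_append, ← List.append_assoc]
      rcases lt_or_ge (m : ℕ) (i + l.length) with h | h
      · exact (List.getD_append _ _ _ _ (by simpa using h)).symm
      · rw [List.getD_eq_default _ _ (by simpa using h),
          List.getD_eq_default _ _ (by simp; omega)]
  | @query l x _ hx ih =>
    simp only [List.length_append, List.length_ofFn] at hW
    obtain ⟨code, hlen, hc⟩ := ih (by omega)
    choose mx hmx using fun k => (hx k).exists_wire (W := W) (by omega)
    rcases Nat.eq_zero_or_pos b with hb | hb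
    · subst hb
      refine ⟨code, by simpa using hlen, fun O v m => ?_⟩
      simpa using hc O v m
    · let y : Fin b ↪ Fin W := ⟨fun k => ⟨i + l.length + k, by omega⟩, fun k k' h => by
        simpa [Fin.ext_iff] using h⟩
      refine ⟨code ++ [.query mx y], by simp; omega, fun O v m => ?_⟩
      rw [List.foldl_append, List.foldl_cons, List.foldl_nil]
      rw [BoolInstr.apply_query]
      have hin : (code.foldl (fun z g => g.apply O z)
          (Bits.load (Fin.castLEEmb (by omega : i ≤ W)) v)) ∘ mx = fun k => x k (O, v) := by
        funext k
        simp only [Function.comp_apply]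
        rw [hc, hmx]
      rw [hin, List.map_append, ← List.append_assoc]
      by_cases hm : m ∈ Set.range y
      · obtain ⟨k, rfl⟩ := hm
        have hy : ((y k : Fin W) : ℕ) = i + (l.length + k) := Nat.add_assoc _ _ _
        rw [Bits.writeAt_apply, hy]
        simp [List.getD_eq_getElem?_getD, List.getElem_ofFn]
      · rw [Bits.writeAt_of_notMem hm, hc]
        rcases lt_or_ge (m : ℕ) (i + l.length) with h | h
        · exact (List.getD_append _ _ _ _ (by simpa using h)).symm
        · have h' : i + l.length + b ≤ m := by
            by_contra hcon
            exact hm ⟨⟨m - (i + l.length), by omega⟩, Fin.ext (by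
              change i + l.length + (m - (i + l.length)) = (m : ℕ); omega)⟩
          rw [List.getD_eq_default _ _ (by simpa using h),
            List.getD_eq_default _ _ (by simp; omega)]

theorem Computes.exists_circuit {s : ℕ} {F : (Bits a → Bits b) × Bits i → Bits o}
    (h : Computes (fun ω => ω.1) (bits Prod.snd) (bits F) s) :
    ∃ C : BoolCircuit a b i o, (∀ O v, C.eval O v = F (O, v)) ∧
      C.size ≤ i + 1 + 2 * s + 4 * o := by
  obtain ⟨l, hl, hls, hF⟩ := h
  have h1 := hl.append_nands (fun k ω => F ω k) (fun k ω => F ω k)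
    (fun k => hF _ ⟨k, rfl⟩) (fun k => hF _ ⟨k, rfl⟩)
  have h2 := h1.append_nands (fun (k : Fin o) ω => !(F ω k && F ω k))
    (fun k ω => !(F ω k && F ω k)) (fun k => .inr (.inl (by simp)))
    (fun k => .inr (.inl (by simp)))
  obtain ⟨code, hlen, hc⟩ := h2.exists_code (i + (l.length + o + o) + 1) (by simp; omega)
  refine ⟨⟨_, code, Fin.castLEEmb (by omega), ⟨fun k => ⟨i + (l.length + o + k), by omega⟩,
    fun k k' h => by simpa [Fin.ext_iff] using h⟩⟩, fun O v => ?_, ?_⟩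
  · funext k
    rw [BoolCircuit.eval, Function.comp_apply, hc]
    change List.getD _ (i + (l.length + o + k)) false = _
    rw [add_assoc l.length]
    simp [List.getD_eq_getElem?_getD, List.getElem_ofFn]
  · simp only [BoolCircuit.size]
    simp at hlen
    omega

end ExistsCircuit

/-! ### Polynomial bounds -/

namespace PolyBounded

theorem mono {f g : ℕ → ℕ} (hg : PolyBounded g) (h : ∀ n, f n ≤ g n) : PolyBounded f := by
  obtain ⟨p, hp⟩ := hg
  exact ⟨p, fun n => (h n).trans (hp n)⟩

theorem const (c : ℕ) : PolyBounded (fun _ => c) := ⟨Polynomial.C c, fun n => by simp⟩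

theorem add {f g : ℕ → ℕ} (hf : PolyBounded f) (hg : PolyBounded g) :
    PolyBounded (fun n => f n + g n) := by
  obtain ⟨p, hp⟩ := hf
  obtain ⟨q, hq⟩ := hg
  exact ⟨p + q, fun n => by rw [Polynomial.eval_add]; exact add_le_add (hp n) (hq n)⟩

theorem mul {f g : ℕ → ℕ} (hf : PolyBounded f) (hg : PolyBounded g) :
    PolyBounded (fun n => f n * g n) := by
  obtain ⟨p, hp⟩ := hf
  obtain ⟨q, hq⟩ := hg
  exact ⟨p * q, fun n => by rw [Polynomial.eval_mul]; exact Nat.mul_le_mul (hp n) (hq n)⟩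

theorem pow {f : ℕ → ℕ} (hf : PolyBounded f) (k : ℕ) : PolyBounded (fun n => f n ^ k) := by
  obtain ⟨p, hp⟩ := hf
  exact ⟨p ^ k, fun n => by rw [Polynomial.eval_pow]; exact Nat.pow_le_pow_left (hp n) k⟩

end PolyBounded

theorem BoolCircuit.input_le_size {a b i o : ℕ} (C : BoolCircuit a b i o) : i ≤ C.size := by
  have := Fintype.card_le_of_embedding C.input
  simp only [Fintype.card_fin] at this
  exact this.trans (Nat.le_add_right _ _)

theorem BoolCircuit.output_le_size {a b i o : ℕ} (C : BoolCircuit a b i o) : o ≤ C.size := by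
  have := Fintype.card_le_of_embedding C.output
  simp only [Fintype.card_fin] at this
  exact this.trans (Nat.le_add_right _ _)

/-! ### Bit strings -/

@[simp] theorem Bits.fst_cat {m n : ℕ} (x : Bits m) (y : Bits n) : (Bits.cat x y).fst = x := by
  funext i; simp [Bits.fst, Bits.cat]

@[simp] theorem Bits.snd_cat {m n : ℕ} (x : Bits m) (y : Bits n) : (Bits.cat x y).snd = y := by
  funext i; simp [Bits.snd, Bits.cat]

theorem Bits.cat_fst_snd {m n : ℕ} (z : Bits (m + n)) : Bits.cat z.fst z.snd = z := by
  funext i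
  refine Fin.addCases (fun i => ?_) (fun i => ?_) i <;> simp [Bits.fst, Bits.snd, Bits.cat]

theorem Bits.cat_inj {m n : ℕ} {x x' : Bits m} {y y' : Bits n} :
    Bits.cat x y = Bits.cat x' y' ↔ x = x' ∧ y = y' := by
  refine ⟨fun h => ?_, fun ⟨h, h'⟩ => by rw [h, h']⟩
  exact ⟨by simpa using congrArg Bits.fst h, by simpa using congrArg Bits.snd h⟩

section

variable {Ω : Type} {m n : ℕ}

theorem bits_cat (F : Ω → Bits m) (G : Ω → Bits n) :
    bits (fun ω => Bits.cat (F ω) (G ω)) = bits F ∪ bits G := by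
  ext f
  constructor
  · rintro ⟨i, rfl⟩
    refine Fin.addCases (fun i => ?_) (fun i => ?_) i
    · exact .inl ⟨i, by simp⟩
    · exact .inr ⟨i, by simp⟩
  · rintro (⟨i, rfl⟩ | ⟨i, rfl⟩)
    · exact ⟨Fin.castAdd n i, by simp⟩
    · exact ⟨Fin.natAdd m i, by simp⟩

theorem bits_fst_subset (F : Ω → Bits (m + n)) : bits (fun ω => (F ω).fst) ⊆ bits F :=
  bits_reindex_subset F (Fin.castAdd n)

theorem bits_snd_subset (F : Ω → Bits (m + n)) : bits (fun ω => (F ω).snd) ⊆ bits F :=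
  bits_reindex_subset F (Fin.natAdd m)

end

/-! ### Efficiency and correctness of the transformed scheme -/

section TOO

variable {ℓ : ℕ → ℕ} (S : PlainSigAlgs ℓ) (H : ChameleonAlgs ℓ) (μ : ℕ → ℕ)

/-- Plain functions with circuits of the given size, applied to computed strings. -/
def CircuitBound {i o : ℕ} (f : Bits i → Bits o) (s : ℕ) : Prop :=
  Computes (fun _ => id : Bits i → Bits 0 → Bits 0) (bits id) (bits f) s

theorem BoolCircuit.circuitBound {i o : ℕ} (C : BoolCircuit 0 0 i o) {f : Bits i → Bits o}
    (hf : ∀ v, C.eval id v = f v) : CircuitBound f C.size := by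
  have := C.computes_plain (fun _ => id : Bits i → Bits 0 → Bits 0) id
  unfold CircuitBound
  convert this using 2
  funext v
  exact (hf v).symm

theorem CircuitBound.computes {Ω : Type} {a b i o s : ℕ} {f : Bits i → Bits o}
    (h : CircuitBound f s) {orc : Ω → Bits a → Bits b} {A : Set (Ω → Bool)} {F : Ω → Bits i}
    (hF : bits F ⊆ A) : Computes orc A (bits fun ω => f (F ω)) s :=
  (Computes.subst h orc F).mono hF subset_rfl le_rfl


theorem TOO_correct (hS : S.IsScheme) (hH : H.IsFamily) (hrange : ∀ n, H.range n ⊆ S.msgs n) :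
    (TOO S H μ).Correct := by
  intro n O g M _ c v
  obtain ⟨_, ⟨_, _, hsr, _⟩, ⟨hinv, _⟩, _⟩ := hH
  have hC := hsr n c.fst.fst
  have h1 := hinv n g.snd (O (Bits.cat M (S.sign n id (S.gen n id g.fst).2
    (H.sampleRange n c.fst.fst) c.fst.snd))) _ hC c.snd
  have h2 := hS.2 n id g.fst _ (hrange n hC) c.fst.snd v
  simp only [TOO, Bits.fst_cat, Bits.snd_cat, h1.1, h1.2, h2, Bool.and_self]

theorem TOO_efficient (hμ : PolyBounded μ) (hS : S.IsScheme) (hH : H.IsFamily) :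
    (TOO S H μ).Efficient := by
  obtain ⟨⟨⟨GS, hGS, hGS'⟩, ⟨SS, hSS, hSS'⟩, ⟨VS, hVS, hVS'⟩⟩, _⟩ := hS
  obtain ⟨⟨⟨GH, hGH, hGH'⟩, ⟨HH, hHH, hHH'⟩, ⟨RH, hRH, hRH'⟩, _, ⟨IH, hIH, hIH'⟩,
    ⟨CH, hCH, hCH'⟩⟩, _⟩ := hH
  have gGS n := (GS n).circuitBound (hGS' n id)
  have gGH n := (GH n).circuitBound (hGH' n)
  refine ⟨?_, ?_, ?_⟩
  · have key : ∀ n, Computes (fun ω => ω.1 : (Bits (μ n + S.sigLen n) → Bits (H.msgLen n)) ×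
        Bits (S.genCoins n + H.genCoins n) → _) (bits Prod.snd)
        (bits fun ω => Bits.cat ((TOO S H μ).gen n ω.1 ω.2).1 ((TOO S H μ).gen n ω.1 ω.2).2)
        ((GS n).size + (GH n).size) := by
      intro n
      refine (((gGS n).computes (bits_fst_subset _)).union
        ((gGH n).computes (bits_snd_subset _))).mono subset_rfl ?_ le_rfl
      simp only [TOO, bits_cat]
      rintro f ((h | h) | (h | h)) <;> simp [h]
    choose C hC hC' using fun n => (key n).exists_circuit
    refine ⟨C, ?_, fun n O c => hC n O c⟩
    refine PolyBounded.mono ((((PolyBounded.const 12).mul (hGS.add hGH))).add (.const 1))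
      fun n => (hC' n).trans ?_
    have h1 := (GS n).input_le_size
    have h2 := (GH n).input_le_size
    have h3 := (GS n).output_le_size
    have h4 := (GH n).output_le_size
    simp only [TOO]
    omega
  · have key : ∀ n, Computes (fun ω => ω.1 : (Bits (μ n + S.sigLen n) → Bits (H.msgLen n)) ×
        Bits (S.skLen n + H.tdLen n + μ n + (H.rangeCoins n + S.signCoins n + H.invCoins n)) → _)
        (bits Prod.snd)
        (bits fun ω => (TOO S H μ).sign n ω.1 ω.2.fst.fst ω.2.fst.snd ω.2.snd)
        ((CH n).size + ((SS n).size + (H.msgLen n + (IH n).size))) := by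
      intro n
      let Ω := (Bits (μ n + S.sigLen n) → Bits (H.msgLen n)) ×
        Bits (S.skLen n + H.tdLen n + μ n + (H.rangeCoins n + S.signCoins n + H.invCoins n))
      let O : Ω → Bits (μ n + S.sigLen n) → Bits (H.msgLen n) := fun ω => ω.1
      let sk' : Ω → Bits (S.skLen n + H.tdLen n) := fun ω => ω.2.fst.fst
      let M : Ω → Bits (μ n) := fun ω => ω.2.fst.snd
      let c : Ω → Bits (H.rangeCoins n + S.signCoins n + H.invCoins n) := fun ω => ω.2.snd
      let Y : Ω → Bits (ℓ n) := fun ω => H.sampleRange n (c ω).fst.fst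
      let σ : Ω → Bits (S.sigLen n) := fun ω => S.sign n id (sk' ω).fst (Y ω) (c ω).fst.snd
      let m : Ω → Bits (H.msgLen n) := fun ω => O ω (Bits.cat (M ω) (σ ω))
      let r : Ω → Bits (H.rndLen n) := fun ω => H.invert n (sk' ω).snd (m ω) (Y ω) (c ω).snd
      let A : Set (Ω → Bool) := bits Prod.snd
      have hsk : bits sk' ⊆ A := (bits_fst_subset _).trans (bits_fst_subset _)
      have hM : bits M ⊆ A := (bits_snd_subset (fun ω : Ω => ω.2.fst)).trans (bits_fst_subset _)
      have hc : bits c ⊆ A := bits_snd_subset _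
      have h1 : Computes O A (bits Y) (CH n).size :=
        ((CH n).circuitBound (hCH' n)).computes
          (((bits_fst_subset _).trans (bits_fst_subset c)).trans hc)
      have h2 : Computes O (A ∪ bits Y) (bits σ) (SS n).size := by
        have := ((SS n).circuitBound (f := fun v => S.sign n id v.fst.fst v.fst.snd v.snd)
          (fun v => by rw [← hSS' n id, Bits.cat_fst_snd, Bits.cat_fst_snd])).computes
          (orc := O) (A := A ∪ bits Y)
          (F := fun ω => ((sk' ω).fst.cat (Y ω)).cat (c ω).fst.snd) (by
            rw [bits_cat, bits_cat]
            refine Set.union_subset (Set.union_subset ?_ Set.subset_union_right) ?_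
            · exact ((bits_fst_subset sk').trans hsk).trans Set.subset_union_left
            · exact (((bits_snd_subset (fun ω => (c ω).fst)).trans (bits_fst_subset c)).trans
                hc).trans Set.subset_union_left)
        simpa only [Bits.fst_cat, Bits.snd_cat] using this
      have h3 : Computes O (A ∪ (bits Y ∪ bits σ)) (bits m) (H.msgLen n) := by
        refine Computes.query (x := fun ω => (M ω).cat (σ ω)) ?_
        rw [bits_cat]
        exact Set.union_subset (hM.trans Set.subset_union_left)
          (Set.subset_union_right.trans Set.subset_union_right)
      have h4 : Computes O (A ∪ (bits Y ∪ (bits σ ∪ bits m))) (bits r) (IH n).size := by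
        have := ((IH n).circuitBound
          (f := fun v => H.invert n v.fst.fst.fst v.fst.fst.snd v.fst.snd v.snd)
          (fun v => by rw [← hIH' n, Bits.cat_fst_snd, Bits.cat_fst_snd,
            Bits.cat_fst_snd])).computes
          (orc := O) (A := A ∪ (bits Y ∪ (bits σ ∪ bits m)))
          (F := fun ω => (((sk' ω).snd.cat (m ω)).cat (Y ω)).cat (c ω).snd) (by
            rw [bits_cat, bits_cat, bits_cat]
            have h5 := (bits_snd_subset sk').trans hsk
            have h6 := (bits_snd_subset c).trans hc
            rintro f (((h | h) | h) | h)
            · exact .inl (h5 h)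
            · exact .inr (.inr (.inr h))
            · exact .inr (.inl h)
            · exact .inl (h6 h))
        simpa only [Bits.fst_cat, Bits.snd_cat] using this
      have h5 := h1.trans_union (h2.trans_union ((h3.mono (by rw [Set.union_assoc]) subset_rfl
        le_rfl).trans_union (h4.mono (by simp only [Set.union_assoc]; rfl) subset_rfl le_rfl)))
      refine h5.mono subset_rfl ?_ le_rfl
      change bits (fun ω => Bits.cat (σ ω) (r ω)) ⊆ _
      rw [bits_cat]
      rintro f (h | h) <;> simp [h]
    choose C hC hC' using fun n => (key n).exists_circuit
    refine ⟨C, ?_, fun n O sk M c => (hC n O _).trans (congr (congr (congrArg _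
      ((congrArg Bits.fst (Bits.fst_cat (Bits.cat sk M) c)).trans (Bits.fst_cat sk M)))
      ((congrArg Bits.snd (Bits.fst_cat (Bits.cat sk M) c)).trans (Bits.snd_cat sk M)))
      (Bits.snd_cat (Bits.cat sk M) c))⟩
    refine PolyBounded.mono ((((PolyBounded.const 12).mul (((hCH.add hSS).add hIH).add hμ))).add
      (.const 1)) fun n => (hC' n).trans ?_
    have h1 := (CH n).input_le_size
    have h2 := (SS n).input_le_size
    have h3 := (IH n).input_le_size
    have h4 := (SS n).output_le_size
    have h5 := (IH n).output_le_size
    simp only [TOO]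
    omega
  · have key : ∀ n, Computes (fun ω => ω.1 : (Bits (μ n + S.sigLen n) → Bits (H.msgLen n)) ×
        Bits (S.pkLen n + H.keyLen n + μ n + (S.sigLen n + H.rndLen n) + S.verCoins n) → _)
        (bits Prod.snd)
        (bits fun ω (_ : Fin 1) => (TOO S H μ).verify n ω.1 ω.2.fst.fst.fst ω.2.fst.fst.snd
          ω.2.fst.snd ω.2.snd)
        (H.msgLen n + ((HH n).size + ((RH n).size + (VS n).size + 2))) := by
      intro n
      let Ω := (Bits (μ n + S.sigLen n) → Bits (H.msgLen n)) ×
        Bits (S.pkLen n + H.keyLen n + μ n + (S.sigLen n + H.rndLen n) + S.verCoins n)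
      let O : Ω → Bits (μ n + S.sigLen n) → Bits (H.msgLen n) := fun ω => ω.1
      let pk' : Ω → Bits (S.pkLen n + H.keyLen n) := fun ω => ω.2.fst.fst.fst
      let M : Ω → Bits (μ n) := fun ω => ω.2.fst.fst.snd
      let σ' : Ω → Bits (S.sigLen n + H.rndLen n) := fun ω => ω.2.fst.snd
      let v : Ω → Bits (S.verCoins n) := fun ω => ω.2.snd
      let m : Ω → Bits (H.msgLen n) := fun ω => O ω (Bits.cat (M ω) (σ' ω).fst)
      let Y : Ω → Bits (ℓ n) := fun ω => H.hash n (pk' ω).snd (m ω) (σ' ω).snd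
      let A : Set (Ω → Bool) := bits Prod.snd
      have h0 : bits (fun ω : Ω => ω.2.fst.fst) ⊆ A :=
        (bits_fst_subset _).trans (bits_fst_subset _)
      have hpk : bits pk' ⊆ A := (bits_fst_subset _).trans h0
      have hM : bits M ⊆ A := (bits_snd_subset _).trans h0
      have hσ : bits σ' ⊆ A := (bits_snd_subset (fun ω : Ω => ω.2.fst)).trans (bits_fst_subset _)
      have hv : bits v ⊆ A := bits_snd_subset _
      have h1 : Computes O A (bits m) (H.msgLen n) := by
        refine Computes.query (x := fun ω => (M ω).cat (σ' ω).fst) ?_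
        rw [bits_cat]
        exact Set.union_subset hM ((bits_fst_subset _).trans hσ)
      have h2 : Computes O (A ∪ bits m) (bits Y) (HH n).size := by
        have := ((HH n).circuitBound (f := fun v => H.hash n v.fst.fst v.fst.snd v.snd)
          (fun v => by rw [← hHH' n, Bits.cat_fst_snd, Bits.cat_fst_snd])).computes
          (orc := O) (A := A ∪ bits m)
          (F := fun ω => ((pk' ω).snd.cat (m ω)).cat (σ' ω).snd) (by
            rw [bits_cat, bits_cat]
            have h5 := (bits_snd_subset pk').trans hpk
            have h6 := (bits_snd_subset σ').trans hσ
            rintro f ((h | h) | h)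
            · exact .inl (h5 h)
            · exact .inr h
            · exact .inl (h6 h))
        simpa only [Bits.fst_cat, Bits.snd_cat] using this
      have h3 : Computes O (A ∪ (bits m ∪ bits Y))
          (bits fun ω (_ : Fin 1) => H.isRnd n (σ' ω).snd) (RH n).size :=
        ((RH n).circuitBound (hRH' n)).computes
          (((bits_snd_subset σ').trans hσ).trans Set.subset_union_left)
      have h4 : Computes O (A ∪ (bits m ∪ bits Y))
          (bits fun ω (_ : Fin 1) => S.verify n id (pk' ω).fst (Y ω) (σ' ω).fst (v ω))
          (VS n).size := by
        have := ((VS n).circuitBound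
          (f := fun v _ => S.verify n id v.fst.fst.fst v.fst.fst.snd v.fst.snd v.snd)
          (fun v => by rw [← hVS' n id, Bits.cat_fst_snd, Bits.cat_fst_snd,
            Bits.cat_fst_snd])).computes
          (orc := O) (A := A ∪ (bits m ∪ bits Y))
          (F := fun ω => (((pk' ω).fst.cat (Y ω)).cat (σ' ω).fst).cat (v ω)) (by
            rw [bits_cat, bits_cat, bits_cat]
            have h5 := (bits_fst_subset pk').trans hpk
            have h6 := (bits_fst_subset σ').trans hσ
            rintro f (((h | h) | h) | h)
            · exact .inl (h5 h)
            · exact .inr (.inr h)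
            · exact .inl (h6 h)
            · exact .inl (hv h))
        simpa only [Bits.fst_cat, Bits.snd_cat] using this
      have h5 := h1.trans (h2.trans_union ((h3.union h4).mono (by rw [Set.union_assoc]) subset_rfl
        le_rfl |>.trans (Computes.and (Or.inr (Or.inl ⟨0, rfl⟩)) (Or.inr (Or.inr ⟨0, rfl⟩)))))
      refine h5.mono subset_rfl ?_ le_rfl
      rintro f ⟨k, rfl⟩
      exact .inr rfl
    choose C hC hC' using fun n => (key n).exists_circuit
    refine ⟨C, ?_, fun n O pk M σ c => funext fun _ =>
      (congrFun (hC n O _) _).trans (congr (congr (congr (congrArg _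
      ((congrArg (fun v => Bits.fst (Bits.fst v))
        (Bits.fst_cat ((Bits.cat pk M).cat σ) c)).trans ((congrArg Bits.fst
          (Bits.fst_cat (Bits.cat pk M) σ)).trans (Bits.fst_cat pk M))))
      ((congrArg (fun v => Bits.snd (Bits.fst v))
        (Bits.fst_cat ((Bits.cat pk M).cat σ) c)).trans ((congrArg Bits.snd
          (Bits.fst_cat (Bits.cat pk M) σ)).trans (Bits.snd_cat pk M))))
      ((congrArg Bits.snd (Bits.fst_cat ((Bits.cat pk M).cat σ) c)).trans
        (Bits.snd_cat (Bits.cat pk M) σ)))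
      (Bits.snd_cat ((Bits.cat pk M).cat σ) c))⟩
    refine PolyBounded.mono ((((PolyBounded.const 12).mul (((hHH.add hRH).add hVS).add hμ))).add
      (.const 9)) fun n => (hC' n).trans ?_
    have h1 := (HH n).input_le_size
    have h2 := (RH n).input_le_size
    have h3 := (VS n).input_le_size
    omega

end TOO

/-! ### Averages -/

section Averages

variable {ι X K : Type} [Fintype ι] [DecidableEq ι] [Fintype X] [DecidableEq X] [Fintype K]

/-- The values of a uniformly random function at distinct points may be resampled. -/
theorem expect_extend [Nonempty K] {E : Type*} [AddCommMonoid E] [Module ℚ≥0 E] {x : ι → X}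
    (hx : Function.Injective x) (F : (X → K) → E) :
    𝔼 O, F O = 𝔼 m : ι → K, 𝔼 O : X → K, F (Function.extend x m O) := by
  let φ : (ι → K) × (X → K) → (ι → K) × (X → K) := fun p => (p.2 ∘ x, Function.extend x p.1 p.2)
  have hφ : Function.Involutive φ := by
    rintro ⟨m, O⟩
    refine Prod.ext ?_ ?_
    · funext i
      simp [φ, hx.extend_apply]
    · funext z
      simp only [φ]
      by_cases hz : ∃ i, x i = z
      · obtain ⟨i, rfl⟩ := hz
        rw [hx.extend_apply, Function.comp_apply]
      · rw [Function.extend_apply' _ _ _ hz, Function.extend_apply' _ _ _ hz]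
  have h1 : 𝔼 p : (ι → K) × (X → K), F (Function.extend x p.1 p.2) =
      𝔼 p : (ι → K) × (X → K), F p.2 :=
    Fintype.expect_bijective φ hφ.bijective _ _ (fun _ => rfl)
  rw [← Finset.univ_product_univ, Finset.expect_product, Finset.expect_product] at h1
  rw [h1]
  exact (Fintype.expect_const _).symm

theorem expect_update [Nonempty K] (x : X) (F : (X → K) → ℝ) :
    𝔼 O, F O = 𝔼 a : K, 𝔼 O : X → K, F (Function.update O x a) := by
  rw [expect_extend (x := fun _ : Unit => x) (fun _ _ _ => rfl)]
  refine Fintype.expect_equiv (Equiv.funUnique Unit K) _ _ (fun m => ?_)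
  refine Finset.expect_congr rfl fun O _ => congrArg F ?_
  funext z
  by_cases hz : z = x
  · subst hz
    rw [Function.update_self]
    exact (Function.Injective.extend_apply (f := fun _ : Unit => z) (fun _ _ _ => rfl) m O ())
  · rw [Function.update_of_ne hz, Function.extend_apply' _ _ _ (by simpa using fun h => hz h.symm)]

theorem sum_split {M : Type*} [AddCommMonoid M] [DecidableEq K] (j : ι) (v : K)
    (G : K → (ι → K) → M) :
    ∑ ρ : ι → K, G (ρ j) (Function.update ρ j v) =
      ∑ a, ∑ ρ : ι → K, if ρ j = v then G a ρ else 0 := by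
  rw [← Finset.sum_product', ← Finset.sum_filter]
  refine Finset.sum_nbij' (fun ρ => (ρ j, Function.update ρ j v))
    (fun p => Function.update p.2 j p.1) ?_ ?_ ?_ ?_ ?_
  · simp
  · simp
  · simp
  · rintro ⟨a, ρ⟩ h
    simp only [Finset.mem_filter] at h
    simp [← h.2]
  · simp

end Averages

/-! ### Elementary gates -/

section Semantics

variable {w a b e d : ℕ}

/-- The elementary gates. -/
def QInstr.IsGate : QInstr w a b e d → Prop
  | .query _ => False
  | .call _ _ => False
  | _ => True

/-- The number of calls in an instruction. -/
def QInstr.callCount : QInstr w a b e d → ℕ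
  | .call _ _ => 1
  | _ => 0

/-- The number of calls in a program. -/
def callTotal (l : List (QInstr w a b e d)) : ℕ := (l.map QInstr.callCount).sum

@[simp] theorem callTotal_nil : callTotal ([] : List (QInstr w a b e d)) = 0 := rfl

@[simp] theorem callTotal_cons (g : QInstr w a b e d) (l : List (QInstr w a b e d)) :
    callTotal (g :: l) = g.callCount + callTotal l := by simp [callTotal]

@[simp] theorem callTotal_append (l l' : List (QInstr w a b e d)) :
    callTotal (l ++ l') = callTotal l + callTotal l' := by simp [callTotal]

theorem QInstr.callCount_le_one (g : QInstr w a b e d) : g.callCount ≤ 1 := by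
  cases g <;> simp [QInstr.callCount]

theorem QInstr.IsGate.callCount {g : QInstr w a b e d} (hg : g.IsGate) : g.callCount = 0 := by
  cases g <;> simp_all [QInstr.callCount, QInstr.IsGate]

theorem callTotal_le_length (l : List (QInstr w a b e d)) : callTotal l ≤ l.length := by
  induction l with
  | nil => simp
  | cons g l ih =>
    have := g.callCount_le_one
    simp only [callTotal_cons, List.length_cons]
    omega

/-- The action of an elementary gate. -/
noncomputable def QInstr.op : QInstr w a b e d → QState w → QState w
  | .not t, ψ => fun z => ψ (Function.update z t (!z t))
  | .cnot c t _, ψ => fun z => ψ (Function.update z t (xor (z t) (z c)))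
  | .toffoli c c' t _ _, ψ => fun z => ψ (Function.update z t (xor (z t) (z c && z c')))
  | .hadamard t, ψ => fun z => ((Real.sqrt 2 : ℝ) : ℂ)⁻¹ *
        (ψ (Function.update z t false) +
          (if z t then -1 else 1) * ψ (Function.update z t true))
  | .phase t, ψ =>
        fun z => (if z t then Complex.exp (Complex.I * (Real.pi / 4)) else 1) * ψ z
  | .query _, ψ => ψ
  | .call _ _, ψ => ψ

theorem QInstr.op_sub (g : QInstr w a b e d) (ψ φ : QState w) :
    g.op (ψ - φ) = g.op ψ - g.op φ := by
  cases g <;> funext z <;> simp only [QInstr.op, Pi.sub_apply] <;> ring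

theorem QInstr.exists_kernel (g : QInstr w a b e d) :
    ∃ K : Bits w → Bits w → ℂ, ∀ ψ z, g.op ψ z = ∑ z', K z z' * ψ z' := by
  have hperm : ∀ p : Bits w → Bits w, ∃ K : Bits w → Bits w → ℂ, ∀ (ψ : QState w) z,
      ψ (p z) = ∑ z', K z z' * ψ z' := fun p =>
    ⟨fun z z' => if z' = p z then 1 else 0, fun ψ z => by simp⟩
  cases g with
  | not t => exact hperm _
  | cnot c t _ => exact hperm _
  | toffoli c c' t _ _ => exact hperm _
  | query _ => exact hperm id
  | call _ _ => exact hperm id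
  | phase t =>
    refine ⟨fun z z' => if z' = z then
      (if z t then Complex.exp (Complex.I * (Real.pi / 4)) else 1) else 0, fun ψ z => ?_⟩
    simp [QInstr.op]
  | hadamard t =>
    refine ⟨fun z z' => ((Real.sqrt 2 : ℝ) : ℂ)⁻¹ *
      ((if z' = Function.update z t false then 1 else 0) +
        (if z t then -1 else 1) * if z' = Function.update z t true then 1 else 0), fun ψ z => ?_⟩
    simp only [QInstr.op, mul_assoc, ← Finset.mul_sum, add_mul, Finset.sum_add_distrib]
    simp

theorem sum_comp_involutive {α M : Type*} [Fintype α] [AddCommMonoid M] {p : α → α}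
    (hp : Function.Involutive p) (f : α → M) : ∑ z, f (p z) = ∑ z, f z :=
  Fintype.sum_bijective p hp.bijective _ _ (fun _ => rfl)

theorem QInstr.sum_normSq_op (g : QInstr w a b e d) (ψ : QState w) :
    ∑ z, ‖g.op ψ z‖ ^ 2 = ∑ z, ‖ψ z‖ ^ 2 := by
  cases g with
  | not t =>
    exact sum_comp_involutive (p := fun z : Bits w => Function.update z t (!z t))
      (fun z => by simp) (fun z => ‖ψ z‖ ^ 2)
  | cnot c t h =>
    exact sum_comp_involutive (p := fun z : Bits w => Function.update z t (xor (z t) (z c)))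
      (fun z => by simp [Function.update_of_ne h]) (fun z => ‖ψ z‖ ^ 2)
  | toffoli c c' t h h' =>
    exact sum_comp_involutive
      (p := fun z : Bits w => Function.update z t (xor (z t) (z c && z c')))
      (fun z => by simp [Function.update_of_ne h, Function.update_of_ne h'])
      (fun z => ‖ψ z‖ ^ 2)
  | phase t =>
    refine Finset.sum_congr rfl fun z _ => ?_
    simp only [QInstr.op, norm_mul]
    split
    · rw [Complex.norm_exp]
      simp
    · simp
  | query _ => rfl
  | call _ _ => rfl
  | hadamard t =>
    have hflip : Function.Involutive (fun z : Bits w => Function.update z t (!z t)) :=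
      fun z => by simp
    have h2 : ∀ f : Bits w → ℝ, ∑ z, (f z + f (Function.update z t (!z t))) = 2 * ∑ z, f z := by
      intro f
      rw [Finset.sum_add_distrib, sum_comp_involutive hflip f]
      ring
    have key : ∀ z : Bits w,
        ‖(QInstr.hadamard t : QInstr w a b e d).op ψ z‖ ^ 2 +
          ‖(QInstr.hadamard t : QInstr w a b e d).op ψ (Function.update z t (!z t))‖ ^ 2 =
        ‖ψ z‖ ^ 2 + ‖ψ (Function.update z t (!z t))‖ ^ 2 := by
      intro z
      have hpar := parallelogram_law_with_norm ℝ (ψ (Function.update z t false))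
        (ψ (Function.update z t true))
      have hs : ‖((Real.sqrt 2 : ℝ) : ℂ)⁻¹‖ ^ 2 = 2⁻¹ := by
        rw [norm_inv, Complex.norm_real, Real.norm_eq_abs, inv_pow, sq_abs,
          Real.sq_sqrt (by norm_num)]
      simp only [QInstr.op, norm_mul, mul_pow, hs, Function.update_idem, Function.update_self]
      cases hz : z t
      · have : Function.update z t false = z := by rw [← hz]; simp
        rw [this] at hpar ⊢
        simp only [Bool.not_false, if_true, neg_mul, one_mul, ← sub_eq_add_neg]
        simp only [Bool.false_eq_true, if_false, one_mul]
        nlinarith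
      · have : Function.update z t true = z := by rw [← hz]; simp
        rw [this] at hpar ⊢
        simp only [Bool.not_true, if_true, neg_mul, one_mul, ← sub_eq_add_neg]
        simp only [Bool.false_eq_true, if_false, one_mul]
        nlinarith
    have := h2 fun z => ‖(QInstr.hadamard t : QInstr w a b e d).op ψ z‖ ^ 2
    rw [Finset.sum_congr rfl (fun z _ => key z), h2 fun z => ‖ψ z‖ ^ 2] at this
    linarith

theorem runProb_gate {r : ℕ} (O : Bits a → Bits b) (R : Bits r → Bits e → Bits d)
    (payoff : List (Bits e × Bits d) → Bits w → ℝ) {g : QInstr w a b e d} (hg : g.IsGate)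
    (l : List (QInstr w a b e d)) (tr : List (Bits e × Bits d)) (ψ : QState w) :
    runProb O R payoff (g :: l) tr ψ = runProb O R payoff l tr (g.op ψ) := by
  cases g <;> first | rfl | exact hg.elim

/-! ### Runs with predetermined answers -/

/-- The expected value of `payoff` when the `j`-th call is answered by means of `R j`. -/
noncomputable def detRun (O : Bits a → Bits b) (R : ℕ → Bits e → Bits d)
    (payoff : List (Bits e × Bits d) → Bits w → ℝ) :
    List (QInstr w a b e d) → ℕ → List (Bits e × Bits d) → QState w → ℝ
  | [], _, tr, ψ => ∑ z, ‖ψ z‖ ^ 2 * payoff tr z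
  | .query xy :: l, j, tr, ψ => detRun O R payoff l j tr (ψ.query O xy)
  | .call x y :: l, j, tr, ψ =>
      ∑ M, detRun O R payoff l (j + 1) (tr ++ [(M, R j M)]) ((ψ.project x M).receive y (R j M))
  | g :: l, j, tr, ψ => detRun O R payoff l j tr (g.op ψ)

theorem detRun_gate (O : Bits a → Bits b) (R : ℕ → Bits e → Bits d)
    (payoff : List (Bits e × Bits d) → Bits w → ℝ) {g : QInstr w a b e d} (hg : g.IsGate)
    (l : List (QInstr w a b e d)) (j : ℕ) (tr : List (Bits e × Bits d)) (ψ : QState w) :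
    detRun O R payoff (g :: l) j tr ψ = detRun O R payoff l j tr (g.op ψ) := by
  cases g <;> first | rfl | exact hg.elim

theorem QInstr.cases_gate {P : QInstr w a b e d → Prop} (g : QInstr w a b e d)
    (gate : ∀ g : QInstr w a b e d, g.IsGate → P g) (query : ∀ xy, P (.query xy))
    (call : ∀ x y, P (.call x y)) : P g := by
  cases g <;> first | exact gate _ trivial | exact query _ | exact call _ _

theorem QInstr.op_zero (g : QInstr w a b e d) : g.op 0 = 0 := by
  have := g.op_sub 0 0
  simpa using this

theorem QState.receive_project_zero (x : Fin e ↪ Fin w) (M : Bits e) (y : Fin d ↪ Fin w)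
    (v : Bits d) : QState.receive y v (QState.project x M 0) = 0 := by
  funext z
  simp [QState.receive, QState.project]

theorem detRun_zero (O : Bits a → Bits b) (R : ℕ → Bits e → Bits d)
    (payoff : List (Bits e × Bits d) → Bits w → ℝ) (l : List (QInstr w a b e d)) (j : ℕ)
    (tr : List (Bits e × Bits d)) : detRun O R payoff l j tr 0 = 0 := by
  induction l generalizing j tr with
  | nil => simp [detRun]
  | cons g l ih =>
    induction g using QInstr.cases_gate with
    | gate g hg => rw [detRun_gate _ _ _ hg, g.op_zero, ih]
    | query xy =>
      rw [detRun]
      exact ih _ _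
    | call x y =>
      rw [detRun]
      refine Finset.sum_eq_zero fun M _ => ?_
      rw [QState.receive_project_zero]
      exact ih _ _

theorem detRun_congr (O : Bits a → Bits b) {R R' : ℕ → Bits e → Bits d}
    (payoff : List (Bits e × Bits d) → Bits w → ℝ) (l : List (QInstr w a b e d)) (j : ℕ)
    (tr : List (Bits e × Bits d)) (ψ : QState w)
    (h : ∀ i, j ≤ i → i < j + callTotal l → R i = R' i) :
    detRun O R payoff l j tr ψ = detRun O R' payoff l j tr ψ := by
  induction l generalizing j tr ψ with
  | nil => rfl
  | cons g l ih =>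
    rw [callTotal_cons] at h
    induction g using QInstr.cases_gate with
    | gate g hg =>
      rw [hg.callCount] at h
      rw [detRun_gate _ _ _ hg, detRun_gate _ _ _ hg]
      exact ih _ _ _ (fun i hi hi' => h i hi (by omega))
    | query xy => exact ih _ _ _ (fun i hi hi' => h i hi (by simp [QInstr.callCount]; omega))
    | call x y =>
      simp only [QInstr.callCount] at h
      rw [detRun, detRun]
      refine Finset.sum_congr rfl fun M _ => ?_
      rw [h j le_rfl (by omega)]
      exact ih _ _ _ (fun i hi hi' => h i (by omega) (by omega))

/-- The index `j`, wrapped around to be less than `q + 1`. -/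
abbrev ix {q : ℕ} (j : ℕ) : Fin (q + 1) := Fin.ofNat (q + 1) j

theorem ix_ne {q i j : ℕ} (hi : i < q + 1) (hj : j < q + 1) (h : i ≠ j) :
    (ix i : Fin (q + 1)) ≠ ix j := by
  intro h'
  have := congrArg Fin.val h'
  simp only [Fin.val_ofNat, Nat.mod_eq_of_lt hi, Nat.mod_eq_of_lt hj] at this
  exact h this

theorem ix_val {q : ℕ} (i : Fin (q + 1)) : (ix (i : ℕ) : Fin (q + 1)) = i :=
  Fin.ext (Nat.mod_eq_of_lt i.2)

/-- The coins of the calls may be drawn in advance. -/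
theorem runProb_eq_expect_detRun {r q : ℕ} (O : Bits a → Bits b) (R : Bits r → Bits e → Bits d)
    (payoff : List (Bits e × Bits d) → Bits w → ℝ) (l : List (QInstr w a b e d)) (j : ℕ)
    (hj : j + callTotal l ≤ q + 1) (tr : List (Bits e × Bits d)) (ψ : QState w) :
    runProb O R payoff l tr ψ =
      𝔼 c : Fin (q + 1) → Bits r, detRun O (fun i M => R (c (ix i)) M) payoff l j tr ψ := by
  induction l generalizing j tr ψ with
  | nil =>
    simp only [runProb, detRun]
    rw [Fintype.expect_const]
  | cons g l ih =>
    rw [callTotal_cons] at hj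
    induction g using QInstr.cases_gate with
    | gate g hg =>
      rw [hg.callCount] at hj
      simp only [runProb_gate _ _ _ hg, detRun_gate _ _ _ hg]
      exact ih _ (by omega) _ _
    | query xy => exact ih _ (by simp only [QInstr.callCount] at hj; omega) _ _
    | call x y =>
      simp only [QInstr.callCount] at hj
      simp only [runProb, detRun]
      rw [Finset.expect_sum_comm]
      refine Finset.sum_congr rfl fun M _ => ?_
      rw [expect_update (ix j : Fin (q + 1))]
      refine Finset.expect_congr rfl fun c₀ _ => ?_
      rw [ih (j + 1) (by omega)]
      refine Finset.expect_congr rfl fun c _ => ?_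
      rw [Function.update_self]
      refine detRun_congr _ _ _ _ _ _ fun i hi hi' => ?_
      rw [Function.update_of_ne (ix_ne (by omega) (by omega) (by omega))]

/-! ### Deferred measurements -/

/-- One step of a run in which the questions of the calls are recorded in a register instead of
being measured. The oracle and the answers may depend on the number of previous calls and on the
record. -/
noncomputable def recStep {q : ℕ} (orc : ℕ → (Fin (q + 1) → Bits e) → Bits a → Bits b)
    (resp : ℕ → (Fin (q + 1) → Bits e) → Bits d) (g : QInstr w a b e d) (j : ℕ)
    (Ψ : (Fin (q + 1) → Bits e) → QState w) : (Fin (q + 1) → Bits e) → QState w :=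
  match g with
  | .query xy => fun ρ => (Ψ ρ).query (orc j ρ) xy
  | .call x y => fun ρ => ((Ψ (Function.update ρ (ix j) fun _ => false)).project x
      (ρ (ix j))).receive y (resp j ρ)
  | g => fun ρ => g.op (Ψ ρ)

/-- The final state of a run with recorded questions. -/
noncomputable def recRun {q : ℕ} (orc : ℕ → (Fin (q + 1) → Bits e) → Bits a → Bits b)
    (resp : ℕ → (Fin (q + 1) → Bits e) → Bits d) :
    List (QInstr w a b e d) → ℕ → ((Fin (q + 1) → Bits e) → QState w) →
      (Fin (q + 1) → Bits e) → QState w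
  | [], _, Ψ => Ψ
  | g :: l, j, Ψ => recRun orc resp l (j + g.callCount) (recStep orc resp g j Ψ)

section RecRun

variable {q : ℕ} (orc : ℕ → (Fin (q + 1) → Bits e) → Bits a → Bits b)
  (resp : ℕ → (Fin (q + 1) → Bits e) → Bits d)

theorem recStep_gate {g : QInstr w a b e d} (hg : g.IsGate) (j : ℕ)
    (Ψ : (Fin (q + 1) → Bits e) → QState w) :
    recStep orc resp g j Ψ = fun ρ => g.op (Ψ ρ) := by
  cases g <;> first | rfl | exact hg.elim

theorem recRun_append (l l' : List (QInstr w a b e d)) (j : ℕ)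
    (Ψ : (Fin (q + 1) → Bits e) → QState w) :
    recRun orc resp (l ++ l') j Ψ =
      recRun orc resp l' (j + callTotal l) (recRun orc resp l j Ψ) := by
  induction l generalizing j Ψ with
  | nil => rfl
  | cons g l ih =>
    rw [List.cons_append, recRun, ih, callTotal_cons, recRun, add_assoc]

theorem recRun_snoc (l : List (QInstr w a b e d)) (g : QInstr w a b e d) (j : ℕ)
    (Ψ : (Fin (q + 1) → Bits e) → QState w) :
    recRun orc resp (l ++ [g]) j Ψ =
      recStep orc resp g (j + callTotal l) (recRun orc resp l j Ψ) := by
  rw [recRun_append]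
  rfl

end RecRun

/-- The transcript of the first `j` calls with the recorded questions. -/
def recTranscript {q : ℕ} (R : ℕ → Bits e → Bits d) (j : ℕ) (ρ : Fin (q + 1) → Bits e) :
    List (Bits e × Bits d) :=
  (List.range j).map fun i => (ρ (ix i), R i (ρ (ix i)))

theorem sum_detRun_eq_recRun {q : ℕ} (O : Bits a → Bits b) (R : ℕ → Bits e → Bits d)
    (payoff : List (Bits e × Bits d) → Bits w → ℝ) (l : List (QInstr w a b e d)) (j : ℕ)
    (hj : j + callTotal l ≤ q + 1) (Ψ : (Fin (q + 1) → Bits e) → QState w)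
    (hΨ : ∀ ρ, ∀ i, j ≤ i → i < q + 1 → ρ (ix i) ≠ (fun _ => false) → Ψ ρ = 0) :
    ∑ ρ, detRun O R payoff l j (recTranscript R j ρ) (Ψ ρ) =
      ∑ ρ, ∑ z, ‖recRun (fun _ _ => O) (fun i ρ => R i (ρ (ix i))) l j Ψ ρ z‖ ^ 2 *
        payoff (recTranscript R (j + callTotal l) ρ) z := by
  induction l generalizing j Ψ with
  | nil => rfl
  | cons g l ih =>
    rw [callTotal_cons] at hj
    induction g using QInstr.cases_gate with
    | gate g hg =>
      rw [hg.callCount] at hj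
      simp only [detRun_gate _ _ _ hg, recRun, recStep_gate _ _ hg, callTotal_cons,
        hg.callCount, add_zero, zero_add]
      refine ih j (by omega) _ fun ρ i hi hi' hρ => ?_
      rw [hΨ ρ i hi hi' hρ, g.op_zero]
    | query xy =>
      simp only [detRun, recRun, callTotal_cons, QInstr.callCount, add_zero, zero_add] at hj ⊢
      refine ih j (by omega) _ fun ρ i hi hi' hρ => ?_
      simp only [hΨ ρ i hi hi' hρ]
      rfl
    | call x y =>
      simp only [detRun, recRun, callTotal_cons, QInstr.callCount, ← add_assoc] at hj ⊢
      rw [← ih (j + 1) (by omega)]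
      · have h1 := sum_split (ι := Fin (q + 1)) (ix j) (fun _ => false : Bits e)
          (fun M ρ => detRun O R payoff l (j + 1) (recTranscript R j ρ ++ [(M, R j M)])
            (((Ψ ρ).project x M).receive y (R j M)))
        rw [Finset.sum_comm] at h1
        refine Eq.trans ?_ (h1.symm.trans ?_)
        · refine Finset.sum_congr rfl fun ρ _ => Finset.sum_congr rfl fun M _ => ?_
          split_ifs with h
          · rfl
          · rw [hΨ ρ j le_rfl (by omega) h]
            rw [QState.receive_project_zero]
            exact detRun_zero O R payoff l (j + 1) _
        · refine Finset.sum_congr rfl fun ρ _ => ?_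
          congr 1
          rw [recTranscript, recTranscript, List.range_succ, List.map_append]
          congr 1
          refine List.map_congr_left fun i hi => ?_
          rw [List.mem_range] at hi
          rw [Function.update_of_ne (ix_ne (by omega) (by omega) (by omega))]
      · intro ρ i hi hi' hρ
        simp only [recStep]
        rw [hΨ (Function.update ρ (ix j) fun _ => false) i (by omega) hi']
        · exact QState.receive_project_zero _ _ _ _
        · rwa [Function.update_of_ne (ix_ne (by omega) (by omega) (by omega))]

/-- The state with empty record. -/
noncomputable def initRec {q : ℕ} (z : Bits w) : (Fin (q + 1) → Bits e) → QState w :=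
  Pi.single (fun _ _ => false) (QState.basis z)

theorem detRun_eq_recRun {q : ℕ} (O : Bits a → Bits b) (R : ℕ → Bits e → Bits d)
    (payoff : List (Bits e × Bits d) → Bits w → ℝ) (l : List (QInstr w a b e d))
    (hl : callTotal l ≤ q + 1) (z₀ : Bits w) :
    detRun O R payoff l 0 [] (QState.basis z₀) =
      ∑ ρ : Fin (q + 1) → Bits e, ∑ z,
        ‖recRun (fun _ _ => O) (fun i ρ => R i (ρ (ix i))) l 0 (initRec z₀) ρ z‖ ^ 2 *
          payoff (recTranscript R (callTotal l) ρ) z := by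
  have h := sum_detRun_eq_recRun (q := q) O R payoff l 0 (by omega) (initRec z₀) (by
    intro ρ i _ _ h
    refine Pi.single_eq_of_ne ?_ _
    rintro rfl
    exact h rfl)
  rw [zero_add] at h
  rw [← h, Finset.sum_eq_single (fun _ _ => false)]
  · simp [initRec, recTranscript]
  · intro ρ _ hρ
    rw [initRec, Pi.single_eq_of_ne hρ]
    exact detRun_zero _ _ _ _ _ _
  · simp

end Semantics

/-! ### Norms of states with a record -/

section Norm

variable {α β : Type} [Fintype α] [Fintype β]

/-- The Hilbert space norm. -/
noncomputable def nrm (Ψ : α → β → ℂ) : ℝ := √(∑ x, ∑ y, ‖Ψ x y‖ ^ 2)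

theorem nrm_nonneg (Ψ : α → β → ℂ) : 0 ≤ nrm Ψ := Real.sqrt_nonneg _

theorem nrm_sq (Ψ : α → β → ℂ) : nrm Ψ ^ 2 = ∑ x, ∑ y, ‖Ψ x y‖ ^ 2 :=
  Real.sq_sqrt (by positivity)

theorem nrm_eq_norm (Ψ : α → β → ℂ) :
    nrm Ψ = ‖(WithLp.toLp 2 fun p : α × β => Ψ p.1 p.2 : EuclideanSpace ℂ (α × β))‖ := by
  rw [EuclideanSpace.norm_eq, nrm, Fintype.sum_prod_type]

theorem nrm_add_le (Ψ Φ : α → β → ℂ) : nrm (Ψ + Φ) ≤ nrm Ψ + nrm Φ := by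
  simp only [nrm_eq_norm]
  exact norm_add_le (WithLp.toLp 2 fun p : α × β => Ψ p.1 p.2 : EuclideanSpace ℂ (α × β))
    (WithLp.toLp 2 fun p : α × β => Φ p.1 p.2 : EuclideanSpace ℂ (α × β))

theorem nrm_sub_le (Ψ Φ : α → β → ℂ) : nrm (Ψ - Φ) ≤ nrm Ψ + nrm Φ := by
  simp only [nrm_eq_norm]
  exact norm_sub_le (WithLp.toLp 2 fun p : α × β => Ψ p.1 p.2 : EuclideanSpace ℂ (α × β))
    (WithLp.toLp 2 fun p : α × β => Φ p.1 p.2 : EuclideanSpace ℂ (α × β))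

theorem nrm_le_nrm {Ψ Φ : α → β → ℂ} (h : ∑ x, ∑ y, ‖Ψ x y‖ ^ 2 ≤ ∑ x, ∑ y, ‖Φ x y‖ ^ 2) :
    nrm Ψ ≤ nrm Φ := Real.sqrt_le_sqrt h

theorem sum_mul_le_nrm (Ψ Φ : α → β → ℂ) : ∑ x, ∑ y, ‖Ψ x y‖ * ‖Φ x y‖ ≤ nrm Ψ * nrm Φ := by
  have := Real.sum_mul_le_sqrt_mul_sqrt Finset.univ (fun p : α × β => ‖Ψ p.1 p.2‖)
    (fun p => ‖Φ p.1 p.2‖)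
  simpa only [Fintype.sum_prod_type, nrm] using this

/-- Expected payoffs are Lipschitz functions of the state. -/
theorem abs_sub_payoff_le (Ψ Φ : α → β → ℂ) (p : α → β → ℝ) (hp₀ : ∀ x y, 0 ≤ p x y)
    (hp₁ : ∀ x y, p x y ≤ 1) :
    |∑ x, ∑ y, ‖Ψ x y‖ ^ 2 * p x y - ∑ x, ∑ y, ‖Φ x y‖ ^ 2 * p x y| ≤
      nrm (Ψ - Φ) * (nrm Ψ + nrm Φ) := by
  rw [mul_add]
  refine le_trans ?_ (add_le_add (sum_mul_le_nrm _ _) (sum_mul_le_nrm _ _))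
  rw [← Finset.sum_sub_distrib, ← Finset.sum_add_distrib]
  refine (Finset.abs_sum_le_sum_abs _ _).trans (Finset.sum_le_sum fun x _ => ?_)
  rw [← Finset.sum_sub_distrib, ← Finset.sum_add_distrib]
  refine (Finset.abs_sum_le_sum_abs _ _).trans (Finset.sum_le_sum fun y _ => ?_)
  rw [← sub_mul, abs_mul, abs_of_nonneg (hp₀ x y), ← mul_add]
  refine (mul_le_of_le_one_right (abs_nonneg _) (hp₁ x y)).trans ?_
  have h1 : ‖Ψ x y‖ ^ 2 - ‖Φ x y‖ ^ 2 = (‖Ψ x y‖ - ‖Φ x y‖) * (‖Ψ x y‖ + ‖Φ x y‖) := by ring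
  rw [h1, abs_mul, abs_of_nonneg (a := ‖Ψ x y‖ + ‖Φ x y‖) (by positivity)]
  exact mul_le_mul_of_nonneg_right (abs_norm_sub_norm_le _ _) (by positivity)

end Norm

/-! ### Properties of runs with recorded questions -/

section RecRun

variable {w a b e d q : ℕ}

theorem Bits.xorAt_apply {k : ℕ} (y : Fin k ↪ Fin w) (v : Bits k) (z : Bits w) (j : Fin k) :
    Bits.xorAt y v z (y j) = xor (z (y j)) (v j) := Bits.writeAt_apply _ _ _ _

theorem Bits.xorAt_of_notMem {k : ℕ} {y : Fin k ↪ Fin w} {v : Bits k} {z : Bits w} {i : Fin w}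
    (h : i ∉ Set.range y) : Bits.xorAt y v z i = z i := Bits.writeAt_of_notMem h

theorem Bits.xorAt_xorAt {k : ℕ} (y : Fin k ↪ Fin w) (v : Bits k) (z : Bits w) :
    Bits.xorAt y v (Bits.xorAt y v z) = z := by
  funext i
  by_cases hi : i ∈ Set.range y
  · obtain ⟨j, rfl⟩ := hi
    simp [Bits.xorAt_apply]
  · simp [Bits.xorAt_of_notMem hi]

theorem Bits.xorAt_query_input (xy : (Fin a ⊕ Fin b) ↪ Fin w) (v : Bits b) (z : Bits w)
    (i : Fin a) :
    Bits.xorAt (Function.Embedding.inr.trans xy) v z (xy (Sum.inl i)) = z (xy (Sum.inl i)) := by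
  refine Bits.xorAt_of_notMem ?_
  rintro ⟨j, hj⟩
  have := xy.injective hj
  simp at this

theorem QState.sum_normSq_query (O : Bits a → Bits b) (xy : (Fin a ⊕ Fin b) ↪ Fin w)
    (ψ : QState w) : ∑ z, ‖ψ.query O xy z‖ ^ 2 = ∑ z, ‖ψ z‖ ^ 2 := by
  refine sum_comp_involutive (p := fun z : Bits w => Bits.xorAt (Function.Embedding.inr.trans xy)
    (O fun i => z (xy (Sum.inl i))) z) (fun z => ?_) (fun z => ‖ψ z‖ ^ 2)
  simp only [Bits.xorAt_query_input, Bits.xorAt_xorAt]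

theorem QState.sum_normSq_receive (y : Fin d ↪ Fin w) (v : Bits d) (ψ : QState w) :
    ∑ z, ‖ψ.receive y v z‖ ^ 2 = ∑ z, ‖ψ z‖ ^ 2 :=
  sum_comp_involutive (p := Bits.xorAt y v) (Bits.xorAt_xorAt y v) (fun z => ‖ψ z‖ ^ 2)

variable (orc : ℕ → (Fin (q + 1) → Bits e) → Bits a → Bits b)
  (resp : ℕ → (Fin (q + 1) → Bits e) → Bits d)

theorem recStep_sub (g : QInstr w a b e d) (j : ℕ) (Ψ Φ : (Fin (q + 1) → Bits e) → QState w) :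
    recStep orc resp g j (Ψ - Φ) = recStep orc resp g j Ψ - recStep orc resp g j Φ := by
  induction g using QInstr.cases_gate with
  | gate g hg =>
    simp only [recStep_gate _ _ hg]
    funext ρ
    simp [QInstr.op_sub]
  | query xy => rfl
  | call x y =>
    funext ρ z
    simp only [recStep, QState.receive, QState.project, Pi.sub_apply]
    split <;> simp

theorem sum_normSq_recStep_le (g : QInstr w a b e d) (j : ℕ)
    (Ψ : (Fin (q + 1) → Bits e) → QState w) :
    ∑ ρ, ∑ z, ‖recStep orc resp g j Ψ ρ z‖ ^ 2 ≤ ∑ ρ, ∑ z, ‖Ψ ρ z‖ ^ 2 := by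
  induction g using QInstr.cases_gate with
  | gate g hg => simp only [recStep_gate _ _ hg, QInstr.sum_normSq_op]; exact le_rfl
  | query xy => simp only [recStep, QState.sum_normSq_query]; exact le_rfl
  | call x y =>
    simp only [recStep, QState.sum_normSq_receive]
    have h1 := sum_split (ι := Fin (q + 1)) (ix j) (fun _ => false : Bits e)
      (fun M ρ => ∑ z, ‖(Ψ ρ).project x M z‖ ^ 2)
    rw [h1, Finset.sum_comm]
    refine Finset.sum_le_sum fun ρ _ => ?_
    by_cases hρ : ρ (ix j) = fun _ => false
    · simp only [hρ, if_true]
      rw [Finset.sum_comm]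
      refine Finset.sum_le_sum fun z _ => ?_
      rw [Finset.sum_eq_single (z ∘ x)]
      · simp [QState.project]
      · intro M _ hM
        simp [QState.project, hM.symm]
      · simp
    · simp only [hρ, if_false, Finset.sum_const_zero]
      positivity

theorem nrm_recStep_le (g : QInstr w a b e d) (j : ℕ) (Ψ : (Fin (q + 1) → Bits e) → QState w) :
    nrm (recStep orc resp g j Ψ) ≤ nrm Ψ :=
  nrm_le_nrm (sum_normSq_recStep_le orc resp g j Ψ)

theorem nrm_recRun_le (l : List (QInstr w a b e d)) (j : ℕ)
    (Ψ : (Fin (q + 1) → Bits e) → QState w) : nrm (recRun orc resp l j Ψ) ≤ nrm Ψ := by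
  induction l generalizing j Ψ with
  | nil => exact le_rfl
  | cons g l ih => exact (ih _ _).trans (nrm_recStep_le _ _ _ _ _)

theorem nrm_initRec (z : Bits w) : nrm (initRec (e := e) (q := q) z) = 1 := by
  rw [nrm, Finset.sum_eq_single (fun _ _ => false), Finset.sum_eq_single z]
  · simp [initRec, QState.basis]
  · intro z' _ h
    simp [initRec, QState.basis, Pi.single_eq_of_ne h]
  · simp
  · intro ρ _ h
    simp [initRec, Pi.single_eq_of_ne h]
  · simp

theorem nrm_recRun_initRec_le (l : List (QInstr w a b e d)) (z : Bits w) :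
    nrm (recRun orc resp l 0 (initRec z)) ≤ 1 :=
  (nrm_recRun_le _ _ _ _ _).trans (nrm_initRec z).le

open Classical in
/-- The part of a state in which the oracle is queried at a point of `Bad`. -/
noncomputable def maskQuery (g : QInstr w a b e d) (Bad : (Fin (q + 1) → Bits e) → Set (Bits a))
    (Ψ : (Fin (q + 1) → Bits e) → QState w) : (Fin (q + 1) → Bits e) → QState w :=
  match g with
  | .query xy => fun ρ z => if (fun i => z (xy (Sum.inl i))) ∈ Bad ρ then Ψ ρ z else 0
  | _ => 0

theorem nrm_recStep_sub_le {orc orc' : ℕ → (Fin (q + 1) → Bits e) → Bits a → Bits b}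
    (g : QInstr w a b e d) (j : ℕ) {Bad : (Fin (q + 1) → Bits e) → Set (Bits a)}
    (h : ∀ ρ, ∀ x ∉ Bad ρ, orc j ρ x = orc' j ρ x)
    (Ψ Φ : (Fin (q + 1) → Bits e) → QState w) :
    nrm (recStep orc resp g j Ψ - recStep orc' resp g j Φ) ≤
      nrm (Ψ - Φ) + 2 * nrm (maskQuery g Bad Ψ) := by
  have hsplit : recStep orc resp g j Ψ - recStep orc' resp g j Φ =
      recStep orc' resp g j (Ψ - Φ) +
        (recStep orc resp g j (maskQuery g Bad Ψ) - recStep orc' resp g j (maskQuery g Bad Ψ)) := by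
    rw [recStep_sub]
    induction g using QInstr.cases_gate with
    | gate g hg => simp only [recStep_gate _ _ hg]; abel
    | call x y => simp only [recStep]; abel
    | query xy =>
      funext ρ z
      simp only [recStep, QState.query, maskQuery, Pi.sub_apply, Pi.add_apply]
      have hv : ∀ v, (fun i => Bits.xorAt (Function.Embedding.inr.trans xy) v z (xy (Sum.inl i))) =
          fun i => z (xy (Sum.inl i)) := fun v => funext (Bits.xorAt_query_input xy v z)
      by_cases hz : (fun i => z (xy (Sum.inl i))) ∈ Bad ρ
      · rw [if_pos (by rw [hv]; exact hz), if_pos (by rw [hv]; exact hz)]; ring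
      · rw [if_neg (by rw [hv]; exact hz), if_neg (by rw [hv]; exact hz), h ρ _ hz]; ring
  rw [hsplit]
  refine (nrm_add_le _ _).trans (add_le_add (nrm_recStep_le _ _ _ _ _) ?_)
  refine (nrm_sub_le _ _).trans ?_
  rw [two_mul]
  exact add_le_add (nrm_recStep_le _ _ _ _ _) (nrm_recStep_le _ _ _ _ _)

/-- If two families of oracles differ only at points that are unlikely to be queried, the
resulting states are close. -/
theorem expect_nrm_recRun_sub_le {Θ : Type} [Fintype Θ] [Nonempty Θ]
    (orc orc' : Θ → ℕ → (Fin (q + 1) → Bits e) → Bits a → Bits b)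
    (resp : Θ → ℕ → (Fin (q + 1) → Bits e) → Bits d) (l : List (QInstr w a b e d))
    (Bad : Θ → ℕ → (Fin (q + 1) → Bits e) → Set (Bits a))
    (h : ∀ θ j ρ, ∀ x ∉ Bad θ j ρ, orc θ j ρ x = orc' θ j ρ x)
    (Ψ : Θ → (Fin (q + 1) → Bits e) → QState w) (B : ℝ)
    (hB : ∀ l' g, (l' ++ [g]) <+: l → 𝔼 θ, nrm (maskQuery g (Bad θ (callTotal l'))
      (recRun (orc θ) (resp θ) l' 0 (Ψ θ))) ≤ B) :
    𝔼 θ, nrm (recRun (orc θ) (resp θ) l 0 (Ψ θ) - recRun (orc' θ) (resp θ) l 0 (Ψ θ)) ≤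
      2 * l.length * B := by
  induction l using List.reverseRecOn with
  | nil => simp [recRun, nrm]
  | append_singleton l g ih =>
    have h1 := ih fun l' g' hl' => hB l' g' (hl'.trans (List.prefix_append _ _))
    have h2 := hB l g List.prefix_rfl
    simp only [recRun_snoc, zero_add]
    have h3 := Finset.expect_le_expect (s := Finset.univ) fun (θ : Θ) _ =>
      nrm_recStep_sub_le (resp θ) g (callTotal l) (h θ (callTotal l))
        (recRun (orc θ) (resp θ) l 0 (Ψ θ)) (recRun (orc' θ) (resp θ) l 0 (Ψ θ))
    rw [Finset.expect_add_distrib, ← Finset.mul_expect] at h3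
    refine h3.trans ?_
    simp only [List.length_append, List.length_singleton]
    push_cast
    linarith

/-- Changing the oracle at a single point has little effect for most points. -/
theorem sum_nrm_recRun_sub_sq_le (orc : ℕ → (Fin (q + 1) → Bits e) → Bits a → Bits b)
    (orc' : Bits a → ℕ → (Fin (q + 1) → Bits e) → Bits a → Bits b)
    (h : ∀ x j ρ, ∀ x' ≠ x, orc j ρ x' = orc' x j ρ x')
    (l : List (QInstr w a b e d)) (z : Bits w) :
    ∑ x, nrm (recRun orc resp l 0 (initRec z) - recRun (orc' x) resp l 0 (initRec z)) ^ 2 ≤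
      (2 * l.length) ^ 2 := by
  induction l using List.reverseRecOn with
  | nil => simp [recRun, nrm]
  | append_singleton l g ih =>
    simp only [recRun_snoc, zero_add]
    set A : Bits a → ℝ := fun x =>
      nrm (recRun orc resp l 0 (initRec z) - recRun (orc' x) resp l 0 (initRec z))
    set M : Bits a → ℝ := fun x =>
      nrm (maskQuery g (fun _ => {x}) (recRun orc resp l 0 (initRec z)))
    have hM : ∑ x, M x ^ 2 ≤ 1 := by
      have h0 := nrm_recRun_initRec_le orc resp l z
      have h1 : nrm (recRun orc resp l 0 (initRec z)) ^ 2 ≤ 1 := by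
        have := nrm_nonneg (recRun orc resp l 0 (initRec z))
        nlinarith
      refine le_trans ?_ h1
      simp only [M, nrm_sq]
      rw [Finset.sum_comm]
      refine Finset.sum_le_sum fun ρ _ => ?_
      rw [Finset.sum_comm]
      refine Finset.sum_le_sum fun z' _ => ?_
      induction g using QInstr.cases_gate with
      | query xy =>
        rw [Finset.sum_eq_single (fun i => z' (xy (Sum.inl i)))]
        · simp [maskQuery]
        · intro x _ hx
          simp [maskQuery, hx.symm]
        · simp
      | gate g hg => cases g <;> first | exact hg.elim | simp [maskQuery]
      | call x y => simp [maskQuery]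
    have hstep : ∀ x, nrm (recStep orc resp g (callTotal l) (recRun orc resp l 0 (initRec z)) -
        recStep (orc' x) resp g (callTotal l) (recRun (orc' x) resp l 0 (initRec z))) ≤
        A x + 2 * M x := fun x =>
      nrm_recStep_sub_le resp g (callTotal l) (fun ρ x' hx' => h x _ ρ x' hx') _ _
    have h1 : ∑ x, (A x + 2 * M x) ^ 2 = ∑ x, A x ^ 2 + 4 * ∑ x, A x * M x + 4 * ∑ x, M x ^ 2 := by
      rw [Finset.mul_sum, Finset.mul_sum, ← Finset.sum_add_distrib, ← Finset.sum_add_distrib]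
      exact Finset.sum_congr rfl fun x _ => by ring
    have h2 : ∑ x, A x * M x ≤ 2 * l.length := by
      refine (Real.sum_mul_le_sqrt_mul_sqrt _ _ _).trans ?_
      have h3 : √(∑ x, A x ^ 2) ≤ 2 * l.length := Real.sqrt_le_iff.2 ⟨by positivity, ih⟩
      have h4 : √(∑ x, M x ^ 2) ≤ 1 := Real.sqrt_le_one.2 hM
      nlinarith [Real.sqrt_nonneg (∑ x, A x ^ 2), Real.sqrt_nonneg (∑ x, M x ^ 2)]
    refine (Finset.sum_le_sum fun x _ => pow_le_pow_left₀ (nrm_nonneg _) (hstep x) 2).trans ?_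
    rw [h1]
    simp only [List.length_append, List.length_singleton]
    push_cast
    nlinarith

/-- The slice of a state at a record depends only on the oracles and answers along it. -/
theorem recRun_congr {orc orc' : ℕ → (Fin (q + 1) → Bits e) → Bits a → Bits b}
    {resp resp' : ℕ → (Fin (q + 1) → Bits e) → Bits d} (l : List (QInstr w a b e d))
    (hl : callTotal l ≤ q + 1) (Ψ : (Fin (q + 1) → Bits e) → QState w)
    (ρ₀ : Fin (q + 1) → Bits e)
    (ho : ∀ j ≤ callTotal l, ∀ ρ, (∀ i < j, ρ (ix i) = ρ₀ (ix i)) → orc j ρ = orc' j ρ)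
    (hr : ∀ j < callTotal l, ∀ ρ, (∀ i < j + 1, ρ (ix i) = ρ₀ (ix i)) → resp j ρ = resp' j ρ)
    (ρ : Fin (q + 1) → Bits e) (hρ : ∀ i < callTotal l, ρ (ix i) = ρ₀ (ix i)) :
    recRun orc resp l 0 Ψ ρ = recRun orc' resp' l 0 Ψ ρ := by
  induction l using List.reverseRecOn generalizing ρ with
  | nil => rfl
  | append_singleton l g ih =>
    have hc : callTotal (l ++ [g]) = callTotal l + g.callCount := by simp
    rw [hc] at hl ho hr hρ
    have ih' := ih (by omega) (fun j hj => ho j (by omega)) (fun j hj => hr j (by omega))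
    simp only [recRun_snoc, zero_add]
    induction g using QInstr.cases_gate with
    | gate g hg =>
      rw [hg.callCount] at hρ
      simp only [recStep_gate _ _ hg]
      rw [ih' ρ hρ]
    | query xy =>
      simp only [recStep]
      rw [ih' ρ (fun i hi => hρ i (by omega)), ho _ (by omega) ρ fun i hi => hρ i (by omega)]
    | call x y =>
      simp only [QInstr.callCount] at hl hρ hr
      simp only [recStep]
      rw [ih', hr _ (by omega) ρ hρ]
      intro i hi
      rw [Function.update_of_ne (ix_ne (by omega) (by omega) (by omega))]
      exact hρ i (by omega)

/-- Records of calls that have not been made yet are empty. -/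
theorem recStep_eq_zero (g : QInstr w a b e d) (j : ℕ) (hj : j + g.callCount ≤ q + 1)
    {Ψ : (Fin (q + 1) → Bits e) → QState w}
    (hΨ : ∀ ρ, ∀ i, j ≤ i → i < q + 1 → ρ (ix i) ≠ (fun _ => false) → Ψ ρ = 0)
    (ρ : Fin (q + 1) → Bits e) (i : ℕ) (hi : j + g.callCount ≤ i) (hi' : i < q + 1)
    (hρ : ρ (ix i) ≠ fun _ => false) : recStep orc resp g j Ψ ρ = 0 := by
  induction g using QInstr.cases_gate with
  | gate g hg =>
    rw [hg.callCount] at hi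
    simp only [recStep_gate _ _ hg]
    rw [hΨ ρ i hi hi' hρ, g.op_zero]
  | query xy =>
    simp only [recStep]
    rw [hΨ ρ i hi hi' hρ]
    rfl
  | call x y =>
    simp only [QInstr.callCount] at hi hj
    simp only [recStep]
    rw [hΨ _ i (by omega) hi']
    · exact QState.receive_project_zero _ _ _ _
    · rwa [Function.update_of_ne (ix_ne (by omega) (by omega) (by omega))]

end RecRun

/-! ### Reversible computation -/

section Reversible

variable {W a b e d : ℕ}

/-- The gates that permute the basis states. -/
def QInstr.IsClassical : QInstr W a b e d → Prop
  | .not _ => True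
  | .cnot _ _ _ => True
  | .toffoli _ _ _ _ _ => True
  | _ => False

/-- The permutation of the basis states given by a classical gate. -/
def QInstr.perm : QInstr W a b e d → Bits W → Bits W
  | .not t, z => Function.update z t (!z t)
  | .cnot c t _, z => Function.update z t (xor (z t) (z c))
  | .toffoli c c' t _ _, z => Function.update z t (xor (z t) (z c && z c'))
  | _, z => z

/-- None of the wires of the classical gate belongs to `Y`. -/
def QInstr.Avoids (Y : Set (Fin W)) : QInstr W a b e d → Prop
  | .not t => t ∉ Y
  | .cnot c t _ => c ∉ Y ∧ t ∉ Y
  | .toffoli c c' t _ _ => c ∉ Y ∧ c' ∉ Y ∧ t ∉ Y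
  | _ => True

/-- `permList [g₁, …, gₙ]` is the composition of the permutations of `g₁`, …, `gₙ`, the last one
being applied first. -/
def permList (gs : List (QInstr W a b e d)) (z : Bits W) : Bits W :=
  gs.foldr (fun g z => g.perm z) z

@[simp] theorem permList_nil (z : Bits W) :
    permList ([] : List (QInstr W a b e d)) z = z := rfl

@[simp] theorem permList_cons (g : QInstr W a b e d) (gs : List (QInstr W a b e d)) (z : Bits W) :
    permList (g :: gs) z = g.perm (permList gs z) := rfl

@[simp] theorem permList_append (gs gs' : List (QInstr W a b e d)) (z : Bits W) :
    permList (gs ++ gs') z = permList gs (permList gs' z) := by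
  simp [permList, List.foldr_append]

theorem QInstr.perm_perm (g : QInstr W a b e d) (z : Bits W) : g.perm (g.perm z) = z := by
  cases g with
  | not t => simp [QInstr.perm]
  | cnot c t h => simp [QInstr.perm, Function.update_of_ne h]
  | toffoli c c' t h h' => simp [QInstr.perm, Function.update_of_ne h, Function.update_of_ne h']
  | _ => rfl

theorem permList_reverse_permList (gs : List (QInstr W a b e d)) (z : Bits W) :
    permList gs.reverse (permList gs z) = z := by
  induction gs generalizing z with
  | nil => rfl
  | cons g gs ih => simp [QInstr.perm_perm, ih]

theorem permList_permList_reverse (gs : List (QInstr W a b e d)) (z : Bits W) :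
    permList gs (permList gs.reverse z) = z := by
  simpa using permList_reverse_permList gs.reverse z

theorem permList_bijective (gs : List (QInstr W a b e d)) : Function.Bijective (permList gs) :=
  Function.bijective_iff_has_inverse.2
    ⟨permList gs.reverse, permList_reverse_permList gs, permList_permList_reverse gs⟩

theorem QInstr.Avoids.perm_congr {Y : Set (Fin W)} {g : QInstr W a b e d} (hg : g.Avoids Y)
    {z z' : Bits W} (h : ∀ m ∉ Y, z m = z' m) : ∀ m ∉ Y, g.perm z m = g.perm z' m := by
  intro m hm
  cases g with
  | not t =>
    by_cases hmt : m = t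
    · subst hmt; simp [QInstr.perm, h m hm]
    · simp [QInstr.perm, Function.update_of_ne hmt, h m hm]
  | cnot c t _ =>
    by_cases hmt : m = t
    · subst hmt; simp [QInstr.perm, h m hm, h c hg.1]
    · simp [QInstr.perm, Function.update_of_ne hmt, h m hm]
  | toffoli c c' t _ _ =>
    by_cases hmt : m = t
    · subst hmt; simp [QInstr.perm, h m hm, h c hg.1, h c' hg.2.1]
    · simp [QInstr.perm, Function.update_of_ne hmt, h m hm]
  | _ => exact h m hm

theorem permList_congr {Y : Set (Fin W)} {gs : List (QInstr W a b e d)}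
    (hgs : ∀ g ∈ gs, g.Avoids Y) {z z' : Bits W} (h : ∀ m ∉ Y, z m = z' m) :
    ∀ m ∉ Y, permList gs z m = permList gs z' m := by
  induction gs with
  | nil => exact h
  | cons g gs ih =>
    exact (hgs g (by simp)).perm_congr (ih fun g' hg' => hgs g' (by simp [hg']))

theorem detRun_classical (O : Bits a → Bits b) (R : ℕ → Bits e → Bits d)
    (payoff : List (Bits e × Bits d) → Bits W → ℝ) {gs : List (QInstr W a b e d)}
    (hgs : ∀ g ∈ gs, g.IsClassical) (l : List (QInstr W a b e d)) (j : ℕ)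
    (tr : List (Bits e × Bits d)) (ψ : QState W) :
    detRun O R payoff (gs ++ l) j tr ψ = detRun O R payoff l j tr (ψ ∘ permList gs) := by
  induction gs generalizing ψ with
  | nil => rfl
  | cons g gs ih =>
    have hg := hgs g (by simp)
    have h1 : detRun O R payoff (g :: (gs ++ l)) j tr ψ =
        detRun O R payoff (gs ++ l) j tr (ψ ∘ g.perm) := by
      cases g <;> first | exact hg.elim | rfl
    rw [List.cons_append, h1, ih fun g' hg' => hgs g' (by simp [hg'])]
    rfl

theorem callTotal_classical {gs : List (QInstr W a b e d)} (hgs : ∀ g ∈ gs, g.IsClassical) :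
    callTotal gs = 0 := by
  induction gs with
  | nil => rfl
  | cons g gs ih =>
    have hg := hgs g (by simp)
    have : g.callCount = 0 := by cases g <;> first | exact hg.elim | rfl
    rw [callTotal_cons, this, ih fun g' hg' => hgs g' (by simp [hg'])]

/-- The values of a straight-line program can be computed on zero-initialized wires. -/
theorem StraightLine.exists_reversible {s : ℕ} {I Y : Set (Fin W)} (anc : Fin s ↪ Fin W)
    (hIY : ∀ i ∈ I, i ∉ Y) (hIa : ∀ i ∈ I, i ∉ Set.range anc) (haY : ∀ k, anc k ∉ Y)
    {l : List (Bits W → Bool)}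
    (h : StraightLine (fun _ => id : Bits W → Bits 0 → Bits 0) {g | ∃ i ∈ I, g = fun Z => Z i} l)
    (hl : l.length ≤ s) :
    ∃ gs : List (QInstr W a b e d), (∀ g ∈ gs, g.IsClassical ∧ g.Avoids Y) ∧
      gs.length ≤ 2 * l.length ∧ (∀ Z, ∀ m ∉ Set.range anc, permList gs Z m = Z m) ∧
      ∀ Z, (∀ k, Z (anc k) = false) → ∀ k : Fin s,
        permList gs Z (anc k) = (l.map (· Z)).getD k false := by
  induction h with
  | nil => exact ⟨[], by simp, by simp, by simp, by simp⟩
  | query x _ _ ih => simpa using ih (by simpa using hl)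
  | @nand l f g _ hf hg ih =>
    simp only [List.length_append, List.length_singleton] at hl
    obtain ⟨gs, hgs, hlen, hout, hval⟩ := ih (by omega)
    let t : Fin s := ⟨l.length, by omega⟩
    have hwire : ∀ f, Available {g | ∃ i ∈ I, g = fun Z => Z i} l f → f = (fun _ => false) ∨
        ∃ m, m ∉ Y ∧ m ≠ anc t ∧
          ∀ Z : Bits W, (∀ k, Z (anc k) = false) → permList gs Z m = f Z := by
      rintro f (⟨i, hi, rfl⟩ | hf | hf)
      · refine .inr ⟨i, hIY i hi, fun h => hIa i hi ⟨t, h.symm⟩, fun Z _ => hout Z i (hIa i hi)⟩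
      · obtain ⟨k, hk, rfl⟩ := List.mem_iff_getElem.1 hf
        refine .inr ⟨anc ⟨k, by omega⟩, haY _, fun h => ?_, fun Z hZ => ?_⟩
        · have := congrArg Fin.val (anc.injective h)
          simp only [t] at this
          omega
        · rw [hval Z hZ]
          simp [List.getD_eq_getElem?_getD, hk]
      · exact .inl hf
    have hZt : ∀ Z : Bits W, (∀ k, Z (anc k) = false) → permList gs Z (anc t) = false := by
      intro Z hZ
      rw [hval Z hZ]
      simp [t, List.getD_eq_getElem?_getD]
    have finish : ∀ gs' : List (QInstr W a b e d), (∀ g ∈ gs', g.IsClassical ∧ g.Avoids Y) →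
        gs'.length ≤ 2 → (∀ Z, ∀ m ≠ anc t, permList gs' Z m = Z m) →
        (∀ Z, (∀ k, Z (anc k) = false) → permList (gs' ++ gs) Z (anc t) = !(f Z && g Z)) →
        ∃ gs : List (QInstr W a b e d), (∀ g ∈ gs, g.IsClassical ∧ g.Avoids Y) ∧
          gs.length ≤ 2 * (l ++ [fun ω => !(f ω && g ω)]).length ∧
          (∀ Z, ∀ m ∉ Set.range anc, permList gs Z m = Z m) ∧
          ∀ Z, (∀ k, Z (anc k) = false) → ∀ k : Fin s,
            permList gs Z (anc k) = ((l ++ [fun ω => !(f ω && g ω)]).map (· Z)).getD k false := by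
      intro gs' h1 h2 h3 h4
      refine ⟨gs' ++ gs, ?_, by simp; omega, fun Z m hm => ?_, fun Z hZ k => ?_⟩
      · intro g hg
        rcases List.mem_append.1 hg with hg | hg
        · exact h1 g hg
        · exact hgs g hg
      · rw [permList_append, h3 _ _ (fun h => hm ⟨t, h.symm⟩), hout Z m hm]
      · by_cases hk : k = t
        · subst hk
          rw [h4 Z hZ]
          simp [t, List.getD_eq_getElem?_getD]
        · rw [permList_append, h3 _ _ (fun h => hk (anc.injective h)), hval Z hZ, List.map_append]
          have hk' : (k : ℕ) ≠ l.length := fun h => hk (Fin.ext h)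
          rcases lt_or_ge (k : ℕ) l.length with h | h
          · exact (List.getD_append _ _ _ _ (by simpa using h)).symm
          · rw [List.getD_eq_default _ _ (by simpa using h),
              List.getD_eq_default _ _ (by simp; omega)]
    have hconst : (∀ Z, (f Z && g Z) = false) → _ := fun hfg =>
      finish [.not (anc t)] (by simp [QInstr.IsClassical, QInstr.Avoids, haY]) (by simp)
        (fun Z m hm => by simp [QInstr.perm, Function.update_of_ne hm])
        (fun Z hZ => by simp [QInstr.perm, hZt Z hZ, hfg])
    rcases hwire f hf with rfl | ⟨mf, hmf, hmf', hmf''⟩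
    · exact hconst (by simp)
    rcases hwire g hg with rfl | ⟨mg, hmg, hmg', hmg''⟩
    · exact hconst (by simp)
    refine finish [.not (anc t), .toffoli mf mg (anc t) hmf' hmg'] ?_ (by simp) ?_ ?_
    · simp [QInstr.IsClassical, QInstr.Avoids, haY, hmf, hmg]
    · intro Z m hm
      simp [QInstr.perm, Function.update_of_ne hm]
    · intro Z hZ
      simp [QInstr.perm, hZt Z hZ, hmf'' Z hZ, hmg'' Z hZ]

theorem exists_copy {o : ℕ} (y : Fin o ↪ Fin W) (u : Fin o → Option (Fin W))
    (hu : ∀ k, ∀ m ∈ u k, m ∉ Set.range y) :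
    ∃ gs : List (QInstr W a b e d), (∀ g ∈ gs, g.IsClassical) ∧ gs.length ≤ o ∧
      ∀ Z, permList gs Z = Bits.xorAt y (fun k => (u k).elim false Z) Z := by
  have key : ∀ S : Finset (Fin o), ∃ gs : List (QInstr W a b e d), (∀ g ∈ gs, g.IsClassical) ∧
      gs.length ≤ S.card ∧ ∀ Z, permList gs Z =
        Bits.xorAt y (fun k => if k ∈ S then (u k).elim false Z else false) Z := by
    intro S
    induction S using Finset.induction_on with
    | empty =>
      refine ⟨[], by simp, by simp, fun Z => ?_⟩
      funext m
      by_cases hm : m ∈ Set.range y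
      · obtain ⟨k, rfl⟩ := hm; simp [Bits.xorAt_apply]
      · simp [Bits.xorAt_of_notMem hm]
    | insert k₀ S hk₀ ih =>
      obtain ⟨gs, hgs, hlen, hval⟩ := ih
      cases huk : u k₀ with
      | none =>
        refine ⟨gs, hgs, hlen.trans (Finset.card_le_card (Finset.subset_insert _ _)), fun Z => ?_⟩
        rw [hval]
        congr 1
        funext k
        by_cases hk : k = k₀
        · subst hk; simp [hk₀, huk]
        · simp [hk]
      | some c =>
        have hc := hu k₀ c huk
        have hck : c ≠ y k₀ := fun h => hc ⟨k₀, h.symm⟩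
        refine ⟨.cnot c (y k₀) hck :: gs, ?_, ?_, fun Z => ?_⟩
        · intro g hg
          rcases List.mem_cons.1 hg with rfl | hg
          · trivial
          · exact hgs g hg
        · rw [Finset.card_insert_of_notMem hk₀]; simpa using hlen
        · rw [permList_cons, hval]
          funext m
          by_cases hm : m ∈ Set.range y
          · obtain ⟨k, rfl⟩ := hm
            by_cases hk : k = k₀
            · subst hk
              simp [QInstr.perm, Bits.xorAt_apply, Bits.xorAt_of_notMem hc, hk₀, huk]
            · simp [QInstr.perm, Bits.xorAt_apply, hk]
          · have : m ≠ y k₀ := fun h => hm ⟨k₀, h.symm⟩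
            simp [QInstr.perm, Function.update_of_ne this, Bits.xorAt_of_notMem hm]
  obtain ⟨gs, hgs, hlen, hval⟩ := key Finset.univ
  exact ⟨gs, hgs, by simpa using hlen, by simpa using hval⟩

/-- Reversible evaluation of a function: compute, copy, uncompute. -/
theorem exists_block {s o : ℕ} (I : Set (Fin W)) (y : Fin o ↪ Fin W) (anc : Fin s ↪ Fin W)
    (hIy : ∀ i ∈ I, i ∉ Set.range y) (hIa : ∀ i ∈ I, i ∉ Set.range anc)
    (hya : ∀ k, anc k ∉ Set.range y) (f : Bits W → Bits o)
    (hf : Computes (fun _ => id : Bits W → Bits 0 → Bits 0) {g | ∃ i ∈ I, g = fun Z => Z i}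
      (bits f) s) :
    ∃ gs : List (QInstr W a b e d), (∀ g ∈ gs, g.IsClassical) ∧ gs.length ≤ 4 * s + o ∧
      (∀ Z, (∀ k, Z (anc k) = false) → permList gs Z = Bits.xorAt y (f Z) Z) ∧
      ∀ Z, ∀ m ∉ Set.range y, permList gs Z m = Z m := by
  obtain ⟨l, hl, hls, hfl⟩ := hf
  obtain ⟨D, hD, hDlen, hDout, hDval⟩ := hl.exists_reversible (a := a) (b := b) (e := e) (d := d)
    anc hIy hIa hya hls
  have hwire : ∀ k, ∃ u : Option (Fin W), (∀ m ∈ u, m ∉ Set.range y) ∧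
      ∀ Z, (∀ k, Z (anc k) = false) → u.elim false (permList D Z) = f Z k := by
    intro k
    rcases hfl _ (mem_bits f k) with ⟨i, hi, hfi⟩ | hf | hf
    · refine ⟨some i, by simpa using hIy i hi, fun Z _ => ?_⟩
      simpa [hDout Z i (hIa i hi)] using (congrFun hfi Z).symm
    · obtain ⟨n, hn, hnf⟩ := List.mem_iff_getElem.1 hf
      refine ⟨some (anc ⟨n, by omega⟩), by simpa using hya ⟨n, by omega⟩, fun Z hZ => ?_⟩
      simp only [Option.elim_some]
      rw [hDval Z hZ]
      have := congrFun hnf Z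
      simp [List.getD_eq_getElem?_getD, hn, this]
    · exact ⟨none, by simp, fun Z _ => (congrFun hf Z).symm⟩
  choose u hu hu' using hwire
  obtain ⟨cp, hcp, hcplen, hcpval⟩ := exists_copy (a := a) (b := b) (e := e) (d := d) y u hu
  have hoff : ∀ Z, ∀ m ∉ Set.range y, permList (D.reverse ++ (cp ++ D)) Z m = Z m := by
    intro Z m hm
    rw [permList_append, permList_append]
    have h1 : ∀ m ∉ Set.range y, permList cp (permList D Z) m = permList D Z m := by
      intro m hm
      rw [hcpval, Bits.xorAt_of_notMem hm]
    have := permList_congr (gs := D.reverse) (fun g hg => (hD g (by simpa using hg)).2) h1 m hm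
    rw [this, permList_reverse_permList]
  refine ⟨D.reverse ++ (cp ++ D), ?_, by simp; omega, fun Z hZ => ?_, hoff⟩
  · intro g hg
    simp only [List.mem_append, List.mem_reverse] at hg
    rcases hg with hg | hg | hg
    · exact (hD g hg).1
    · exact hcp g hg
    · exact (hD g hg).1
  · funext m
    by_cases hm : m ∈ Set.range y
    · obtain ⟨k, rfl⟩ := hm
      have hk : y k ∉ Set.range anc := by
        rintro ⟨k', hk'⟩
        exact hya k' ⟨k, hk'.symm⟩
      have hrev : ∀ Z, permList D.reverse Z (y k) = Z (y k) := by
        intro Z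
        have := hDout (permList D.reverse Z) (y k) hk
        rw [permList_permList_reverse] at this
        exact this.symm
      rw [permList_append, permList_append, hrev, hcpval, Bits.xorAt_apply, Bits.xorAt_apply,
        hDout Z _ hk, hu' k Z hZ]
    · rw [hoff Z m hm, Bits.xorAt_of_notMem hm]

end Reversible

/-! ### Simulation of an algorithm with oracles

The wires of the simulator are those of the simulated algorithm, a record of its questions, wires
with classical content, and zero-initialized wires. -/

section Simulation

/-- The layout of the wires of the simulator. -/
abbrev SimLayout (W w q e : ℕ) (T : Type) (s : ℕ) : Type :=
  (Fin w ⊕ (Fin (q + 1) × Fin e) ⊕ T ⊕ Fin s) ≃ Fin W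

variable {W w a b e d q s e' d' : ℕ} {T : Type}

namespace SimLayout

variable (L : SimLayout W w q e T s)

def reg : Fin w ↪ Fin W := ⟨fun k => L (.inl k), fun k k' h => by simpa using h⟩

def recd (j : Fin (q + 1)) : Fin e ↪ Fin W :=
  ⟨fun k => L (.inr (.inl (j, k))), fun k k' h => by simpa using h⟩

def stat : T ↪ Fin W := ⟨fun t => L (.inr (.inr (.inl t))), fun k k' h => by simpa using h⟩

def anc : Fin s ↪ Fin W := ⟨fun k => L (.inr (.inr (.inr k))), fun k k' h => by simpa using h⟩

def recdOf (Z : Bits W) : Fin (q + 1) → Bits e := fun j k => Z (L.recd j k)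

/-- The state of the simulator that corresponds to `Ψ` when the classical wires carry `st`. -/
noncomputable def encode (st : T → Bool) (Ψ : (Fin (q + 1) → Bits e) → QState w) : QState W :=
  open Classical in
  fun Z => if (∀ t, Z (L.stat t) = st t) ∧ (∀ k, Z (L.anc k) = false) then
    Ψ (L.recdOf Z) (Z ∘ L.reg) else 0

theorem reg_ne_stat (k : Fin w) (t : T) : L.reg k ≠ L.stat t := fun h => by
  simpa using L.injective h

theorem reg_ne_anc (k : Fin w) (k' : Fin s) : L.reg k ≠ L.anc k' := fun h => by
  simpa using L.injective h

theorem reg_ne_recd (k : Fin w) (j : Fin (q + 1)) (k' : Fin e) : L.reg k ≠ L.recd j k' :=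
  fun h => by simpa using L.injective h

theorem recd_ne_stat (j : Fin (q + 1)) (k : Fin e) (t : T) : L.recd j k ≠ L.stat t :=
  fun h => by simpa using L.injective h

theorem recd_ne_anc (j : Fin (q + 1)) (k : Fin e) (k' : Fin s) : L.recd j k ≠ L.anc k' :=
  fun h => by simpa using L.injective h

theorem stat_ne_anc (t : T) (k' : Fin s) : L.stat t ≠ L.anc k' := fun h => by
  simpa using L.injective h

theorem recd_ne_recd {j j' : Fin (q + 1)} (h : j ≠ j') (k k' : Fin e) :
    L.recd j k ≠ L.recd j' k' := fun h' => by
  have := L.injective h'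
  simp [h] at this

/-- The wires carry the classical content `st` and zeros. -/
def Good (st : T → Bool) (Z : Bits W) : Prop :=
  (∀ t, Z (L.stat t) = st t) ∧ ∀ k, Z (L.anc k) = false

theorem encode_good {st : T → Bool} (Ψ : (Fin (q + 1) → Bits e) → QState w) {Z : Bits W}
    (h : L.Good st Z) : L.encode st Ψ Z = Ψ (L.recdOf Z) (Z ∘ L.reg) := if_pos h

theorem encode_not_good {st : T → Bool} (Ψ : (Fin (q + 1) → Bits e) → QState w) {Z : Bits W}
    (h : ¬L.Good st Z) : L.encode st Ψ Z = 0 := if_neg h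

theorem encode_ext {st : T → Bool} {Ψ : (Fin (q + 1) → Bits e) → QState w} {φ : QState W}
    (h : ∀ Z, L.Good st Z → φ Z = Ψ (L.recdOf Z) (Z ∘ L.reg))
    (h' : ∀ Z, ¬L.Good st Z → φ Z = 0) : φ = L.encode st Ψ := by
  funext Z
  by_cases hZ : L.Good st Z
  · rw [h Z hZ, encode_good L Ψ hZ]
  · rw [h' Z hZ, encode_not_good L Ψ hZ]

theorem good_iff {st : T → Bool} {Z Z' : Bits W} (hs : ∀ t, Z' (L.stat t) = Z (L.stat t))
    (ha : ∀ k, Z' (L.anc k) = Z (L.anc k)) : L.Good st Z' ↔ L.Good st Z := by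
  simp only [Good, hs, ha]

/-- The gate acting on the simulated wires. -/
def lift : QInstr w a b e d → List (QInstr W 0 0 e' d')
  | .not t => [.not (L.reg t)]
  | .cnot c t h => [.cnot (L.reg c) (L.reg t) (L.reg.injective.ne h)]
  | .toffoli c c' t h h' =>
      [.toffoli (L.reg c) (L.reg c') (L.reg t) (L.reg.injective.ne h) (L.reg.injective.ne h')]
  | .hadamard t => [.hadamard (L.reg t)]
  | .phase t => [.phase (L.reg t)]
  | _ => []

theorem good_update {st : T → Bool} {Z : Bits W} (t : Fin w) (v : Bool) :
    L.Good st (Function.update Z (L.reg t) v) ↔ L.Good st Z :=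
  L.good_iff (fun t' => Function.update_of_ne (L.reg_ne_stat t t').symm _ _)
    (fun k => Function.update_of_ne (L.reg_ne_anc t k).symm _ _)

theorem recdOf_update (Z : Bits W) (t : Fin w) (v : Bool) :
    L.recdOf (Function.update Z (L.reg t) v) = L.recdOf Z := by
  funext j k
  exact Function.update_of_ne (L.reg_ne_recd t j k).symm _ _

theorem reg_update (Z : Bits W) (t : Fin w) (v : Bool) :
    Function.update Z (L.reg t) v ∘ L.reg = Function.update (Z ∘ L.reg) t v :=
  Function.update_comp_eq_of_injective _ L.reg.injective _ _

theorem encode_update {st : T → Bool} (Ψ : (Fin (q + 1) → Bits e) → QState w) {Z : Bits W}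
    (h : L.Good st Z) (t : Fin w) (v : Bool) :
    L.encode st Ψ (Function.update Z (L.reg t) v) =
      Ψ (L.recdOf Z) (Function.update (Z ∘ L.reg) t v) := by
  rw [L.encode_good Ψ ((L.good_update t v).2 h), L.recdOf_update, L.reg_update]

theorem encode_update_not {st : T → Bool} (Ψ : (Fin (q + 1) → Bits e) → QState w) {Z : Bits W}
    (h : ¬L.Good st Z) (t : Fin w) (v : Bool) :
    L.encode st Ψ (Function.update Z (L.reg t) v) = 0 :=
  L.encode_not_good Ψ fun h' => h ((L.good_update t v).1 h')

theorem detRun_lift (R : ℕ → Bits e' → Bits d') (payoff : List (Bits e' × Bits d') → Bits W → ℝ)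
    {g : QInstr w a b e d} (hg : g.IsGate) (l : List (QInstr W 0 0 e' d')) (j : ℕ)
    (tr : List (Bits e' × Bits d')) (st : T → Bool) (Ψ : (Fin (q + 1) → Bits e) → QState w) :
    detRun id R payoff (L.lift g ++ l) j tr (L.encode st Ψ) =
      detRun id R payoff l j tr (L.encode st fun ρ => g.op (Ψ ρ)) := by
  cases g with
  | query _ => exact hg.elim
  | call _ _ => exact hg.elim
  | _ =>
    simp only [lift, List.cons_append, List.nil_append]
    refine (detRun_gate id R payoff ?_ l j tr _).trans (congrArg _ ?_)
    · trivial
    refine L.encode_ext (fun Z hZ => ?_) (fun Z hZ => ?_)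
    · simp only [QInstr.op, L.encode_update Ψ hZ, L.encode_good Ψ hZ, Function.comp_apply]
    · simp only [QInstr.op, L.encode_update_not Ψ hZ, L.encode_not_good Ψ hZ, mul_zero, add_zero]

theorem length_lift_le (g : QInstr w a b e d) :
    (L.lift g : List (QInstr W 0 0 e' d')).length ≤ 1 := by
  cases g <;> simp [lift]

theorem callTotal_lift (g : QInstr w a b e d) :
    callTotal (L.lift g : List (QInstr W 0 0 e' d')) = 0 := by
  cases g <;> simp [lift, QInstr.callCount]

end SimLayout

/-- The bits from which the simulator may compute. -/
def simInputs (q e : ℕ) (T κ : Type) :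
    Set ((T → Bool) × (Fin (q + 1) → Bits e) × (κ → Bool) → Bool) :=
  bits (fun ω => ω.1) ∪ (bits (fun ω (p : Fin (q + 1) × Fin e) => ω.2.1 p.1 p.2) ∪
    bits (fun ω => ω.2.2))

namespace SimLayout

variable (L : SimLayout W w q e T s)

/-- Pullback of a computation to the wires of the simulator. -/
theorem computes_pullback {κ : Type} {o : ℕ}
    {F : (T → Bool) × (Fin (q + 1) → Bits e) × (κ → Bool) → Bits o}
    (hF : Computes (fun _ => id : _ → Bits 0 → Bits 0) (simInputs q e T κ) (bits F) s)
    (u : κ → Fin w) :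
    Computes (fun _ => id : Bits W → Bits 0 → Bits 0)
      {g | ∃ i ∈ Set.range L.stat ∪ (⋃ j, Set.range (L.recd j)) ∪ Set.range (L.reg ∘ u),
        g = fun Z => Z i}
      (bits fun Z => F (Z ∘ L.stat, L.recdOf Z, Z ∘ L.reg ∘ u)) s := by
  refine (hF.comp (fun Z => (Z ∘ L.stat, L.recdOf Z, Z ∘ L.reg ∘ u))
    (orc' := fun _ => id) (fun _ => rfl)).mono ?_ ?_ le_rfl
  · rintro _ ⟨_, (⟨t, rfl⟩ | ⟨p, rfl⟩ | ⟨k, rfl⟩), rfl⟩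
    · exact ⟨_, .inl (.inl ⟨t, rfl⟩), rfl⟩
    · exact ⟨_, .inl (.inr (Set.mem_iUnion.2 ⟨p.1, p.2, rfl⟩)), rfl⟩
    · exact ⟨_, .inr ⟨k, rfl⟩, rfl⟩
  · rintro _ ⟨k, rfl⟩
    exact ⟨_, ⟨k, rfl⟩, rfl⟩

theorem xorAt_reg_good {o : ℕ} (y : Fin o ↪ Fin w) (v : Bits o) {st : T → Bool} {Z : Bits W} :
    L.Good st (Bits.xorAt (y.trans L.reg) v Z) ↔ L.Good st Z :=
  L.good_iff
    (fun t => Bits.xorAt_of_notMem (by rintro ⟨k, hk⟩; exact L.reg_ne_stat _ _ hk))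
    (fun k => Bits.xorAt_of_notMem (by rintro ⟨k, hk⟩; exact L.reg_ne_anc _ _ hk))

theorem xorAt_reg_recdOf {o : ℕ} (y : Fin o ↪ Fin w) (v : Bits o) (Z : Bits W) :
    L.recdOf (Bits.xorAt (y.trans L.reg) v Z) = L.recdOf Z := by
  funext j k
  exact Bits.xorAt_of_notMem (by rintro ⟨k, hk⟩; exact L.reg_ne_recd _ _ _ hk)

theorem xorAt_reg_reg {o : ℕ} (y : Fin o ↪ Fin w) (v : Bits o) (Z : Bits W) :
    Bits.xorAt (y.trans L.reg) v Z ∘ L.reg = Bits.xorAt y v (Z ∘ L.reg) := by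
  funext k
  simp only [Function.comp_apply]
  by_cases hk : k ∈ Set.range y
  · obtain ⟨i, rfl⟩ := hk
    rw [Bits.xorAt_apply]
    exact Bits.xorAt_apply (y.trans L.reg) v Z i
  · rw [Bits.xorAt_of_notMem hk]
    refine Bits.xorAt_of_notMem ?_
    rintro ⟨i, hi⟩
    exact hk ⟨i, L.reg.injective hi⟩

/-- A function of classical data, the record and some wires can be added to other wires. -/
theorem exists_regBlock {κ : Type} {o : ℕ}
    {F : (T → Bool) × (Fin (q + 1) → Bits e) × (κ → Bool) → Bits o}
    (hF : Computes (fun _ => id : _ → Bits 0 → Bits 0) (simInputs q e T κ) (bits F) s)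
    (u : κ → Fin w) (y : Fin o ↪ Fin w) (huy : ∀ k, u k ∉ Set.range y) :
    ∃ gs : List (QInstr W 0 0 e' d'), (∀ g ∈ gs, g.IsClassical) ∧ gs.length ≤ 4 * s + o ∧
      ∀ st Ψ, L.encode st Ψ ∘ permList gs =
        L.encode st fun ρ z => Ψ ρ (Bits.xorAt y (F (st, ρ, z ∘ u)) z) := by
  obtain ⟨gs, hgs, hlen, hval, hoff⟩ := exists_block (a := 0) (b := 0) (e := e') (d := d')
    (Set.range L.stat ∪ (⋃ j, Set.range (L.recd j)) ∪ Set.range (L.reg ∘ u)) (y.trans L.reg) L.anc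
    (by
      rintro i ((⟨t, rfl⟩ | hi) | ⟨k, rfl⟩) ⟨k', hk'⟩
      · exact L.reg_ne_stat _ _ hk'
      · obtain ⟨j, k, rfl⟩ := Set.mem_iUnion.1 hi
        exact L.reg_ne_recd _ _ _ hk'
      · exact huy k ⟨k', L.reg.injective hk'⟩)
    (by
      rintro i ((⟨t, rfl⟩ | hi) | ⟨k, rfl⟩) ⟨k', hk'⟩
      · exact L.stat_ne_anc _ _ hk'.symm
      · obtain ⟨j, k, rfl⟩ := Set.mem_iUnion.1 hi
        exact L.recd_ne_anc _ _ _ hk'.symm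
      · exact L.reg_ne_anc _ _ hk'.symm)
    (by rintro k ⟨k', hk'⟩; exact L.reg_ne_anc _ _ hk')
    (fun Z => F (Z ∘ L.stat, L.recdOf Z, Z ∘ L.reg ∘ u)) (L.computes_pullback hF u)
  refine ⟨gs, hgs, hlen, fun st Ψ => L.encode_ext (fun Z hZ => ?_) (fun Z hZ => ?_)⟩
  · have hst : Z ∘ L.stat = st := funext hZ.1
    rw [Function.comp_apply, hval Z hZ.2, L.encode_good _ ((L.xorAt_reg_good _ _).2 hZ),
      L.xorAt_reg_recdOf, L.xorAt_reg_reg, hst]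
    rfl
  · rw [Function.comp_apply, L.encode_not_good]
    intro h
    refine hZ ((L.good_iff (fun t => ?_) (fun k => ?_)).1 h)
    · exact hoff Z _ (by rintro ⟨k, hk⟩; exact L.reg_ne_stat _ _ hk)
    · exact hoff Z _ (by rintro ⟨k, hk⟩; exact L.reg_ne_anc _ _ hk)

/-- The question of a call is copied to the record. -/
theorem exists_recordBlock (x : Fin e ↪ Fin w) (j : Fin (q + 1)) :
    ∃ gs : List (QInstr W 0 0 e' d'), (∀ g ∈ gs, g.IsClassical) ∧ gs.length ≤ e ∧
      ∀ st Ψ, (∀ ρ, ρ j ≠ (fun _ => false) → Ψ ρ = 0) → L.encode st Ψ ∘ permList gs =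
        L.encode st fun ρ => (Ψ (Function.update ρ j fun _ => false)).project x (ρ j) := by
  obtain ⟨gs, hgs, hlen, hval⟩ := exists_copy (a := 0) (b := 0) (e := e') (d := d') (L.recd j)
    (fun k => some (L.reg (x k))) (by
      rintro k m hm ⟨k', hk'⟩
      simp only [Option.mem_some_iff] at hm
      subst hm
      exact L.reg_ne_recd _ _ _ hk'.symm)
  have hs : ∀ v Z t, Bits.xorAt (L.recd j) v Z (L.stat t) = Z (L.stat t) := fun v Z t =>
    Bits.xorAt_of_notMem (by rintro ⟨k, hk⟩; exact L.recd_ne_stat _ _ _ hk)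
  have ha : ∀ v Z k, Bits.xorAt (L.recd j) v Z (L.anc k) = Z (L.anc k) := fun v Z t =>
    Bits.xorAt_of_notMem (by rintro ⟨k, hk⟩; exact L.recd_ne_anc _ _ _ hk)
  have hr : ∀ v Z, Bits.xorAt (L.recd j) v Z ∘ L.reg = Z ∘ L.reg := fun v Z => funext fun k =>
    Bits.xorAt_of_notMem (by rintro ⟨k, hk⟩; exact L.reg_ne_recd _ _ _ hk.symm)
  have hc : ∀ v Z, L.recdOf (Bits.xorAt (L.recd j) v Z) =
      Function.update (L.recdOf Z) j (fun k => xor (L.recdOf Z j k) (v k)) := by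
    intro v Z
    funext j' k
    by_cases hj : j' = j
    · subst hj
      rw [Function.update_self]
      exact Bits.xorAt_apply _ _ _ _
    · rw [Function.update_of_ne hj]
      exact Bits.xorAt_of_notMem (by rintro ⟨k', hk⟩; exact L.recd_ne_recd hj _ _ hk.symm)
  refine ⟨gs, hgs, hlen, fun st Ψ hΨ => L.encode_ext (fun Z hZ => ?_) (fun Z hZ => ?_)⟩
  · rw [Function.comp_apply, hval, L.encode_good _ ((L.good_iff (hs _ _) (ha _ _)).2 hZ), hr, hc]
    simp only [QState.project]
    split_ifs with h
    · congr 2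
      funext k
      simp [← h]
    · rw [hΨ]
      · rfl
      · rw [Function.update_self]
        intro h0
        refine h (funext fun k => ?_)
        have := congrFun h0 k
        simp only [Option.elim_some] at this
        simp only [Function.comp_apply]
        cases h1 : L.recdOf Z j k <;> cases h2 : Z (L.reg (x k)) <;> simp_all
  · rw [Function.comp_apply, hval, L.encode_not_good]
    exact fun h => hZ ((L.good_iff (hs _ _) (ha _ _)).1 h)

/-- A call whose question is classical. -/
theorem detRun_call (R : ℕ → Bits e' → Bits d') (payoff : List (Bits e' × Bits d') → Bits W → ℝ)
    (cw : Fin e' ↪ T) (sw : Fin d' ↪ T) (l : List (QInstr W 0 0 e' d')) (j : ℕ)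
    (tr : List (Bits e' × Bits d')) (st : T → Bool) (Ψ : (Fin (q + 1) → Bits e) → QState w) :
    detRun id R payoff (.call (cw.trans L.stat) (sw.trans L.stat) :: l) j tr (L.encode st Ψ) =
      detRun id R payoff l (j + 1) (tr ++ [(st ∘ cw, R j (st ∘ cw))])
        (L.encode (Function.extend sw (fun k => xor (st (sw k)) (R j (st ∘ cw) k)) st) Ψ) := by
  rw [detRun, Finset.sum_eq_single (st ∘ cw)]
  · congr 1
    have hx : ∀ Z : Bits W, ∀ v, Bits.xorAt (sw.trans L.stat) v Z ∘ L.stat =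
        Function.extend sw (fun k => xor (Z (L.stat (sw k))) (v k)) (Z ∘ L.stat) := by
      intro Z v
      funext t
      by_cases ht : ∃ k, sw k = t
      · obtain ⟨k, rfl⟩ := ht
        rw [sw.injective.extend_apply]
        exact Bits.xorAt_apply (sw.trans L.stat) v Z k
      · rw [Function.extend_apply' _ _ _ ht]
        refine Bits.xorAt_of_notMem ?_
        rintro ⟨k, hk⟩
        exact ht ⟨k, L.stat.injective hk⟩
    set v := R j (st ∘ cw)
    set st' := Function.extend sw (fun k => xor (st (sw k)) (v k)) st
    have hst' : Function.extend sw (fun k => xor (st' (sw k)) (v k)) st' = st := by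
      funext t
      by_cases ht : ∃ k, sw k = t
      · obtain ⟨k, rfl⟩ := ht
        simp [st', sw.injective.extend_apply]
      · rw [Function.extend_apply' _ _ _ ht]
        exact Function.extend_apply' _ _ _ ht
    have ha : ∀ Z k, Bits.xorAt (sw.trans L.stat) v Z (L.anc k) = Z (L.anc k) := fun Z t =>
      Bits.xorAt_of_notMem (by rintro ⟨k, hk⟩; exact L.stat_ne_anc _ _ hk)
    have hr : ∀ Z, Bits.xorAt (sw.trans L.stat) v Z ∘ L.reg = Z ∘ L.reg := fun Z => funext fun k =>
      Bits.xorAt_of_notMem (by rintro ⟨k, hk⟩; exact L.reg_ne_stat _ _ hk.symm)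
    have hc : ∀ Z, L.recdOf (Bits.xorAt (sw.trans L.stat) v Z) = L.recdOf Z := fun Z =>
      funext fun j => funext fun k =>
        Bits.xorAt_of_notMem (by rintro ⟨k, hk⟩; exact L.recd_ne_stat _ _ _ hk.symm)
    have hg : ∀ Z, L.Good st (Bits.xorAt (sw.trans L.stat) v Z) ↔ L.Good st' Z := by
      intro Z
      have h1 : (∀ t, Bits.xorAt (sw.trans L.stat) v Z (L.stat t) = st t) ↔
          ∀ t, Z (L.stat t) = st' t := by
        constructor
        · intro h t
          have h2 : Bits.xorAt (sw.trans L.stat) v Z ∘ L.stat = st := funext h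
          have h3 := hx (Bits.xorAt (sw.trans L.stat) v Z) v
          rw [Bits.xorAt_xorAt] at h3
          have h4 := congrFun h3 t
          rw [h2] at h4
          simp only [h] at h4
          exact h4
        · intro h t
          have h2 : Z ∘ L.stat = st' := funext h
          have h4 := congrFun (hx Z v) t
          rw [h2] at h4
          simp only [h] at h4
          rw [hst'] at h4
          exact h4
      simp only [Good, h1, ha]
    refine L.encode_ext (fun Z hZ => ?_) (fun Z hZ => ?_)
    · have hZ' := (hg Z).2 hZ
      have h1 : Bits.xorAt (sw.trans L.stat) v Z ∘ (cw.trans L.stat) = st ∘ cw :=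
        funext fun k => hZ'.1 (cw k)
      simp only [QState.receive, QState.project]
      rw [if_pos h1, L.encode_good _ hZ', hr, hc]
    · simp only [QState.receive, QState.project]
      rw [L.encode_not_good _ fun h => hZ ((hg Z).1 h), ite_self]
  · intro M _ hM
    have : (L.encode st Ψ).project (cw.trans L.stat) M = 0 := by
      funext Z
      simp only [QState.project]
      split_ifs with h
      · refine L.encode_not_good _ fun hZ => hM ?_
        rw [← h]
        exact funext fun k => hZ.1 (cw k)
      · rfl
    rw [this]
    exact detRun_zero _ _ _ _ _ _
  · simp

/-- Simulation of a program. -/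
theorem exists_simulation (L : SimLayout W w q e T s)
    (orc : ℕ → (T → Bool) → (Fin (q + 1) → Bits e) → Bits a → Bits b)
    (resp : ℕ → (T → Bool) → (Fin (q + 1) → Bits e) → Bits d)
    (horc : ∀ j, Computes (fun _ => id : _ → Bits 0 → Bits 0) (simInputs q e T (Fin a))
      (bits fun ω => orc j ω.1 ω.2.1 ω.2.2) s)
    (hresp : ∀ j, Computes (fun _ => id : _ → Bits 0 → Bits 0) (simInputs q e T (Fin 0))
      (bits fun ω => resp j ω.1 ω.2.1) s)
    (cw : ℕ → Fin e' ↪ T) (sw : ℕ → Fin d' ↪ T) (l : List (QInstr w a b e d)) (j : ℕ)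
    (hj : j + callTotal l ≤ q + 1) :
    ∃ code : List (QInstr W 0 0 e' d'), code.length ≤ l.length * (4 * s + b + d + e + 1) ∧
      callTotal code = callTotal l ∧
      ∀ (R : ℕ → Bits e' → Bits d') (payoff : List (Bits e' × Bits d') → Bits W → ℝ)
        (st : ℕ → T → Bool)
        (_ : ∀ i, st (i + 1) = Function.extend (sw i)
          (fun k => xor (st i (sw i k)) (R i (st i ∘ cw i) k)) (st i))
        (l' : List (QInstr W 0 0 e' d')) (tr : List (Bits e' × Bits d'))
        (Ψ : (Fin (q + 1) → Bits e) → QState w)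
        (_ : ∀ ρ, ∀ i, j ≤ i → i < q + 1 → ρ (ix i) ≠ (fun _ => false) → Ψ ρ = 0),
        detRun id R payoff (code ++ l') j tr (L.encode (st j) Ψ) =
          detRun id R payoff l' (j + callTotal l)
            (tr ++ (List.range' j (callTotal l)).map fun i =>
              (st i ∘ cw i, R i (st i ∘ cw i)))
            (L.encode (st (j + callTotal l)) (recRun (fun i => orc i (st i))
              (fun i => resp i (st (i + 1))) l j Ψ)) := by
  induction l generalizing j with
  | nil => exact ⟨[], by simp, rfl, fun R payoff st _ l' tr Ψ _ => by simp [recRun]⟩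
  | cons g l ih =>
    rw [callTotal_cons] at hj
    obtain ⟨code, hlen, hct, hcode⟩ := ih (j + g.callCount) (by omega)
    induction g using QInstr.cases_gate with
    | gate g hg =>
      rw [hg.callCount] at hj hcode
      refine ⟨L.lift g ++ code, ?_, ?_, fun R payoff st hst l' tr Ψ hΨ => ?_⟩
      · have := L.length_lift_le (e' := e') (d' := d') g
        rw [List.length_append, List.length_cons, Nat.succ_mul]
        omega
      · rw [callTotal_append, L.callTotal_lift, callTotal_cons, hg.callCount, hct]
      · rw [List.append_assoc, L.detRun_lift _ _ hg]
        have h := hcode R payoff st hst l' tr (fun ρ => g.op (Ψ ρ)) (fun ρ i hi hi' hρ => by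
          rw [hΨ ρ i hi hi' hρ, g.op_zero])
        simp only [add_zero] at h
        rw [h, callTotal_cons, recRun, recStep_gate _ _ hg, hg.callCount, zero_add, add_zero]
    | query xy =>
      obtain ⟨gs, hgs, hgl, hval⟩ := L.exists_regBlock (e' := e') (d' := d') (horc j)
        (fun i => xy (.inl i)) (Function.Embedding.inr.trans xy) (by
          rintro k ⟨k', hk'⟩
          have := xy.injective hk'
          simp at this)
      simp only [QInstr.callCount] at hj hcode
      refine ⟨gs ++ code, ?_, ?_, fun R payoff st hst l' tr Ψ hΨ => ?_⟩
      · rw [List.length_append, List.length_cons, Nat.succ_mul]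
        omega
      · rw [callTotal_append, callTotal_classical hgs, callTotal_cons, hct]
        rfl
      · rw [List.append_assoc, detRun_classical _ _ _ hgs, hval]
        have h := hcode R payoff st hst l' tr (recStep (fun i => orc i (st i))
          (fun i => resp i (st (i + 1))) (.query xy) j Ψ) (fun ρ i hi hi' hρ =>
          recStep_eq_zero _ _ _ j (by simpa [QInstr.callCount] using by omega) hΨ ρ i
            (by simpa [QInstr.callCount] using hi) hi' hρ)
        simp only [add_zero] at h
        refine Eq.trans ?_ (h.trans ?_)
        · rfl
        · rw [callTotal_cons, recRun]
          simp [QInstr.callCount]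
    | call x y =>
      simp only [QInstr.callCount] at hj hcode
      obtain ⟨gs, hgs, hgl, hval⟩ := L.exists_recordBlock (e' := e') (d' := d') x (ix j)
      obtain ⟨gs', hgs', hgl', hval'⟩ := L.exists_regBlock (e' := e') (d' := d') (hresp j)
        (fun i => i.elim0) y (fun i => i.elim0)
      refine ⟨gs ++ (.call ((cw j).trans L.stat) ((sw j).trans L.stat) :: (gs' ++ code)), ?_, ?_,
        fun R payoff st hst l' tr Ψ hΨ => ?_⟩
      · simp only [List.length_append, List.length_cons]
        rw [Nat.add_one_mul]
        omega
      · simp only [callTotal_append, callTotal_cons, callTotal_classical hgs,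
          callTotal_classical hgs', hct, QInstr.callCount]
        omega
      · rw [List.append_assoc, detRun_classical _ _ _ hgs,
          hval _ _ (fun ρ hρ => hΨ ρ j le_rfl (by omega) hρ), List.cons_append, L.detRun_call,
          ← hst, List.append_assoc, detRun_classical _ _ _ hgs', hval']
        have h := hcode R payoff st hst l' (tr ++ [(st j ∘ cw j, R j (st j ∘ cw j))])
          (recStep (fun i => orc i (st i))
          (fun i => resp i (st (i + 1))) (.call x y) j Ψ) (fun ρ i hi hi' hρ =>
          recStep_eq_zero _ _ _ j (by simpa [QInstr.callCount] using by omega) hΨ ρ i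
            (by simpa [QInstr.callCount] using hi) hi' hρ)
        refine Eq.trans ?_ (h.trans ?_)
        · rfl
        · rw [callTotal_cons, recRun]
          simp only [QInstr.callCount]
          rw [← add_assoc, add_comm 1 (callTotal l), List.range'_succ]
          simp [add_comm, add_left_comm]

end SimLayout

end Simulation

section Simulator

variable {W w a b e d q s e' d' i o : ℕ} {T : Type}

namespace SimLayout

variable (L : SimLayout W w q e T s)

/-- The content of the wires for given classical data, record and simulated wires. -/
def content (st : T → Bool) (ρ : Fin (q + 1) → Bits e) (z : Bits w) : Bits W := fun m =>
  Sum.elim z (Sum.elim (fun p => ρ p.1 p.2) (Sum.elim st fun _ => false)) (L.symm m)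

@[simp] theorem content_reg (st : T → Bool) (ρ : Fin (q + 1) → Bits e) (z : Bits w) (k : Fin w) :
    L.content st ρ z (L.reg k) = z k :=
  congrArg _ (L.symm_apply_apply (.inl k))

@[simp] theorem content_recd (st : T → Bool) (ρ : Fin (q + 1) → Bits e) (z : Bits w)
    (j : Fin (q + 1)) (k : Fin e) : L.content st ρ z (L.recd j k) = ρ j k :=
  congrArg _ (L.symm_apply_apply (.inr (.inl (j, k))))

@[simp] theorem content_stat (st : T → Bool) (ρ : Fin (q + 1) → Bits e) (z : Bits w) (t : T) :
    L.content st ρ z (L.stat t) = st t :=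
  congrArg _ (L.symm_apply_apply (.inr (.inr (.inl t))))

@[simp] theorem content_anc (st : T → Bool) (ρ : Fin (q + 1) → Bits e) (z : Bits w) (k : Fin s) :
    L.content st ρ z (L.anc k) = false :=
  congrArg _ (L.symm_apply_apply (.inr (.inr (.inr k))))

theorem content_good (st : T → Bool) (ρ : Fin (q + 1) → Bits e) (z : Bits w) :
    L.Good st (L.content st ρ z) := ⟨by simp, by simp⟩

theorem content_recdOf (st : T → Bool) (ρ : Fin (q + 1) → Bits e) (z : Bits w) :
    L.recdOf (L.content st ρ z) = ρ := by
  funext j k; simp [recdOf]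

theorem content_comp_reg (st : T → Bool) (ρ : Fin (q + 1) → Bits e) (z : Bits w) :
    L.content st ρ z ∘ L.reg = z := by
  funext k; simp

theorem ext_wires {Z Z' : Bits W} (h1 : ∀ k, Z (L.reg k) = Z' (L.reg k))
    (h2 : ∀ j k, Z (L.recd j k) = Z' (L.recd j k)) (h3 : ∀ t, Z (L.stat t) = Z' (L.stat t))
    (h4 : ∀ k, Z (L.anc k) = Z' (L.anc k)) : Z = Z' := by
  funext m
  obtain ⟨x, rfl⟩ := L.surjective m
  rcases x with k | ⟨j, k⟩ | t | k
  · exact h1 k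
  · exact h2 j k
  · exact h3 t
  · exact h4 k

theorem eq_content {st : T → Bool} {Z : Bits W} (h : L.Good st Z) :
    Z = L.content st (L.recdOf Z) (Z ∘ L.reg) :=
  L.ext_wires (by simp) (fun j k => by simp [recdOf]) (fun t => by simp [h.1])
    (fun k => by simp [h.2])

theorem encode_initRec (st : T → Bool) (z : Bits w) :
    L.encode st (initRec z) = QState.basis (L.content st (fun _ _ => false) z) := by
  symm
  refine L.encode_ext (fun Z hZ => ?_) (fun Z hZ => ?_)
  · rw [QState.basis, initRec]
    by_cases h1 : L.recdOf Z = fun _ _ => false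
    · rw [h1, Pi.single_eq_same, QState.basis]
      by_cases h2 : Z ∘ L.reg = z
      · rw [h2, Pi.single_eq_same, L.eq_content hZ, h1, h2, Pi.single_eq_same]
      · rw [Pi.single_eq_of_ne h2, Pi.single_eq_of_ne]
        rintro rfl
        exact h2 (L.content_comp_reg _ _ _)
    · rw [Pi.single_eq_of_ne h1, Pi.single_eq_of_ne]
      · rfl
      · rintro rfl
        exact h1 (L.content_recdOf _ _ _)
  · rw [QState.basis, Pi.single_eq_of_ne]
    rintro rfl
    exact hZ (L.content_good _ _ _)

theorem sum_encode (st : T → Bool) (Ψ : (Fin (q + 1) → Bits e) → QState w) (p : Bits W → ℝ) :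
    ∑ Z, ‖L.encode st Ψ Z‖ ^ 2 * p Z =
      ∑ ρ, ∑ z, ‖Ψ ρ z‖ ^ 2 * p (L.content st ρ z) := by
  rw [← Fintype.sum_prod_type']
  symm
  refine Fintype.sum_of_injective (fun x : (Fin (q + 1) → Bits e) × Bits w => L.content st x.1 x.2)
    ?_ _ _ ?_ ?_
  · rintro ⟨ρ, z⟩ ⟨ρ', z'⟩ h
    have h1 := congrArg L.recdOf h
    have h2 := congrArg (· ∘ L.reg) h
    simp only [L.content_recdOf, L.content_comp_reg] at h1 h2
    rw [h1, h2]
  · intro Z hZ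
    rw [L.encode_not_good]
    · simp
    · intro h
      exact hZ ⟨(L.recdOf Z, Z ∘ L.reg), (L.eq_content h).symm⟩
  · rintro ⟨ρ, z⟩
    simp only [L.encode_good Ψ (L.content_good st ρ z), L.content_recdOf, L.content_comp_reg]

end SimLayout

theorem Computes.extend_static {κ T' : Type} {o s : ℕ}
    {F : (T → Bool) × (Fin (q + 1) → Bits e) × (κ → Bool) → Bits o}
    (hF : Computes (fun _ => id : _ → Bits 0 → Bits 0) (simInputs q e T κ) (bits F) s) :
    Computes (fun _ => id : _ → Bits 0 → Bits 0) (simInputs q e (T ⊕ T') κ)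
      (bits fun ω => F (ω.1 ∘ Sum.inl, ω.2)) s := by
  refine (hF.comp (fun ω : (T ⊕ T' → Bool) × (Fin (q + 1) → Bits e) × (κ → Bool) =>
    (ω.1 ∘ Sum.inl, ω.2)) (orc' := fun _ => id) (fun _ => rfl)).mono ?_ ?_ le_rfl
  · rintro _ ⟨_, (⟨t, rfl⟩ | ⟨p, rfl⟩ | ⟨k, rfl⟩), rfl⟩
    · exact .inl ⟨.inl t, rfl⟩
    · exact .inr (.inl ⟨p, rfl⟩)
    · exact .inr (.inr ⟨k, rfl⟩)
  · rintro _ ⟨k, rfl⟩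
    exact ⟨_, ⟨k, rfl⟩, rfl⟩

theorem sum_elim_extend {T T' κ : Type} (f : κ ↪ T) (u : κ → Bool) (v : T → Bool) (v' : T' → Bool) :
    Sum.elim (Function.extend f u v) v' =
      Function.extend (f.trans Function.Embedding.inl) u (Sum.elim v v') := by
  funext t
  rcases t with t | t
  · by_cases ht : ∃ k, f k = t
    · obtain ⟨k, rfl⟩ := ht
      rw [Sum.elim_inl, f.injective.extend_apply]
      exact ((f.trans Function.Embedding.inl).injective.extend_apply u (Sum.elim v v') k).symm
    · rw [Sum.elim_inl, Function.extend_apply' _ _ _ ht, Function.extend_apply', Sum.elim_inl]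
      rintro ⟨k, hk⟩
      exact ht ⟨k, Sum.inl_injective hk⟩
  · rw [Sum.elim_inr, Function.extend_apply', Sum.elim_inr]
    rintro ⟨k, hk⟩
    exact Sum.inl_ne_inr hk

/-- An algorithm with oracles can be simulated by one that computes the oracles itself, makes
calls with classical questions, and postprocesses the output. -/
theorem exists_simulator [Fintype T] (code : List (QInstr w a b e d))
    (hq : callTotal code ≤ q + 1) (start : Bits i → Fin w ⊕ T → Bool)
    (hstart : Computes (fun _ => id : _ → Bits 0 → Bits 0) (bits id) (bits start) s)
    (orc : ℕ → (T → Bool) → (Fin (q + 1) → Bits e) → Bits a → Bits b)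
    (resp : ℕ → (T → Bool) → (Fin (q + 1) → Bits e) → Bits d)
    (horc : ∀ j, Computes (fun _ => id : _ → Bits 0 → Bits 0) (simInputs q e T (Fin a))
      (bits fun ω => orc j ω.1 ω.2.1 ω.2.2) s)
    (hresp : ∀ j, Computes (fun _ => id : _ → Bits 0 → Bits 0) (simInputs q e T (Fin 0))
      (bits fun ω => resp j ω.1 ω.2.1) s)
    (fin : (T → Bool) → (Fin (q + 1) → Bits e) → Bits w → Bits o)
    (hfin : Computes (fun _ => id : _ → Bits 0 → Bits 0) (simInputs q e T (Fin w))
      (bits fun ω => fin ω.1 ω.2.1 ω.2.2) s)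
    (cw : ℕ → Fin e' ↪ T) (sw : ℕ → Fin d' ↪ T) :
    ∃ B : QCircuit 0 0 e' d' i o,
      B.size ≤ w + (q + 1) * e + Fintype.card T + i + o + s +
        (4 * s + w + Fintype.card T + code.length * (4 * s + b + d + e + 1) + 4 * s + o) ∧
      callTotal B.code = callTotal code ∧
      ∀ (R : ℕ → Bits e' → Bits d') (v : Bits i)
        (payoff : List (Bits e' × Bits d') → Bits o → ℝ) (st : ℕ → T → Bool)
        (_ : st 0 = fun t => start v (.inr t))
        (_ : ∀ j, st (j + 1) = Function.extend (sw j)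
          (fun k => xor (st j (sw j k)) (R j (st j ∘ cw j) k)) (st j)),
        detRun id R (fun tr z => payoff tr (z ∘ B.output)) B.code 0 []
            (QState.basis (Bits.load B.input v)) =
          ∑ ρ, ∑ z, ‖recRun (fun j => orc j (st j)) (fun j => resp j (st (j + 1))) code 0
              (initRec fun k => start v (.inl k)) ρ z‖ ^ 2 *
            payoff ((List.range (callTotal code)).map fun j => (st j ∘ cw j, R j (st j ∘ cw j)))
              (fin (st (callTotal code)) ρ z) := by
  classical
  let T' := T ⊕ Fin i ⊕ Fin o
  obtain ⟨W, L, hW⟩ : ∃ W, ∃ _ : SimLayout W w q e T' s,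
      W = w + (q + 1) * e + Fintype.card T + i + o + s := by
    refine ⟨_, Fintype.equivFin _, ?_⟩
    simp only [Fintype.card_sum, Fintype.card_fin, Fintype.card_prod, T']
    ring
  let inp : Fin i ↪ Fin W :=
    (Function.Embedding.inl.trans Function.Embedding.inr).trans L.stat
  let out : Fin o ↪ Fin W :=
    (Function.Embedding.inr.trans Function.Embedding.inr).trans L.stat
  -- the initialization
  let ε := Fintype.equivFin (Fin w ⊕ T)
  let yE : Fin w ⊕ T ↪ Fin W := ⟨Sum.elim L.reg (fun t => L.stat (.inl t)), by
    rintro (k | t) (k' | t') h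
    · exact congrArg _ (L.reg.injective h)
    · exact (L.reg_ne_stat _ _ h).elim
    · exact (L.reg_ne_stat _ _ h.symm).elim
    · exact congrArg _ (Sum.inl_injective (L.stat.injective h))⟩
  let y₀ : Fin (Fintype.card (Fin w ⊕ T)) ↪ Fin W := ε.symm.toEmbedding.trans yE
  have hy₀ : ∀ m, m ∈ Set.range y₀ ↔ m ∈ Set.range yE := by
    intro m
    constructor
    · rintro ⟨k, rfl⟩; exact ⟨_, rfl⟩
    · rintro ⟨k, rfl⟩; exact ⟨ε k, congrArg yE (ε.symm_apply_apply k)⟩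
  have hinp_yE : ∀ k, inp k ∉ Set.range yE := by
    rintro k ⟨k' | t, h⟩
    · exact L.reg_ne_stat _ _ h
    · simpa using L.stat.injective h
  obtain ⟨gs₀, hgs₀, hlen₀, hval₀, -⟩ := exists_block (a := 0) (b := 0) (e := e') (d := d')
    (Set.range inp) y₀ L.anc
    (by rintro _ ⟨k, rfl⟩ h; exact hinp_yE k ((hy₀ _).1 h))
    (by rintro _ ⟨k, rfl⟩ ⟨k', h⟩; exact L.stat_ne_anc _ _ h.symm)
    (by
      intro k h
      obtain ⟨k' | t, h⟩ := (hy₀ _).1 h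
      · exact L.reg_ne_anc _ _ h
      · exact L.stat_ne_anc _ _ h)
    (fun Z k => start (Z ∘ inp) (ε.symm k)) (by
      refine (hstart.comp (fun Z : Bits W => Z ∘ inp) (orc' := fun _ => id)
        (fun _ => rfl)).mono ?_ ?_ le_rfl
      · rintro _ ⟨_, ⟨k, rfl⟩, rfl⟩
        exact ⟨inp k, ⟨k, rfl⟩, rfl⟩
      · rintro _ ⟨k, rfl⟩
        exact ⟨_, ⟨ε.symm k, rfl⟩, rfl⟩)
  -- the simulation
  obtain ⟨sim, hsimlen, hsimcalls, hsim⟩ := L.exists_simulation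
    (fun j st => orc j (st ∘ Sum.inl)) (fun j st => resp j (st ∘ Sum.inl))
    (fun j => (horc j).extend_static) (fun j => (hresp j).extend_static)
    (fun j => (cw j).trans Function.Embedding.inl) (fun j => (sw j).trans Function.Embedding.inl)
    code 0 (by omega)
  -- the postprocessing
  let fO : Bits W → Bits o := fun Z => fin (fun t => Z (L.stat (.inl t))) (L.recdOf Z) (Z ∘ L.reg)
  obtain ⟨gs₁, hgs₁, hlen₁, hval₁, hoff₁⟩ := exists_block (a := 0) (b := 0) (e := e') (d := d')
    (Set.range (fun t => L.stat (.inl t)) ∪ (⋃ j, Set.range (L.recd j)) ∪ Set.range L.reg)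
    out L.anc
    (by
      rintro m ((⟨t, rfl⟩ | hi) | ⟨k, rfl⟩) ⟨k', hk'⟩
      · simpa using L.stat.injective hk'
      · obtain ⟨j, k, rfl⟩ := Set.mem_iUnion.1 hi
        exact L.recd_ne_stat _ _ _ hk'.symm
      · exact L.reg_ne_stat _ _ hk'.symm)
    (by
      rintro m ((⟨t, rfl⟩ | hi) | ⟨k, rfl⟩) ⟨k', hk'⟩
      · exact L.stat_ne_anc _ _ hk'.symm
      · obtain ⟨j, k, rfl⟩ := Set.mem_iUnion.1 hi
        exact L.recd_ne_anc _ _ _ hk'.symm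
      · exact L.reg_ne_anc _ _ hk'.symm)
    (by rintro k ⟨k', hk'⟩; exact L.stat_ne_anc _ _ hk') fO (by
      refine (hfin.comp (fun Z : Bits W => (fun t => Z (L.stat (.inl t)), L.recdOf Z, Z ∘ L.reg))
        (orc' := fun _ => id) (fun _ => rfl)).mono ?_ ?_ le_rfl
      · rintro _ ⟨_, (⟨t, rfl⟩ | ⟨p, rfl⟩ | ⟨k, rfl⟩), rfl⟩
        · exact ⟨_, .inl (.inl ⟨t, rfl⟩), rfl⟩
        · exact ⟨_, .inl (.inr (Set.mem_iUnion.2 ⟨p.1, p.2, rfl⟩)), rfl⟩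
        · exact ⟨_, .inr ⟨k, rfl⟩, rfl⟩
      · rintro _ ⟨k, rfl⟩
        exact ⟨_, ⟨k, rfl⟩, rfl⟩)
  refine ⟨⟨W, gs₀ ++ (sim ++ gs₁), inp, out⟩, ?_, ?_, fun R v payoff st hst₀ hst => ?_⟩
  · simp only [QCircuit.size, List.length_append, hW]
    simp only [Fintype.card_sum, Fintype.card_fin] at hlen₀
    omega
  · simp [callTotal_classical hgs₀, callTotal_classical hgs₁, hsimcalls]
  let st' : ℕ → T' → Bool := fun j => Sum.elim (st j) (Sum.elim v fun _ => false)
  have hst' : ∀ j, st' (j + 1) = Function.extend ((sw j).trans Function.Embedding.inl)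
      (fun k => xor (st' j ((sw j).trans Function.Embedding.inl k))
        (R j (st' j ∘ (cw j).trans Function.Embedding.inl) k)) (st' j) := by
    intro j
    change Sum.elim (st (j + 1)) _ = _
    rw [hst, sum_elim_extend]
    rfl
  -- the state after the initialization
  have hstart : QState.basis (Bits.load inp v) ∘ permList gs₀ =
      L.encode (st' 0) (initRec fun k => start v (.inl k)) := by
    rw [L.encode_initRec]
    set Z₁ := L.content (st' 0) (fun _ _ => false) (fun k => start v (.inl k)) with hZ₁
    have hin : Z₁ ∘ inp = v := by
      funext k
      refine Eq.trans ?_ (L.content_stat (st' 0) (fun _ _ => false)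
        (fun k => start v (.inl k)) (.inr (.inl k)))
      rw [← hZ₁]
      rfl
    have hload : permList gs₀ Z₁ = Bits.load inp v := by
      rw [hval₀ Z₁ (by simp [hZ₁]), hin]
      have hout : ∀ m, m ∉ Set.range inp → Bits.load inp v m = false := fun m hm => by
        rw [Bits.load, Bits.writeAt_of_notMem hm]
      have hy : ∀ x, Bits.xorAt y₀ (fun k => start v (ε.symm k)) Z₁ (yE x) =
          xor (Z₁ (yE x)) (start v x) := by
        intro x
        have := Bits.xorAt_apply y₀ (fun k => start v (ε.symm k)) Z₁ (ε x)
        have hx : y₀ (ε x) = yE x := congrArg yE (ε.symm_apply_apply x)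
        rw [hx, ε.symm_apply_apply] at this
        exact this
      refine L.ext_wires (fun k => ?_) (fun j k => ?_) (fun t => ?_) (fun k => ?_)
      · rw [hout]
        · refine (hy (.inl k)).trans ?_
          change xor (L.content _ _ _ (L.reg k)) _ = _
          simp
        · rintro ⟨k', h⟩
          exact L.reg_ne_stat _ _ h.symm
      · rw [hout, Bits.xorAt_of_notMem]
        · simp [hZ₁]
        · intro h
          obtain ⟨k' | t, h⟩ := (hy₀ _).1 h
          · exact L.reg_ne_recd _ _ _ h
          · exact L.recd_ne_stat _ _ _ h.symm
        · rintro ⟨k', h⟩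
          exact L.recd_ne_stat _ _ _ h.symm
      · rcases t with t | k | k
        · rw [hout]
          · refine (hy (.inr t)).trans ?_
            change xor (L.content _ _ _ (L.stat (.inl t))) _ = _
            simp [st', hst₀]
          · rintro ⟨k', h⟩
            simpa using L.stat.injective h
        · refine Eq.trans ?_ (Bits.load_apply inp v k).symm
          rw [← hin]
          exact Bits.xorAt_of_notMem fun h => hinp_yE k ((hy₀ _).1 h)
        · rw [hout, Bits.xorAt_of_notMem]
          · simp [hZ₁, st']
          · intro h
            obtain ⟨k' | t, h⟩ := (hy₀ _).1 h
            · exact L.reg_ne_stat _ _ h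
            · simpa using L.stat.injective h
          · rintro ⟨k', h⟩
            exact Sum.inl_ne_inr (Sum.inr_injective (L.stat.injective h))
      · rw [hout, Bits.xorAt_of_notMem]
        · simp [hZ₁]
        · intro h
          obtain ⟨k' | t, h⟩ := (hy₀ _).1 h
          · exact L.reg_ne_anc _ _ h
          · exact L.stat_ne_anc _ _ h
        · rintro ⟨k', h⟩
          exact L.stat_ne_anc _ _ h
    funext Z
    rw [Function.comp_apply, QState.basis, QState.basis]
    by_cases hZ : Z = Z₁
    · rw [hZ, hload, Pi.single_eq_same, Pi.single_eq_same]
    · rw [Pi.single_eq_of_ne hZ, Pi.single_eq_of_ne]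
      intro h
      exact hZ ((permList_bijective gs₀).1 (h.trans hload.symm))
  rw [detRun_classical _ _ _ hgs₀, hstart, hsim R _ st' hst' gs₁ [] _ (by
    intro ρ j _ _ h
    refine Pi.single_eq_of_ne ?_ _
    rintro rfl
    exact h rfl)]
  rw [← List.append_nil gs₁, detRun_classical _ _ _ hgs₁]
  simp only [detRun, zero_add, List.nil_append]
  set Ψ := recRun (fun i => orc i (st' i ∘ Sum.inl)) (fun i => resp i (st' (i + 1) ∘ Sum.inl))
    code 0 (initRec fun k => start v (.inl k)) with hΨ
  set tr := (List.range' 0 (callTotal code)).map fun i =>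
    (st' i ∘ (cw i).trans Function.Embedding.inl,
      R i (st' i ∘ (cw i).trans Function.Embedding.inl)) with htr
  have key : ∀ Z, ‖(L.encode (st' (callTotal code)) Ψ ∘ permList gs₁) Z‖ ^ 2 * payoff tr (Z ∘ out) =
      ‖L.encode (st' (callTotal code)) Ψ (permList gs₁ Z)‖ ^ 2 *
        payoff tr (fO (permList gs₁ Z)) := by
    intro Z
    rw [Function.comp_apply]
    by_cases hZ : L.Good (st' (callTotal code)) (permList gs₁ Z)
    · congr 2
      have hanc : ∀ k, Z (L.anc k) = false := fun k => by
        rw [← hZ.2 k, hoff₁]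
        rintro ⟨k', h⟩
        exact L.stat_ne_anc _ _ h
      have hfO : fO (permList gs₁ Z) = fO Z := by
        simp only [fO]
        congr 1
        · funext t
          refine hoff₁ _ _ ?_
          rintro ⟨k', h⟩
          simpa using L.stat.injective h
        · funext j k
          refine hoff₁ _ _ ?_
          rintro ⟨k', h⟩
          exact L.recd_ne_stat _ _ _ h.symm
        · funext k
          refine hoff₁ _ _ ?_
          rintro ⟨k', h⟩
          exact L.reg_ne_stat _ _ h.symm
      rw [hfO]
      funext k
      have h1 : permList gs₁ Z (out k) = false := hZ.1 (.inr (.inr k))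
      rw [hval₁ Z hanc, Bits.xorAt_apply] at h1
      simpa using h1
    · rw [L.encode_not_good _ hZ]
      simp
  rw [Finset.sum_congr rfl fun Z _ => key Z,
    Fintype.sum_bijective (permList gs₁) (permList_bijective gs₁) _
      (fun Z => ‖L.encode (st' (callTotal code)) Ψ Z‖ ^ 2 * payoff tr (fO Z)) (fun _ => rfl),
    L.sum_encode]
  refine Finset.sum_congr rfl fun ρ _ => Finset.sum_congr rfl fun z _ => ?_
  have h1 : tr = (List.range (callTotal code)).map fun j => (st j ∘ cw j, R j (st j ∘ cw j)) := by
    rw [htr, ← List.range_eq_range']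
    rfl
  rw [h1]
  simp only [fO, L.content_recdOf, L.content_comp_reg, L.content_stat]
  rfl

end Simulator

/-! ### Functions of few values of an oracle -/

section Local

variable {X Y : Type} {d d' : ℕ}

/-- The span of the functions of `O` that depend on at most `d` values of `O`. -/
def localFns (X Y : Type) (d : ℕ) : Submodule ℂ ((X → Y) → ℂ) :=
  Submodule.span ℂ {F | ∃ s : Finset X, s.card ≤ d ∧
    ∀ O O' : X → Y, (∀ x ∈ s, O x = O' x) → F O = F O'}

theorem localFns_mono (h : d ≤ d') : localFns X Y d ≤ localFns X Y d' :=
  Submodule.span_mono fun _ ⟨s, hs, hF⟩ => ⟨s, hs.trans h, hF⟩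

theorem const_mem_localFns (c : ℂ) : (fun _ => c) ∈ localFns X Y d :=
  Submodule.subset_span ⟨∅, by simp, fun _ _ _ => rfl⟩

theorem eval_mem_localFns (x : X) (f : Y → ℂ) : (fun O => f (O x)) ∈ localFns X Y 1 :=
  Submodule.subset_span ⟨{x}, by simp, fun O O' h => by simp only [h x (by simp)]⟩

theorem mul_mem_localFns {F G : (X → Y) → ℂ} (hF : F ∈ localFns X Y d)
    (hG : G ∈ localFns X Y d') : (fun O => F O * G O) ∈ localFns X Y (d + d') := by
  classical
  refine Submodule.span_induction (p := fun F _ => (fun O => F O * G O) ∈ localFns X Y (d + d'))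
    ?_ ?_ ?_ ?_ hF
  · rintro F ⟨s, hs, hF⟩
    refine Submodule.span_induction (p := fun G _ => (fun O => F O * G O) ∈ localFns X Y (d + d'))
      ?_ ?_ ?_ ?_ hG
    · rintro G ⟨s', hs', hG⟩
      refine Submodule.subset_span ⟨s ∪ s', (Finset.card_union_le _ _).trans (by omega),
        fun O O' h => ?_⟩
      simp only [hF O O' fun x hx => h x (Finset.mem_union_left _ hx),
        hG O O' fun x hx => h x (Finset.mem_union_right _ hx)]
    · simpa using const_mem_localFns 0
    · intro G G' _ _ h h'
      convert Submodule.add_mem _ h h' using 1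
      funext O
      simp [mul_add]
    · intro c G _ h
      convert Submodule.smul_mem _ c h using 1
      funext O
      simp [mul_left_comm]
  · simpa using const_mem_localFns 0
  · intro F F' _ _ h h'
    convert Submodule.add_mem _ h h' using 1
    funext O
    simp [add_mul]
  · intro c F _ h
    convert Submodule.smul_mem _ c h using 1
    funext O
    simp [mul_assoc]

theorem conj_mem_localFns {F : (X → Y) → ℂ} (hF : F ∈ localFns X Y d) :
    (fun O => starRingEnd ℂ (F O)) ∈ localFns X Y d := by
  refine Submodule.span_induction (p := fun F _ => (fun O => starRingEnd ℂ (F O)) ∈ localFns X Y d)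
    ?_ ?_ ?_ ?_ hF
  · rintro F ⟨s, hs, hF⟩
    exact Submodule.subset_span ⟨s, hs, fun O O' h => by simp only [hF O O' h]⟩
  · simpa using const_mem_localFns 0
  · intro F F' _ _ h h'
    convert Submodule.add_mem _ h h' using 1
    funext O
    simp
  · intro c F _ h
    convert Submodule.smul_mem _ (starRingEnd ℂ c) h using 1
    funext O
    simp

theorem sum_mem_localFns {ι : Type*} (s : Finset ι) {F : ι → (X → Y) → ℂ}
    (hF : ∀ i ∈ s, F i ∈ localFns X Y d) : (fun O => ∑ i ∈ s, F i O) ∈ localFns X Y d := by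
  have := Submodule.sum_mem _ hF
  convert this using 1
  funext O
  simp

theorem eval_comp_mem_localFns [Fintype Y] (x : X) {F : Y → (X → Y) → ℂ}
    (hF : ∀ v, F v ∈ localFns X Y d) : (fun O => F (O x) O) ∈ localFns X Y (d + 1) := by
  classical
  have : (fun O => F (O x) O) = fun O : X → Y => ∑ v, F v O * (if O x = v then 1 else 0) := by
    funext O
    simp
  rw [this]
  exact sum_mem_localFns _ fun v _ =>
    mul_mem_localFns (hF v) (eval_mem_localFns x fun y => if y = v then 1 else 0)

end Local

section LocalRun

variable {X Y : Type} [Fintype Y] {w a b e d q : ℕ}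

theorem recRun_mem_localFns
    (orc : (X → Y) → ℕ → (Fin (q + 1) → Bits e) → Bits a → Bits b)
    (resp : (X → Y) → ℕ → (Fin (q + 1) → Bits e) → Bits d)
    (horc : ∀ j ρ x, ∃ (p : X) (g : Y → Bits b), ∀ O, orc O j ρ x = g (O p))
    (hresp : ∀ j ρ, ∃ (p : X) (g : Y → Bits d), ∀ O, resp O j ρ = g (O p))
    (l : List (QInstr w a b e d)) :
    ∀ (j t : ℕ) (Ψ : (X → Y) → (Fin (q + 1) → Bits e) → QState w),
      (∀ ρ z, (fun O => Ψ O ρ z) ∈ localFns X Y t) →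
      ∀ ρ z, (fun O => recRun (orc O) (resp O) l j (Ψ O) ρ z) ∈ localFns X Y (t + l.length) := by
  induction l with
  | nil => exact fun _ _ _ h => h
  | cons g l ih =>
    intro j t Ψ hΨ ρ z
    have hlen : t + (g :: l).length = t + 1 + l.length := by simp; omega
    rw [hlen]
    refine ih (j + g.callCount) (t + 1) (fun O => recStep (orc O) (resp O) g j (Ψ O))
      (fun ρ z => ?_) ρ z
    refine QInstr.cases_gate (P := fun g => (fun O => recStep (orc O) (resp O) g j (Ψ O) ρ z) ∈
      localFns X Y (t + 1)) g ?_ ?_ ?_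
    · intro g hg
      obtain ⟨K, hK⟩ := g.exists_kernel
      simp only [recStep_gate _ _ hg, hK]
      exact localFns_mono (Nat.le_succ t) <| sum_mem_localFns _ fun z' _ =>
        Submodule.smul_mem _ (K z z') (hΨ ρ z')
    · intro xy
      obtain ⟨p, g, hg⟩ := horc j ρ fun i => z (xy (Sum.inl i))
      simp only [recStep, QState.query, hg]
      exact eval_comp_mem_localFns p (F := fun v O =>
        Ψ O ρ (Bits.xorAt (Function.Embedding.inr.trans xy) (g v) z)) fun v => hΨ _ _
    · intro x y
      obtain ⟨p, g, hg⟩ := hresp j ρ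
      simp only [recStep, QState.receive, QState.project, hg]
      refine eval_comp_mem_localFns p (F := fun v O => if Bits.xorAt y (g v) z ∘ x = ρ (ix j) then
        Ψ O (Function.update ρ (ix j) fun _ => false) (Bits.xorAt y (g v) z) else 0) fun v => ?_
      by_cases h : Bits.xorAt y (g v) z ∘ x = ρ (ix j)
      · simp only [if_pos h]
        exact hΨ _ _
      · simp only [if_neg h]
        exact const_mem_localFns 0

/-- The expected payoff depends on boundedly many values of the oracle at a time. -/
theorem value_mem_localFns
    (orc : (X → Y) → ℕ → (Fin (q + 1) → Bits e) → Bits a → Bits b)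
    (resp : (X → Y) → ℕ → (Fin (q + 1) → Bits e) → Bits d)
    (horc : ∀ j ρ x, ∃ (p : X) (g : Y → Bits b), ∀ O, orc O j ρ x = g (O p))
    (hresp : ∀ j ρ, ∃ (p : X) (g : Y → Bits d), ∀ O, resp O j ρ = g (O p))
    (l : List (QInstr w a b e d)) (z₀ : Bits w)
    (pay : (X → Y) → (Fin (q + 1) → Bits e) → Bits w → ℝ)
    (hpay : ∀ ρ z, ∃ (p : X) (g : Y → ℝ), ∀ O, pay O ρ z = g (O p)) :
    (fun O => ((∑ ρ, ∑ z, ‖recRun (orc O) (resp O) l 0 (initRec z₀) ρ z‖ ^ 2 * pay O ρ z : ℝ) : ℂ))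
      ∈ localFns X Y (2 * l.length + 1) := by
  push_cast
  refine sum_mem_localFns _ fun ρ _ => sum_mem_localFns _ fun z _ => ?_
  have h := recRun_mem_localFns orc resp horc hresp l 0 0 (fun _ => initRec z₀)
    (fun ρ z => const_mem_localFns _) ρ z
  rw [zero_add] at h
  obtain ⟨p, g, hg⟩ := hpay ρ z
  simp only [hg]
  refine mul_mem_localFns ?_ (eval_mem_localFns p fun y => (g y : ℂ))
  simp only [← Complex.mul_conj', two_mul]
  exact mul_mem_localFns h (conj_mem_localFns h)

end LocalRun

/-! ### Functions with bounded independence -/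

section Family

theorem expect_surjective_hom {A B : Type*} [AddCommGroup A] [AddCommGroup B] [Fintype A]
    [Fintype B] (f : A →+ B) (hf : Function.Surjective f) (G : B → ℂ) :
    𝔼 a, G (f a) = 𝔼 b, G b := by
  classical
  have hc : ∀ b : B, (Finset.univ.filter fun a => f a = b).card =
      (Finset.univ.filter fun a => f a = 0).card := fun b =>
    AddMonoidHom.card_fiber_eq_of_mem_range f (hf b) (hf 0)
  set k := (Finset.univ.filter fun a => f a = 0).card with hk
  have hsum : ∀ G : B → ℂ, ∑ a, G (f a) = k * ∑ b, G b := by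
    intro G
    rw [← Finset.sum_fiberwise_of_maps_to (t := Finset.univ) (g := f) (fun _ _ => Finset.mem_univ _),
      Finset.mul_sum]
    refine Finset.sum_congr rfl fun b _ => ?_
    rw [Finset.sum_congr rfl (g := fun _ => G b) (fun a ha => by rw [(Finset.mem_filter.1 ha).2]),
      Finset.sum_const, hc b, nsmul_eq_mul]
  have h1 := hsum fun _ => 1
  simp only [Finset.sum_const, Finset.card_univ, nsmul_eq_mul, mul_one] at h1
  have hk0 : (k : ℂ) ≠ 0 := by
    intro h
    rw [h, zero_mul, Nat.cast_eq_zero, Fintype.card_eq_zero_iff] at h1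
    exact h1.elim 0
  have hB : (Fintype.card B : ℂ) ≠ 0 := by
    exact Nat.cast_ne_zero.2 Fintype.card_ne_zero
  rw [Fintype.expect_eq_sum_div_card, Fintype.expect_eq_sum_div_card, hsum, h1]
  field_simp

/-- A family of functions on which functions of `t` values have the same mean as on all
functions. -/
def IsIndependentFamily {X Y Ξ : Type} [Fintype X] [DecidableEq X] [Fintype Y] [Fintype Ξ]
    (t : ℕ) (fam : Ξ → X → Y) : Prop :=
  ∀ F ∈ localFns X Y t, 𝔼 O, F O = 𝔼 ξ, F (fam ξ)

theorem isIndependentFamily_of_restrict {X Y Ξ : Type} [Fintype X] [DecidableEq X] [Fintype Y]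
    [Nonempty Y] [Fintype Ξ] {t : ℕ} {fam : Ξ → X → Y}
    (h : ∀ s : Finset X, s.card ≤ t → ∀ G : (s → Y) → ℂ,
      𝔼 ξ, G (fun x => fam ξ x) = 𝔼 u, G u) : IsIndependentFamily t fam := by
  intro F hF
  refine Submodule.span_induction (p := fun F _ => 𝔼 O, F O = 𝔼 ξ, F (fam ξ)) ?_ ?_ ?_ ?_ hF
  · rintro F ⟨s, hs, hF⟩
    obtain ⟨y⟩ := ‹Nonempty Y›
    let G : (s → Y) → ℂ := fun u => F (Function.extend (fun x : s => (x : X)) u fun _ => y)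
    have h1 : ∀ O : X → Y, F O = G fun x => O x := fun O => hF _ _ fun x hx => by
      rw [Subtype.val_injective.extend_apply (fun x : s => O x) _ ⟨x, hx⟩]
    have h2 : ∀ (u : s → Y) (O : X → Y), F (Function.extend (fun x : s => (x : X)) u O) = G u := by
      intro u O
      refine hF _ _ fun x hx => ?_
      rw [Subtype.val_injective.extend_apply u _ ⟨x, hx⟩,
        Subtype.val_injective.extend_apply u _ ⟨x, hx⟩]
    have : Nonempty Y := ⟨y⟩
    rw [expect_extend (x := fun x : s => (x : X)) Subtype.val_injective F]
    simp only [h2, Fintype.expect_const]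
    rw [← h s hs G]
    simp only [h1]
  · simp
  · intro F F' _ _ h h'
    simp only [Pi.add_apply, Finset.expect_add_distrib, h, h']
  · intro c F _ h
    simp only [Pi.smul_apply, smul_eq_mul, ← Finset.mul_expect, h]

theorem decide_add_zmodTwo (x y : ZMod 2) :
    decide (x + y = 1) = xor (decide (x = 1)) (decide (y = 1)) := by
  revert x y
  decide

theorem decide_sum_zmodTwo {ι : Type*} (L : List ι) (f : ι → ZMod 2) :
    decide ((L.map f).sum = 1) = (L.map fun i => decide (f i = 1)).foldr Bool.xor false := by
  induction L with
  | nil => rfl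
  | cons i L ih =>
    rw [List.map_cons, List.sum_cons, decide_add_zmodTwo, ih]
    rfl

theorem Module.Basis.repr_mul_sum {R K ι κ : Type*} [CommRing R] [CommRing K] [Algebra R K]
    [Fintype ι] [Fintype κ] (bas : Module.Basis ι R K) (y : K) (x : κ → R) (e : κ → ι) (k : ι) :
    bas.repr (y * ∑ j, x j • bas (e j)) k =
      ∑ p : ι × κ, bas.repr (bas p.1 * bas (e p.2)) k * (bas.repr y p.1 * x p.2) := by
  have h : y * ∑ j, x j • bas (e j) =
      ∑ i, ∑ j, (bas.repr y i * x j) • (bas i * bas (e j)) := by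
    conv_lhs => rw [← bas.sum_repr y, Finset.sum_mul_sum]
    simp only [smul_mul_smul_comm]
  rw [h, Fintype.sum_prod_type]
  simp only [map_sum, map_smul, Finsupp.coe_finsetSum, Finset.sum_apply, Finsupp.smul_apply,
    smul_eq_mul]
  exact Finset.sum_congr rfl fun i _ => Finset.sum_congr rfl fun j _ => mul_comm _ _

/-- Evaluation of a polynomial with coefficients `c`, the leading one first, by Horner's rule. -/
def horner {K : Type*} [Semiring K] (c : ℕ → K) (x : K) : ℕ → K
  | 0 => 0
  | i + 1 => horner c x i * x + c i

theorem horner_eq_sum {K : Type*} [Semiring K] (c : ℕ → K) (x : K) (n : ℕ) :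
    horner c x n = ∑ i ∈ Finset.range n, c i * x ^ (n - 1 - i) := by
  induction n with
  | zero => rfl
  | succ n ih =>
    rw [horner, ih, Finset.sum_range_succ, Finset.sum_mul]
    congr 1
    · refine Finset.sum_congr rfl fun i hi => ?_
      have : n + 1 - 1 - i = n - 1 - i + 1 := by
        have := Finset.mem_range.1 hi
        omega
      rw [this, pow_succ, mul_assoc]
    · simp

theorem exists_horner_eq {K X : Type*} [Field K] [DecidableEq X] (s : Finset X) {t : ℕ}
    (hs : s.card ≤ t) {x : X → K} (hx : Function.Injective x) (y : X → K) :
    ∃ c : ℕ → K, ∀ i ∈ s, horner c (x i) t = y i := by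
  let p := Lagrange.interpolate s x y
  refine ⟨fun i => p.coeff (t - 1 - i), fun i hi => ?_⟩
  rw [← Lagrange.eval_interpolate_at_node y hx.injOn hi, horner_eq_sum,
    Finset.sum_range_reflect (fun j => p.coeff j * x i ^ j) t]
  by_cases hp : p = 0
  · change _ = p.eval _
    simp [hp]
  · refine (Polynomial.eval_eq_sum_range' ?_ _).symm
    rw [Polynomial.natDegree_lt_iff_degree_lt hp]
    exact (Lagrange.degree_interpolate_lt y hx.injOn).trans_le (by exact_mod_cast hs)

theorem exists_independentFamily (t a b : ℕ) :
    ∃ (Ξ : Type) (_ : Fintype Ξ) (_ : Nonempty Ξ) (fam : Ξ → Bits a → Bits b),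
      IsIndependentFamily t fam ∧
      ∀ ξ, CircuitBound (fam ξ) (t * (20 * (a + b + 1) ^ 3)) := by
  classical
  set N := a + b + 1 with hN
  have hN0 : N ≠ 0 := by omega
  let K := GaloisField 2 N
  have : Fintype K := Fintype.ofFinite K
  let bas : Module.Basis (Fin N) (ZMod 2) K :=
    Module.finBasisOfFinrankEq _ _ (GaloisField.finrank 2 hN0)
  let ea : Fin a → Fin N := Fin.castLE (by omega)
  let eb : Fin b → Fin N := Fin.castLE (by omega)
  let bz : Bool → ZMod 2 := fun c => if c then 1 else 0
  have hbz : ∀ c, decide (bz c = 1) = c := by decide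
  have hbz' : ∀ c : ZMod 2, bz (decide (c = 1)) = c := by decide
  let zB : ZMod 2 ≃ Bool := ⟨fun c => decide (c = 1), bz, hbz', hbz⟩
  let enc : Bits a → K := fun x => ∑ j, bz (x j) • bas (ea j)
  have henc : ∀ x j, bas.repr (enc x) (ea j) = bz (x j) := by
    intro x j
    simp only [enc, map_sum, map_smul, Module.Basis.repr_self, Finsupp.coe_finsetSum,
      Finset.sum_apply, Finsupp.smul_apply, Finsupp.single_apply, smul_eq_mul, mul_ite, mul_one,
      mul_zero]
    rw [Finset.sum_eq_single j]
    · simp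
    · intro j' _ h
      rw [if_neg]
      intro h'
      exact h (Fin.castLE_injective _ h')
    · simp
  have henc_inj : Function.Injective enc := by
    intro x x' h
    funext j
    have := henc x j
    rw [h, henc] at this
    rw [← hbz (x j), ← this, hbz]
  let dec : K → Bits N := fun y k => decide (bas.repr y k = 1)
  let ext : (Fin t → K) → ℕ → K := fun c i => if h : i < t then c ⟨i, h⟩ else 0
  let val : (Fin t → K) → K → K := fun c x => horner (ext c) x t
  let fam : (Fin t → K) → Bits a → Bits b := fun c x k => dec (val c (enc x)) (eb k)
  refine ⟨Fin t → K, inferInstance, inferInstance, fam, ?_, ?_⟩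
  · refine isIndependentFamily_of_restrict fun s hs G => ?_
    let φ : (Fin t → K) →+ (s → Fin b → ZMod 2) :=
      { toFun := fun c x k => bas.repr (val c (enc x)) (eb k)
        map_zero' := by
          funext x k
          have : val 0 (enc x) = 0 := by simp [val, horner_eq_sum, ext]
          simp [this]
        map_add' := fun c c' => by
          funext x k
          have : val (c + c') (enc x) = val c (enc x) + val c' (enc x) := by
            simp only [val, horner_eq_sum, ← Finset.sum_add_distrib, ← add_mul]
            refine Finset.sum_congr rfl fun i _ => ?_
            congr 1
            simp only [ext]
            split_ifs <;> simp
          simp [this] }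
    have hφ : Function.Surjective φ := by
      intro u
      let y : Bits a → K := fun x => if h : x ∈ s then ∑ k, u ⟨x, h⟩ k • bas (eb k) else 0
      obtain ⟨c, hc⟩ := exists_horner_eq s hs henc_inj y
      refine ⟨fun i => c i, ?_⟩
      funext x k
      have h1 : val (fun i => c i) (enc x) = y x := by
        rw [← hc x x.2]
        simp only [val, horner_eq_sum]
        refine Finset.sum_congr rfl fun i hi => ?_
        simp [ext, Finset.mem_range.1 hi]
      change bas.repr (val (fun i => c i) (enc x)) (eb k) = _
      rw [h1]
      simp only [y, dif_pos x.2, map_sum, map_smul, Module.Basis.repr_self,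
        Finsupp.coe_finsetSum, Finset.sum_apply, Finsupp.smul_apply, Finsupp.single_apply,
        smul_eq_mul, mul_ite, mul_one, mul_zero]
      rw [Finset.sum_eq_single k]
      · simp
      · intro k' _ h
        rw [if_neg]
        intro h'
        exact h (Fin.castLE_injective _ h')
      · simp
    have h1 := expect_surjective_hom φ hφ fun u => G fun x k => zB (u x k)
    refine (Eq.trans ?_ h1).trans ?_
    · rfl
    · exact Fintype.expect_equiv
        (Equiv.piCongrRight fun _ : s => Equiv.piCongrRight fun _ : Fin b => zB) _ _ fun u => rfl
  · intro c
    let F : ℕ → Bits a → Bits N := fun i x => dec (horner (ext c) (enc x) i)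
    have hstep : ∀ (y : K) (x : Bits a) (c₀ : K) (k : Fin N),
        dec (y * enc x + c₀) k = xor ((Finset.univ.toList.map fun p : Fin N × Fin a =>
          (decide (bas.repr (bas p.1 * bas (ea p.2)) k = 1) && (dec y p.1 && x p.2))).foldr
            Bool.xor false) (dec c₀ k) := by
      intro y x c₀ k
      simp only [dec, map_add, Finsupp.add_apply, decide_add_zmodTwo]
      congr 1
      have h1 : bas.repr (y * enc x) k = ∑ p : Fin N × Fin a,
          bas.repr (bas p.1 * bas (ea p.2)) k * (bas.repr y p.1 * bz (x p.2)) := by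
        exact bas.repr_mul_sum y (fun j => bz (x j)) ea k
      rw [h1, ← Finset.sum_map_toList, decide_sum_zmodTwo]
      congr 2
      funext p
      have hmul : ∀ x y : ZMod 2, decide (x * y = 1) = (decide (x = 1) && decide (y = 1)) := by
        decide
      rw [hmul, hmul, hbz]
    have key : ∀ i < t, Computes (fun _ => id : Bits a → Bits 0 → Bits 0) (bits id ∪ bits (F i))
        (bits (F (i + 1))) (20 * N ^ 3) := by
      intro i _
      let P : Bits a → Fin N × (Fin N × Fin a) → Bool := fun x p =>
        decide (bas.repr (bas p.2.1 * bas (ea p.2.2)) p.1 = 1) && (F i x p.2.1 && x p.2.2)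
      have h1 : Computes (fun _ => id : Bits a → Bits 0 → Bits 0) (bits id ∪ bits (F i))
          (bits P) (Fintype.card (Fin N × (Fin N × Fin a)) * 2) := by
        refine Computes.bits_of_forall fun p => ?_
        by_cases hp : bas.repr (bas p.2.1 * bas (ea p.2.2)) p.1 = 1
        · have : (fun x => P x p) = fun x => F i x p.2.1 && x p.2.2 := by
            funext x
            simp only [P, decide_eq_true hp, Bool.true_and]
          rw [this]
          exact Computes.and (.inr ⟨p.2.1, rfl⟩) (.inl ⟨p.2.2, rfl⟩)
        · have : (fun x => P x p) = fun x => false := by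
            funext x
            simp only [P, decide_eq_false hp, Bool.false_and]
          rw [this]
          exact Computes.const_false
      have h2 : ∀ k, Computes (fun _ => id : Bits a → Bits 0 → Bits 0)
          (bits id ∪ bits (F i) ∪ bits P) {fun x => F (i + 1) x k} (N * a * 4 + (1 + 4)) := by
        intro k
        have h3 := Computes.xor_list (orc := (fun _ => id : Bits a → Bits 0 → Bits 0))
          (A := bits id ∪ bits (F i) ∪ bits P) (Finset.univ : Finset (Fin N × Fin a)).toList
          (fun p x => P x (k, p)) (fun p => .inr ⟨(k, p), rfl⟩)
        refine (h3.trans ((Computes.const (dec (ext c i) k)).trans ((Computes.xor (.inl (.inr rfl))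
          (.inr rfl)).mono subset_rfl ?_ le_rfl))).weaken ?_
        · rintro _ rfl
          refine Set.mem_singleton_iff.2 (funext fun x => ?_)
          exact hstep _ _ _ _
        · simp
      refine (h1.trans ((Computes.bits_of_forall h2))).weaken ?_
      simp only [Fintype.card_prod, Fintype.card_fin]
      have ha : a ≤ N := by omega
      have hN1 : 1 ≤ N := by omega
      nlinarith [Nat.mul_le_mul_left (N * N) ha, Nat.mul_le_mul hN1 hN1,
        Nat.mul_le_mul_left N (Nat.mul_le_mul hN1 hN1)]
    have h0 := Computes.iterate F t key
    have hF0 : Computes (fun _ => id : Bits a → Bits 0 → Bits 0) (bits id) (bits (F 0)) 0 := by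
      refine ⟨[], .nil, le_rfl, ?_⟩
      rintro _ ⟨k, rfl⟩
      refine .inr (.inr (funext fun x => ?_))
      simp [F, horner, dec]
    exact (hF0.trans h0).mono subset_rfl (bits_reindex_subset (F t) eb) (by simp)

end Family

/-! ### Expected payoffs -/

section Value

variable {w a b e d q : ℕ} (code : List (QInstr w a b e d)) (z₀ : Bits w)

/-- Expected payoff of a run with records of the questions. -/
noncomputable def value (orc : ℕ → (Fin (q + 1) → Bits e) → Bits a → Bits b)
    (resp : ℕ → (Fin (q + 1) → Bits e) → Bits d) (pay : (Fin (q + 1) → Bits e) → Bits w → ℝ) : ℝ :=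
  ∑ ρ, ∑ z, ‖recRun orc resp code 0 (initRec z₀) ρ z‖ ^ 2 * pay ρ z

variable {orc orc' : ℕ → (Fin (q + 1) → Bits e) → Bits a → Bits b}
  {resp : ℕ → (Fin (q + 1) → Bits e) → Bits d} {pay pay' : (Fin (q + 1) → Bits e) → Bits w → ℝ}

theorem value_mono (h : ∀ ρ z, pay ρ z ≤ pay' ρ z) :
    value code z₀ orc resp pay ≤ value code z₀ orc resp pay' :=
  Finset.sum_le_sum fun ρ _ => Finset.sum_le_sum fun z _ =>
    mul_le_mul_of_nonneg_left (h ρ z) (by positivity)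

theorem value_nonneg (h : ∀ ρ z, 0 ≤ pay ρ z) : 0 ≤ value code z₀ orc resp pay :=
  Finset.sum_nonneg fun ρ _ => Finset.sum_nonneg fun z _ => mul_nonneg (by positivity) (h ρ z)

theorem value_add : value code z₀ orc resp (fun ρ z => pay ρ z + pay' ρ z) =
    value code z₀ orc resp pay + value code z₀ orc resp pay' := by
  simp only [value, mul_add, Finset.sum_add_distrib]

theorem value_sum {ι : Type*} (s : Finset ι) (p : ι → (Fin (q + 1) → Bits e) → Bits w → ℝ) :
    value code z₀ orc resp (fun ρ z => ∑ i ∈ s, p i ρ z) =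
      ∑ i ∈ s, value code z₀ orc resp (p i) := by
  simp only [value, Finset.mul_sum]
  rw [Finset.sum_comm (s := s)]
  exact Finset.sum_congr rfl fun ρ _ => Finset.sum_comm

theorem value_one_le : value code z₀ orc resp (fun _ _ => 1) ≤ 1 := by
  have h := nrm_recRun_initRec_le orc resp code z₀
  simp only [value, mul_one, ← nrm_sq]
  exact pow_le_one₀ (nrm_nonneg _) h

theorem value_le {B : ℝ} (hB : 0 ≤ B) (h : ∀ ρ z, pay ρ z ≤ B) :
    value code z₀ orc resp pay ≤ B := by
  have h1 : value code z₀ orc resp (fun _ _ => B) = B * value code z₀ orc resp (fun _ _ => 1) := by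
    simp only [value, Finset.mul_sum, mul_one, mul_comm]
  calc _ ≤ _ := value_mono code z₀ h
    _ ≤ B * 1 := by rw [h1]; exact mul_le_mul_of_nonneg_left (value_one_le code z₀) hB
    _ = B := mul_one B

theorem value_sub_le (hp₀ : ∀ ρ z, 0 ≤ pay ρ z) (hp₁ : ∀ ρ z, pay ρ z ≤ 1) :
    value code z₀ orc resp pay - value code z₀ orc' resp pay ≤
      2 * nrm (recRun orc resp code 0 (initRec z₀) - recRun orc' resp code 0 (initRec z₀)) := by
  have h := abs_sub_payoff_le (recRun orc resp code 0 (initRec z₀))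
    (recRun orc' resp code 0 (initRec z₀)) pay hp₀ hp₁
  have h1 := nrm_recRun_initRec_le orc resp code z₀
  have h2 := nrm_recRun_initRec_le orc' resp code z₀
  have h3 := nrm_nonneg (recRun orc resp code 0 (initRec z₀) - recRun orc' resp code 0 (initRec z₀))
  refine (le_abs_self _).trans (h.trans ?_)
  nlinarith

end Value

/-! ### Indicators and averages -/

section Expect

variable {α β : Type} [Fintype α] [Fintype β]

theorem ind_nonneg (p : Prop) : 0 ≤ ind p := by
  unfold ind; split_ifs <;> norm_num

theorem ind_le_one (p : Prop) : ind p ≤ 1 := by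
  unfold ind; split_ifs <;> norm_num

theorem ind_of {p : Prop} (h : p) : ind p = 1 := if_pos h

theorem ind_of_not {p : Prop} (h : ¬p) : ind p = 0 := if_neg h

theorem ind_mono {p p' : Prop} (h : p → p') : ind p ≤ ind p' := by
  by_cases hp : p
  · rw [ind_of hp, ind_of (h hp)]
  · rw [ind_of_not hp]; exact ind_nonneg _

theorem ind_or_le (p p' : Prop) : ind (p ∨ p') ≤ ind p + ind p' := by
  by_cases hp : p
  · rw [ind_of hp, ind_of (.inl hp)]; linarith [ind_nonneg p']
  · rw [ind_of_not hp, zero_add]; exact ind_mono fun h => h.resolve_left hp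

theorem ind_and (p p' : Prop) : ind (p ∧ p') = ind p * ind p' := by
  by_cases hp : p
  · by_cases hp' : p'
    · rw [ind_of hp, ind_of hp', ind_of ⟨hp, hp'⟩, one_mul]
    · rw [ind_of_not hp', ind_of_not fun h => hp' h.2, mul_zero]
  · rw [ind_of_not hp, ind_of_not fun h => hp h.1, zero_mul]

theorem ind_exists_le (p : α → Prop) : ind (∃ x, p x) ≤ ∑ x, ind (p x) := by
  by_cases h : ∃ x, p x
  · obtain ⟨x, hx⟩ := h
    calc ind (∃ x, p x) ≤ 1 := ind_le_one _
      _ = ind (p x) := (ind_of hx).symm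
      _ ≤ _ := Finset.single_le_sum (f := fun x => ind (p x)) (fun x _ => ind_nonneg _)
          (Finset.mem_univ x)
  · rw [ind_of_not h]
    exact Finset.sum_nonneg fun x _ => ind_nonneg _

theorem expect_mono {f g : α → ℝ} (h : ∀ x, f x ≤ g x) : 𝔼 x, f x ≤ 𝔼 x, g x :=
  Finset.expect_le_expect fun x _ => h x

theorem expect_nonneg' {f : α → ℝ} (h : ∀ x, 0 ≤ f x) : 0 ≤ 𝔼 x, f x :=
  Finset.expect_nonneg fun x _ => h x

theorem expect_le [Nonempty α] {f : α → ℝ} {B : ℝ} (h : ∀ x, f x ≤ B) : 𝔼 x, f x ≤ B :=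
  Finset.expect_le Finset.univ_nonempty fun x _ => h x

theorem exists_expect_le [Nonempty α] (f : α → ℝ) : ∃ x, 𝔼 x, f x ≤ f x := by
  by_contra! h
  obtain ⟨x, -, hx⟩ := Finset.exists_max_image Finset.univ f Finset.univ_nonempty
  exact (h x).not_ge (expect_le fun y => hx y (Finset.mem_univ y))

theorem expect_prod (f : α × β → ℝ) : 𝔼 p, f p = 𝔼 x, 𝔼 y, f (x, y) := by
  rw [← Finset.univ_product_univ, Finset.expect_product]

theorem sq_expect_le (f : α → ℝ) : (𝔼 x, f x) ^ 2 ≤ 𝔼 x, f x ^ 2 := by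
  rcases isEmpty_or_nonempty α with h | h
  · simp [Finset.univ_eq_empty]
  have hc : (0 : ℝ) < Fintype.card α := by exact_mod_cast Fintype.card_pos
  rw [Fintype.expect_eq_sum_div_card, Fintype.expect_eq_sum_div_card, div_pow, div_le_div_iff₀
    (by positivity) hc]
  have := sq_sum_le_card_mul_sum_sq (s := (Finset.univ : Finset α)) (f := f)
  rw [Finset.card_univ] at this
  nlinarith

theorem expect_sqrt_le {f : α → ℝ} (h : ∀ x, 0 ≤ f x) : 𝔼 x, √(f x) ≤ √(𝔼 x, f x) := by
  refine Real.le_sqrt_of_sq_le ((sq_expect_le _).trans (le_of_eq ?_))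
  exact Finset.expect_congr rfl fun x _ => Real.sq_sqrt (h x)

/-- The probability that a sample hits a given value, in terms of the collision probability. -/
theorem expect_ind_eq_le {Y : Type} (f : α → Y) (y : Y) :
    𝔼 x, ind (y = f x) ≤ √(𝔼 x, 𝔼 x', ind (f x = f x')) := by
  refine Real.le_sqrt_of_sq_le ?_
  rw [sq, Finset.expect_mul_expect]
  refine expect_mono fun x => expect_mono fun x' => ?_
  rw [← ind_and]
  exact ind_mono fun h => h.1.symm.trans h.2

end Expect

/-! ### Programming an oracle -/

section Program

variable {X Y : Type} [DecidableEq X] {q : ℕ}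

/-- The oracle `O`, overwritten at the points `x 0, …, x (j - 1)` by the values `m`. -/
def program (O : X → Y) (x : Fin (q + 1) → X) (m : Fin (q + 1) → Y) : ℕ → X → Y
  | 0 => O
  | j + 1 => Function.update (program O x m j) (x (ix j)) (m (ix j))

variable (O : X → Y) (x : Fin (q + 1) → X) (m : Fin (q + 1) → Y)

theorem program_of_ne {j : ℕ} {y : X} (h : ∀ i < j, y ≠ x (ix i)) : program O x m j y = O y := by
  induction j with
  | zero => rfl
  | succ j ih =>
    rw [program, Function.update_of_ne (h j j.lt_succ_self),
      ih fun i hi => h i (hi.trans j.lt_succ_self)]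

theorem program_eq_or (j : ℕ) (y : X) :
    program O x m j y = O y ∨ ∃ i < j, y = x (ix i) ∧ program O x m j y = m (ix i) := by
  induction j with
  | zero => exact .inl rfl
  | succ j ih =>
    by_cases h : y = x (ix j)
    · subst h
      exact .inr ⟨j, j.lt_succ_self, rfl, Function.update_self _ _ _⟩
    · rw [program, Function.update_of_ne h]
      exact ih.imp_right fun ⟨i, hi, h⟩ => ⟨i, hi.trans j.lt_succ_self, h⟩

theorem program_apply {x : Fin (q + 1) → X} (hx : Function.Injective x) {i j : ℕ} (hi : i < j)
    (hj : j ≤ q + 1) : program O x m j (x (ix i)) = m (ix i) := by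
  induction j with
  | zero => omega
  | succ j ih =>
    by_cases h : i = j
    · subst h
      exact Function.update_self _ _ _
    · rw [program, Function.update_of_ne, ih (by omega) (by omega)]
      exact fun h' => ix_ne (by omega) (by omega) h (hx h')

theorem program_congr_point (O O' : X → Y) {y : X} (h : O y = O' y) (j : ℕ) :
    program O x m j y = program O' x m j y := by
  induction j with
  | zero => exact h
  | succ j ih =>
    by_cases hy : y = x (ix j)
    · subst hy
      rw [program, program, Function.update_self, Function.update_self]
    · rw [program, program, Function.update_of_ne hy, Function.update_of_ne hy, ih]

end Program

/-! ### The games -/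

section Games

variable {w μ s k rl q : ℕ}

/-- The oracle queries that are made by the signer. -/
def points (σ : Fin (q + 1) → Bits s) (ρ : Fin (q + 1) → Bits μ) (i : Fin (q + 1)) :
    Bits (μ + s) := Bits.cat (ρ i) (σ i)

theorem points_injective {σ : Fin (q + 1) → Bits s} (hσ : Function.Injective σ)
    (ρ : Fin (q + 1) → Bits μ) : Function.Injective (points σ ρ) :=
  fun _ _ h => hσ (Bits.cat_inj.1 h).2

open Classical in
/-- Before the `i`-th signature is given out, queries that contain it are answered by an
independent oracle. -/
noncomputable def hideOracle (σ : Fin (q + 1) → Bits s) (O' : Bits (μ + s) → Bits k)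
    (F : ℕ → (Fin (q + 1) → Bits μ) → Bits (μ + s) → Bits k) :
    ℕ → (Fin (q + 1) → Bits μ) → Bits (μ + s) → Bits k :=
  fun j ρ x => if ∃ i : Fin (q + 1), j ≤ i ∧ x.snd = σ i then O' x else F j ρ x

/-- The answers of the signing oracle that uses the random oracle `O`. -/
def oracleResp (σ : Fin (q + 1) → Bits s) (inv : Fin (q + 1) → Bits k → Bits rl)
    (O : Bits (μ + s) → Bits k) (j : ℕ) (ρ : Fin (q + 1) → Bits μ) : Bits (s + rl) :=
  Bits.cat (σ (ix j)) (inv (ix j) (O (points σ ρ (ix j))))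

/-- The answers of the signing oracle for given signatures and given randomness. -/
def fixedResp (σ : Fin (q + 1) → Bits s) (r : Fin (q + 1) → Bits rl) (j : ℕ)
    (_ : Fin (q + 1) → Bits μ) : Bits (s + rl) :=
  Bits.cat (σ (ix j)) (r (ix j))

/-- The random oracle that is programmed at the queries of the signer, with the later signatures
hidden. -/
noncomputable def progOracle (σ : Fin (q + 1) → Bits s) (m : Fin (q + 1) → Bits k)
    (O O' : Bits (μ + s) → Bits k) :
    ℕ → (Fin (q + 1) → Bits μ) → Bits (μ + s) → Bits k :=
  hideOracle σ O' fun j ρ => program O (points σ ρ) m j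

variable (code : List (QInstr w (μ + s) k μ (s + rl))) (z₀ : Bits w)

theorem recRun_extend_eq_program (hcode : callTotal code ≤ q + 1)
    {σ : Fin (q + 1) → Bits s} (hσ : Function.Injective σ)
    (inv : Fin (q + 1) → Bits k → Bits rl) (m : Fin (q + 1) → Bits k)
    (O O' : Bits (μ + s) → Bits k) (ρ : Fin (q + 1) → Bits μ) :
    recRun (hideOracle σ O' fun _ _ => Function.extend (points σ ρ) m O)
        (oracleResp σ inv (Function.extend (points σ ρ) m O)) code 0 (initRec z₀) ρ =
      recRun (progOracle σ m O O') (fixedResp σ fun i => inv i (m i)) code 0 (initRec z₀) ρ := by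
  refine recRun_congr code hcode _ ρ (fun j hj ρ' hρ' => ?_) (fun j hj ρ' hρ' => ?_) ρ
    fun _ _ => rfl
  · funext x
    unfold progOracle hideOracle
    by_cases hx : ∃ i : Fin (q + 1), j ≤ i ∧ x.snd = σ i
    · rw [if_pos hx, if_pos hx]
    · rw [if_neg hx, if_neg hx]
      beta_reduce
      push Not at hx
      by_cases hp : ∃ i, points σ ρ i = x
      · obtain ⟨i, rfl⟩ := hp
        have hi : (i : ℕ) < j := by
          by_contra h
          exact hx i (by omega) (by simp [points])
        have h1 : points σ ρ i = points σ ρ' (ix i) := by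
          have := hρ' i hi
          rw [ix_val] at this ⊢
          rw [points, points, this]
        rw [(points_injective hσ ρ).extend_apply, h1,
          program_apply O m (points_injective hσ ρ') hi (hj.trans hcode), ix_val]
      · rw [Function.extend_apply' _ _ _ hp, program_of_ne]
        intro i hi h
        refine hp ⟨ix i, ?_⟩
        rw [h, points, points, hρ' i hi]
  · unfold oracleResp fixedResp
    have h1 : points σ ρ' (ix j) = points σ ρ (ix j) := by
      rw [points, points, hρ' j j.lt_succ_self]
    rw [h1, (points_injective hσ ρ).extend_apply]

/-- If the signatures are distinct, the values of the random oracle at the queries of the signer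
may be chosen afresh. -/
theorem expect_value_program (hcode : callTotal code ≤ q + 1)
    {σ : Fin (q + 1) → Bits s} (hσ : Function.Injective σ)
    (inv : Fin (q + 1) → Bits k → Bits rl) (O' : Bits (μ + s) → Bits k)
    (y : Bits w → Bits (μ + s))
    (P : (Fin (q + 1) → Bits μ) → Bits w → Bits k → (Fin (q + 1) → Bits rl) → ℝ) :
    𝔼 O : Bits (μ + s) → Bits k, value code z₀ (hideOracle σ O' fun _ _ => O)
        (oracleResp σ inv O) (fun ρ z => P ρ z (O (y z)) fun i => inv i (O (points σ ρ i))) =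
      𝔼 m : Fin (q + 1) → Bits k, 𝔼 O : Bits (μ + s) → Bits k,
        value code z₀ (progOracle σ m O O') (fixedResp σ fun i => inv i (m i))
          (fun ρ z => P ρ z (program O (points σ ρ) m (q + 1) (y z)) fun i => inv i (m i)) := by
  simp only [value]
  rw [Finset.expect_sum_comm]
  simp only [Finset.expect_sum_comm Finset.univ (Finset.univ : Finset (Fin (q + 1) → Bits μ))]
  refine Finset.sum_congr rfl fun ρ _ => ?_
  rw [expect_extend (points_injective hσ ρ)]
  refine Finset.expect_congr rfl fun m _ => Finset.expect_congr rfl fun O _ => ?_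
  have h1 : ∀ x, Function.extend (points σ ρ) m O x = program O (points σ ρ) m (q + 1) x := by
    intro x
    by_cases hp : ∃ i, points σ ρ i = x
    · obtain ⟨i, rfl⟩ := hp
      have := program_apply O m (points_injective hσ ρ) i.2 le_rfl
      rw [ix_val] at this
      rw [(points_injective hσ ρ).extend_apply, this]
    · rw [Function.extend_apply' _ _ _ hp, program_of_ne]
      exact fun i _ h => hp ⟨_, h.symm⟩
  refine Finset.sum_congr rfl fun z _ => ?_
  rw [recRun_extend_eq_program code z₀ hcode hσ]
  simp only [← h1, (points_injective hσ ρ).extend_apply]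

theorem recRun_update_coin {Coin : Type} (hcode : callTotal code ≤ q + 1)
    (sgm : Coin → Bits s) (inv : Coin → Bits k → Bits rl)
    (orc : ℕ → (Fin (q + 1) → Bits μ) → Bits (μ + s) → Bits k) (O : Bits (μ + s) → Bits k)
    (c : Fin (q + 1) → Coin) (i : Fin (q + 1)) (hi : callTotal code ≤ i) (x : Coin) :
    recRun orc (oracleResp (fun j => sgm (Function.update c i x j))
        (fun j => inv (Function.update c i x j)) O) code 0 (initRec z₀) =
      recRun orc (oracleResp (fun i => sgm (c i)) (fun i => inv (c i)) O) code 0 (initRec z₀) := by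
  funext ρ
  refine recRun_congr code hcode _ ρ (fun _ _ _ _ => rfl) (fun j hj ρ' _ => ?_) ρ fun _ _ => rfl
  have h : (ix j : Fin (q + 1)) ≠ i := by
    rintro rfl
    simp only [Fin.val_ofNat] at hi
    rw [Nat.mod_eq_of_lt (by omega)] at hi
    omega
  simp only [oracleResp, points, Function.update_of_ne h]

/-- Replacing the oracle at points that contain future signatures is noticed only if signatures
can be guessed. -/
theorem expect_nrm_hide_le {Coin : Type} [Fintype Coin] [Nonempty Coin]
    (hcode : callTotal code ≤ q + 1) (sgm : Coin → Bits s) (inv : Coin → Bits k → Bits rl)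
    (O O' : Bits (μ + s) → Bits k) :
    𝔼 c : Fin (q + 1) → Coin,
      nrm (recRun (fun _ _ => O) (oracleResp (fun i => sgm (c i)) (fun i => inv (c i)) O)
          code 0 (initRec z₀) -
        recRun (hideOracle (fun i => sgm (c i)) O' fun _ _ => O)
          (oracleResp (fun i => sgm (c i)) (fun i => inv (c i)) O) code 0 (initRec z₀)) ≤
      2 * code.length * √((q + 1) * √(𝔼 x, 𝔼 x', ind (sgm x = sgm x'))) := by
  classical
  set κ := √(𝔼 x, 𝔼 x', ind (sgm x = sgm x')) with hκ
  let Bad : (Fin (q + 1) → Coin) → ℕ → (Fin (q + 1) → Bits μ) → Set (Bits (μ + s)) :=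
    fun c j _ => {x | ∃ i : Fin (q + 1), j ≤ i ∧ x.snd = sgm (c i)}
  have hBad : ∀ c j ρ, ∀ x ∉ Bad c j ρ,
      O x = hideOracle (fun i => sgm (c i)) O' (fun _ _ => O) j ρ x := by
    intro c j ρ x hx
    unfold hideOracle
    exact (if_neg hx).symm
  refine expect_nrm_recRun_sub_le (fun _ _ _ => O)
    (fun c => hideOracle (fun i => sgm (c i)) O' fun _ _ => O)
    (fun c => oracleResp (fun i => sgm (c i)) (fun i => inv (c i)) O) code Bad hBad
    (fun _ => initRec z₀) (√((q + 1) * κ)) fun l' g hpre => ?_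
  refine Real.le_sqrt_of_sq_le ((sq_expect_le _).trans ?_)
  have hl' : callTotal l' ≤ q + 1 := by
    obtain ⟨l₂, hl₂⟩ := hpre
    rw [← hl₂] at hcode
    simp at hcode
    omega
  have hκ0 : 0 ≤ κ := Real.sqrt_nonneg _
  have hzero : nrm (0 : (Fin (q + 1) → Bits μ) → QState w) = 0 := by simp [nrm]
  have hRHS : 0 ≤ ((q : ℝ) + 1) * κ := by positivity
  cases g with
  | query xy =>
    set j := callTotal l' with hj
    let Ψ : (Fin (q + 1) → Coin) → (Fin (q + 1) → Bits μ) → QState w := fun c =>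
      recRun (fun _ _ => O) (oracleResp (fun i => sgm (c i)) (fun i => inv (c i)) O) l' 0
        (initRec z₀)
    let y : Bits w → Bits s := fun z => Bits.snd fun i => z (xy (Sum.inl i))
    have h1 : ∀ c, nrm (maskQuery (.query xy : QInstr w (μ + s) k μ (s + rl))
        (fun _ => {x | ∃ i : Fin (q + 1), j ≤ i ∧ x.snd = sgm (c i)}) (Ψ c)) ^ 2 ≤
        ∑ i : Fin (q + 1), ∑ ρ, ∑ z, ‖Ψ c ρ z‖ ^ 2 * ind (j ≤ i ∧ y z = sgm (c i)) := by
      intro c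
      rw [nrm_sq, Finset.sum_comm]
      conv_rhs => rw [Finset.sum_comm]
      rw [Finset.sum_comm]
      refine Finset.sum_le_sum fun ρ _ => ?_
      rw [Finset.sum_comm]
      refine Finset.sum_le_sum fun z _ => ?_
      rw [← Finset.mul_sum]
      simp only [maskQuery]
      by_cases hx : (fun i => z (xy (Sum.inl i))) ∈
          {x : Bits (μ + s) | ∃ i : Fin (q + 1), j ≤ i ∧ x.snd = sgm (c i)}
      · rw [if_pos hx]
        refine le_mul_of_one_le_right (by positivity) ?_
        rw [← ind_of hx]
        exact ind_exists_le _
      · rw [if_neg hx, norm_zero, zero_pow two_ne_zero]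
        have : 0 ≤ ∑ i : Fin (q + 1), ind (j ≤ i ∧ y z = sgm (c i)) :=
          Finset.sum_nonneg fun _ _ => ind_nonneg _
        positivity
    have h2 : ∀ i : Fin (q + 1),
        𝔼 c, ∑ ρ, ∑ z, ‖Ψ c ρ z‖ ^ 2 * ind (j ≤ i ∧ y z = sgm (c i)) ≤ κ := by
      intro i
      by_cases hi : j ≤ i
      · rw [expect_update i, Finset.expect_comm]
        refine expect_le fun c => ?_
        have h3 : ∀ x, Ψ (Function.update c i x) = Ψ c := fun x =>
          recRun_update_coin l' z₀ hl' sgm inv _ O c i hi x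
        simp only [h3, Function.update_self, hi, true_and]
        have h4 : 𝔼 x, ∑ ρ, ∑ z, ‖Ψ c ρ z‖ ^ 2 * ind (y z = sgm x) =
            value l' z₀ (fun _ _ => O) (oracleResp (fun i => sgm (c i)) (fun i => inv (c i)) O)
              (fun _ z => 𝔼 x, ind (y z = sgm x)) := by
          simp only [Finset.expect_sum_comm, value, Finset.mul_expect, Ψ]
        rw [h4]
        exact value_le _ _ hκ0 fun ρ z => expect_ind_eq_le sgm (y z)
      · refine expect_le fun c => ?_
        simp only [hi, false_and, ind_of_not not_false, mul_zero, Finset.sum_const_zero]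
        exact hκ0
    calc _ ≤ 𝔼 c, ∑ i : Fin (q + 1), ∑ ρ, ∑ z, ‖Ψ c ρ z‖ ^ 2 * ind (j ≤ i ∧ y z = sgm (c i)) :=
          expect_mono h1
      _ = ∑ i : Fin (q + 1), 𝔼 c, ∑ ρ, ∑ z, ‖Ψ c ρ z‖ ^ 2 * ind (j ≤ i ∧ y z = sgm (c i)) :=
          Finset.expect_sum_comm _ _ _
      _ ≤ ∑ i : Fin (q + 1), κ := Finset.sum_le_sum fun i _ => h2 i
      _ = (q + 1) * κ := by simp
  | _ =>
    refine expect_le fun c => ?_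
    simp only [maskQuery]
    rw [hzero]
    simpa using hRHS

/-- Finding a preimage of `v` under the random oracle. -/
theorem expect_value_search_le (σ : Fin (q + 1) → Bits s) (r : Fin (q + 1) → Bits rl)
    (m : Fin (q + 1) → Bits k) (O' : Bits (μ + s) → Bits k) (y : Bits w → Bits (μ + s))
    (v : Bits k) :
    𝔼 O : Bits (μ + s) → Bits k, value code z₀ (progOracle σ m O O') (fixedResp σ r)
      (fun _ z => ind (O (y z) = v)) ≤ ((2 : ℝ) ^ k)⁻¹ * (2 + 2 * (2 * code.length) ^ 2) := by
  classical
  have h1 : ∀ O : Bits (μ + s) → Bits k,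
      value code z₀ (progOracle σ m O O') (fixedResp σ r) (fun _ z => ind (O (y z) = v)) =
      ∑ x, ind (O x = v) * value code z₀ (progOracle σ m O O') (fixedResp σ r)
        (fun _ z => ind (y z = x)) := by
    intro O
    have : ∀ z, ind (O (y z) = v) = ∑ x, ind (O x = v) * ind (y z = x) := by
      intro z
      rw [Finset.sum_eq_single (y z)]
      · rw [ind_of rfl, mul_one]
      · intro x _ hx
        rw [ind_of_not hx.symm, mul_zero]
      · simp
    simp only [this, value_sum]
    refine Finset.sum_congr rfl fun x _ => ?_
    simp only [value, Finset.mul_sum, mul_left_comm]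
  have h2 : ∀ x : Bits (μ + s), 𝔼 O : Bits (μ + s) → Bits k,
      ind (O x = v) * value code z₀ (progOracle σ m O O') (fixedResp σ r) (fun _ z => ind (y z = x))
      = ((2 : ℝ) ^ k)⁻¹ * 𝔼 O : Bits (μ + s) → Bits k,
        value code z₀ (progOracle σ m (Function.update O x v) O') (fixedResp σ r)
          (fun _ z => ind (y z = x)) := by
    intro x
    rw [expect_update x]
    simp only [Function.update_self]
    rw [Fintype.expect_eq_sum_div_card, Finset.sum_eq_single v]
    · simp only [ind_of, one_mul]
      rw [div_eq_inv_mul]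
      simp
    · intro u _ hu
      simp [ind_of_not hu]
    · simp
  have h3 : ∀ O : Bits (μ + s) → Bits k,
      ∑ x, value code z₀ (progOracle σ m (Function.update O x v) O') (fixedResp σ r)
          (fun _ z => ind (y z = x)) ≤ 2 + 2 * (2 * code.length) ^ 2 := by
    intro O
    set Ψ := recRun (progOracle σ m O O') (fixedResp σ r) code 0 (initRec z₀) with hΨ
    set Φ := fun x => recRun (progOracle σ m (Function.update O x v) O') (fixedResp σ r) code 0
      (initRec z₀) with hΦ
    have h4 := sum_nrm_recRun_sub_sq_le (fixedResp σ r) (progOracle σ m O O')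
      (fun x => progOracle σ m (Function.update O x v) O') (fun x j ρ x' hx' => by
        unfold progOracle hideOracle
        by_cases h : ∃ i : Fin (q + 1), j ≤ i ∧ x'.snd = σ i
        · rw [if_pos h, if_pos h]
        · rw [if_neg h, if_neg h]
          exact program_congr_point _ _ _ _ (Function.update_of_ne hx' _ _).symm j) code z₀
    have h5 : ∀ x, value code z₀ (progOracle σ m (Function.update O x v) O') (fixedResp σ r)
          (fun _ z => ind (y z = x)) ≤
        2 * value code z₀ (progOracle σ m O O') (fixedResp σ r) (fun _ z => ind (y z = x)) +
          2 * nrm (Ψ - Φ x) ^ 2 := by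
      intro x
      rw [nrm_sq]
      simp only [value, Finset.mul_sum, ← Finset.sum_add_distrib]
      refine Finset.sum_le_sum fun ρ _ => Finset.sum_le_sum fun z _ => ?_
      change ‖Φ x ρ z‖ ^ 2 * _ ≤ 2 * (‖Ψ ρ z‖ ^ 2 * _) + 2 * ‖Ψ ρ z - Φ x ρ z‖ ^ 2
      have h6 : ‖Φ x ρ z‖ ≤ ‖Ψ ρ z‖ + ‖Ψ ρ z - Φ x ρ z‖ := by
        have := norm_sub_le (Ψ ρ z) (Ψ ρ z - Φ x ρ z)
        simpa using this
      have h7 := norm_nonneg (Φ x ρ z)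
      by_cases hz : y z = x
      · rw [ind_of hz]
        nlinarith [sq_nonneg (‖Ψ ρ z‖ - ‖Ψ ρ z - Φ x ρ z‖)]
      · rw [ind_of_not hz]
        nlinarith [sq_nonneg ‖Ψ ρ z - Φ x ρ z‖]
    have h6 : ∑ x, value code z₀ (progOracle σ m O O') (fixedResp σ r)
        (fun _ z => ind (y z = x)) ≤ 1 := by
      rw [← value_sum]
      refine value_le _ _ zero_le_one fun ρ z => le_of_eq ?_
      rw [Finset.sum_eq_single (y z)]
      · exact ind_of rfl
      · exact fun x _ hx => ind_of_not hx.symm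
      · simp
    calc _ ≤ ∑ x, (2 * value code z₀ (progOracle σ m O O') (fixedResp σ r)
          (fun _ z => ind (y z = x)) + 2 * nrm (Ψ - Φ x) ^ 2) := Finset.sum_le_sum fun x _ => h5 x
      _ ≤ 2 * 1 + 2 * (2 * code.length) ^ 2 := by
        rw [Finset.sum_add_distrib, ← Finset.mul_sum, ← Finset.mul_sum]
        gcongr
      _ = _ := by ring
  simp only [h1]
  rw [Finset.expect_sum_comm]
  simp only [h2]
  rw [← Finset.mul_sum, ← Finset.expect_sum_comm]
  exact mul_le_mul_of_nonneg_left (expect_le h3) (by positivity)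

end Games

/-! ### Independent samples -/

section Samples

variable {α U U' V : Type} [Fintype U] [Fintype U'] [Fintype V]

theorem expect_cat {m n : ℕ} (F : Bits (m + n) → ℝ) :
    𝔼 c, F c = 𝔼 x : Bits m, 𝔼 y : Bits n, F (Bits.cat x y) := by
  rw [← expect_prod fun p : Bits m × Bits n => F (Bits.cat p.1 p.2)]
  refine (Fintype.expect_equiv ⟨fun p : Bits m × Bits n => Bits.cat p.1 p.2,
    fun z => (z.fst, z.snd), fun p => by simp, fun z => Bits.cat_fst_snd z⟩ _ _ fun p => rfl).symm

theorem expect_arrow_prod {ι : Type} [Fintype ι] [DecidableEq ι] (F : (ι → U × V) → ℝ) :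
    𝔼 c, F c = 𝔼 x : ι → U, 𝔼 y : ι → V, F fun i => (x i, y i) := by
  rw [← expect_prod fun p : (ι → U) × (ι → V) => F fun i => (p.1 i, p.2 i)]
  exact Fintype.expect_equiv (Equiv.arrowProdEquivProdArrow ι _ _) _ _ fun c => rfl

theorem expect_arrow_cat {ι : Type} [Fintype ι] [DecidableEq ι] {m n : ℕ}
    (F : (ι → Bits (m + n)) → ℝ) :
    𝔼 c, F c = 𝔼 x : ι → Bits m, 𝔼 y : ι → Bits n, F fun i => Bits.cat (x i) (y i) := by
  rw [← expect_arrow_prod fun c : ι → Bits m × Bits n => F fun i => Bits.cat (c i).1 (c i).2]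
  refine Fintype.expect_equiv (Equiv.piCongrRight fun _ : ι => ⟨fun z => (z.fst, z.snd),
    fun p : Bits m × Bits n => Bits.cat p.1 p.2, fun z => Bits.cat_fst_snd z,
    fun p => by simp⟩) _ _ fun c => ?_
  congr 1
  funext i
  exact (Bits.cat_fst_snd _).symm

theorem expect_fin_succ {N : ℕ} (F : (Fin (N + 1) → U) → ℝ) :
    𝔼 c, F c = 𝔼 x : U, 𝔼 y : Fin N → U, F (Fin.cons x y) := by
  rw [← expect_prod fun p : U × (Fin N → U) => F (Fin.cons p.1 p.2)]
  exact (Fintype.expect_equiv (Fin.consEquiv fun _ : Fin (N + 1) => U) _ _ fun c => rfl).symm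

/-- Replacing the distribution of independent samples one after the other. -/
theorem expect_samples_sub_le [Nonempty U] [Nonempty U'] (f : U → α) (g : U' → α) {δ : ℝ}
    (h : ∀ φ : α → ℝ, (∀ x, 0 ≤ φ x) → (∀ x, φ x ≤ 1) → 𝔼 u, φ (f u) ≤ 𝔼 u', φ (g u') + δ)
    (N : ℕ) : ∀ Φ : (Fin N → α) → ℝ, (∀ x, 0 ≤ Φ x) → (∀ x, Φ x ≤ 1) →
      𝔼 u : Fin N → U, Φ (fun i => f (u i)) ≤
        𝔼 u' : Fin N → U', Φ (fun i => g (u' i)) + N * δ := by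
  induction N with
  | zero =>
    intro Φ _ _
    have h1 : ∀ u : Fin 0 → U, Φ (fun i => f (u i)) = Φ finZeroElim :=
      fun u => congrArg Φ (Subsingleton.elim _ _)
    have h2 : ∀ u : Fin 0 → U', Φ (fun i => g (u i)) = Φ finZeroElim :=
      fun u => congrArg Φ (Subsingleton.elim _ _)
    simp [h1, h2]
  | succ N ih =>
    intro Φ h0 h1
    have hcons : ∀ {W : Type} (k : W → α) (x : W) (y : Fin N → W),
        (fun i => k ((Fin.cons x y : Fin (N + 1) → W) i)) =
          (Fin.cons (k x) fun i => k (y i) : Fin (N + 1) → α) := by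
      intro W k x y
      funext i
      refine Fin.cases ?_ (fun i => ?_) i <;> simp
    rw [expect_fin_succ, expect_fin_succ]
    simp only [hcons]
    have h2 : 𝔼 x : U, 𝔼 y : Fin N → U, Φ (Fin.cons (f x) fun i => f (y i)) ≤
        𝔼 x : U, (𝔼 y : Fin N → U', Φ (Fin.cons (f x) fun i => g (y i)) + N * δ) :=
      expect_mono fun x => ih (fun t => Φ (Fin.cons (f x) t)) (fun _ => h0 _) (fun _ => h1 _)
    have h3 : 𝔼 y : Fin N → U', 𝔼 x : U, Φ (Fin.cons (f x) fun i => g (y i)) ≤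
        𝔼 y : Fin N → U', (𝔼 x : U', Φ (Fin.cons (g x) fun i => g (y i)) + δ) :=
      expect_mono fun y => h (fun t => Φ (Fin.cons t fun i => g (y i))) (fun _ => h0 _)
        (fun _ => h1 _)
    rw [Finset.expect_add_distrib, Fintype.expect_const] at h2 h3
    rw [Finset.expect_comm] at h3
    rw [Finset.expect_comm (s := (Finset.univ : Finset (Fin N → U')))] at h3
    push_cast
    linarith

/-- The probability that independent samples are not distinct. -/
theorem expect_not_injective_le {Y : Type} [Nonempty U] {N : ℕ} (f : U → Y) :
    𝔼 u : Fin N → U, ind (¬ Function.Injective fun i => f (u i)) ≤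
      N ^ 2 * 𝔼 x, 𝔼 x', ind (f x = f x') := by
  classical
  have h1 : ∀ u : Fin N → U, ind (¬ Function.Injective fun i => f (u i)) ≤
      ∑ p : Fin N × Fin N, ind (p.1 ≠ p.2 ∧ f (u p.1) = f (u p.2)) := fun u => by
    refine (ind_mono fun h => ?_).trans (ind_exists_le _)
    simp only [Function.Injective, not_forall] at h
    obtain ⟨i, j, h, hij⟩ := h
    exact ⟨(i, j), hij, h⟩
  have h2 : ∀ p : Fin N × Fin N, 𝔼 u : Fin N → U, ind (p.1 ≠ p.2 ∧ f (u p.1) = f (u p.2)) ≤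
      𝔼 x, 𝔼 x', ind (f x = f x') := by
    rintro ⟨i, j⟩
    by_cases hij : i = j
    · refine (expect_le fun u => ?_).trans (expect_nonneg' fun x => expect_nonneg' fun x' =>
        ind_nonneg _)
      rw [ind_of_not (by simp [hij])]
    · rw [expect_update i]
      refine expect_mono fun x => ?_
      rw [expect_update j]
      refine expect_mono fun x' => expect_le fun u => ind_mono fun h => ?_
      have h := h.2
      rw [Function.update_self, Function.update_of_ne (Ne.symm hij), Function.update_self] at h
      exact h
  refine (expect_mono h1).trans ?_
  rw [Finset.expect_sum_comm]
  refine (Finset.sum_le_sum fun p _ => h2 p).trans (le_of_eq ?_)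
  simp [sq]

theorem sum_sub_mul_le {β : Type} [Fintype β] (P Q ψ : β → ℝ) (h0 : ∀ x, 0 ≤ ψ x)
    (h1 : ∀ x, ψ x ≤ 1) : ∑ x, P x * ψ x ≤ ∑ x, Q x * ψ x + ∑ x, |P x - Q x| := by
  rw [← Finset.sum_add_distrib]
  refine Finset.sum_le_sum fun x _ => ?_
  have h2 := le_abs_self (P x - Q x)
  have h3 := abs_nonneg (P x - Q x)
  nlinarith [h0 x, h1 x]

theorem expect_eq_sum_weights {β : Type} [Fintype β] (f : U → β) (ψ : β → ℝ) :
    𝔼 u, ψ (f u) = ∑ y, (𝔼 u, ind (f u = y)) * ψ y := by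
  classical
  simp only [Finset.expect_mul]
  rw [← Finset.expect_sum_comm]
  refine Finset.expect_congr rfl fun u _ => ?_
  rw [Finset.sum_eq_single (f u)]
  · rw [ind_of rfl, one_mul]
  · intro y _ hy
    rw [ind_of_not hy.symm, zero_mul]
  · simp

theorem sum_abs_eq_statDist {β : Type} [Fintype β] (P Q : β → ℝ) :
    ∑ x, |P x - Q x| = 2 * statDist P Q := by
  rw [statDist]; ring

end Samples

/-! ### Chameleon hashing without the trapdoor -/

namespace ChameleonAlgs

variable {ℓ : ℕ → ℕ} (H : ChameleonAlgs ℓ) (n : ℕ)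

/-- Distance of `h(m, r)` from uniform, for the function with coins `g`. -/
noncomputable def hashDist (g : Bits (H.genCoins n)) (m : Bits (H.msgLen n)) : ℝ :=
  ∑ y, |H.uniformRange n y - 𝔼 c, ind (H.hash n (H.gen n g).1 m (H.sampleRnd n c) = y)|

theorem expect_hashDist {ε : ℝ} (m : Bits (H.msgLen n))
    (h : statDist
      (fun p : Bits (H.keyLen n) × Bits (ℓ n) =>
        𝔼 g, 𝔼 c, ind ((H.gen n g).1 = p.1 ∧ H.hash n p.1 m (H.sampleRnd n c) = p.2))
      (fun p => (𝔼 g, ind ((H.gen n g).1 = p.1)) * H.uniformRange n p.2) ≤ ε) :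
    𝔼 g, H.hashDist n g m ≤ 2 * ε := by
  have h1 : 𝔼 g, H.hashDist n g m = ∑ p : Bits (H.keyLen n) × Bits (ℓ n),
      |(𝔼 g, 𝔼 c, ind ((H.gen n g).1 = p.1 ∧ H.hash n p.1 m (H.sampleRnd n c) = p.2)) -
        (𝔼 g, ind ((H.gen n g).1 = p.1)) * H.uniformRange n p.2| := by
    have h2 := expect_eq_sum_weights (fun g => (H.gen n g).1) fun h => ∑ y, |H.uniformRange n y -
      𝔼 c, ind (H.hash n h m (H.sampleRnd n c) = y)|
    rw [show 𝔼 g, H.hashDist n g m = _ from h2, Fintype.sum_prod_type]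
    refine Finset.sum_congr rfl fun h _ => ?_
    rw [Finset.mul_sum]
    refine Finset.sum_congr rfl fun y _ => ?_
    have h3 : (𝔼 g, 𝔼 c, ind ((H.gen n g).1 = h ∧ H.hash n h m (H.sampleRnd n c) = y)) =
        (𝔼 g, ind ((H.gen n g).1 = h)) * 𝔼 c, ind (H.hash n h m (H.sampleRnd n c) = y) := by
      simp only [ind_and, Finset.expect_mul_expect]
    rw [h3, ← mul_sub, abs_mul, abs_of_nonneg (expect_nonneg' fun g => ind_nonneg _),
      abs_sub_comm]
  rw [h1, sum_abs_eq_statDist]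
  linarith

/-- The distribution of `(C, m, r)` for random `C` and `m` and a trapdoor preimage `r` is close to
the one for random `m` and `r` and `C = h(m, r)`. -/
theorem expect_invert_le (g : Bits (H.genCoins n)) {ε₁ ε₂ : ℝ}
    (hsr : ∀ c, H.sampleRange n c ∈ H.range n)
    (hrange : statDist (fun y => 𝔼 c, ind (H.sampleRange n c = y)) (H.uniformRange n) ≤ ε₁)
    (hinv : ∀ m, ∀ y ∈ H.range n,
      statDist (fun r => 𝔼 c, ind (H.invert n (H.gen n g).2 m y c = r))
        (fun r => (𝔼 c, ind (H.sampleRnd n c = r ∧ H.hash n (H.gen n g).1 m r = y)) /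
          (𝔼 c, ind (H.hash n (H.gen n g).1 m (H.sampleRnd n c) = y))) ≤ ε₂)
    (φ : Bits (ℓ n) × Bits (H.msgLen n) × Bits (H.rndLen n) → ℝ) (h0 : ∀ x, 0 ≤ φ x)
    (h1 : ∀ x, φ x ≤ 1) :
    𝔼 u : Bits (H.msgLen n) × Bits (H.rangeCoins n) × Bits (H.invCoins n),
        φ (H.sampleRange n u.2.1, u.1,
          H.invert n (H.gen n g).2 u.1 (H.sampleRange n u.2.1) u.2.2) ≤
      𝔼 u : Bits (H.msgLen n) × Bits (H.rndCoins n),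
        φ (H.hash n (H.gen n g).1 u.1 (H.sampleRnd n u.2), u.1, H.sampleRnd n u.2) +
      (2 * ε₂ + 2 * ε₁ + 𝔼 m, H.hashDist n g m) := by
  simp only [expect_prod]
  let Qy : Bits (H.msgLen n) → Bits (ℓ n) → ℝ := fun m y =>
    𝔼 c, ind (H.hash n (H.gen n g).1 m (H.sampleRnd n c) = y)
  let J : Bits (H.msgLen n) → Bits (ℓ n) → Bits (H.rndLen n) → ℝ := fun m y r =>
    𝔼 c, ind (H.sampleRnd n c = r ∧ H.hash n (H.gen n g).1 m r = y)
  let ψ : Bits (H.msgLen n) → Bits (ℓ n) → ℝ := fun m y => ∑ r, J m y r / Qy m y * φ (y, m, r)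
  have hJ0 : ∀ m y r, 0 ≤ J m y r := fun m y r => expect_nonneg' fun c => ind_nonneg _
  have hQ0 : ∀ m y, 0 ≤ Qy m y := fun m y => expect_nonneg' fun c => ind_nonneg _
  have hJQ : ∀ m y, ∑ r, J m y r = Qy m y := by
    intro m y
    simp only [J, Qy]
    rw [← Finset.expect_sum_comm]
    refine Finset.expect_congr rfl fun c _ => ?_
    rw [Finset.sum_eq_single (H.sampleRnd n c)]
    · simp
    · intro r _ hr
      exact ind_of_not fun h => hr h.1.symm
    · simp
  have hψ0 : ∀ m y, 0 ≤ ψ m y := fun m y => Finset.sum_nonneg fun r _ =>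
    mul_nonneg (div_nonneg (hJ0 _ _ _) (hQ0 _ _)) (h0 _)
  have hψ1 : ∀ m y, ψ m y ≤ 1 := fun m y => by
    calc ψ m y ≤ ∑ r, J m y r / Qy m y := Finset.sum_le_sum fun r _ =>
          mul_le_of_le_one_right (div_nonneg (hJ0 _ _ _) (hQ0 _ _)) (h1 _)
      _ = Qy m y / Qy m y := by rw [← Finset.sum_div, hJQ]
      _ ≤ 1 := div_self_le_one _
  have step1 : ∀ m c, 𝔼 i, φ (H.sampleRange n c, m,
      H.invert n (H.gen n g).2 m (H.sampleRange n c) i) ≤ ψ m (H.sampleRange n c) + 2 * ε₂ := by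
    intro m c
    have h2 := sum_sub_mul_le (fun r => 𝔼 i, ind (H.invert n (H.gen n g).2 m
      (H.sampleRange n c) i = r)) (fun r => J m (H.sampleRange n c) r / Qy m (H.sampleRange n c))
      (fun r => φ (H.sampleRange n c, m, r)) (fun _ => h0 _) (fun _ => h1 _)
    rw [← expect_eq_sum_weights (fun i => H.invert n (H.gen n g).2 m (H.sampleRange n c) i)
      fun r => φ (H.sampleRange n c, m, r), sum_abs_eq_statDist] at h2
    have h3 := hinv m _ (hsr c)
    simp only [ψ]
    linarith
  have step2 : ∀ m, 𝔼 c, ψ m (H.sampleRange n c) ≤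
      ∑ y, Qy m y * ψ m y + 2 * ε₁ + H.hashDist n g m := by
    intro m
    have h2 := sum_sub_mul_le (fun y => 𝔼 c, ind (H.sampleRange n c = y)) (H.uniformRange n)
      (ψ m) (hψ0 m) (hψ1 m)
    have h3 := sum_sub_mul_le (H.uniformRange n) (Qy m) (ψ m) (hψ0 m) (hψ1 m)
    rw [← expect_eq_sum_weights (fun c => H.sampleRange n c) (ψ m), sum_abs_eq_statDist] at h2
    rw [hashDist]
    linarith
  have step3 : ∀ m, ∑ y, Qy m y * ψ m y = 𝔼 c, φ (H.hash n (H.gen n g).1 m (H.sampleRnd n c), m,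
      H.sampleRnd n c) := by
    intro m
    have h2 : ∀ y, Qy m y * ψ m y = ∑ r, J m y r * φ (y, m, r) := by
      intro y
      simp only [ψ, Finset.mul_sum]
      refine Finset.sum_congr rfl fun r _ => ?_
      by_cases hQ : Qy m y = 0
      · have h3 : J m y r = 0 := by
          refine le_antisymm ?_ (hJ0 m y r)
          rw [← hQ, ← hJQ]
          exact Finset.single_le_sum (f := J m y) (fun r _ => hJ0 m y r) (Finset.mem_univ r)
        rw [hQ, h3]; ring
      · field_simp
    simp only [h2, J, Finset.expect_mul]
    have h4 : ∀ c, φ (H.hash n (H.gen n g).1 m (H.sampleRnd n c), m, H.sampleRnd n c) =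
        ∑ y, ∑ r, ind (H.sampleRnd n c = r ∧ H.hash n (H.gen n g).1 m r = y) * φ (y, m, r) := by
      intro c
      rw [Finset.sum_eq_single (H.hash n (H.gen n g).1 m (H.sampleRnd n c)),
        Finset.sum_eq_single (H.sampleRnd n c)]
      · rw [ind_of ⟨rfl, rfl⟩, one_mul]
      · intro r _ hr
        rw [ind_of_not fun h => hr h.1.symm, zero_mul]
      · simp
      · intro y _ hy
        refine Finset.sum_eq_zero fun r _ => ?_
        rw [ind_of_not fun h => hy (h.2.symm.trans (by rw [h.1])), zero_mul]
      · simp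
    simp only [h4, Finset.expect_sum_comm]
  calc _ ≤ 𝔼 m, 𝔼 c, (ψ m (H.sampleRange n c) + 2 * ε₂) :=
        expect_mono fun m => expect_mono fun c => step1 m c
    _ = 𝔼 m, 𝔼 c, ψ m (H.sampleRange n c) + 2 * ε₂ := by
        simp only [Finset.expect_add_distrib, Fintype.expect_const]
    _ ≤ 𝔼 m, (∑ y, Qy m y * ψ m y + 2 * ε₁ + H.hashDist n g m) + 2 * ε₂ := by
        gcongr
        exact step2 _
    _ = _ := by
        simp only [Finset.expect_add_distrib, Fintype.expect_const, step3]
        ring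

end ChameleonAlgs

/-! ### Forgeries that hit a signed hash value -/

section Reuse

variable {ℓ : ℕ → ℕ} (S : PlainSigAlgs ℓ) (H : ChameleonAlgs ℓ) (n : ℕ)

/-- The signature of the underlying scheme that is made with the coins `c`. -/
noncomputable def coinSig (gS : Bits (S.genCoins n))
    (c : Bits (H.rangeCoins n + S.signCoins n + H.invCoins n)) : Bits (S.sigLen n) :=
  S.sign n id (S.gen n id gS).2 (H.sampleRange n c.fst.fst) c.fst.snd

/-- The trapdoor preimage that is computed with the coins `c`. -/
noncomputable def coinInv (gH : Bits (H.genCoins n))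
    (c : Bits (H.rangeCoins n + S.signCoins n + H.invCoins n)) (m : Bits (H.msgLen n)) :
    Bits (H.rndLen n) :=
  H.invert n (H.gen n gH).2 m (H.sampleRange n c.fst.fst) c.snd

/-- The probability that two signatures of random elements of the range agree. -/
noncomputable def sigCollision (gS : Bits (S.genCoins n)) : ℝ :=
  𝔼 c, 𝔼 c', ind (coinSig S H n gS c = coinSig S H n gS c')

variable {S H n} {μ w q : ℕ}

/-- The oracle query that belongs to a forgery. -/
def forgeryPoint {s rl : ℕ} (out : Bits (μ + (s + rl))) : Bits (μ + s) :=
  Bits.cat out.fst out.snd.fst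

/-- The forgery is new, and its hash value is one of the first `nc` signed ones. -/
noncomputable def reusePay (h : Bits (H.keyLen n)) (nc : ℕ) (σ : Fin (q + 1) → Bits (S.sigLen n))
    (C : Fin (q + 1) → Bits (ℓ n)) (out : Bits (μ + (S.sigLen n + H.rndLen n)))
    (ρ : Fin (q + 1) → Bits μ) (m : Bits (H.msgLen n)) (r : Fin (q + 1) → Bits (H.rndLen n)) : ℝ :=
  ind ((∀ i < nc, (out.fst, out.snd) ≠ (ρ (ix i), Bits.cat (σ (ix i)) (r (ix i)))) ∧
    H.isRnd n out.snd.snd = true ∧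
    ∃ l : Fin (q + 1), (l : ℕ) < nc ∧ H.hash n h m out.snd.snd = C l)

variable (code : List (QInstr w (μ + S.sigLen n) (H.msgLen n) μ (S.sigLen n + H.rndLen n)))
  (z₀ : Bits w) (out : Bits w → Bits (μ + (S.sigLen n + H.rndLen n)))

/-- The expected payoff in the game with programmed oracle, where the `i`-th signed hash value, its
preimage and the randomness are given by `t i`. -/
noncomputable def swapValue (gS : Bits (S.genCoins n)) (h : Bits (H.keyLen n)) (nc : ℕ)
    (cS : Fin (q + 1) → Bits (S.signCoins n))
    (O O' : Bits (μ + S.sigLen n) → Bits (H.msgLen n))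
    (t : Fin (q + 1) → Bits (ℓ n) × Bits (H.msgLen n) × Bits (H.rndLen n)) : ℝ :=
  value code z₀
    (progOracle (fun i => S.sign n id (S.gen n id gS).2 (t i).1 (cS i)) (fun i => (t i).2.1) O O')
    (fixedResp (fun i => S.sign n id (S.gen n id gS).2 (t i).1 (cS i)) fun i => (t i).2.2)
    (fun ρ z => reusePay h nc (fun i => S.sign n id (S.gen n id gS).2 (t i).1 (cS i))
      (fun i => (t i).1) (out z) ρ
      (program O (points (fun i => S.sign n id (S.gen n id gS).2 (t i).1 (cS i)) ρ)
        (fun i => (t i).2.1) (q + 1) (forgeryPoint (out z))) fun i => (t i).2.2)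

theorem expect_reuse_le (hcode : callTotal code ≤ q + 1) (gS : Bits (S.genCoins n))
    (gH : Bits (H.genCoins n)) {δ : ℝ}
    (hδ : ∀ φ : Bits (ℓ n) × Bits (H.msgLen n) × Bits (H.rndLen n) → ℝ, (∀ x, 0 ≤ φ x) →
      (∀ x, φ x ≤ 1) →
      𝔼 u : Bits (H.msgLen n) × Bits (H.rangeCoins n) × Bits (H.invCoins n),
          φ (H.sampleRange n u.2.1, u.1,
            H.invert n (H.gen n gH).2 u.1 (H.sampleRange n u.2.1) u.2.2) ≤
        𝔼 u : Bits (H.msgLen n) × Bits (H.rndCoins n),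
          φ (H.hash n (H.gen n gH).1 u.1 (H.sampleRnd n u.2), u.1, H.sampleRnd n u.2) + δ) :
    𝔼 c : Fin (q + 1) → Bits (H.rangeCoins n + S.signCoins n + H.invCoins n),
      𝔼 O : Bits (μ + S.sigLen n) → Bits (H.msgLen n),
      value code z₀ (fun _ _ => O) (oracleResp (fun i => coinSig S H n gS (c i))
          (fun i => coinInv S H n gH (c i)) O)
        (fun ρ z => reusePay (H.gen n gH).1 (callTotal code) (fun i => coinSig S H n gS (c i))
          (fun i => H.sampleRange n (c i).fst.fst) (out z) ρ (O (forgeryPoint (out z)))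
          fun i => coinInv S H n gH (c i) (O (points (fun i => coinSig S H n gS (c i)) ρ i))) ≤
      𝔼 cS : Fin (q + 1) → Bits (S.signCoins n),
        𝔼 u : Fin (q + 1) → Bits (H.msgLen n) × Bits (H.rndCoins n),
        𝔼 O' : Bits (μ + S.sigLen n) → Bits (H.msgLen n),
        𝔼 O : Bits (μ + S.sigLen n) → Bits (H.msgLen n),
        swapValue code z₀ out gS (H.gen n gH).1 (callTotal code) cS O O'
          (fun i => (H.hash n (H.gen n gH).1 (u i).1 (H.sampleRnd n (u i).2), (u i).1,
            H.sampleRnd n (u i).2)) +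
      (4 * code.length * √((q + 1) * √(sigCollision S H n gS)) +
        (q + 1) ^ 2 * sigCollision S H n gS + (q + 1) * δ) := by
  classical
  let h := (H.gen n gH).1
  let nc := callTotal code
  let Coin := Bits (H.rangeCoins n + S.signCoins n + H.invCoins n)
  let Orc := Bits (μ + S.sigLen n) → Bits (H.msgLen n)
  let sg : (Fin (q + 1) → Coin) → Fin (q + 1) → Bits (S.sigLen n) := fun c i => coinSig S H n gS (c i)
  let iv : (Fin (q + 1) → Coin) → Fin (q + 1) → Bits (H.msgLen n) → Bits (H.rndLen n) :=
    fun c i => coinInv S H n gH (c i)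
  let Cs : (Fin (q + 1) → Coin) → Fin (q + 1) → Bits (ℓ n) := fun c i => H.sampleRange n (c i).fst.fst
  let P : (Fin (q + 1) → Coin) → (Fin (q + 1) → Bits μ) → Bits w → Bits (H.msgLen n) →
      (Fin (q + 1) → Bits (H.rndLen n)) → ℝ := fun c ρ z m r => reusePay h nc (sg c) (Cs c) (out z) ρ m r
  have hP0 : ∀ c ρ z m r, 0 ≤ P c ρ z m r := fun _ _ _ _ _ => ind_nonneg _
  have hP1 : ∀ c ρ z m r, P c ρ z m r ≤ 1 := fun _ _ _ _ _ => ind_le_one _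
  let V₀ : (Fin (q + 1) → Coin) → Orc → ℝ := fun c O =>
    value code z₀ (fun _ _ => O) (oracleResp (sg c) (iv c) O)
      (fun ρ z => P c ρ z (O (forgeryPoint (out z))) fun i => iv c i (O (points (sg c) ρ i)))
  let V₁ : (Fin (q + 1) → Coin) → Orc → Orc → ℝ := fun c O' O =>
    value code z₀ (hideOracle (sg c) O' fun _ _ => O) (oracleResp (sg c) (iv c) O)
      (fun ρ z => P c ρ z (O (forgeryPoint (out z))) fun i => iv c i (O (points (sg c) ρ i)))
  let V₂ : (Fin (q + 1) → Coin) → Orc → (Fin (q + 1) → Bits (H.msgLen n)) → Orc → ℝ :=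
    fun c O' m O => value code z₀ (progOracle (sg c) m O O') (fixedResp (sg c) fun i => iv c i (m i))
      (fun ρ z => P c ρ z (program O (points (sg c) ρ) m (q + 1) (forgeryPoint (out z)))
        fun i => iv c i (m i))
  set E₁ := 2 * code.length * √((q + 1) * √(sigCollision S H n gS)) with hE₁
  -- hiding the future signatures
  have h1 : ∀ O O' : Orc, 𝔼 c, V₀ c O ≤ 𝔼 c, V₁ c O' O + 2 * E₁ := by
    intro O O'
    have h2 := expect_nrm_hide_le code z₀ hcode (coinSig S H n gS) (coinInv S H n gH) O O'
    have h3 : ∀ c, V₀ c O ≤ V₁ c O' O + 2 * nrm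
        (recRun (fun _ _ => O) (oracleResp (sg c) (iv c) O) code 0 (initRec z₀) -
          recRun (hideOracle (sg c) O' fun _ _ => O) (oracleResp (sg c) (iv c) O) code 0
            (initRec z₀)) := fun c => by
      have := value_sub_le code z₀ (orc := fun _ _ => O)
        (orc' := hideOracle (sg c) O' fun _ _ => O) (resp := oracleResp (sg c) (iv c) O)
        (pay := fun ρ z => P c ρ z (O (forgeryPoint (out z)))
          fun i => iv c i (O (points (sg c) ρ i))) (fun _ _ => hP0 _ _ _ _ _) (fun _ _ => hP1 _ _ _ _ _)
      simp only [V₀, V₁]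
      linarith
    refine (expect_mono h3).trans ?_
    rw [Finset.expect_add_distrib, ← Finset.mul_expect]
    exact add_le_add le_rfl (mul_le_mul_of_nonneg_left h2 zero_le_two)
  -- programming the oracle
  have h2 : ∀ c O', 𝔼 O, V₁ c O' O ≤
      𝔼 m, 𝔼 O, V₂ c O' m O + ind (¬ Function.Injective (sg c)) := by
    intro c O'
    by_cases hσ : Function.Injective (sg c)
    · rw [ind_of_not (not_not.2 hσ), add_zero]
      exact (expect_value_program code z₀ hcode hσ (iv c) O' (fun z => forgeryPoint (out z)) (P c)).le
    · rw [ind_of hσ]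
      have : 0 ≤ 𝔼 m, 𝔼 O, V₂ c O' m O := expect_nonneg' fun m => expect_nonneg' fun O =>
        value_nonneg _ _ fun _ _ => hP0 _ _ _ _ _
      have h3 : 𝔼 O, V₁ c O' O ≤ 1 := expect_le fun O => value_le _ _ zero_le_one
        fun _ _ => hP1 _ _ _ _ _
      linarith
  have h3 : 𝔼 c, ind (¬ Function.Injective (sg c)) ≤ (q + 1) ^ 2 * sigCollision S H n gS := by
    have := expect_not_injective_le (N := q + 1) (coinSig S H n gS)
    push_cast at this
    exact this
  -- swapping the order in which hash values and preimages are chosen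
  have h4 : 𝔼 c, 𝔼 O', 𝔼 m, 𝔼 O, V₂ c O' m O =
      𝔼 cS : Fin (q + 1) → Bits (S.signCoins n),
        𝔼 u : Fin (q + 1) → Bits (H.msgLen n) × Bits (H.rangeCoins n) × Bits (H.invCoins n),
        𝔼 O' : Orc, 𝔼 O : Orc, swapValue code z₀ out gS h nc cS O O'
          (fun i => (H.sampleRange n (u i).2.1, (u i).1,
            H.invert n (H.gen n gH).2 (u i).1 (H.sampleRange n (u i).2.1) (u i).2.2)) := by
    rw [expect_arrow_cat, expect_arrow_cat]
    simp only [expect_arrow_prod]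
    rw [Finset.expect_comm]
    refine Finset.expect_congr rfl fun cS _ => ?_
    have h5 : ∀ (x : Fin (q + 1) → Bits (H.rangeCoins n)) (y : Fin (q + 1) → Bits (H.invCoins n)),
        𝔼 O', 𝔼 m, 𝔼 O, V₂ (fun i => Bits.cat (Bits.cat (x i) (cS i)) (y i)) O' m O =
        𝔼 m, 𝔼 O', 𝔼 O, V₂ (fun i => Bits.cat (Bits.cat (x i) (cS i)) (y i)) O' m O :=
      fun x y => Finset.expect_comm _ _ _
    simp only [h5]
    simp only [Finset.expect_comm (t := (Finset.univ : Finset (Fin (q + 1) → Bits (H.msgLen n))))]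
    refine Finset.expect_congr rfl fun m _ => Finset.expect_congr rfl fun x _ =>
      Finset.expect_congr rfl fun y _ => Finset.expect_congr rfl fun O' _ =>
      Finset.expect_congr rfl fun O _ => ?_
    simp only [V₂, swapValue, P, sg, iv, Cs, coinSig, coinInv, Bits.fst_cat, Bits.snd_cat]
  have h5 : ∀ cS, 𝔼 u : Fin (q + 1) → Bits (H.msgLen n) × Bits (H.rangeCoins n) × Bits (H.invCoins n),
        𝔼 O' : Orc, 𝔼 O : Orc, swapValue code z₀ out gS h nc cS O O'
          (fun i => (H.sampleRange n (u i).2.1, (u i).1,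
            H.invert n (H.gen n gH).2 (u i).1 (H.sampleRange n (u i).2.1) (u i).2.2)) ≤
      𝔼 u : Fin (q + 1) → Bits (H.msgLen n) × Bits (H.rndCoins n), 𝔼 O' : Orc, 𝔼 O : Orc,
        swapValue code z₀ out gS h nc cS O O'
          (fun i => (H.hash n (H.gen n gH).1 (u i).1 (H.sampleRnd n (u i).2), (u i).1,
            H.sampleRnd n (u i).2)) + (q + 1) * δ := by
    intro cS
    have := expect_samples_sub_le _ _ hδ (q + 1)
      (fun t => 𝔼 O' : Orc, 𝔼 O : Orc, swapValue code z₀ out gS h nc cS O O' t)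
      (fun t => expect_nonneg' fun O' => expect_nonneg' fun O => value_nonneg _ _ fun _ _ =>
        ind_nonneg _)
      (fun t => expect_le fun O' => expect_le fun O => value_le _ _ zero_le_one fun _ _ =>
        ind_le_one _)
    push_cast at this
    exact this
  have h6 : 𝔼 c, 𝔼 O, V₀ c O ≤ 𝔼 c, 𝔼 O', 𝔼 O, V₁ c O' O + 2 * E₁ := by
    have h7 : 𝔼 O' : Orc, 𝔼 O : Orc, 𝔼 c, V₀ c O ≤ 𝔼 O' : Orc, 𝔼 O : Orc, (𝔼 c, V₁ c O' O + 2 * E₁) :=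
      expect_mono fun O' => expect_mono fun O => h1 O O'
    have h8 : 𝔼 O : Orc, 𝔼 c, V₀ c O = 𝔼 c, 𝔼 O, V₀ c O := Finset.expect_comm _ _ _
    have h9 : 𝔼 O' : Orc, 𝔼 O : Orc, 𝔼 c, V₁ c O' O = 𝔼 c, 𝔼 O', 𝔼 O, V₁ c O' O := by
      rw [Finset.expect_congr rfl fun O' _ => Finset.expect_comm _ _ _, Finset.expect_comm]
    simp only [Finset.expect_add_distrib, Fintype.expect_const] at h7
    rwa [h8, h9] at h7
  have h7 : 𝔼 c, 𝔼 O', 𝔼 O, V₁ c O' O ≤ 𝔼 c, 𝔼 O', 𝔼 m, 𝔼 O, V₂ c O' m O +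
      𝔼 c, ind (¬ Function.Injective (sg c)) := by
    rw [← Finset.expect_add_distrib]
    refine expect_mono fun c => ?_
    refine (expect_mono fun O' => h2 c O').trans (le_of_eq ?_)
    rw [Finset.expect_add_distrib, Fintype.expect_const]
  have h8 := expect_mono h5
  rw [Finset.expect_add_distrib, Fintype.expect_const] at h8
  rw [h4] at h7
  change 𝔼 c, 𝔼 O, V₀ c O ≤ _
  have h9 : 4 * code.length * √((q + 1) * √(sigCollision S H n gS)) = 2 * E₁ := by
    rw [hE₁]; ring
  rw [h9]
  linarith

/-- The expected payoff if the forgery has to collide with the `l`-th signed hash value. -/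
noncomputable def collValue (gS : Bits (S.genCoins n)) (h : Bits (H.keyLen n))
    (cS : Fin (q + 1) → Bits (S.signCoins n)) (m : Fin (q + 1) → Bits (H.msgLen n))
    (r : Fin (q + 1) → Bits (H.rndLen n)) (l : Fin (q + 1))
    (O O' : Bits (μ + S.sigLen n) → Bits (H.msgLen n)) : ℝ :=
  value code z₀
    (progOracle (fun i => S.sign n id (S.gen n id gS).2 (H.hash n h (m i) (r i)) (cS i)) m O O')
    (fixedResp (fun i => S.sign n id (S.gen n id gS).2 (H.hash n h (m i) (r i)) (cS i)) r)
    (fun ρ z =>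
      let m' := program O (points (fun i => S.sign n id (S.gen n id gS).2
        (H.hash n h (m i) (r i)) (cS i)) ρ) m (q + 1) (forgeryPoint (out z))
      ind (H.isRnd n (out z).snd.snd = true ∧ (m', (out z).snd.snd) ≠ (m l, r l) ∧
        H.hash n h m' (out z).snd.snd = H.hash n h (m l) (r l)))

theorem expect_ind_eq_bits {k : ℕ} (v : Bits k) : 𝔼 x : Bits k, ind (x = v) = ((2 : ℝ) ^ k)⁻¹ := by
  rw [Fintype.expect_eq_sum_div_card, Finset.sum_eq_single v]
  · rw [ind_of rfl]
    simp
  · exact fun x _ hx => ind_of_not hx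
  · simp

theorem expect_exists_eq_le {V : Type} [Fintype V] [Nonempty V] {k : ℕ} (l : Fin (q + 1)) :
    𝔼 u : Fin (q + 1) → Bits k × V, ind (∃ i, i ≠ l ∧ (u i).1 = (u l).1) ≤
      (q + 1) * ((2 : ℝ) ^ k)⁻¹ := by
  classical
  refine (expect_mono fun u => ind_exists_le _).trans ?_
  rw [Finset.expect_sum_comm]
  have h : ∀ i : Fin (q + 1), 𝔼 u : Fin (q + 1) → Bits k × V, ind (i ≠ l ∧ (u i).1 = (u l).1) ≤
      ((2 : ℝ) ^ k)⁻¹ := by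
    intro i
    by_cases hi : i = l
    · refine expect_le fun u => ?_
      rw [ind_of_not fun h => h.1 hi]
      positivity
    · rw [expect_update i, Finset.expect_comm]
      refine expect_le fun u => ?_
      simp only [Function.update_self, Function.update_of_ne (Ne.symm hi)]
      rw [expect_prod]
      refine (expect_mono (g := fun x => ind (x = (u l).1)) fun x => expect_le fun y =>
        ind_mono fun h => h.2).trans ?_
      exact (expect_ind_eq_bits _).le
  refine (Finset.sum_le_sum fun i _ => h i).trans (le_of_eq ?_)
  simp

theorem swapValue_le (gS : Bits (S.genCoins n)) (h : Bits (H.keyLen n)) (nc : ℕ)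
    (cS : Fin (q + 1) → Bits (S.signCoins n)) (m : Fin (q + 1) → Bits (H.msgLen n))
    (r : Fin (q + 1) → Bits (H.rndLen n)) (O' : Bits (μ + S.sigLen n) → Bits (H.msgLen n)) :
    𝔼 O, swapValue code z₀ out gS h nc cS O O' (fun i => (H.hash n h (m i) (r i), m i, r i)) ≤
      ∑ l, (𝔼 O, collValue code z₀ out gS h cS m r l O O' + ind (∃ i, i ≠ l ∧ m i = m l) +
        ((2 : ℝ) ^ H.msgLen n)⁻¹ * (2 + 2 * (2 * code.length) ^ 2)) := by
  set σ : Fin (q + 1) → Bits (S.sigLen n) := fun i => S.sign n id (S.gen n id gS).2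
    (H.hash n h (m i) (r i)) (cS i) with hσ
  have h1 : ∀ O, swapValue code z₀ out gS h nc cS O O' (fun i => (H.hash n h (m i) (r i), m i, r i)) ≤
      ∑ l, (collValue code z₀ out gS h cS m r l O O' + ind (∃ i, i ≠ l ∧ m i = m l) +
        value code z₀ (progOracle σ m O O') (fixedResp σ r)
          (fun _ z => ind (O (forgeryPoint (out z)) = m l))) := by
    intro O
    have h2 : ∀ l, value code z₀ (progOracle σ m O O') (fixedResp σ r)
        (fun _ _ => ind (∃ i, i ≠ l ∧ m i = m l)) ≤ ind (∃ i, i ≠ l ∧ m i = m l) := fun l =>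
      value_le _ _ (ind_nonneg _) fun _ _ => le_rfl
    refine le_trans ?_ (Finset.sum_le_sum fun l _ => add_le_add (add_le_add le_rfl (h2 l)) le_rfl)
    have h3 : ∀ l, collValue code z₀ out gS h cS m r l O O' +
        value code z₀ (progOracle σ m O O') (fixedResp σ r)
          (fun _ _ => ind (∃ i, i ≠ l ∧ m i = m l)) +
        value code z₀ (progOracle σ m O O') (fixedResp σ r)
          (fun _ z => ind (O (forgeryPoint (out z)) = m l)) =
        value code z₀ (progOracle σ m O O') (fixedResp σ r) (fun ρ z =>
          ind (H.isRnd n (out z).snd.snd = true ∧ (program O (points σ ρ) m (q + 1)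
            (forgeryPoint (out z)), (out z).snd.snd) ≠ (m l, r l) ∧
          H.hash n h (program O (points σ ρ) m (q + 1) (forgeryPoint (out z))) (out z).snd.snd =
            H.hash n h (m l) (r l)) + ind (∃ i, i ≠ l ∧ m i = m l) +
          ind (O (forgeryPoint (out z)) = m l)) := fun l => by
      rw [value_add, value_add]
      rfl
    rw [Finset.sum_congr rfl fun l _ => h3 l, ← value_sum]
    refine value_mono _ _ fun ρ z => ?_
    have key : ∀ l : Fin (q + 1), (l : ℕ) < nc →
        (∀ i < nc, ((out z).fst, (out z).snd) ≠ (ρ (ix i), Bits.cat (σ (ix i)) (r (ix i)))) →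
        (program O (points σ ρ) m (q + 1) (forgeryPoint (out z)), (out z).snd.snd) = (m l, r l) →
        (∃ i, i ≠ l ∧ m i = m l) ∨ O (forgeryPoint (out z)) = m l := by
      intro l hl hfresh heq
      obtain ⟨hm, hr⟩ := Prod.ext_iff.1 heq
      simp only at hm hr
      rcases program_eq_or O (points σ ρ) m (q + 1) (forgeryPoint (out z)) with h | ⟨i, hi, hy, h⟩
      · exact .inr (h.symm.trans hm)
      · by_cases hil : (ix i : Fin (q + 1)) = l
        · refine absurd ?_ (hfresh l hl)
          rw [ix_val]
          rw [hil] at hy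
          obtain ⟨h3, h4⟩ := Bits.cat_inj.1 hy
          rw [← h3, ← h4, ← hr, Bits.cat_fst_snd]
        · exact .inl ⟨ix i, hil, h.symm.trans hm⟩
    refine le_trans ((ind_mono ?_).trans (ind_exists_le fun l =>
      ((H.isRnd n (out z).snd.snd = true ∧ (program O (points σ ρ) m (q + 1)
          (forgeryPoint (out z)), (out z).snd.snd) ≠ (m l, r l) ∧
        H.hash n h (program O (points σ ρ) m (q + 1) (forgeryPoint (out z))) (out z).snd.snd =
          H.hash n h (m l) (r l)) ∨ (∃ i, i ≠ l ∧ m i = m l)) ∨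
        O (forgeryPoint (out z)) = m l)) (Finset.sum_le_sum fun l _ => ?_)
    · rintro ⟨hfresh, hrnd, l, hl, hh⟩
      refine ⟨l, ?_⟩
      by_cases heq : (program O (points σ ρ) m (q + 1) (forgeryPoint (out z)),
          (out z).snd.snd) = (m l, r l)
      · rcases key l hl hfresh heq with h | h
        · exact .inl (.inr h)
        · exact .inr h
      · exact .inl (.inl ⟨hrnd, heq, hh⟩)
    · exact (ind_or_le _ _).trans (add_le_add (ind_or_le _ _) le_rfl)
  refine (expect_mono h1).trans ?_
  rw [Finset.expect_sum_comm]
  refine Finset.sum_le_sum fun l _ => ?_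
  rw [Finset.expect_add_distrib, Finset.expect_add_distrib, Fintype.expect_const]
  exact add_le_add le_rfl (expect_value_search_le code z₀ σ r m O' _ (m l))

theorem expect_swapValue_le (gS : Bits (S.genCoins n)) (h : Bits (H.keyLen n)) (nc : ℕ) :
    𝔼 cS : Fin (q + 1) → Bits (S.signCoins n),
      𝔼 u : Fin (q + 1) → Bits (H.msgLen n) × Bits (H.rndCoins n),
      𝔼 O' : Bits (μ + S.sigLen n) → Bits (H.msgLen n),
      𝔼 O : Bits (μ + S.sigLen n) → Bits (H.msgLen n),
      swapValue code z₀ out gS h nc cS O O'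
        (fun i => (H.hash n h (u i).1 (H.sampleRnd n (u i).2), (u i).1, H.sampleRnd n (u i).2)) ≤
    ∑ l, 𝔼 cS : Fin (q + 1) → Bits (S.signCoins n),
        𝔼 u : Fin (q + 1) → Bits (H.msgLen n) × Bits (H.rndCoins n),
        𝔼 O' : Bits (μ + S.sigLen n) → Bits (H.msgLen n),
        𝔼 O : Bits (μ + S.sigLen n) → Bits (H.msgLen n),
        collValue code z₀ out gS h cS (fun i => (u i).1) (fun i => H.sampleRnd n (u i).2) l O O' +
      (q + 1) * ((q + 1) * ((2 : ℝ) ^ H.msgLen n)⁻¹ +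
        ((2 : ℝ) ^ H.msgLen n)⁻¹ * (2 + 2 * (2 * code.length) ^ 2)) := by
  set B := ((2 : ℝ) ^ H.msgLen n)⁻¹ * (2 + 2 * (2 * code.length) ^ 2) with hB
  have h1 : ∀ (cS : Fin (q + 1) → Bits (S.signCoins n))
      (u : Fin (q + 1) → Bits (H.msgLen n) × Bits (H.rndCoins n)),
      𝔼 O', 𝔼 O, swapValue code z₀ out gS h nc cS O O'
        (fun i => (H.hash n h (u i).1 (H.sampleRnd n (u i).2), (u i).1, H.sampleRnd n (u i).2)) ≤
      ∑ l, 𝔼 O', 𝔼 O, collValue code z₀ out gS h cS (fun i => (u i).1)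
          (fun i => H.sampleRnd n (u i).2) l O O' +
        (∑ l, ind (∃ i, i ≠ l ∧ (u i).1 = (u l).1) + (q + 1) * B) := by
    intro cS u
    refine (expect_mono fun O' => swapValue_le code z₀ out gS h nc cS (fun i => (u i).1)
      (fun i => H.sampleRnd n (u i).2) O').trans (le_of_eq ?_)
    simp only [Finset.expect_sum_comm, Finset.expect_add_distrib, Fintype.expect_const,
      Finset.sum_add_distrib, ← hB]
    simp [add_assoc]
  have h2 : ∀ cS : Fin (q + 1) → Bits (S.signCoins n),
      𝔼 u : Fin (q + 1) → Bits (H.msgLen n) × Bits (H.rndCoins n),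
      𝔼 O', 𝔼 O, swapValue code z₀ out gS h nc cS O O'
        (fun i => (H.hash n h (u i).1 (H.sampleRnd n (u i).2), (u i).1, H.sampleRnd n (u i).2)) ≤
      ∑ l, 𝔼 u : Fin (q + 1) → Bits (H.msgLen n) × Bits (H.rndCoins n), 𝔼 O', 𝔼 O,
        collValue code z₀ out gS h cS (fun i => (u i).1) (fun i => H.sampleRnd n (u i).2) l O O' +
        (q + 1) * ((q + 1) * ((2 : ℝ) ^ H.msgLen n)⁻¹ + B) := by
    intro cS
    refine (expect_mono (h1 cS)).trans ?_
    rw [Finset.expect_add_distrib, Finset.expect_add_distrib, Fintype.expect_const,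
      Finset.expect_sum_comm, Finset.expect_sum_comm, mul_add]
    refine add_le_add le_rfl (add_le_add ?_ le_rfl)
    refine (Finset.sum_le_sum fun l _ => expect_exists_eq_le l).trans (le_of_eq ?_)
    simp
  refine (expect_mono h2).trans (le_of_eq ?_)
  rw [Finset.expect_add_distrib, Fintype.expect_const, Finset.expect_sum_comm]

end Reuse

/-! ### Circuits for the reductions -/

section Circuits

variable {Ω : Type} {a b : ℕ}

/-- The constant bits. -/
def constBits (Ω : Type) : Set (Ω → Bool) := bits fun _ (c : Bool) => c

theorem bits_const_subset {κ : Type} (v : κ → Bool) : bits (fun _ : Ω => v) ⊆ constBits Ω := by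
  rintro _ ⟨k, rfl⟩
  exact ⟨v k, rfl⟩

theorem Computes.of_constBits {orc : Ω → Bits a → Bits b} {A B : Set (Ω → Bool)} {s : ℕ}
    (h : Computes orc (A ∪ constBits Ω) B s) : Computes orc A B (1 + s) :=
  (Computes.const_bits _).trans h

theorem Computes.iUnion {ι : Type} [Fintype ι] {orc : Ω → Bits a → Bits b} {A : Set (Ω → Bool)}
    {B : ι → Set (Ω → Bool)} {s : ℕ} (h : ∀ i, Computes orc A (B i) s) :
    Computes orc A (⋃ i, B i) (Fintype.card ι * s) := by
  classical
  have key : ∀ I : Finset ι, Computes orc A (⋃ i ∈ I, B i) (I.card * s) := by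
    intro I
    induction I using Finset.induction_on with
    | empty => exact ⟨[], .nil, by simp, by simp⟩
    | insert k I hk ih =>
      refine ((h k).union ih).mono subset_rfl ?_ ?_
      · rw [Finset.set_biUnion_insert]
      · rw [Finset.card_insert_of_notMem hk]; exact le_of_eq (by ring)
  simpa using key Finset.univ

theorem Computes.program {k q sF : ℕ} {F : Bits a → Bits k} (hF : CircuitBound F sF) {a' b' : ℕ}
    {orc : Ω → Bits a' → Bits b'} {A : Set (Ω → Bool)} {x : Ω → Bits a}
    {P : Ω → Fin (q + 1) → Bits a} (m : Fin (q + 1) → Bits k) (hx : bits x ⊆ A)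
    (hP : ∀ i, bits (fun ω => P ω i) ⊆ A) (hA : constBits Ω ⊆ A) (j : ℕ) :
    Computes orc A (bits fun ω => _root_.program F (P ω) m j (x ω))
      (sF + j * (a * 8 + 1 + k * 4)) := by
  refine (hF.computes hx).trans (Computes.iterate
    (fun j ω => _root_.program F (P ω) m j (x ω)) j fun i _ => ?_)
  have h1 : Computes orc (A ∪ bits fun ω => _root_.program F (P ω) m i (x ω))
      {fun ω => decide (x ω = P ω (ix i))} (a * 8 + 1) := by
    have := Computes.eq_test (orc := orc)
      (A := A ∪ bits fun ω => _root_.program F (P ω) m i (x ω))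
      (F := x) (G := fun ω => P ω (ix i)) (hx.trans Set.subset_union_left)
      ((hP _).trans Set.subset_union_left)
    simpa using this
  refine h1.trans ?_
  have h2 := Computes.cond_bits (orc := orc)
    (A := (A ∪ bits fun ω => _root_.program F (P ω) m i (x ω)) ∪
      {fun ω => decide (x ω = P ω (ix i))})
    (c := fun ω => decide (x ω = P ω (ix i))) (F := fun _ => m (ix i))
    (G := fun ω => _root_.program F (P ω) m i (x ω)) (.inr rfl)
    (((bits_const_subset _).trans hA).trans (Set.subset_union_left.trans Set.subset_union_left))
    (Set.subset_union_right.trans Set.subset_union_left)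
  rw [Fintype.card_fin] at h2
  convert h2 using 2
  funext ω
  by_cases h : x ω = P ω (ix i)
  · simp only [_root_.program, h, Function.update_self, decide_true, if_true]
  · simp only [_root_.program, Function.update_of_ne h, decide_eq_true_eq, if_neg h]

theorem simulator_size_le {w q e T i o s L b d X : ℕ} (hX : 1 ≤ X) (hw : w ≤ X) (hq : q + 1 ≤ X)
    (he : e ≤ X) (hT : T ≤ X) (hi : i ≤ X) (ho : o ≤ X) (hs : s ≤ X) (hL : L ≤ X) (hb : b ≤ X)
    (hd : d ≤ X) :
    w + (q + 1) * e + T + i + o + s + (4 * s + w + T + L * (4 * s + b + d + e + 1) + 4 * s + o) ≤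
      30 * X ^ 2 := by
  have h1 := Nat.mul_le_mul hq he
  have h2 : L * (4 * s + b + d + e + 1) ≤ X * (8 * X) := Nat.mul_le_mul hL (by omega)
  nlinarith

end Circuits

section Registers

variable {q e d : ℕ}

/-- Wires for questions and answers of classical calls. -/
abbrev CallWires (q e d : ℕ) : Type := (Fin (q + 1) × Fin e) ⊕ (Fin (q + 1) × Fin d)

/-- The wires of the `j`-th question. -/
def questionWires (j : ℕ) : Fin e ↪ CallWires q e d :=
  ⟨fun k => .inl (ix j, k), fun _ _ h => (Prod.ext_iff.1 (Sum.inl_injective h)).2⟩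

/-- The wires of the `j`-th answer. -/
def answerWires (j : ℕ) : Fin d ↪ CallWires q e d :=
  ⟨fun k => .inr (ix j, k), fun _ _ h => (Prod.ext_iff.1 (Sum.inr_injective h)).2⟩

theorem callWires_eq (R : ℕ → Bits e → Bits d) (C : Fin (q + 1) → Bits e)
    (st : ℕ → CallWires q e d → Bool)
    (h0 : st 0 = Sum.elim (fun p => C p.1 p.2) fun _ => false)
    (hst : ∀ j, st (j + 1) = Function.extend (answerWires j)
      (fun k => xor (st j (answerWires j k)) (R j (st j ∘ questionWires j) k)) (st j))
    (j : ℕ) (hj : j ≤ q + 1) :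
    st j = Sum.elim (fun p => C p.1 p.2)
      fun p => if (p.1 : ℕ) < j then R p.1 (C p.1) p.2 else false := by
  induction j with
  | zero => simpa using h0
  | succ j ih =>
    specialize ih (by omega)
    have hq : st j ∘ questionWires j = C (ix j) := by
      rw [ih]; rfl
    have hix : ((ix j : Fin (q + 1)) : ℕ) = j := by
      simp only [Fin.val_ofNat]
      exact Nat.mod_eq_of_lt (by omega)
    rw [hst, hq]
    funext t
    by_cases ht : ∃ k, answerWires j k = t
    · obtain ⟨k, rfl⟩ := ht
      rw [(answerWires j).injective.extend_apply, ih]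
      change xor (if ((ix j : Fin (q + 1)) : ℕ) < j then R _ _ _ else false) _ =
        if ((ix j : Fin (q + 1)) : ℕ) < j + 1 then R _ _ _ else false
      rw [hix, if_neg (lt_irrefl j), if_pos j.lt_succ_self, Bool.false_xor]
    · rw [Function.extend_apply' _ _ _ ht, ih]
      rcases t with p | p
      · rfl
      · have hp : (p.1 : ℕ) ≠ j := by
          intro h
          refine ht ⟨p.2, ?_⟩
          change (Sum.inr (ix j, p.2) : CallWires q e d) = _
          rw [show (ix j : Fin (q + 1)) = p.1 from by rw [← h, ix_val]]
        change (if (p.1 : ℕ) < j then _ else _) = if (p.1 : ℕ) < j + 1 then _ else _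
        by_cases h : (p.1 : ℕ) < j
        · rw [if_pos h, if_pos (by omega)]
        · rw [if_neg h, if_neg (by omega)]

end Registers

/-- The circuits of the two schemes have size at most `D`, and so do the lengths. -/
structure ReductionCost {ℓ : ℕ → ℕ} (S : PlainSigAlgs ℓ) (H : ChameleonAlgs ℓ) (n D : ℕ) :
    Prop where
  sign : CircuitBound (fun v : Bits (S.skLen n + ℓ n + S.signCoins n) =>
    S.sign n id v.fst.fst v.fst.snd v.snd) D
  hash : CircuitBound (fun v : Bits (H.keyLen n + H.msgLen n + H.rndLen n) =>
    H.hash n v.fst.fst v.fst.snd v.snd) D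
  invert : CircuitBound (fun v : Bits (H.tdLen n + H.msgLen n + ℓ n + H.invCoins n) =>
    H.invert n v.fst.fst.fst v.fst.fst.snd v.fst.snd v.snd) D
  one_le : 1 ≤ D
  pkLen_le : S.pkLen n ≤ D
  sigLen_le : S.sigLen n ≤ D
  keyLen_le : H.keyLen n ≤ D
  msgLen_le : H.msgLen n ≤ D
  rndLen_le : H.rndLen n ≤ D
  range_le : ℓ n ≤ D

namespace ReductionCost

variable {ℓ : ℕ → ℕ} {S : PlainSigAlgs ℓ} {H : ChameleonAlgs ℓ} {n D : ℕ}
  {Ω : Type} {a b : ℕ} {orc : Ω → Bits a → Bits b} {A : Set (Ω → Bool)}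

theorem computes_sign (hD : ReductionCost S H n D) {sk : Ω → Bits (S.skLen n)} {M : Ω → Bits (ℓ n)}
    {c : Ω → Bits (S.signCoins n)} (h1 : bits sk ⊆ A) (h2 : bits M ⊆ A) (h3 : bits c ⊆ A) :
    Computes orc A (bits fun ω => S.sign n id (sk ω) (M ω) (c ω)) D := by
  have := hD.sign.computes (orc := orc) (A := A) (F := fun ω => ((sk ω).cat (M ω)).cat (c ω)) (by
    rw [bits_cat, bits_cat]
    exact Set.union_subset (Set.union_subset h1 h2) h3)
  simpa only [Bits.fst_cat, Bits.snd_cat] using this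

theorem computes_hash (hD : ReductionCost S H n D) {h : Ω → Bits (H.keyLen n)}
    {m : Ω → Bits (H.msgLen n)} {r : Ω → Bits (H.rndLen n)} (h1 : bits h ⊆ A) (h2 : bits m ⊆ A)
    (h3 : bits r ⊆ A) : Computes orc A (bits fun ω => H.hash n (h ω) (m ω) (r ω)) D := by
  have := hD.hash.computes (orc := orc) (A := A) (F := fun ω => ((h ω).cat (m ω)).cat (r ω)) (by
    rw [bits_cat, bits_cat]
    exact Set.union_subset (Set.union_subset h1 h2) h3)
  simpa only [Bits.fst_cat, Bits.snd_cat] using this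

theorem computes_invert (hD : ReductionCost S H n D) {td : Ω → Bits (H.tdLen n)}
    {m : Ω → Bits (H.msgLen n)} {y : Ω → Bits (ℓ n)} {c : Ω → Bits (H.invCoins n)}
    (h1 : bits td ⊆ A) (h2 : bits m ⊆ A) (h3 : bits y ⊆ A) (h4 : bits c ⊆ A) :
    Computes orc A (bits fun ω => H.invert n (td ω) (m ω) (y ω) (c ω)) D := by
  have := hD.invert.computes (orc := orc) (A := A)
    (F := fun ω => (((td ω).cat (m ω)).cat (y ω)).cat (c ω)) (by
    rw [bits_cat, bits_cat, bits_cat]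
    exact Set.union_subset (Set.union_subset (Set.union_subset h1 h2) h3) h4)
  simpa only [Bits.fst_cat, Bits.snd_cat] using this

end ReductionCost

/-! ### The forger for the underlying scheme -/

section Forger

variable {ℓ : ℕ → ℕ} {S : PlainSigAlgs ℓ} {H : ChameleonAlgs ℓ} {n μ q D : ℕ}

/-- Forgers in the plain model, with the coins of the signing oracle drawn in advance. -/
theorem winProb_eq_expect_detRun
    (fresh : List (Bits (ℓ n) × Bits (S.sigLen n)) → Bits (ℓ n) → Bits (S.sigLen n) → Prop)
    (B : QCircuit 0 0 (ℓ n) (S.sigLen n) (S.pkLen n) (ℓ n + S.sigLen n))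
    (hB : callTotal B.code ≤ q + 1) :
    S.winProb n fresh B = 𝔼 g, 𝔼 c : Fin (q + 1) → Bits (S.signCoins n),
      detRun id (fun j M => S.sign n id (S.gen n id g).2 M (c (ix j)))
        (fun tr z => ind ((∀ q ∈ tr, q.1 ∈ S.msgs n) ∧ (Bits.fst (z ∘ B.output)) ∈ S.msgs n ∧
            fresh tr (Bits.fst (z ∘ B.output)) (Bits.snd (z ∘ B.output))) *
          𝔼 v, ind (S.verify n id (S.gen n id g).1 (Bits.fst (z ∘ B.output))
            (Bits.snd (z ∘ B.output)) v = true))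
        B.code 0 [] (QState.basis (Bits.load B.input (S.gen n id g).1)) := by
  have h1 : ∀ O : Bits 0 → Bits 0, O = id := fun O => Subsingleton.elim _ _
  unfold SigAlgs.winProb
  refine (Finset.expect_congr rfl fun O _ => ?_).trans (Fintype.expect_const (ι := Bits 0 → Bits 0) _)
  refine Finset.expect_congr rfl fun g _ => ?_
  have := h1 O
  subst this
  exact runProb_eq_expect_detRun _ _ _ _ 0 (by omega) _ _

theorem exists_forger (hD : ReductionCost S H n D)
    (hmem : ∀ g m r, H.isRnd n r = true → H.hash n (H.gen n g).1 m r ∈ S.msgs n)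
    (hsr : ∀ c, H.sampleRange n c ∈ S.msgs n)
    (A : QCircuit (μ + S.sigLen n) (H.msgLen n) μ (S.sigLen n + H.rndLen n)
      (S.pkLen n + H.keyLen n) (μ + (S.sigLen n + H.rndLen n)))
    (hcalls : callTotal A.code ≤ q + 1) (hA : A.size ≤ D) (hμ : μ ≤ D) (hq : q + 1 ≤ D)
    {F : Bits (μ + S.sigLen n) → Bits (H.msgLen n)} (hF : CircuitBound F D)
    (gH : Bits (H.genCoins n)) (cC : Fin (q + 1) → Bits (H.rangeCoins n))
    (cI : Fin (q + 1) → Bits (H.invCoins n)) :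
    ∃ B : QCircuit 0 0 (ℓ n) (S.sigLen n) (S.pkLen n) (ℓ n + S.sigLen n),
      B.size ≤ 30 * (3 * D ^ 2) ^ 2 ∧
      𝔼 gS, 𝔼 cS : Fin (q + 1) → Bits (S.signCoins n),
        value A.code (Bits.load A.input (Bits.cat (S.gen n id gS).1 (H.gen n gH).1)) (fun _ _ => F)
          (oracleResp (fun i => S.sign n id (S.gen n id gS).2 (H.sampleRange n (cC i)) (cS i))
            (fun i m => H.invert n (H.gen n gH).2 m (H.sampleRange n (cC i)) (cI i)) F)
          (fun _ z =>
            let out : Bits (μ + (S.sigLen n + H.rndLen n)) := z ∘ A.output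
            let C := H.hash n (H.gen n gH).1 (F (forgeryPoint out)) out.snd.snd
            ind (H.isRnd n out.snd.snd = true ∧
                ∀ i < callTotal A.code, C ≠ H.sampleRange n (cC (ix i))) *
              𝔼 v, ind (S.verify n id (S.gen n id gS).1 C out.snd.fst v = true)) ≤
        S.winProb n (fun tr M _ => ∀ q ∈ tr, M ≠ q.1) B := by
  classical
  let T := CallWires q (ℓ n) (S.sigLen n)
  let C : Fin (q + 1) → Bits (ℓ n) := fun i => H.sampleRange n (cC i)
  let h := (H.gen n gH).1
  let start : Bits (S.pkLen n) → Fin A.width ⊕ T → Bool := fun v =>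
    Sum.elim (Bits.load A.input (Bits.cat v h)) (Sum.elim (fun p => C p.1 p.2) fun _ => false)
  let sig : ℕ → (T → Bool) → Bits (S.sigLen n) := fun j st k => st (.inr (ix j, k))
  let orc : ℕ → (T → Bool) → (Fin (q + 1) → Bits μ) → Bits (μ + S.sigLen n) → Bits (H.msgLen n) :=
    fun _ _ _ x => F x
  let resp : ℕ → (T → Bool) → (Fin (q + 1) → Bits μ) → Bits (S.sigLen n + H.rndLen n) :=
    fun j st ρ => Bits.cat (sig j st)
      (H.invert n (H.gen n gH).2 (F (Bits.cat (ρ (ix j)) (sig j st))) (C (ix j)) (cI (ix j)))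
  let fin : (T → Bool) → (Fin (q + 1) → Bits μ) → Bits A.width → Bits (ℓ n + S.sigLen n) :=
    fun _ _ z =>
      let out : Bits (μ + (S.sigLen n + H.rndLen n)) := z ∘ A.output
      Bits.cat (H.hash n h (F (forgeryPoint out)) out.snd.snd) out.snd.fst
  have hD1 := hD.one_le
  have hstart : Computes (fun _ => id : _ → Bits 0 → Bits 0) (bits id) (bits start) (3 * D) := by
    refine (Computes.of_constBits (s := 0) ?_).weaken (by omega)
    have h1 := (Computes.load (orc := (fun _ => id : Bits (S.pkLen n) → Bits 0 → Bits 0)) A.input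
      (fun v : Bits (S.pkLen n) => Bits.cat v h)).mono (A' := bits id ∪ constBits _) (by
        rw [bits_cat]
        exact Set.union_subset_union_right _ (bits_const_subset h)) subset_rfl le_rfl
    refine (h1.union (Computes.of_subset (s := 0) Set.subset_union_right)).mono subset_rfl ?_
      (by simp)
    rintro _ ⟨k | p | p, rfl⟩
    · exact .inl ⟨k, rfl⟩
    · exact .inr ⟨C p.1 p.2, rfl⟩
    · exact .inr ⟨false, rfl⟩
  have horc : ∀ j, Computes (fun _ => id : _ → Bits 0 → Bits 0)
      (simInputs q μ T (Fin (μ + S.sigLen n))) (bits fun ω => orc j ω.1 ω.2.1 ω.2.2) (3 * D) :=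
    fun j => (hF.computes (Set.subset_union_right.trans Set.subset_union_right)).weaken (by omega)
  have hresp : ∀ j, Computes (fun _ => id : _ → Bits 0 → Bits 0)
      (simInputs q μ T (Fin 0)) (bits fun ω => resp j ω.1 ω.2.1) (3 * D) := by
    intro j
    refine (Computes.of_constBits (s := D + D) ?_).weaken (by omega)
    set A₀ := simInputs q μ T (Fin 0) ∪ constBits _ with hA₀
    have hs : bits (fun ω : (T → Bool) × (Fin (q + 1) → Bits μ) × (Fin 0 → Bool) => sig j ω.1) ⊆
        A₀ := by
      rintro _ ⟨k, rfl⟩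
      exact .inl (.inl ⟨.inr (ix j, k), rfl⟩)
    have hr : bits (fun ω : (T → Bool) × (Fin (q + 1) → Bits μ) × (Fin 0 → Bool) => ω.2.1 (ix j)) ⊆
        A₀ := by
      rintro _ ⟨k, rfl⟩
      exact .inl (.inr (.inl ⟨(ix j, k), rfl⟩))
    have h1 := hF.computes (orc := (fun _ => id : _ → Bits 0 → Bits 0)) (A := A₀)
      (F := fun ω => Bits.cat (ω.2.1 (ix j)) (sig j ω.1)) (by
        rw [bits_cat]
        exact Set.union_subset hr hs)
    have hc : ∀ {κ : Type} (v : κ → Bool), bits (fun _ => v) ⊆ A₀ := fun v =>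
      (bits_const_subset v).trans Set.subset_union_right
    have h2 := h1.trans (hD.computes_invert ((hc (H.gen n gH).2).trans Set.subset_union_left)
      Set.subset_union_right ((hc (C (ix j))).trans Set.subset_union_left)
      ((hc (cI (ix j))).trans Set.subset_union_left))
    have h3 := (Computes.of_subset (s := 0) (orc := (fun _ => id : _ → Bits 0 → Bits 0)) hs).union h2
    rw [← bits_cat] at h3
    exact h3.weaken (by omega)
  have hfin : Computes (fun _ => id : _ → Bits 0 → Bits 0)
      (simInputs q μ T (Fin A.width)) (bits fun ω => fin ω.1 ω.2.1 ω.2.2) (3 * D) := by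
    refine (Computes.of_constBits (s := D + D) ?_).weaken (by omega)
    set A₀ := simInputs q μ T (Fin A.width) ∪ constBits _ with hA₀
    let out : (T → Bool) × (Fin (q + 1) → Bits μ) × Bits A.width →
      Bits (μ + (S.sigLen n + H.rndLen n)) := fun ω => ω.2.2 ∘ A.output
    have ho : bits out ⊆ A₀ := by
      rintro _ ⟨k, rfl⟩
      exact .inl (.inr (.inr ⟨A.output k, rfl⟩))
    have h1 := hF.computes (orc := (fun _ => id : _ → Bits 0 → Bits 0)) (A := A₀)
      (F := fun ω => forgeryPoint (out ω)) (by
        unfold forgeryPoint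
        rw [bits_cat]
        exact Set.union_subset ((bits_fst_subset out).trans ho)
          (((bits_fst_subset fun ω => (out ω).snd).trans (bits_snd_subset out)).trans ho))
    have h2 := h1.trans (hD.computes_hash (h := fun _ => h)
      (((bits_const_subset h).trans Set.subset_union_right).trans Set.subset_union_left)
      Set.subset_union_right (r := fun ω => (out ω).snd.snd)
      ((((bits_snd_subset fun ω => (out ω).snd).trans (bits_snd_subset out)).trans ho).trans
        Set.subset_union_left))
    have h3 := h2.union (Computes.of_subset (s := 0)
      (orc := (fun _ => id : _ → Bits 0 → Bits 0))
      (((bits_fst_subset fun ω => (out ω).snd).trans (bits_snd_subset out)).trans ho))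
    rw [← bits_cat] at h3
    exact h3.weaken (by omega)
  obtain ⟨B, hsize, hBcalls, hB⟩ := exists_simulator A.code hcalls start hstart orc resp horc hresp
    fin hfin questionWires answerWires
  refine ⟨B, hsize.trans ?_, ?_⟩
  · have hw : A.width + A.code.length ≤ D := hA
    have h1 := hD.sigLen_le
    have h2 := hD.range_le
    have h3 := hD.rndLen_le
    have h4 := hD.pkLen_le
    have h5 := hD.msgLen_le
    have hDD : D ≤ D ^ 2 := by nlinarith
    have hT : Fintype.card T ≤ 3 * D ^ 2 := by
      simp only [T, CallWires, Fintype.card_sum, Fintype.card_prod, Fintype.card_fin]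
      nlinarith [Nat.mul_le_mul hq h1, Nat.mul_le_mul hq h2]
    apply simulator_size_le <;> first | exact hT | omega
  · rw [winProb_eq_expect_detRun (q := q) _ B (hBcalls.le.trans hcalls)]
    refine expect_mono fun gS => expect_mono fun cS => ?_
    let R : ℕ → Bits (ℓ n) → Bits (S.sigLen n) := fun j M =>
      S.sign n id (S.gen n id gS).2 M (cS (ix j))
    let st : ℕ → T → Bool := fun j => Nat.rec (fun t => start (S.gen n id gS).1 (.inr t))
      (fun j st => Function.extend (answerWires j)
        (fun k => xor (st (answerWires j k)) (R j (st ∘ questionWires j) k)) st) j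
    have hst := callWires_eq R C st rfl (fun _ => rfl)
    have hquest : ∀ j < callTotal A.code, st j ∘ questionWires j = C (ix j) := fun j hj => by
      rw [hst j (by omega)]; rfl
    have h1 := hB R (S.gen n id gS).1 (fun tr out =>
      ind ((∀ q ∈ tr, q.1 ∈ S.msgs n) ∧ out.fst ∈ S.msgs n ∧ ∀ q ∈ tr, out.fst ≠ q.1) *
        𝔼 v, ind (S.verify n id (S.gen n id gS).1 out.fst out.snd v = true)) st rfl (fun _ => rfl)
    rw [show detRun id (fun j M => S.sign n id (S.gen n id gS).2 M (cS (ix j))) _ B.code 0 []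
      (QState.basis (Bits.load B.input (S.gen n id gS).1)) = _ from h1]
    have h2 : recRun (fun j => orc j (st j)) (fun j => resp j (st (j + 1))) A.code 0
        (initRec fun k => start (S.gen n id gS).1 (.inl k)) =
        recRun (fun _ _ => F) (oracleResp (fun i => S.sign n id (S.gen n id gS).2 (C i) (cS i))
          (fun i m => H.invert n (H.gen n gH).2 m (C i) (cI i)) F) A.code 0
        (initRec (Bits.load A.input (Bits.cat (S.gen n id gS).1 h))) := by
      funext ρ
      refine recRun_congr A.code hcalls _ ρ (fun _ _ _ _ => rfl) (fun j hj ρ' _ => ?_) ρ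
        fun _ _ => rfl
      have hsig : sig j (st (j + 1)) = S.sign n id (S.gen n id gS).2 (C (ix j)) (cS (ix j)) := by
        have hix : ((ix j : Fin (q + 1)) : ℕ) = j := by
          simp only [Fin.val_ofNat]
          exact Nat.mod_eq_of_lt (by omega)
        funext k
        simp only [sig]
        rw [hst (j + 1) (by omega)]
        change (if ((ix j : Fin (q + 1)) : ℕ) < j + 1 then R _ (C (ix j)) k else false) = _
        rw [hix, if_pos j.lt_succ_self]
      simp only [resp, hsig, oracleResp, points]
    rw [h2]
    refine Finset.sum_le_sum fun ρ _ => Finset.sum_le_sum fun z _ =>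
      mul_le_mul_of_nonneg_left ?_ (by positivity)
    simp only [fin, Bits.fst_cat, Bits.snd_cat]
    refine mul_le_mul_of_nonneg_right (ind_mono ?_) (expect_nonneg' fun _ => ind_nonneg _)
    rintro ⟨hr, hC⟩
    refine ⟨?_, hmem _ _ _ hr, ?_⟩
    · intro p hp
      obtain ⟨j, hj, rfl⟩ := List.mem_map.1 hp
      simp only [hquest j (List.mem_range.1 hj)]
      exact hsr _
    · intro p hp
      obtain ⟨j, hj, rfl⟩ := List.mem_map.1 hp
      simp only [hquest j (List.mem_range.1 hj)]
      exact hC j (List.mem_range.1 hj)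

end Forger

/-! ### The collision finder -/

section Finder

variable {ℓ : ℕ → ℕ} {S : PlainSigAlgs ℓ} {H : ChameleonAlgs ℓ} {n μ q D : ℕ}

theorem collisionProb_eq_expect_detRun (B : H.CollisionFinder n) (hB : callTotal B.code ≤ q + 1) :
    H.collisionProb n B = 𝔼 g, detRun id (fun _ M => M)
      (fun _ z =>
        let out : Bits ((H.msgLen n + H.rndLen n) + (H.msgLen n + H.rndLen n)) := z ∘ B.output
        ind (H.isRnd n out.fst.snd = true ∧ H.isRnd n out.snd.snd = true ∧
          (out.fst.fst, out.fst.snd) ≠ (out.snd.fst, out.snd.snd) ∧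
          H.hash n (H.gen n g).1 out.fst.fst out.fst.snd =
            H.hash n (H.gen n g).1 out.snd.fst out.snd.snd))
      B.code 0 [] (QState.basis (Bits.load B.input (H.gen n g).1)) := by
  refine Finset.expect_congr rfl fun g _ => ?_
  refine (runProb_eq_expect_detRun (q := q) _ _ _ _ 0 (by omega) _ _).trans ?_
  exact Fintype.expect_const _

open Classical in
theorem Computes.exists_eq {Ω : Type} {a b s : ℕ} {orc : Ω → Bits a → Bits b}
    {A : Set (Ω → Bool)} {y : Ω → Bits s} {σ : Ω → Fin (q + 1) → Bits s} (j : ℕ)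
    (hy : bits y ⊆ A) (hσ : ∀ i, bits (fun ω => σ ω i) ⊆ A) :
    Computes orc A {fun ω => decide (∃ i : Fin (q + 1), j ≤ i ∧ y ω = σ ω i)}
      ((q + 1) * (s * 8 + 2) + ((q + 1) * 2 + 2)) := by
  let E : Ω → Fin (q + 1) → Bool := fun ω i => !decide (y ω = σ ω i)
  have h1 : Computes orc A (bits E) ((q + 1) * (s * 8 + 2)) := by
    have : ∀ i, Computes orc A {fun ω => E ω i} (s * 8 + 1 + 1) := by
      intro i
      have h2 := Computes.eq_test (orc := orc) hy (hσ i)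
      rw [Fintype.card_fin] at h2
      convert h2.trans (Computes.not (.inr rfl)) using 4
    simpa using Computes.bits_of_forall this
  let I : Finset (Fin (q + 1)) := Finset.univ.filter fun i => j ≤ (i : ℕ)
  have h2 := Computes.forall_finset (orc := orc) (A := A ∪ bits E) I (fun i ω => E ω i)
    (fun i => .inr ⟨i, rfl⟩)
  have hI : I.card ≤ q + 1 := (Finset.card_le_univ _).trans (by simp)
  have h3 := h1.trans (h2.trans (Computes.not (.inr rfl)))
  refine h3.mono subset_rfl ?_ (by omega)
  rintro _ rfl
  refine Set.mem_singleton_iff.2 (funext fun ω => ?_)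
  rw [Bool.eq_iff_iff]
  simp [I, E]

/-- The programmed oracle has small circuits. -/
theorem Computes.progOracle {Ω : Type} {a b s k sF : ℕ} {orc : Ω → Bits a → Bits b}
    {A : Set (Ω → Bool)} {F F' : Bits (μ + s) → Bits k} (hF : CircuitBound F sF)
    (hF' : CircuitBound F' sF) {x : Ω → Bits (μ + s)} {σ : Ω → Fin (q + 1) → Bits s}
    {ρ : Ω → Fin (q + 1) → Bits μ} (m : Fin (q + 1) → Bits k) (j : ℕ) (hx : bits x ⊆ A)
    (hσ : ∀ i, bits (fun ω => σ ω i) ⊆ A) (hρ : ∀ i, bits (fun ω => ρ ω i) ⊆ A)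
    (hA : constBits Ω ⊆ A) :
    Computes orc A (bits fun ω => _root_.progOracle (σ ω) m F F' j (ρ ω) (x ω))
      (sF + j * ((μ + s) * 8 + 1 + k * 4) + (sF + ((q + 1) * (s * 8 + 2) + ((q + 1) * 2 + 2) +
        k * 4))) := by
  classical
  have h1 := Computes.program (orc := orc) hF (P := fun ω => points (σ ω) (ρ ω)) m hx (fun i => by
    unfold points
    rw [bits_cat]
    exact Set.union_subset (hρ i) (hσ i)) hA j
  refine h1.trans ?_
  refine (hF'.computes (hx.trans Set.subset_union_left)).trans ?_
  have hsub : A ⊆ A ∪ bits (fun ω => _root_.program F (points (σ ω) (ρ ω)) m j (x ω)) ∪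
      bits (fun ω => F' (x ω)) := Set.subset_union_left.trans Set.subset_union_left
  have h2 := Computes.exists_eq (orc := orc) (q := q) (y := fun ω => (x ω).snd) (σ := σ) j
    (((bits_snd_subset x).trans hx).trans hsub) (fun i => (hσ i).trans hsub)
  refine h2.trans ?_
  have h3 := Computes.cond_bits (orc := orc)
    (A := A ∪ bits (fun ω => _root_.program F (points (σ ω) (ρ ω)) m j (x ω)) ∪ bits (fun ω => F' (x ω)) ∪
      {fun ω => decide (∃ i : Fin (q + 1), j ≤ i ∧ (x ω).snd = σ ω i)})
    (c := fun ω => decide (∃ i : Fin (q + 1), j ≤ i ∧ (x ω).snd = σ ω i))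
    (F := fun ω => F' (x ω)) (G := fun ω => _root_.program F (points (σ ω) (ρ ω)) m j (x ω)) (.inr rfl)
    (Set.subset_union_right.trans Set.subset_union_left)
    ((Set.subset_union_right.trans Set.subset_union_left).trans Set.subset_union_left)
  rw [Fintype.card_fin] at h3
  convert h3 using 2
  funext ω
  unfold _root_.progOracle hideOracle
  by_cases h : ∃ i : Fin (q + 1), j ≤ i ∧ (x ω).snd = σ ω i
  · rw [if_pos h, if_pos (decide_eq_true h)]
  · rw [if_neg h, if_neg (by simpa using h)]

theorem exists_finder (hD : ReductionCost S H n D)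
    (A : QCircuit (μ + S.sigLen n) (H.msgLen n) μ (S.sigLen n + H.rndLen n)
      (S.pkLen n + H.keyLen n) (μ + (S.sigLen n + H.rndLen n)))
    (hcalls : callTotal A.code ≤ q + 1) (hA : A.size ≤ D) (hμ : μ ≤ D) (hq : q + 1 ≤ D)
    {F F' : Bits (μ + S.sigLen n) → Bits (H.msgLen n)} (hF : CircuitBound F D)
    (hF' : CircuitBound F' D) (gS : Bits (S.genCoins n))
    (cS : Fin (q + 1) → Bits (S.signCoins n)) (m : Fin (q + 1) → Bits (H.msgLen n))
    (r : Fin (q + 1) → Bits (H.rndLen n)) (hr : ∀ i, H.isRnd n (r i) = true) (l : Fin (q + 1)) :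
    ∃ B : H.CollisionFinder n, B.size ≤ 30 * (50 * D ^ 2) ^ 2 ∧
      𝔼 gH, collValue A.code
          (Bits.load A.input (Bits.cat (S.gen n id gS).1 (H.gen n gH).1)) (fun z => z ∘ A.output)
          gS (H.gen n gH).1 cS m r l F F' ≤
        H.collisionProb n B := by
  classical
  let T := Fin (q + 1) × Fin (S.sigLen n)
  let sgn : Bits (H.keyLen n) → Fin (q + 1) → Bits (S.sigLen n) := fun h i =>
    S.sign n id (S.gen n id gS).2 (H.hash n h (m i) (r i)) (cS i)
  let start : Bits (H.keyLen n) → Fin A.width ⊕ T → Bool := fun h =>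
    Sum.elim (Bits.load A.input (Bits.cat (S.gen n id gS).1 h)) fun p => sgn h p.1 p.2
  let sig : (T → Bool) → Fin (q + 1) → Bits (S.sigLen n) := fun st i k => st (i, k)
  let orc : ℕ → (T → Bool) → (Fin (q + 1) → Bits μ) → Bits (μ + S.sigLen n) → Bits (H.msgLen n) :=
    fun j st => progOracle (sig st) m F F' (min j (q + 1))
  let resp : ℕ → (T → Bool) → (Fin (q + 1) → Bits μ) → Bits (S.sigLen n + H.rndLen n) :=
    fun j st => fixedResp (sig st) r j
  let fin : (T → Bool) → (Fin (q + 1) → Bits μ) → Bits A.width →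
      Bits ((H.msgLen n + H.rndLen n) + (H.msgLen n + H.rndLen n)) := fun st ρ z =>
    let out : Bits (μ + (S.sigLen n + H.rndLen n)) := z ∘ A.output
    Bits.cat (Bits.cat (program F (points (sig st) ρ) m (q + 1) (forgeryPoint out)) out.snd.snd)
      (Bits.cat (m l) (r l))
  have hD1 := hD.one_le
  have hDD : D ≤ D ^ 2 := by nlinarith
  have hs := hD.sigLen_le
  have hk := hD.msgLen_le
  have hprod : (q + 1) * ((μ + S.sigLen n) * 8 + 1 + H.msgLen n * 4) ≤ 21 * D ^ 2 := by
    calc _ ≤ D * (21 * D) := Nat.mul_le_mul hq (by omega)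
      _ = _ := by ring
  have hprod' : (q + 1) * (S.sigLen n * 8 + 2) ≤ 10 * D ^ 2 := by
    calc _ ≤ D * (10 * D) := Nat.mul_le_mul hq (by omega)
      _ = _ := by ring
  have hstart : Computes (fun _ => id : _ → Bits 0 → Bits 0) (bits id) (bits start)
      (50 * D ^ 2) := by
    refine (Computes.of_constBits (s := (q + 1) * (D + D)) ?_).weaken (by
      have : (q + 1) * (D + D) ≤ 2 * D ^ 2 := by
        calc _ ≤ D * (D + D) := Nat.mul_le_mul_right _ hq
          _ = _ := by ring
      omega)
    have hc : ∀ {κ : Type} (v : κ → Bool), bits (fun _ : Bits (H.keyLen n) => v) ⊆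
        bits id ∪ constBits (Bits (H.keyLen n)) := fun v =>
      (bits_const_subset v).trans Set.subset_union_right
    have h1 := (Computes.load (orc := (fun _ => id : Bits (H.keyLen n) → Bits 0 → Bits 0)) A.input
      (fun h : Bits (H.keyLen n) => Bits.cat (S.gen n id gS).1 h)).mono (A' := bits id ∪ constBits _)
      (by
        rw [bits_cat]
        exact Set.union_subset (hc _) Set.subset_union_left) subset_rfl le_rfl
    have h2 : ∀ i, Computes (fun _ => id : Bits (H.keyLen n) → Bits 0 → Bits 0)
        (bits id ∪ constBits _) (bits fun h => sgn h i) (D + D) := fun i =>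
      (hD.computes_hash (h := id) Set.subset_union_left (hc (m i)) (hc (r i))).trans
        (hD.computes_sign ((hc (S.gen n id gS).2).trans Set.subset_union_left)
          Set.subset_union_right ((hc (cS i)).trans Set.subset_union_left))
    have h3 := h1.union (Computes.iUnion h2)
    rw [Fintype.card_fin, zero_add] at h3
    refine h3.mono subset_rfl ?_ le_rfl
    rintro _ ⟨k | p, rfl⟩
    · exact .inl ⟨k, rfl⟩
    · exact .inr (Set.mem_iUnion.2 ⟨p.1, p.2, rfl⟩)
  have hsig : ∀ (κ : Type) (i : Fin (q + 1)),
      bits (fun ω : (T → Bool) × (Fin (q + 1) → Bits μ) × (κ → Bool) => sig ω.1 i) ⊆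
        simInputs q μ T κ ∪ constBits _ := by
    rintro κ i _ ⟨k, rfl⟩
    exact .inl (.inl ⟨(i, k), rfl⟩)
  have hrec : ∀ (κ : Type) (i : Fin (q + 1)),
      bits (fun ω : (T → Bool) × (Fin (q + 1) → Bits μ) × (κ → Bool) => ω.2.1 i) ⊆
        simInputs q μ T κ ∪ constBits _ := by
    rintro κ i _ ⟨k, rfl⟩
    exact .inl (.inr (.inl ⟨(i, k), rfl⟩))
  have horc : ∀ j, Computes (fun _ => id : _ → Bits 0 → Bits 0)
      (simInputs q μ T (Fin (μ + S.sigLen n))) (bits fun ω => orc j ω.1 ω.2.1 ω.2.2)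
      (50 * D ^ 2) := by
    intro j
    have h1 := Computes.progOracle (orc := (fun _ => id : _ → Bits 0 → Bits 0)) hF hF'
      (A := simInputs q μ T (Fin (μ + S.sigLen n)) ∪ constBits _)
      (x := fun ω => ω.2.2) (σ := fun ω => sig ω.1) (ρ := fun ω => ω.2.1) m (min j (q + 1))
      ((Set.subset_union_right.trans Set.subset_union_right).trans Set.subset_union_left)
      (hsig _) (hrec _) Set.subset_union_right
    refine (Computes.of_constBits h1).weaken ?_
    have h2 : min j (q + 1) * ((μ + S.sigLen n) * 8 + 1 + H.msgLen n * 4) ≤ 21 * D ^ 2 :=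
      (Nat.mul_le_mul_right _ (min_le_right _ _)).trans hprod
    omega
  have hresp : ∀ j, Computes (fun _ => id : _ → Bits 0 → Bits 0)
      (simInputs q μ T (Fin 0)) (bits fun ω => resp j ω.1 ω.2.1) (50 * D ^ 2) := by
    intro j
    refine (Computes.of_constBits (Computes.of_subset (s := 0) ?_)).weaken (by omega)
    simp only [resp, fixedResp, bits_cat]
    exact Set.union_subset (hsig _ _) ((bits_const_subset _).trans Set.subset_union_right)
  have hfin : Computes (fun _ => id : _ → Bits 0 → Bits 0)
      (simInputs q μ T (Fin A.width)) (bits fun ω => fin ω.1 ω.2.1 ω.2.2) (50 * D ^ 2) := by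
    set A₀ := simInputs q μ T (Fin A.width) ∪ constBits _ with hA₀
    let out : (T → Bool) × (Fin (q + 1) → Bits μ) × Bits A.width →
      Bits (μ + (S.sigLen n + H.rndLen n)) := fun ω => ω.2.2 ∘ A.output
    have ho : bits out ⊆ A₀ := by
      rintro _ ⟨k, rfl⟩
      exact .inl (.inr (.inr ⟨A.output k, rfl⟩))
    have h1 := Computes.program (orc := (fun _ => id : _ → Bits 0 → Bits 0)) hF (A := A₀)
      (x := fun ω => forgeryPoint (out ω)) (P := fun ω => points (sig ω.1) ω.2.1) m
      (by
        unfold forgeryPoint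
        rw [bits_cat]
        exact Set.union_subset ((bits_fst_subset out).trans ho)
          (((bits_fst_subset fun ω => (out ω).snd).trans (bits_snd_subset out)).trans ho))
      (fun i => by
        unfold points
        rw [bits_cat]
        exact Set.union_subset (hrec _ i) (hsig _ i)) Set.subset_union_right (q + 1)
    have h2 := h1.union (Computes.of_subset (s := 0)
      (orc := (fun _ => id : _ → Bits 0 → Bits 0)) (A := A₀)
      (((bits_snd_subset fun ω => (out ω).snd).trans (bits_snd_subset out)).trans ho))
    rw [← bits_cat] at h2
    have h3 := h2.union (Computes.of_subset (s := 0)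
      (orc := (fun _ => id : _ → Bits 0 → Bits 0)) (A := A₀)
      (B := bits fun _ => Bits.cat (m l) (r l))
      ((bits_const_subset _).trans Set.subset_union_right))
    rw [← bits_cat] at h3
    exact (Computes.of_constBits h3).weaken (by omega)
  obtain ⟨B, hsize, hBcalls, hB⟩ := exists_simulator A.code hcalls start hstart orc resp horc hresp
    fin hfin (fun _ => (Function.Embedding.ofIsEmpty : Fin 0 ↪ T))
    (fun _ => (Function.Embedding.ofIsEmpty : Fin 0 ↪ T))
  refine ⟨B, hsize.trans ?_, ?_⟩
  · have hw : A.width + A.code.length ≤ D := hA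
    have h3 := hD.rndLen_le
    have h4 := hD.keyLen_le
    have hT : Fintype.card T ≤ 50 * D ^ 2 := by
      simp only [T, Fintype.card_prod, Fintype.card_fin]
      nlinarith [Nat.mul_le_mul hq hs]
    apply simulator_size_le <;> first | exact hT | omega
  · rw [collisionProb_eq_expect_detRun (q := q) B (hBcalls.le.trans hcalls)]
    refine expect_mono fun gH => ?_
    let h := (H.gen n gH).1
    have h1 := hB (fun _ M => M) h (fun _ out =>
      ind (H.isRnd n out.fst.snd = true ∧ H.isRnd n out.snd.snd = true ∧
          (out.fst.fst, out.fst.snd) ≠ (out.snd.fst, out.snd.snd) ∧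
          H.hash n h out.fst.fst out.fst.snd = H.hash n h out.snd.fst out.snd.snd))
      (fun _ p => sgn h p.1 p.2) rfl (fun j => by
        funext t
        rw [Function.extend_apply']
        rintro ⟨k, -⟩
        exact k.elim0)
    rw [show detRun id (fun _ M => M) _ B.code 0 []
      (QState.basis (Bits.load B.input (H.gen n gH).1)) = _ from h1]
    have h2 : recRun (fun j => orc j fun p => sgn h p.1 p.2)
        (fun j => resp j fun p => sgn h p.1 p.2) A.code 0 (initRec fun k => start h (.inl k)) =
        recRun (progOracle (sgn h) m F F') (fixedResp (sgn h) r) A.code 0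
        (initRec (Bits.load A.input (Bits.cat (S.gen n id gS).1 h))) := by
      funext ρ
      refine recRun_congr A.code hcalls _ ρ (fun j hj ρ' _ => ?_) (fun _ _ _ _ => rfl) ρ
        fun _ _ => rfl
      simp only [orc, min_eq_left (hj.trans hcalls)]
      rfl
    rw [h2]
    refine Finset.sum_le_sum fun ρ _ => Finset.sum_le_sum fun z _ =>
      mul_le_mul_of_nonneg_left ?_ (by positivity)
    simp only [fin, Bits.fst_cat, Bits.snd_cat]
    refine ind_mono ?_
    rintro ⟨hr', hne, hh⟩
    exact ⟨hr', hr l, hne, hh⟩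

end Finder

/-! ### Signatures are hard to guess -/

section Guess

variable {ℓ : ℕ → ℕ} {S : PlainSigAlgs ℓ} {H : ChameleonAlgs ℓ} {n D : ℕ}

/-- The forger that passes a signature on `C` off as one on `C'`. -/
theorem exists_replay_forger (hS : S.Correct) (hD : ReductionCost S H n D) {C C' : Bits (ℓ n)}
    (hC : C ∈ S.msgs n) (hC' : C' ∈ S.msgs n) :
    ∃ B : QCircuit 0 0 (ℓ n) (S.sigLen n) (S.pkLen n) (ℓ n + S.sigLen n),
      B.size ≤ 30 * (3 * D ^ 2) ^ 2 ∧
      ind (C ≠ C') * 𝔼 gS, 𝔼 c, 𝔼 c', ind (S.sign n id (S.gen n id gS).2 C c =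
          S.sign n id (S.gen n id gS).2 C' c') ≤
        S.winProb n (fun tr M _ => ∀ q ∈ tr, M ≠ q.1) B := by
  classical
  let T := CallWires 0 (ℓ n) (S.sigLen n)
  let code : List (QInstr 0 0 0 0 0) :=
    [.call Function.Embedding.ofIsEmpty Function.Embedding.ofIsEmpty]
  have hcalls : callTotal code ≤ 0 + 1 := by simp [code, QInstr.callCount]
  have hcalls' : callTotal code = 1 := by simp [code, QInstr.callCount]
  let start : Bits (S.pkLen n) → Fin 0 ⊕ T → Bool := fun _ =>
    Sum.elim finZeroElim (Sum.elim (fun p => C p.2) fun _ => false)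
  let orc : ℕ → (T → Bool) → (Fin (0 + 1) → Bits 0) → Bits 0 → Bits 0 := fun _ _ _ x => x
  let resp : ℕ → (T → Bool) → (Fin (0 + 1) → Bits 0) → Bits 0 := fun _ _ _ => finZeroElim
  let fin : (T → Bool) → (Fin (0 + 1) → Bits 0) → Bits 0 → Bits (ℓ n + S.sigLen n) :=
    fun st _ _ => Bits.cat C' fun k => st (.inr (0, k))
  have hD1 := hD.one_le
  have hstart : Computes (fun _ => id : _ → Bits 0 → Bits 0) (bits id) (bits start) 1 := by
    refine Computes.of_constBits (s := 0) (Computes.of_subset ?_)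
    rintro _ ⟨k | p | p, rfl⟩
    · exact k.elim0
    · exact .inr ⟨C p.2, rfl⟩
    · exact .inr ⟨false, rfl⟩
  have horc : ∀ j, Computes (fun _ => id : _ → Bits 0 → Bits 0)
      (simInputs 0 0 T (Fin 0)) (bits fun ω => orc j ω.1 ω.2.1 ω.2.2) 1 := by
    refine fun j => Computes.of_subset ?_
    rintro _ ⟨k, rfl⟩
    exact k.elim0
  have hresp : ∀ j, Computes (fun _ => id : _ → Bits 0 → Bits 0)
      (simInputs 0 0 T (Fin 0)) (bits fun ω => resp j ω.1 ω.2.1) 1 := by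
    refine fun j => Computes.of_subset ?_
    rintro _ ⟨k, rfl⟩
    exact k.elim0
  have hfin : Computes (fun _ => id : _ → Bits 0 → Bits 0)
      (simInputs 0 0 T (Fin 0)) (bits fun ω => fin ω.1 ω.2.1 ω.2.2) 1 := by
    refine Computes.of_constBits (s := 0) (Computes.of_subset ?_)
    simp only [fin, bits_cat]
    refine Set.union_subset ((bits_const_subset _).trans Set.subset_union_right) ?_
    rintro _ ⟨k, rfl⟩
    exact .inl (.inl ⟨.inr (0, k), rfl⟩)
  obtain ⟨B, hsize, hBcalls, hB⟩ := exists_simulator code hcalls start hstart orc resp horc hresp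
    fin hfin questionWires answerWires
  refine ⟨B, hsize.trans ?_, ?_⟩
  · have h1 := hD.sigLen_le
    have h2 := hD.range_le
    have h4 := hD.pkLen_le
    have hDD : D ≤ D ^ 2 := by nlinarith
    have hT : Fintype.card T ≤ 3 * D ^ 2 := by
      simp only [T, CallWires, Fintype.card_sum, Fintype.card_prod, Fintype.card_fin]
      omega
    have hlen : code.length = 1 := rfl
    have hX : 3 * D ^ 2 ≤ (3 * D ^ 2) ^ 2 := Nat.le_self_pow two_ne_zero _
    rw [hlen]
    omega
  · rw [winProb_eq_expect_detRun (q := 0) _ B (hBcalls.le.trans hcalls), Finset.mul_expect]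
    refine expect_mono fun gS => ?_
    have hone : ∀ f : Bits (S.signCoins n) → ℝ,
        𝔼 c : Fin (0 + 1) → Bits (S.signCoins n), f (c 0) = 𝔼 c, f c := fun f =>
      Fintype.expect_equiv (Equiv.funUnique (Fin 1) _) _ _ fun c => rfl
    rw [← hone fun c => 𝔼 c', ind (S.sign n id (S.gen n id gS).2 C c =
      S.sign n id (S.gen n id gS).2 C' c'), Finset.mul_expect]
    refine expect_mono fun cS => ?_
    let R : ℕ → Bits (ℓ n) → Bits (S.sigLen n) := fun j M =>
      S.sign n id (S.gen n id gS).2 M (cS (ix j))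
    let st : ℕ → T → Bool := fun j => Nat.rec (fun t => start (S.gen n id gS).1 (.inr t))
      (fun j st => Function.extend (answerWires j)
        (fun k => xor (st (answerWires j k)) (R j (st ∘ questionWires j) k)) st) j
    have hst := callWires_eq R (fun _ => C) st rfl (fun _ => rfl)
    have h1 := hB R (S.gen n id gS).1 (fun tr out =>
      ind ((∀ q ∈ tr, q.1 ∈ S.msgs n) ∧ out.fst ∈ S.msgs n ∧ ∀ q ∈ tr, out.fst ≠ q.1) *
        𝔼 v, ind (S.verify n id (S.gen n id gS).1 out.fst out.snd v = true)) st rfl (fun _ => rfl)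
    rw [show detRun id (fun j M => S.sign n id (S.gen n id gS).2 M (cS (ix j))) _ B.code 0 []
      (QState.basis (Bits.load B.input (S.gen n id gS).1)) = _ from h1]
    have hfin' : ∀ ρ z, fin (st (callTotal code)) ρ z =
        Bits.cat C' (S.sign n id (S.gen n id gS).2 C (cS 0)) := by
      intro ρ z
      simp only [fin, hcalls', hst 1 le_rfl]
      rfl
    have htr : ((List.range (callTotal code)).map fun j => (st j ∘ questionWires j,
        R j (st j ∘ questionWires j))) = [(C, S.sign n id (S.gen n id gS).2 C (cS 0))] := by
      rw [hcalls']
      rfl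
    have hrun : ∀ ρ z, ‖recRun (fun j => orc j (st j)) (fun j => resp j (st (j + 1))) code 0
        (initRec fun k => start (S.gen n id gS).1 (.inl k)) ρ z‖ ^ 2 = 1 := by
      intro ρ z
      simp only [code, recRun, recStep, QState.receive, QState.project]
      rw [if_pos (Subsingleton.elim _ _), initRec,
        Subsingleton.elim (Function.update ρ (ix 0) fun _ => false) (fun _ _ => false),
        Pi.single_eq_same, QState.basis,
        Subsingleton.elim (Bits.xorAt _ _ z) (fun k => start (S.gen n id gS).1 (.inl k)),
        Pi.single_eq_same]
      simp
    simp only [hfin', htr, hrun, Bits.fst_cat, Bits.snd_cat, one_mul]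
    rw [Fintype.sum_unique, Fintype.sum_unique]
    by_cases hne : C = C'
    · rw [ind_of_not (not_not.2 hne), zero_mul]
      exact mul_nonneg (ind_nonneg _) (expect_nonneg' fun _ => ind_nonneg _)
    · have hp : ind ((∀ q ∈ [(C, S.sign n id (S.gen n id gS).2 C (cS 0))], q.1 ∈ S.msgs n) ∧
          C' ∈ S.msgs n ∧ ∀ q ∈ [(C, S.sign n id (S.gen n id gS).2 C (cS 0))], C' ≠ q.1) = 1 :=
        ind_of ⟨by simpa using hC, hC', by simpa using Ne.symm hne⟩
      rw [ind_of hne, hp, one_mul, one_mul]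
      refine expect_le fun c' => ?_
      by_cases heq : S.sign n id (S.gen n id gS).2 C (cS 0) =
          S.sign n id (S.gen n id gS).2 C' c'
      · rw [heq]
        have : ∀ v, ind (S.verify n id (S.gen n id gS).1 C'
            (S.sign n id (S.gen n id gS).2 C' c') v = true) = 1 := fun v =>
          ind_of (hS n id gS C' hC' c' v)
        simp only [this, Fintype.expect_const]
        exact ind_le_one _
      · rw [ind_of_not heq]
        exact expect_nonneg' fun _ => ind_nonneg _

/-- The finder with a fixed output. -/
theorem exists_constant_finder (hD : ReductionCost S H n D) {m m' : Bits (H.msgLen n)}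
    {r r' : Bits (H.rndLen n)} (hr : H.isRnd n r = true)
    (hr' : H.isRnd n r' = true) :
    ∃ B : H.CollisionFinder n, B.size ≤ 30 * (50 * D ^ 2) ^ 2 ∧
      ind (m ≠ m') *
          𝔼 gH, ind (H.hash n (H.gen n gH).1 m r = H.hash n (H.gen n gH).1 m' r') ≤
        H.collisionProb n B := by
  classical
  let code : List (QInstr 0 0 0 0 0) := []
  let start : Bits (H.keyLen n) → Fin 0 ⊕ Empty → Bool := fun _ => Sum.elim finZeroElim Empty.elim
  let orc : ℕ → (Empty → Bool) → (Fin (0 + 1) → Bits 0) → Bits 0 → Bits 0 := fun _ _ _ x => x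
  let resp : ℕ → (Empty → Bool) → (Fin (0 + 1) → Bits 0) → Bits 0 := fun _ _ _ => finZeroElim
  let fin : (Empty → Bool) → (Fin (0 + 1) → Bits 0) → Bits 0 →
      Bits ((H.msgLen n + H.rndLen n) + (H.msgLen n + H.rndLen n)) := fun _ _ _ =>
    Bits.cat (Bits.cat m r) (Bits.cat m' r')
  have hstart : Computes (fun _ => id : _ → Bits 0 → Bits 0) (bits id) (bits start) 1 := by
    refine Computes.of_subset ?_
    rintro _ ⟨k | p, rfl⟩
    · exact k.elim0
    · exact p.elim
  have horc : ∀ j, Computes (fun _ => id : _ → Bits 0 → Bits 0)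
      (simInputs 0 0 Empty (Fin 0)) (bits fun ω => orc j ω.1 ω.2.1 ω.2.2) 1 := by
    refine fun j => Computes.of_subset ?_
    rintro _ ⟨k, rfl⟩
    exact k.elim0
  have hresp : ∀ j, Computes (fun _ => id : _ → Bits 0 → Bits 0)
      (simInputs 0 0 Empty (Fin 0)) (bits fun ω => resp j ω.1 ω.2.1) 1 := by
    refine fun j => Computes.of_subset ?_
    rintro _ ⟨k, rfl⟩
    exact k.elim0
  have hfin : Computes (fun _ => id : _ → Bits 0 → Bits 0)
      (simInputs 0 0 Empty (Fin 0)) (bits fun ω => fin ω.1 ω.2.1 ω.2.2) 1 := Computes.const_bits _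
  obtain ⟨B, hsize, hBcalls, hB⟩ := exists_simulator code (by simp [code]) start hstart orc resp horc
    hresp fin hfin (fun _ => (Function.Embedding.ofIsEmpty : Fin 0 ↪ Empty))
    (fun _ => (Function.Embedding.ofIsEmpty : Fin 0 ↪ Empty))
  refine ⟨B, hsize.trans ?_, ?_⟩
  · have h1 := hD.keyLen_le
    have h2 := hD.msgLen_le
    have h3 := hD.rndLen_le
    have hD1 := hD.one_le
    have hDD : D ≤ D ^ 2 := by nlinarith
    have hlen : code.length = 0 := rfl
    have hT : Fintype.card Empty = 0 := rfl
    have hX : 50 * D ^ 2 ≤ (50 * D ^ 2) ^ 2 := Nat.le_self_pow two_ne_zero _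
    rw [hlen]
    omega
  · rw [collisionProb_eq_expect_detRun (q := 0) B (hBcalls.le.trans (by simp [code])),
      Finset.mul_expect]
    refine expect_mono fun gH => ?_
    have h1 := hB (fun _ M => M) (H.gen n gH).1 (fun _ out =>
      ind (H.isRnd n out.fst.snd = true ∧ H.isRnd n out.snd.snd = true ∧
          (out.fst.fst, out.fst.snd) ≠ (out.snd.fst, out.snd.snd) ∧
          H.hash n (H.gen n gH).1 out.fst.fst out.fst.snd =
            H.hash n (H.gen n gH).1 out.snd.fst out.snd.snd))
      (fun _ => Empty.elim) (Subsingleton.elim _ _) (fun j => Subsingleton.elim _ _)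
    rw [show detRun id (fun _ M => M) _ B.code 0 []
      (QState.basis (Bits.load B.input (H.gen n gH).1)) = _ from h1]
    have hrun : ∀ ρ z, ‖(initRec (fun k => start (H.gen n gH).1 (.inl k)) :
        (Fin (0 + 1) → Bits 0) → QState 0) ρ z‖ ^ 2 = 1 := by
      intro ρ z
      rw [initRec, Subsingleton.elim ρ (fun _ _ => false), Pi.single_eq_same, QState.basis,
        Subsingleton.elim z (fun k => start (H.gen n gH).1 (.inl k)), Pi.single_eq_same]
      simp
    simp only [code, recRun, hrun, fin, Bits.fst_cat, Bits.snd_cat, one_mul]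
    rw [Fintype.sum_unique, Fintype.sum_unique]
    rw [← ind_and]
    exact ind_mono fun h => ⟨hr, hr', fun h' => h.1 (Prod.ext_iff.1 h').1, h.2⟩

theorem uniformRange_nonneg (H : ChameleonAlgs ℓ) (n : ℕ) (y : Bits (ℓ n)) :
    0 ≤ H.uniformRange n y := div_nonneg (ind_nonneg _) (Nat.cast_nonneg _)

theorem uniformRange_le_one (H : ChameleonAlgs ℓ) (n : ℕ) (y : Bits (ℓ n)) :
    H.uniformRange n y ≤ 1 := by
  rw [ChameleonAlgs.uniformRange]
  rcases Nat.eq_zero_or_pos (H.range n).ncard with h | h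
  · rw [h]; simp
  · refine div_le_one_of_le₀ ((ind_le_one _).trans ?_) (Nat.cast_nonneg _)
    exact_mod_cast h

/-- Random elements of the range rarely agree. -/
theorem expect_range_collision_le (hD : ReductionCost S H n D)
    (hrnd : ∀ c, H.isRnd n (H.sampleRnd n c) = true) {ε₁ ε₃ : ℝ}
    (hrange : statDist (fun y => 𝔼 c, ind (H.sampleRange n c = y)) (H.uniformRange n) ≤ ε₁)
    (hunif : ∀ m, 𝔼 g, H.hashDist n g m ≤ 2 * ε₃) :
    ∃ B : H.CollisionFinder n, B.size ≤ 30 * (50 * D ^ 2) ^ 2 ∧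
      𝔼 c, 𝔼 c', ind (H.sampleRange n c = H.sampleRange n c') ≤
        H.collisionProb n B + ((2 : ℝ) ^ H.msgLen n)⁻¹ + 4 * ε₁ + 4 * ε₃ := by
  classical
  obtain ⟨m, m', hmm⟩ : ∃ m m' : Bits (H.msgLen n), ind (m = m') ≤ ((2 : ℝ) ^ H.msgLen n)⁻¹ := by
    rcases Nat.eq_zero_or_pos (H.msgLen n) with h | h
    · refine ⟨fun _ => false, fun _ => false, (ind_le_one _).trans ?_⟩
      rw [h]; simp
    · refine ⟨fun _ => false, fun _ => true, ?_⟩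
      rw [ind_of_not fun h' => Bool.false_ne_true (congrFun h' ⟨0, h⟩)]
      positivity
  obtain ⟨⟨c, c'⟩, hcc⟩ := exists_expect_le fun p : Bits (H.rndCoins n) × Bits (H.rndCoins n) =>
    𝔼 gH, ind (H.hash n (H.gen n gH).1 m (H.sampleRnd n p.1) =
      H.hash n (H.gen n gH).1 m' (H.sampleRnd n p.2))
  obtain ⟨B, hsize, hB⟩ := exists_constant_finder hD (m := m) (m' := m') (hrnd c) (hrnd c')
  refine ⟨B, hsize, ?_⟩
  have hP : ∑ y, |(𝔼 c, ind (H.sampleRange n c = y)) - H.uniformRange n y| ≤ 2 * ε₁ := by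
    rw [sum_abs_eq_statDist]; linarith
  have hg : ∀ g, 𝔼 c, 𝔼 c', ind (H.sampleRange n c = H.sampleRange n c') ≤
      𝔼 c, 𝔼 c', ind (H.hash n (H.gen n g).1 m (H.sampleRnd n c) =
        H.hash n (H.gen n g).1 m' (H.sampleRnd n c')) +
      (4 * ε₁ + H.hashDist n g m + H.hashDist n g m') := by
    intro g
    have h1 : 𝔼 c, 𝔼 c', ind (H.sampleRange n c = H.sampleRange n c') =
        ∑ y, (𝔼 c, ind (H.sampleRange n c = y)) * 𝔼 c', ind (H.sampleRange n c' = y) := by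
      rw [expect_eq_sum_weights (H.sampleRange n)
        fun y => 𝔼 c', ind (y = H.sampleRange n c')]
      simp only [eq_comm]
    have h2 := sum_sub_mul_le (fun y => 𝔼 c, ind (H.sampleRange n c = y)) (H.uniformRange n)
      (fun y => 𝔼 c', ind (H.sampleRange n c' = y)) (fun _ => expect_nonneg' fun _ => ind_nonneg _)
      (fun _ => expect_le fun _ => ind_le_one _)
    have h3 := sum_sub_mul_le (fun y => 𝔼 c, ind (H.sampleRange n c = y)) (H.uniformRange n)
      (H.uniformRange n) (uniformRange_nonneg H n) (uniformRange_le_one H n)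
    have h4 := sum_sub_mul_le (H.uniformRange n)
      (fun y => 𝔼 c, ind (H.hash n (H.gen n g).1 m (H.sampleRnd n c) = y))
      (H.uniformRange n) (uniformRange_nonneg H n) (uniformRange_le_one H n)
    have h5 := sum_sub_mul_le (H.uniformRange n)
      (fun y => 𝔼 c, ind (H.hash n (H.gen n g).1 m' (H.sampleRnd n c) = y))
      (fun y => 𝔼 c, ind (H.hash n (H.gen n g).1 m (H.sampleRnd n c) = y))
      (fun _ => expect_nonneg' fun _ => ind_nonneg _) (fun _ => expect_le fun _ => ind_le_one _)
    have h6 : 𝔼 c, 𝔼 c', ind (H.hash n (H.gen n g).1 m (H.sampleRnd n c) =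
        H.hash n (H.gen n g).1 m' (H.sampleRnd n c')) =
        ∑ y, (𝔼 c, ind (H.hash n (H.gen n g).1 m (H.sampleRnd n c) = y)) *
          𝔼 c', ind (H.hash n (H.gen n g).1 m' (H.sampleRnd n c') = y) := by
      rw [expect_eq_sum_weights (fun c => H.hash n (H.gen n g).1 m (H.sampleRnd n c))
        fun y => 𝔼 c', ind (y = H.hash n (H.gen n g).1 m' (H.sampleRnd n c'))]
      simp only [eq_comm]
    simp only [ChameleonAlgs.hashDist]
    simp only [mul_comm (H.uniformRange n _)] at h2 h3 h4 h5
    simp only [mul_comm (𝔼 c, ind (H.hash n (H.gen n g).1 m' (H.sampleRnd n c) = _))] at h5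
    rw [h1, h6]
    linarith
  have havg : 𝔼 c, 𝔼 c', ind (H.sampleRange n c = H.sampleRange n c') ≤
      𝔼 g, 𝔼 c, 𝔼 c', ind (H.hash n (H.gen n g).1 m (H.sampleRnd n c) =
        H.hash n (H.gen n g).1 m' (H.sampleRnd n c')) + (4 * ε₁ + 4 * ε₃) := by
    rw [← Fintype.expect_const (ι := Bits (H.genCoins n))
      (𝔼 c, 𝔼 c', ind (H.sampleRange n c = H.sampleRange n c'))]
    refine (expect_mono hg).trans ?_
    simp only [Finset.expect_add_distrib, Fintype.expect_const]
    linarith [hunif m, hunif m']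
  have hswap : 𝔼 g, 𝔼 c, 𝔼 c', ind (H.hash n (H.gen n g).1 m (H.sampleRnd n c) =
        H.hash n (H.gen n g).1 m' (H.sampleRnd n c')) ≤
      𝔼 g, ind (H.hash n (H.gen n g).1 m (H.sampleRnd n c) =
        H.hash n (H.gen n g).1 m' (H.sampleRnd n c')) := by
    refine le_trans (le_of_eq ?_) hcc
    rw [expect_prod, Finset.expect_comm]
    exact Finset.expect_congr rfl fun c _ => Finset.expect_comm _ _ _
  have hlast : 𝔼 g, ind (H.hash n (H.gen n g).1 m (H.sampleRnd n c) =
        H.hash n (H.gen n g).1 m' (H.sampleRnd n c')) ≤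
      H.collisionProb n B + ((2 : ℝ) ^ H.msgLen n)⁻¹ := by
    have h1 : 𝔼 g, ind (H.hash n (H.gen n g).1 m (H.sampleRnd n c) =
        H.hash n (H.gen n g).1 m' (H.sampleRnd n c')) ≤ 1 := expect_le fun _ => ind_le_one _
    by_cases h : m = m'
    · rw [ind_of h] at hmm
      rw [ind_of_not (not_not.2 h), zero_mul] at hB
      linarith
    · rw [ind_of h, one_mul] at hB
      rw [ind_of_not h] at hmm
      linarith
  linarith

/-- Signatures on random elements of the range rarely agree. -/
theorem expect_sigCollision_le (hS : S.Correct) (hD : ReductionCost S H n D)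
    (hsr : ∀ c, H.sampleRange n c ∈ S.msgs n) :
    ∃ B : QCircuit 0 0 (ℓ n) (S.sigLen n) (S.pkLen n) (ℓ n + S.sigLen n),
      B.size ≤ 30 * (3 * D ^ 2) ^ 2 ∧
      𝔼 gS, sigCollision S H n gS ≤ S.winProb n (fun tr M _ => ∀ q ∈ tr, M ≠ q.1) B +
        𝔼 c, 𝔼 c', ind (H.sampleRange n c = H.sampleRange n c') := by
  classical
  let f : Bits (H.rangeCoins n) × Bits (H.rangeCoins n) → ℝ := fun p =>
    ind (H.sampleRange n p.1 ≠ H.sampleRange n p.2) *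
      𝔼 gS, 𝔼 c, 𝔼 c', ind (S.sign n id (S.gen n id gS).2 (H.sampleRange n p.1) c =
        S.sign n id (S.gen n id gS).2 (H.sampleRange n p.2) c')
  obtain ⟨p, hp⟩ := exists_expect_le f
  obtain ⟨B, hsize, hB⟩ := exists_replay_forger hS hD (hsr p.1) (hsr p.2)
  refine ⟨B, hsize, ?_⟩
  have h1 : ∀ gS, sigCollision S H n gS = 𝔼 x, 𝔼 x', 𝔼 c, 𝔼 c',
      ind (S.sign n id (S.gen n id gS).2 (H.sampleRange n x) c =
        S.sign n id (S.gen n id gS).2 (H.sampleRange n x') c') := by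
    intro gS
    simp only [sigCollision, coinSig, expect_cat, Bits.fst_cat, Bits.snd_cat, Fintype.expect_const]
    exact Finset.expect_congr rfl fun x _ => Finset.expect_comm _ _ _
  have h2 : 𝔼 gS, sigCollision S H n gS = 𝔼 x, 𝔼 x', 𝔼 gS, 𝔼 c, 𝔼 c',
      ind (S.sign n id (S.gen n id gS).2 (H.sampleRange n x) c =
        S.sign n id (S.gen n id gS).2 (H.sampleRange n x') c') := by
    simp only [h1]
    rw [Finset.expect_comm]
    exact Finset.expect_congr rfl fun x _ => Finset.expect_comm _ _ _
  have h3 : ∀ x x', 𝔼 gS, 𝔼 c, 𝔼 c', ind (S.sign n id (S.gen n id gS).2 (H.sampleRange n x) c =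
        S.sign n id (S.gen n id gS).2 (H.sampleRange n x') c') ≤
      f (x, x') + ind (H.sampleRange n x = H.sampleRange n x') := by
    intro x x'
    simp only [f]
    by_cases h : H.sampleRange n x = H.sampleRange n x'
    · rw [ind_of h, ind_of_not (not_not.2 h), zero_mul, zero_add]
      exact expect_le fun _ => expect_le fun _ => expect_le fun _ => ind_le_one _
    · rw [ind_of_not h, ind_of h, one_mul, add_zero]
  rw [h2]
  refine (expect_mono fun x => expect_mono fun x' => h3 x x').trans ?_
  simp only [Finset.expect_add_distrib]
  rw [← expect_prod f]
  exact add_le_add (hp.trans hB) le_rfl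

end Guess

/-! ### The chosen message attack on the transformed scheme -/

section Average

variable {α β : Type} [Fintype α] [Fintype β]

theorem exists_expect_comm_le [Nonempty β] (f : α → β → ℝ) :
    ∃ y, 𝔼 x, 𝔼 y, f x y ≤ 𝔼 x, f x y := by
  rw [Finset.expect_comm]
  exact exists_expect_le fun y => 𝔼 x, f x y

/-- A `2 L + 1`-wise independent family replaces the random function of a run of length `L`. -/
theorem IsIndependentFamily.expect_value {X Y Ξ : Type} [Fintype X] [DecidableEq X] [Fintype Y]
    [Fintype Ξ] {fam : Ξ → X → Y} {w a b e d q : ℕ} {l : List (QInstr w a b e d)}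
    (hfam : IsIndependentFamily (2 * l.length + 1) fam) (z₀ : Bits w)
    {orc : (X → Y) → ℕ → (Fin (q + 1) → Bits e) → Bits a → Bits b}
    {resp : (X → Y) → ℕ → (Fin (q + 1) → Bits e) → Bits d}
    {pay : (X → Y) → (Fin (q + 1) → Bits e) → Bits w → ℝ}
    (horc : ∀ j ρ x, ∃ (p : X) (g : Y → Bits b), ∀ O, orc O j ρ x = g (O p))
    (hresp : ∀ j ρ, ∃ (p : X) (g : Y → Bits d), ∀ O, resp O j ρ = g (O p))
    (hpay : ∀ ρ z, ∃ (p : X) (g : Y → ℝ), ∀ O, pay O ρ z = g (O p)) :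
    𝔼 O, value l z₀ (orc O) (resp O) (pay O) =
      𝔼 ξ, value l z₀ (orc (fam ξ)) (resp (fam ξ)) (pay (fam ξ)) := by
  have h := hfam _ (value_mem_localFns orc resp horc hresp l z₀ pay hpay)
  rw [← Complex.ofReal_expect, ← Complex.ofReal_expect] at h
  exact_mod_cast h

end Average

section Attack

variable {ℓ : ℕ → ℕ} {S : PlainSigAlgs ℓ} {H : ChameleonAlgs ℓ} {n q D : ℕ}

/-- Payoff of a forgery whose hash value has not been signed. -/
noncomputable def newPay {μ : ℕ} (pk : Bits (S.pkLen n)) (h : Bits (H.keyLen n)) (nc : ℕ)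
    (C : Fin (q + 1) → Bits (ℓ n)) (O : Bits (μ + S.sigLen n) → Bits (H.msgLen n))
    (out : Bits (μ + (S.sigLen n + H.rndLen n))) : ℝ :=
  ind (H.isRnd n out.snd.snd = true ∧
      ∀ i < nc, H.hash n h (O (forgeryPoint out)) out.snd.snd ≠ C (ix i)) *
    𝔼 v, ind (S.verify n id pk (H.hash n h (O (forgeryPoint out)) out.snd.snd) out.snd.fst v = true)

theorem newPay_nonneg {μ : ℕ} (pk : Bits (S.pkLen n)) (h : Bits (H.keyLen n)) (nc : ℕ)
    (C : Fin (q + 1) → Bits (ℓ n)) (O : Bits (μ + S.sigLen n) → Bits (H.msgLen n))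
    (out : Bits (μ + (S.sigLen n + H.rndLen n))) : 0 ≤ newPay pk h nc C O out :=
  mul_nonneg (ind_nonneg _) (expect_nonneg' fun _ => ind_nonneg _)

/-- Probability that the forger reaches a forgery whose hash value has not been signed. -/
noncomputable def newValue {μ : ℕ}
    (A : QCircuit (μ + S.sigLen n) (H.msgLen n) μ (S.sigLen n + H.rndLen n)
      (S.pkLen n + H.keyLen n) (μ + (S.sigLen n + H.rndLen n)))
    (gS : Bits (S.genCoins n)) (gH : Bits (H.genCoins n))
    (c : Fin (q + 1) → Bits (H.rangeCoins n + S.signCoins n + H.invCoins n))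
    (O : Bits (μ + S.sigLen n) → Bits (H.msgLen n)) : ℝ :=
  value A.code (Bits.load A.input (Bits.cat (S.gen n id gS).1 (H.gen n gH).1)) (fun _ _ => O)
    (oracleResp (fun i => coinSig S H n gS (c i)) (fun i => coinInv S H n gH (c i)) O)
    (fun _ z => newPay (S.gen n id gS).1 (H.gen n gH).1 (callTotal A.code)
      (fun i => H.sampleRange n (c i).fst.fst) O (z ∘ A.output))

/-- Probability that the forger reaches a forgery with the hash value of a signed message. -/
noncomputable def reuseValue {μ : ℕ}
    (A : QCircuit (μ + S.sigLen n) (H.msgLen n) μ (S.sigLen n + H.rndLen n)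
      (S.pkLen n + H.keyLen n) (μ + (S.sigLen n + H.rndLen n)))
    (gS : Bits (S.genCoins n)) (gH : Bits (H.genCoins n))
    (c : Fin (q + 1) → Bits (H.rangeCoins n + S.signCoins n + H.invCoins n))
    (O : Bits (μ + S.sigLen n) → Bits (H.msgLen n)) : ℝ :=
  value A.code (Bits.load A.input (Bits.cat (S.gen n id gS).1 (H.gen n gH).1)) (fun _ _ => O)
    (oracleResp (fun i => coinSig S H n gS (c i)) (fun i => coinInv S H n gH (c i)) O)
    (fun ρ z => reusePay (H.gen n gH).1 (callTotal A.code) (fun i => coinSig S H n gS (c i))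
      (fun i => H.sampleRange n (c i).fst.fst) (z ∘ A.output) ρ (O (forgeryPoint (z ∘ A.output)))
      fun i => coinInv S H n gH (c i) (O (points (fun i => coinSig S H n gS (c i)) ρ i)))

theorem expected_le_newValue_add_reuseValue {μ : ℕ}
    (A : QCircuit (μ + S.sigLen n) (H.msgLen n) μ (S.sigLen n + H.rndLen n)
      (S.pkLen n + H.keyLen n) (μ + (S.sigLen n + H.rndLen n)))
    (hcalls : callTotal A.code ≤ q + 1) (O : Bits (μ + S.sigLen n) → Bits (H.msgLen n))
    (gS : Bits (S.genCoins n)) (gH : Bits (H.genCoins n)) :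
    A.expected O (fun c M => Bits.cat (coinSig S H n gS c)
          (coinInv S H n gH c (O (Bits.cat M (coinSig S H n gS c)))))
        (Bits.cat (S.gen n id gS).1 (H.gen n gH).1)
        (fun tr out => ind (∀ q ∈ tr, (out.fst, out.snd) ≠ q) *
          𝔼 v, ind ((H.isRnd n out.snd.snd && S.verify n id (S.gen n id gS).1
            (H.hash n (H.gen n gH).1 (O (forgeryPoint out)) out.snd.snd) out.snd.fst v) = true)) ≤
      𝔼 c : Fin (q + 1) → Bits (H.rangeCoins n + S.signCoins n + H.invCoins n),
        (newValue A gS gH c O + reuseValue A gS gH c O) := by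
  classical
  rw [QCircuit.expected, runProb_eq_expect_detRun (q := q) _ _ _ _ 0 (by omega) _ _]
  refine expect_mono fun c => ?_
  rw [detRun_eq_recRun (q := q) _ _ _ _ hcalls _, newValue, reuseValue, ← value_add]
  refine value_mono _ _ fun ρ z => ?_
  obtain ⟨out, hout⟩ : ∃ out : Bits (μ + (S.sigLen n + H.rndLen n)), z ∘ A.output = out := ⟨_, rfl⟩
  rw [hout]
  by_cases hr : H.isRnd n out.snd.snd = true
  swap
  · have h0 : ∀ v, ind ((H.isRnd n out.snd.snd && S.verify n id (S.gen n id gS).1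
        (H.hash n (H.gen n gH).1 (O (forgeryPoint out)) out.snd.snd) out.snd.fst v) = true) = 0 :=
      fun v => ind_of_not fun h => hr (Bool.and_eq_true_iff.1 h).1
    simp only [h0, Fintype.expect_const, mul_zero]
    exact add_nonneg (newPay_nonneg _ _ _ _ _ _) (ind_nonneg _)
  have hverify : ∀ v, ((H.isRnd n out.snd.snd && S.verify n id (S.gen n id gS).1
        (H.hash n (H.gen n gH).1 (O (forgeryPoint out)) out.snd.snd) out.snd.fst v) = true) =
      (S.verify n id (S.gen n id gS).1
        (H.hash n (H.gen n gH).1 (O (forgeryPoint out)) out.snd.snd) out.snd.fst v = true) := by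
    intro v
    rw [hr, Bool.true_and]
  simp only [hverify]
  by_cases hC : ∀ i < callTotal A.code, H.hash n (H.gen n gH).1 (O (forgeryPoint out))
      out.snd.snd ≠ H.sampleRange n (c (ix i)).fst.fst
  · refine le_add_of_le_of_nonneg ?_ (ind_nonneg _)
    exact mul_le_mul_of_nonneg_right ((ind_le_one _).trans (ind_of ⟨hr, hC⟩).ge)
      (expect_nonneg' fun _ => ind_nonneg _)
  · refine le_add_of_nonneg_of_le (newPay_nonneg _ _ _ _ _ _) ?_
    refine (mul_le_of_le_one_right (ind_nonneg _) (expect_le fun _ => ind_le_one _)).trans ?_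
    push Not at hC
    obtain ⟨i, hi, hiC⟩ := hC
    refine ind_mono fun h => ⟨fun i hi => h _ ?_, hr, ix i, ?_, hiC⟩
    · exact List.mem_map.2 ⟨i, List.mem_range.2 hi, rfl⟩
    · rwa [Fin.val_ofNat, Nat.mod_eq_of_lt (by omega)]

/-- A forgery has a new hash value or reuses the hash value of a signed message. -/
theorem TOO_winProb_le (μ : ℕ → ℕ)
    (A : QCircuit (μ n + S.sigLen n) (H.msgLen n) (μ n) (S.sigLen n + H.rndLen n)
      (S.pkLen n + H.keyLen n) (μ n + (S.sigLen n + H.rndLen n)))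
    (hcalls : callTotal A.code ≤ q + 1) :
    (TOO S H μ).winProb n (fun tr M σ => ∀ q ∈ tr, (M, σ) ≠ q) A ≤
      𝔼 gS, 𝔼 gH, 𝔼 c : Fin (q + 1) → _, 𝔼 O, newValue A gS gH c O +
      𝔼 gS, 𝔼 gH, 𝔼 c : Fin (q + 1) → _, 𝔼 O, reuseValue A gS gH c O := by
  classical
  simp only [← Finset.expect_add_distrib]
  have hreorder : ∀ f : (Bits (μ n + S.sigLen n) → Bits (H.msgLen n)) → Bits (S.genCoins n) →
      Bits (H.genCoins n) →
      (Fin (q + 1) → Bits (H.rangeCoins n + S.signCoins n + H.invCoins n)) → ℝ,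
      𝔼 O, 𝔼 gS, 𝔼 gH, 𝔼 c, f O gS gH c = 𝔼 gS, 𝔼 gH, 𝔼 c, 𝔼 O, f O gS gH c := by
    intro f
    refine (Finset.expect_comm _ _ _).trans (Finset.expect_congr rfl fun gS _ => ?_)
    refine (Finset.expect_comm _ _ _).trans (Finset.expect_congr rfl fun gH _ => ?_)
    exact Finset.expect_comm _ _ _
  rw [← hreorder fun O gS gH c => newValue A gS gH c O + reuseValue A gS gH c O]
  refine expect_mono fun O => ?_
  refine (expect_cat (m := S.genCoins n) (n := H.genCoins n) _).le.trans ?_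
  refine expect_mono fun gS => expect_mono fun gH => ?_
  have hgen : (TOO S H μ).gen n O (Bits.cat gS gH) =
      (Bits.cat (S.gen n id gS).1 (H.gen n gH).1, Bits.cat (S.gen n id gS).2 (H.gen n gH).2) := by
    simp only [TOO, Bits.fst_cat, Bits.snd_cat]
  rw [hgen]
  refine le_trans (le_of_eq ?_) (expected_le_newValue_add_reuseValue A hcalls O gS gH)
  simp only [TOO, coinSig, coinInv, forgeryPoint, Bits.fst_cat, Bits.snd_cat, Set.mem_univ,
    implies_true, true_and]
  rfl

/-- Forgeries with new hash values break the original scheme. -/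
theorem exists_forger_newValue_le {μ : ℕ} (hD : ReductionCost S H n D)
    (hmem : ∀ g m r, H.isRnd n r = true → H.hash n (H.gen n g).1 m r ∈ S.msgs n)
    (hsr : ∀ c, H.sampleRange n c ∈ S.msgs n)
    (A : QCircuit (μ + S.sigLen n) (H.msgLen n) μ (S.sigLen n + H.rndLen n)
      (S.pkLen n + H.keyLen n) (μ + (S.sigLen n + H.rndLen n)))
    (hcalls : callTotal A.code ≤ q + 1) (hA : A.size ≤ D) (hμ : μ ≤ D) (hq : q + 1 ≤ D)
    (hfam : (2 * A.code.length + 1) * (20 * (μ + S.sigLen n + H.msgLen n + 1) ^ 3) ≤ D) :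
    ∃ B : QCircuit 0 0 (ℓ n) (S.sigLen n) (S.pkLen n) (ℓ n + S.sigLen n),
      B.size ≤ 30 * (3 * D ^ 2) ^ 2 ∧
      𝔼 gS, 𝔼 gH, 𝔼 c : Fin (q + 1) → _, 𝔼 O, newValue A gS gH c O ≤
        S.winProb n (fun tr M _ => ∀ q ∈ tr, M ≠ q.1) B := by
  classical
  obtain ⟨Ξ, _, _, fam, hind, hcost⟩ := exists_independentFamily (2 * A.code.length + 1)
    (μ + S.sigLen n) (H.msgLen n)
  have hswap : ∀ gS gH (c : Fin (q + 1) → _),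
      𝔼 O, newValue A gS gH c O = 𝔼 ξ, newValue A gS gH c (fam ξ) := by
    intro gS gH c
    refine hind.expect_value _ (fun j ρ x => ⟨x, id, fun O => rfl⟩) (fun j ρ => ?_) fun ρ z => ?_
    · exact ⟨points (fun i => coinSig S H n gS (c i)) ρ (ix j), fun v =>
        Bits.cat (coinSig S H n gS (c (ix j))) (coinInv S H n gH (c (ix j)) v), fun O => rfl⟩
    · exact ⟨forgeryPoint (z ∘ A.output), fun v => newPay (S.gen n id gS).1 (H.gen n gH).1
        (callTotal A.code) (fun i => H.sampleRange n (c i).fst.fst) (fun _ => v) (z ∘ A.output),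
        fun O => rfl⟩
  simp only [hswap]
  let V : Bits (S.genCoins n) → Bits (H.genCoins n) → (Fin (q + 1) → Bits (H.rangeCoins n)) →
      (Fin (q + 1) → Bits (S.signCoins n)) → (Fin (q + 1) → Bits (H.invCoins n)) → Ξ → ℝ :=
    fun gS gH cC cS cI ξ =>
      newValue A gS gH (fun i => Bits.cat (Bits.cat (cC i) (cS i)) (cI i)) (fam ξ)
  have hV : ∀ gS gH, 𝔼 c : Fin (q + 1) → _, 𝔼 ξ, newValue A gS gH c (fam ξ) =
      𝔼 cC, 𝔼 cS, 𝔼 cI, 𝔼 ξ, V gS gH cC cS cI ξ := by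
    intro gS gH
    rw [expect_arrow_cat, expect_arrow_cat]
  simp only [hV]
  obtain ⟨gH, h1⟩ := exists_expect_comm_le fun gS gH => 𝔼 cC, 𝔼 cS, 𝔼 cI, 𝔼 ξ, V gS gH cC cS cI ξ
  obtain ⟨cC, h2⟩ := exists_expect_comm_le fun gS cC => 𝔼 cS, 𝔼 cI, 𝔼 ξ, V gS gH cC cS cI ξ
  rw [← expect_prod fun p : Bits (S.genCoins n) × (Fin (q + 1) → Bits (S.signCoins n)) =>
    𝔼 cI, 𝔼 ξ, V p.1 gH cC p.2 cI ξ] at h2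
  obtain ⟨cI, h3⟩ := exists_expect_comm_le
    fun (p : Bits (S.genCoins n) × (Fin (q + 1) → Bits (S.signCoins n))) cI =>
      𝔼 ξ, V p.1 gH cC p.2 cI ξ
  obtain ⟨ξ, h4⟩ := exists_expect_comm_le
    fun (p : Bits (S.genCoins n) × (Fin (q + 1) → Bits (S.signCoins n))) ξ => V p.1 gH cC p.2 cI ξ
  have h5 := expect_prod fun p : Bits (S.genCoins n) × (Fin (q + 1) → Bits (S.signCoins n)) =>
    V p.1 gH cC p.2 cI ξ
  obtain ⟨B, hsize, hB⟩ := exists_forger hD hmem hsr A hcalls hA hμ hq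
    (Computes.mono (hcost ξ) subset_rfl subset_rfl hfam) gH cC cI
  refine ⟨B, hsize, h1.trans (h2.trans (h3.trans (h4.trans (h5.le.trans (le_trans (le_of_eq ?_) hB)))))⟩
  refine Finset.expect_congr rfl fun gS _ => Finset.expect_congr rfl fun cS _ => ?_
  have hI : ∀ i, coinInv S H n gH (Bits.cat (Bits.cat (cC i) (cS i)) (cI i)) =
      fun m => H.invert n (H.gen n gH).2 m (H.sampleRange n (cC i)) (cI i) := by
    intro i
    funext m
    simp only [coinInv, Bits.fst_cat, Bits.snd_cat]
  simp only [V, newValue, hI, coinSig, Bits.fst_cat, Bits.snd_cat, newPay]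

/-- Runs that reach a collision give collision finders. -/
theorem exists_finder_collValue_le {μ : ℕ} (hD : ReductionCost S H n D)
    (hrnd : ∀ c, H.isRnd n (H.sampleRnd n c) = true)
    (A : QCircuit (μ + S.sigLen n) (H.msgLen n) μ (S.sigLen n + H.rndLen n)
      (S.pkLen n + H.keyLen n) (μ + (S.sigLen n + H.rndLen n)))
    (hcalls : callTotal A.code ≤ q + 1) (hA : A.size ≤ D) (hμ : μ ≤ D) (hq : q + 1 ≤ D)
    (hfam : (2 * A.code.length + 1) * (20 * (μ + S.sigLen n + H.msgLen n + 1) ^ 3) ≤ D)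
    (l : Fin (q + 1)) :
    ∃ B : H.CollisionFinder n, B.size ≤ 30 * (50 * D ^ 2) ^ 2 ∧
      𝔼 gS, 𝔼 gH, 𝔼 cS : Fin (q + 1) → Bits (S.signCoins n),
        𝔼 u : Fin (q + 1) → Bits (H.msgLen n) × Bits (H.rndCoins n),
        𝔼 O' : Bits (μ + S.sigLen n) → Bits (H.msgLen n),
        𝔼 O : Bits (μ + S.sigLen n) → Bits (H.msgLen n),
        collValue A.code (Bits.load A.input (Bits.cat (S.gen n id gS).1 (H.gen n gH).1))
          (fun z => z ∘ A.output) gS (H.gen n gH).1 cS (fun i => (u i).1)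
          (fun i => H.sampleRnd n (u i).2) l O O' ≤
        H.collisionProb n B := by
  classical
  obtain ⟨Ξ, _, _, fam, hind, hcost⟩ := exists_independentFamily (2 * A.code.length + 1)
    (μ + S.sigLen n) (H.msgLen n)
  let V : Bits (S.genCoins n) → Bits (H.genCoins n) → (Fin (q + 1) → Bits (S.signCoins n)) →
      (Fin (q + 1) → Bits (H.msgLen n) × Bits (H.rndCoins n)) →
      (Bits (μ + S.sigLen n) → Bits (H.msgLen n)) → (Bits (μ + S.sigLen n) → Bits (H.msgLen n)) →
      ℝ := fun gS gH cS u O O' =>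
    collValue A.code (Bits.load A.input (Bits.cat (S.gen n id gS).1 (H.gen n gH).1))
      (fun z => z ∘ A.output) gS (H.gen n gH).1 cS (fun i => (u i).1)
      (fun i => H.sampleRnd n (u i).2) l O O'
  change ∃ B : H.CollisionFinder n, B.size ≤ 30 * (50 * D ^ 2) ^ 2 ∧
    𝔼 gS, 𝔼 gH, 𝔼 cS, 𝔼 u, 𝔼 O', 𝔼 O, V gS gH cS u O O' ≤ H.collisionProb n B
  have hswap : ∀ gS gH cS u O', 𝔼 O, V gS gH cS u O O' = 𝔼 ξ, V gS gH cS u (fam ξ) O' := by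
    intro gS gH cS u O'
    refine hind.expect_value _ (fun j ρ x => ?_) (fun j ρ => ?_) fun ρ z => ?_
    · refine ⟨x, fun v => progOracle (fun i => S.sign n id (S.gen n id gS).2
        (H.hash n (H.gen n gH).1 (u i).1 (H.sampleRnd n (u i).2)) (cS i)) (fun i => (u i).1)
        (fun _ => v) O' j ρ x, fun O => ?_⟩
      simp only [progOracle, hideOracle]
      rw [program_congr_point _ _ O (fun _ => O x) rfl]
    · exact ⟨fun _ => false, fun _ => _, fun O => rfl⟩
    · let pay : (Bits (μ + S.sigLen n) → Bits (H.msgLen n)) → ℝ := fun O =>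
        let out : Bits (μ + (S.sigLen n + H.rndLen n)) := z ∘ A.output
        let m' := program O (points (fun i => S.sign n id (S.gen n id gS).2
          (H.hash n (H.gen n gH).1 (u i).1 (H.sampleRnd n (u i).2)) (cS i)) ρ)
          (fun i => (u i).1) (q + 1) (forgeryPoint out)
        ind (H.isRnd n out.snd.snd = true ∧
          (m', out.snd.snd) ≠ ((u l).1, H.sampleRnd n (u l).2) ∧
          H.hash n (H.gen n gH).1 m' out.snd.snd =
            H.hash n (H.gen n gH).1 (u l).1 (H.sampleRnd n (u l).2))
      refine ⟨forgeryPoint (z ∘ A.output), fun v => pay fun _ => v, fun O => ?_⟩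
      change pay O = pay fun _ => O (forgeryPoint (z ∘ A.output))
      simp only [pay]
      rw [program_congr_point _ _ O (fun _ => O (forgeryPoint (z ∘ A.output))) rfl]
  have hswap' : ∀ gS gH cS u ξ, 𝔼 O', V gS gH cS u (fam ξ) O' =
      𝔼 ξ', V gS gH cS u (fam ξ) (fam ξ') := by
    intro gS gH cS u ξ
    refine hind.expect_value _ (fun j ρ x => ?_) (fun j ρ => ?_) fun ρ z => ?_
    · exact ⟨x, fun v => progOracle (fun i => S.sign n id (S.gen n id gS).2
        (H.hash n (H.gen n gH).1 (u i).1 (H.sampleRnd n (u i).2)) (cS i)) (fun i => (u i).1)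
        (fam ξ) (fun _ => v) j ρ x, fun O => rfl⟩
    · exact ⟨fun _ => false, fun _ => _, fun O => rfl⟩
    · exact ⟨fun _ => false, fun _ => _, fun O => rfl⟩
  have hboth : ∀ gS gH cS u, 𝔼 O', 𝔼 O, V gS gH cS u O O' =
      𝔼 ξ, 𝔼 ξ', V gS gH cS u (fam ξ) (fam ξ') := by
    intro gS gH cS u
    simp only [hswap]
    rw [Finset.expect_comm]
    simp only [hswap']
  simp only [hboth]
  obtain ⟨gS, h1⟩ := exists_expect_le fun gS =>
    𝔼 gH, 𝔼 cS, 𝔼 u, 𝔼 ξ, 𝔼 ξ', V gS gH cS u (fam ξ) (fam ξ')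
  obtain ⟨cS, h2⟩ := exists_expect_comm_le fun gH cS =>
    𝔼 u, 𝔼 ξ, 𝔼 ξ', V gS gH cS u (fam ξ) (fam ξ')
  obtain ⟨u, h3⟩ := exists_expect_comm_le fun gH u => 𝔼 ξ, 𝔼 ξ', V gS gH cS u (fam ξ) (fam ξ')
  obtain ⟨ξ, h4⟩ := exists_expect_comm_le fun gH ξ => 𝔼 ξ', V gS gH cS u (fam ξ) (fam ξ')
  obtain ⟨ξ', h5⟩ := exists_expect_comm_le fun gH ξ' => V gS gH cS u (fam ξ) (fam ξ')
  obtain ⟨B, hsize, hB⟩ := exists_finder hD A hcalls hA hμ hq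
    (Computes.mono (hcost ξ) subset_rfl subset_rfl hfam)
    (Computes.mono (hcost ξ') subset_rfl subset_rfl hfam) gS cS (fun i => (u i).1) (fun i => H.sampleRnd n (u i).2)
    (fun i => hrnd _) l
  exact ⟨B, hsize, h1.trans (h2.trans (h3.trans (h4.trans (h5.trans hB))))⟩

/-- Forgeries with the hash value of a signed message give collisions. -/
theorem exists_finder_reuseValue_le {μ : ℕ} (hD : ReductionCost S H n D)
    (hrnd : ∀ c, H.isRnd n (H.sampleRnd n c) = true) {ε₁ ε₂ ε₃ : ℝ}
    (hsr : ∀ c, H.sampleRange n c ∈ H.range n)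
    (hrange : statDist (fun y => 𝔼 c, ind (H.sampleRange n c = y)) (H.uniformRange n) ≤ ε₁)
    (hinv : ∀ g m, ∀ y ∈ H.range n,
      statDist (fun r => 𝔼 c, ind (H.invert n (H.gen n g).2 m y c = r))
        (fun r => (𝔼 c, ind (H.sampleRnd n c = r ∧ H.hash n (H.gen n g).1 m r = y)) /
          (𝔼 c, ind (H.hash n (H.gen n g).1 m (H.sampleRnd n c) = y))) ≤ ε₂)
    (hunif : ∀ m, 𝔼 g, H.hashDist n g m ≤ 2 * ε₃)
    (A : QCircuit (μ + S.sigLen n) (H.msgLen n) μ (S.sigLen n + H.rndLen n)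
      (S.pkLen n + H.keyLen n) (μ + (S.sigLen n + H.rndLen n)))
    (hcalls : callTotal A.code ≤ q + 1) (hA : A.size ≤ D) (hμ : μ ≤ D) (hq : q + 1 ≤ D)
    (hfam : (2 * A.code.length + 1) * (20 * (μ + S.sigLen n + H.msgLen n + 1) ^ 3) ≤ D) :
    ∃ B : H.CollisionFinder n, B.size ≤ 30 * (50 * D ^ 2) ^ 2 ∧
      𝔼 gS, 𝔼 gH, 𝔼 c : Fin (q + 1) → _, 𝔼 O, reuseValue A gS gH c O ≤
        (q + 1) * H.collisionProb n B +
        (q + 1) * ((q + 1) * ((2 : ℝ) ^ H.msgLen n)⁻¹ +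
          ((2 : ℝ) ^ H.msgLen n)⁻¹ * (2 + 2 * (2 * A.code.length) ^ 2)) +
        4 * A.code.length * √((q + 1) * √(𝔼 gS, sigCollision S H n gS)) +
        (q + 1) ^ 2 * 𝔼 gS, sigCollision S H n gS +
        (q + 1) * (2 * ε₂ + 2 * ε₁ + 2 * ε₃) := by
  classical
  let W : Fin (q + 1) → Bits (S.genCoins n) → Bits (H.genCoins n) → ℝ := fun l gS gH =>
    𝔼 cS : Fin (q + 1) → Bits (S.signCoins n),
      𝔼 u : Fin (q + 1) → Bits (H.msgLen n) × Bits (H.rndCoins n),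
      𝔼 O' : Bits (μ + S.sigLen n) → Bits (H.msgLen n),
      𝔼 O : Bits (μ + S.sigLen n) → Bits (H.msgLen n),
      collValue A.code (Bits.load A.input (Bits.cat (S.gen n id gS).1 (H.gen n gH).1))
        (fun z => z ∘ A.output) gS (H.gen n gH).1 cS (fun i => (u i).1)
        (fun i => H.sampleRnd n (u i).2) l O O'
  obtain ⟨l, -, hl⟩ := Finset.exists_max_image (Finset.univ : Finset (Fin (q + 1)))
    (fun l => 𝔼 gS, 𝔼 gH, W l gS gH) ⟨0, Finset.mem_univ _⟩
  obtain ⟨B, hsize, hB⟩ := exists_finder_collValue_le hD hrnd A hcalls hA hμ hq hfam l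
  refine ⟨B, hsize, ?_⟩
  set E : ℝ := (q + 1) * ((q + 1) * ((2 : ℝ) ^ H.msgLen n)⁻¹ +
    ((2 : ℝ) ^ H.msgLen n)⁻¹ * (2 + 2 * (2 * A.code.length) ^ 2)) with hE
  have hκ : ∀ gS, 0 ≤ sigCollision S H n gS := fun gS =>
    expect_nonneg' fun _ => expect_nonneg' fun _ => ind_nonneg _
  have hpoint : ∀ gS gH, 𝔼 c : Fin (q + 1) → _, 𝔼 O, reuseValue A gS gH c O ≤
      ∑ l, W l gS gH + E + (4 * A.code.length * √((q + 1) * √(sigCollision S H n gS)) +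
        (q + 1) ^ 2 * sigCollision S H n gS +
        (q + 1) * (2 * ε₂ + 2 * ε₁ + 𝔼 m, H.hashDist n gH m)) := fun gS gH =>
    (expect_reuse_le A.code _ _ hcalls gS gH
      (H.expect_invert_le n gH hsr hrange (hinv gH))).trans
      (add_le_add_left (expect_swapValue_le A.code _ _ gS _ _) _)
  have havg : 𝔼 gS, 𝔼 gH, 𝔼 c : Fin (q + 1) → _, 𝔼 O, reuseValue A gS gH c O ≤
      𝔼 gS, 𝔼 gH, (∑ l, W l gS gH + E +
        (4 * A.code.length * √((q + 1) * √(sigCollision S H n gS)) +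
        (q + 1) ^ 2 * sigCollision S H n gS +
        (q + 1) * (2 * ε₂ + 2 * ε₁ + 𝔼 m, H.hashDist n gH m))) :=
    expect_mono fun gS => expect_mono fun gH => hpoint gS gH
  simp only [Finset.expect_add_distrib, Fintype.expect_const, ← Finset.mul_expect,
    Finset.expect_sum_comm] at havg
  have h1 : ∑ l, 𝔼 gS, 𝔼 gH, W l gS gH ≤ (q + 1) * H.collisionProb n B := by
    refine (Finset.sum_le_card_nsmul _ _ _ fun l' hl' => (hl l' hl').trans hB).trans (le_of_eq ?_)
    simp
  have h2 : 𝔼 gS, √((q + 1) * √(sigCollision S H n gS)) ≤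
      √((q + 1) * √(𝔼 gS, sigCollision S H n gS)) := by
    refine (expect_sqrt_le fun gS => by positivity).trans (Real.sqrt_le_sqrt ?_)
    rw [← Finset.mul_expect]
    exact mul_le_mul_of_nonneg_left (expect_sqrt_le hκ) (by positivity)
  have h3 : 𝔼 gH, 𝔼 m, H.hashDist n gH m ≤ 2 * ε₃ := by
    rw [Finset.expect_comm]
    exact expect_le hunif
  have h4 := mul_le_mul_of_nonneg_left h2 (by positivity : (0 : ℝ) ≤ 4 * A.code.length)
  have h5 := mul_le_mul_of_nonneg_left h3 (by positivity : (0 : ℝ) ≤ q + 1)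
  linarith

end Attack

/-! ### Asymptotics -/

namespace Negligible

variable {f g : ℕ → ℝ}

theorem of_le (hg : Negligible g) (hf : ∀ n, 0 ≤ f n) (h : ∀ n, f n ≤ g n) : Negligible f :=
  Asymptotics.SuperpolynomialDecay.trans_abs_le hg fun n => by
    simpa [abs_of_nonneg (hf n)] using (h n).trans (le_abs_self _)

theorem add (hf : Negligible f) (hg : Negligible g) : Negligible fun n => f n + g n :=
  Asymptotics.SuperpolynomialDecay.add hf hg

theorem const_mul (hf : Negligible f) (c : ℝ) : Negligible fun n => c * f n :=
  Asymptotics.SuperpolynomialDecay.const_mul hf c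

theorem polyBounded_mul (hf : Negligible f) {p : ℕ → ℕ} (hp : PolyBounded p) :
    Negligible fun n => p n * f n := by
  obtain ⟨P, hP⟩ := hp
  have h := Asymptotics.SuperpolynomialDecay.polynomial_mul hf (P.map (Nat.castRingHom ℝ))
  refine Asymptotics.SuperpolynomialDecay.trans_abs_le h fun n => ?_
  simp only [abs_mul]
  refine mul_le_mul_of_nonneg_right ?_ (abs_nonneg _)
  have h1 : (P.map (Nat.castRingHom ℝ)).eval (n : ℝ) = (P.eval n : ℕ) := by
    simp
  rw [h1, Nat.abs_cast, Nat.abs_cast]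
  exact_mod_cast hP n

theorem sqrt (hf : Negligible f) (h0 : ∀ n, 0 ≤ f n) : Negligible fun n => √(f n) := by
  intro c
  have h := (Real.continuous_sqrt.tendsto 0).comp (hf (c * 2))
  rw [Real.sqrt_zero] at h
  refine h.congr fun n => ?_
  rw [Function.comp_apply, Real.sqrt_mul' _ (h0 n), pow_mul, Real.sqrt_sq (by positivity)]

end Negligible

theorem QCircuit.expected_nonneg {a b e d i o r : ℕ} (A : QCircuit a b e d i o)
    (O : Bits a → Bits b) (R : Bits r → Bits e → Bits d) (v : Bits i)
    {payoff : List (Bits e × Bits d) → Bits o → ℝ} (h : ∀ tr out, 0 ≤ payoff tr out) :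
    0 ≤ A.expected O R v payoff := by
  rw [QCircuit.expected, runProb_eq_expect_detRun (q := callTotal A.code) _ _ _ _ 0 (by omega) _ _]
  refine expect_nonneg' fun c => ?_
  rw [detRun_eq_recRun (q := callTotal A.code) _ _ _ _ (by omega) _]
  exact Finset.sum_nonneg fun _ _ => Finset.sum_nonneg fun _ _ => mul_nonneg (by positivity) (h _ _)

theorem SigAlgs.winProb_nonneg {a b ℓ : ℕ → ℕ} (S : SigAlgs a b ℓ) (n : ℕ)
    (fresh : List (Bits (ℓ n) × Bits (S.sigLen n)) → Bits (ℓ n) → Bits (S.sigLen n) → Prop)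
    (A : S.Forger n) : 0 ≤ S.winProb n fresh A :=
  expect_nonneg' fun _ => expect_nonneg' fun _ => A.expected_nonneg _ _ _ fun _ _ =>
    mul_nonneg (ind_nonneg _) (expect_nonneg' fun _ => ind_nonneg _)

/-- The sizes of the circuits of a scheme and of a hash family bound the cost of reductions. -/
theorem exists_reductionCost {ℓ : ℕ → ℕ} {S : PlainSigAlgs ℓ} {H : ChameleonAlgs ℓ}
    (hS : S.Efficient) (hH : H.Efficient) :
    ∃ E : ℕ → ℕ, PolyBounded E ∧ ∀ n D, E n ≤ D → ReductionCost S H n D := by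
  obtain ⟨⟨CG, hCG, _⟩, ⟨CS, hCS, hCS'⟩, _⟩ := hS
  obtain ⟨⟨CK, hCK, _⟩, ⟨CH, hCH, hCH'⟩, _, _, ⟨CI, hCI, hCI'⟩, _⟩ := hH
  refine ⟨fun n => (CG n).size + (CS n).size + (CK n).size + (CH n).size + (CI n).size + 1,
    ((((hCG.add hCS).add hCK).add hCH).add hCI).add (.const 1), fun n D hD => ?_⟩
  beta_reduce at hD
  have h1 := (CG n).output_le_size
  have h2 := (CS n).output_le_size
  have h3 := (CK n).output_le_size
  have h4 := (CH n).output_le_size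
  have h5 := (CH n).input_le_size
  have h6 := (CI n).output_le_size
  refine ⟨?_, ?_, ?_, by omega, by omega, by omega, by omega, by omega, by omega, by omega⟩
  · refine Computes.mono ((CS n).circuitBound fun v => ?_) subset_rfl subset_rfl
      (by omega : (CS n).size ≤ D)
    rw [← hCS', Bits.cat_fst_snd, Bits.cat_fst_snd]
  · refine Computes.mono ((CH n).circuitBound fun v => ?_) subset_rfl subset_rfl
      (by omega : (CH n).size ≤ D)
    rw [← hCH', Bits.cat_fst_snd, Bits.cat_fst_snd]
  · refine Computes.mono ((CI n).circuitBound fun v => ?_) subset_rfl subset_rfl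
      (by omega : (CI n).size ≤ D)
    rw [← hCI', Bits.cat_fst_snd, Bits.cat_fst_snd, Bits.cat_fst_snd]

theorem TOO_quantumSUACMA {ℓ μ : ℕ → ℕ} (hμ : PolyBounded μ) {S : PlainSigAlgs ℓ}
    (hS : S.IsScheme) {H : ChameleonAlgs ℓ} (hH : H.IsFamily)
    (hrange : ∀ n, H.range n ⊆ S.msgs n)
    (hmsg : Negligible (fun n => ((2 : ℝ) ^ H.msgLen n)⁻¹))
    (hSsec : S.QuantumEUACMA) (hHsec : H.QuantumCollisionResistant) :
    (TOO S H μ).QuantumSUACMA := by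
  intro A hA
  obtain ⟨hHeff, ⟨hrnd, hhash, hsr, hε₁⟩, ⟨_, ε₂, hε₂, hinv⟩, ⟨ε₃, hε₃, hunif⟩⟩ := hH
  obtain ⟨E, hE, hcost⟩ := exists_reductionCost hS.1 hHeff
  let A' : ∀ n, QCircuit (μ n + S.sigLen n) (H.msgLen n) (μ n) (S.sigLen n + H.rndLen n)
    (S.pkLen n + H.keyLen n) (μ n + (S.sigLen n + H.rndLen n)) := A
  let L : ℕ → ℕ := fun n => (A' n).code.length
  have hL : PolyBounded L := hA.mono fun n => Nat.le_add_left _ _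
  let X : ℕ → ℕ := fun n => E n + μ n + (A' n).size + 1
  have hX : PolyBounded X := ((hE.add hμ).add hA).add (.const 1)
  let D : ℕ → ℕ := fun n => X n + (2 * X n + 1) * (20 * (3 * X n + 1) ^ 3)
  have hD : PolyBounded D := hX.add ((((PolyBounded.const 2).mul hX).add (.const 1)).mul
    ((PolyBounded.const 20).mul ((((PolyBounded.const 3).mul hX).add (.const 1)).pow 3)))
  have hXD : ∀ n, X n ≤ D n := fun n => Nat.le_add_right _ _
  have hEX : ∀ n, E n ≤ X n := fun n => by simp only [X]; omega
  have hμX : ∀ n, μ n ≤ X n := fun n => by simp only [X]; omega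
  have hAX : ∀ n, (A' n).size ≤ X n := fun n => by simp only [X]; omega
  have hLX : ∀ n, L n + 1 ≤ X n := fun n => by
    have : L n ≤ (A' n).size := Nat.le_add_left _ _
    simp only [X]; omega
  have hfam : ∀ n, (2 * L n + 1) * (20 * (μ n + S.sigLen n + H.msgLen n + 1) ^ 3) ≤ D n := by
    intro n
    have h1 := (hcost n (E n) le_rfl).sigLen_le
    have h2 := (hcost n (E n) le_rfl).msgLen_le
    have h3 := hEX n
    have h4 := hμX n
    have h5 := hLX n
    refine le_trans ?_ (Nat.le_add_left _ _)
    gcongr <;> omega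
  have hDcost : ∀ n, ReductionCost S H n (D n) := fun n => hcost n _ ((hEX n).trans (hXD n))
  have hcalls : ∀ n, callTotal (A' n).code ≤ L n + 1 := fun n =>
    (callTotal_le_length _).trans (Nat.le_succ _)
  have hdist : ∀ n m, 𝔼 g, H.hashDist n g m ≤ 2 * ε₃ n := fun n m =>
    H.expect_hashDist n m (hunif n m)
  choose B₁ hB₁ hB₁' using fun n => exists_forger_newValue_le (hDcost n)
    (fun g m r h => hrange n (hhash n g m r h)) (fun c => hrange n (hsr n c)) (A' n) (hcalls n)
    ((hAX n).trans (hXD n)) ((hμX n).trans (hXD n)) ((hLX n).trans (hXD n)) (hfam n)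
  choose F₁ hF₁ hF₁' using fun n => exists_finder_reuseValue_le (hDcost n) (hrnd n) (hsr n) le_rfl
    (hinv n) (hdist n) (A' n) (hcalls n) ((hAX n).trans (hXD n)) ((hμX n).trans (hXD n))
    ((hLX n).trans (hXD n)) (hfam n)
  choose B₂ hB₂ hB₂' using fun n => expect_sigCollision_le hS.2 (hDcost n)
    fun c => hrange n (hsr n c)
  choose F₂ hF₂ hF₂' using fun n => expect_range_collision_le (hDcost n) (hrnd n) le_rfl (hdist n)
  have hpoly : ∀ k, PolyBounded fun n => 30 * (k * D n ^ 2) ^ 2 := fun k =>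
    (PolyBounded.const 30).mul (((PolyBounded.const k).mul (hD.pow 2)).pow 2)
  have nB₁ := hSsec B₁ ((hpoly 3).mono hB₁)
  have nB₂ := hSsec B₂ ((hpoly 3).mono hB₂)
  have nF₁ := hHsec F₁ ((hpoly 50).mono hF₁)
  have nF₂ := hHsec F₂ ((hpoly 50).mono hF₂)
  have hK : ∀ n, 0 ≤ 𝔼 gS, sigCollision S H n gS := fun n =>
    expect_nonneg' fun _ => expect_nonneg' fun _ => expect_nonneg' fun _ => ind_nonneg _
  have nK : Negligible fun n => 𝔼 gS, sigCollision S H n gS :=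
    (nB₂.add (((nF₂.add hmsg).add (hε₁.const_mul 4)).add (hε₃.const_mul 4))).of_le hK
      fun n => (hB₂' n).trans (add_le_add_right (hF₂' n) _)
  have hL1 : PolyBounded fun n => L n + 1 := hL.add (.const 1)
  have nsqrt : Negligible fun n => √(((L n + 1 : ℕ) : ℝ) * √(𝔼 gS, sigCollision S H n gS)) :=
    ((nK.sqrt hK).polyBounded_mul hL1).sqrt fun n => by positivity
  refine ((((((nB₁.add (nF₁.polyBounded_mul hL1)).add
    (hmsg.polyBounded_mul (p := fun n => (L n + 1) * ((L n + 1) + (2 + 2 * (2 * L n) ^ 2))) ?_)).add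
    (nsqrt.polyBounded_mul (p := fun n => 4 * L n) ?_)).add
    (nK.polyBounded_mul (hL1.pow 2))).add
    ((((hε₂.const_mul 2).add (hε₁.const_mul 2)).add (hε₃.const_mul 2)).polyBounded_mul
      hL1))).of_le (fun n => SigAlgs.winProb_nonneg _ _ _ _) fun n => ?_
  · exact hL1.mul (hL1.add ((PolyBounded.const 2).add
      ((PolyBounded.const 2).mul (((PolyBounded.const 2).mul hL).pow 2))))
  · exact (PolyBounded.const 4).mul hL
  · refine (TOO_winProb_le μ (A' n) (hcalls n)).trans
      ((add_le_add (hB₁' n) (hF₁' n)).trans (le_of_eq ?_))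
    push_cast
    simp only [L]
    ring

theorem theorem1 (ℓ μ : ℕ → ℕ) (hμ : PolyBounded μ)
    (S : PlainSigAlgs ℓ) (hS : S.IsScheme)
    (H : ChameleonAlgs ℓ) (hH : H.IsFamily)
    (hrange : ∀ n, H.range n ⊆ S.msgs n)
    (hmsg : Negligible (fun n => ((2 : ℝ) ^ H.msgLen n)⁻¹))
    (hSsec : S.QuantumEUACMA) (hHsec : H.QuantumCollisionResistant) :
    (TOO S H μ).IsScheme ∧ (TOO S H μ).QuantumSUACMA :=
  ⟨⟨TOO_efficient S H μ hμ hS hH, TOO_correct S H μ hS hH hrange⟩,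
    TOO_quantumSUACMA hμ hS hH hrange hmsg hSsec hHsec⟩
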